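/- **Model.** Algorithms are randomized word-RAM programs: one fixed finite program works on words of $w$ bits (arithmetic modulo $2^w$, comparisons, bit operations, indirect memory access and drawing a uniformly random word take one time unit each). For inputs of size parameter $m$ it may assume $w\ge c\log m$ for a constant $c$ of the algorithm, and it must work for all such $w$. The running time is the worst-case number of steps over all random choices, and on every input the output must be correct with probability at least $2/3$. In particular deterministic algorithms are included. **3SUM conjecture.** 3SUM is the problem: given three sets $A,B,C$ of $m\ge 1$ integers in $\{1,\dots,U\}$, decide whether there are $a\in A$, $b\in B$, $c\in C$ with $a+b=c$. The 3SUM conjecture says that there is a constant $\kappa$ such that, for no $\varepsilon>0$, 3SUM with universe size $U=\kappa\, m^3(\lfloor\log_2 m\rfloor+1)^2$ can be solved in time $O(m^{2-\varepsilon})$. **Grammar compression.** A straight-line program (SLP) of size $n$ over $\{0,1\}$ is a sequence of $n$ rules, each of which is either a letter $0$ or $1$ or the concatenation of two previous rules; it generates the sequence that is produced by its last rule. **Theorem.** Assume the 3SUM conjecture. Let $0<c_1<c_2$ and $\varepsilon>0$. Then there is no algorithm that, given $N\ge 1$, a number $n$ with $c_1N^{1/5}\le n\le c_2N^{1/5}$,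 for every row of a matrix $M\in\{0,1\}^{N\times N}$ an SLP of size $n$ that generates the row, and an SLP of size $n$ that generates a vector $v\in\{0,1\}^N$, computes the product $Mv\in\mathbb{Z}^N$ in time $O(N n^{2-\varepsilon})$. (Here the size parameter that bounds the word length from below is $N$.) -/

import Mathlib

open scoped Matrix

/-! Randomized word RAM: a fixed finite program works on registers and arrays, all of whose cells are
`w`-bit words; arrays are indexed by words.  A program mentions only finitely many registers and arrays.
Control flow is structured (sequencing, branching, loops). -/
namespace WordRAM

/-- An operand: the content of a register, or a constant (reduced modulo `2 ^ w`). -/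
inductive Operand where
  | reg (r : ℕ)
  | const (k : ℕ)

/-- The word operations that take one time unit. -/
inductive Op where
  | add | sub | mul | div | mod | and | or | xor | shl | shr | lt | eq

inductive Cmd where
  /-- do nothing -/
  | skip
  /-- register `r` := `x op y` -/
  | set (r : ℕ) (op : Op) (x y : Operand)
  /-- register `r` := content of cell `x` of array `a` -/
  | load (r a : ℕ) (x : Operand)
  /-- cell `x` of array `a` := `y` -/
  | store (a : ℕ) (x y : Operand)
  /-- register `r` := a fresh uniformly random word -/
  | rand (r : ℕ)
  /-- first `p`, then `q` -/
  | seq (p q : Cmd)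
  /-- if `x` is nonzero then `p`, else `q` -/
  | branch (x : Operand) (p q : Cmd)
  /-- while `x` is nonzero, do `p` -/
  | loop (x : Operand) (p : Cmd)

/-- The contents of all registers and of all arrays. -/
structure State (w : ℕ) where
  reg : ℕ → BitVec w
  arr : ℕ → BitVec w → BitVec w

variable {w : ℕ}

def Operand.eval (s : State w) : Operand → BitVec w
  | .reg r => s.reg r
  | .const k => BitVec.ofNat w k

/-- Arithmetic is unsigned, modulo `2 ^ w` (with `x / 0 = 0`, `x % 0 = x`); comparisons return `1` or `0`. -/
def Op.eval : Op → BitVec w → BitVec w → BitVec w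
  | .add, a, b => a + b
  | .sub, a, b => a - b
  | .mul, a, b => a * b
  | .div, a, b => a / b
  | .mod, a, b => a % b
  | .and, a, b => a &&& b
  | .or, a, b => a ||| b
  | .xor, a, b => a ^^^ b
  | .shl, a, b => a <<< b.toNat
  | .shr, a, b => a >>> b.toNat
  | .lt, a, b => if a.toNat < b.toNat then BitVec.ofNat w 1 else BitVec.ofNat w 0
  | .eq, a, b => if a = b then BitVec.ofNat w 1 else BitVec.ofNat w 0

def State.setReg (s : State w) (r : ℕ) (x : BitVec w) : State w :=
  ⟨Function.update s.reg r x, s.arr⟩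

def State.setArr (s : State w) (a : ℕ) (i x : BitVec w) : State w :=
  ⟨s.reg, Function.update s.arr a (Function.update (s.arr a) i x)⟩

/-- The stack of commands still to be executed, and the memory.  The machine has halted when the
stack is empty. -/
abbrev Config (w : ℕ) := List Cmd × State w

noncomputable def randomWord (w : ℕ) : PMF (BitVec w) :=
  (PMF.uniformOfFintype (Fin (2 ^ w))).map BitVec.ofFin

/-- One step of the machine (one unit of time). -/
noncomputable def step : Config w → PMF (Config w)
  | ([], s) => PMF.pure ([], s)
  | (.skip :: k, s) => PMF.pure (k, s)
  | (.set r op x y :: k, s) => PMF.pure (k, s.setReg r (op.eval (x.eval s) (y.eval s)))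
  | (.load r a x :: k, s) => PMF.pure (k, s.setReg r (s.arr a (x.eval s)))
  | (.store a x y :: k, s) => PMF.pure (k, s.setArr a (x.eval s) (y.eval s))
  | (.rand r :: k, s) => (randomWord w).map fun x => (k, s.setReg r x)
  | (.seq p q :: k, s) => PMF.pure (p :: q :: k, s)
  | (.branch x p q :: k, s) => PMF.pure (if x.eval s ≠ 0 then (p :: k, s) else (q :: k, s))
  | (.loop x p :: k, s) => PMF.pure (if x.eval s ≠ 0 then (p :: .loop x p :: k, s) else (k, s))

/-- The distribution of the configuration after `T` steps. -/
noncomputable def run : ℕ → Config w → PMF (Config w)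
  | 0, c => PMF.pure c
  | T + 1, c => (step c).bind (run T)

/-- Started on `s`, the program `P` halts within `T` steps, whatever the random words are, and with
probability at least `2/3` the final memory satisfies `good`. -/
def SolvesWithin (P : Cmd) (s : State w) (T : ℕ) (good : State w → Prop) : Prop :=
  (∀ c ∈ (run T ([P], s)).support, c.1 = []) ∧
    2 / 3 ≤ (run T ([P], s)).toOuterMeasure {c | good c.2}

/-- The array holding `f 0, …, f (n - 1)`, followed by zeros. -/
def arrayOf {n : ℕ} (f : Fin n → ℕ) : BitVec w → BitVec w := fun a =>
  if h : a.toNat < n then BitVec.ofNat w (f ⟨a.toNat, h⟩) else 0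

end WordRAM

/-! 3SUM -/

/-- The input: `m` in register `0`, the sets in the arrays `0`, `1`, `2`, zeros elsewhere. -/
def threeSumInput (w : ℕ) {m : ℕ} (A B C : Fin m → ℕ) : WordRAM.State w where
  reg := fun r => if r = 0 then BitVec.ofNat w m else 0
  arr := fun a => match a with
    | 0 => WordRAM.arrayOf A
    | 1 => WordRAM.arrayOf B
    | 2 => WordRAM.arrayOf C
    | _ => fun _ => 0

open Classical in
/-- `P` is a randomized algorithm (with words of `O(log m)` bits) that decides, in at most
`K * m ^ (2 - ε)` steps, every 3SUM instance that consists of three sets of `m` integers in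
`{1, …, κ * m ^ 3 * (⌊log₂ m⌋ + 1) ^ 2}`, leaving the answer in register `0`. -/
def SolvesThreeSum (κ : ℕ) (P : WordRAM.Cmd) (ε K : ℝ) : Prop :=
  ∃ c : ℕ, ∀ m w : ℕ, 1 ≤ m → c * (Nat.log 2 m + 1) ≤ w →
    ∀ A B C : Fin m → ℕ,
      Function.Injective A → Function.Injective B → Function.Injective C →
      (∀ i, A i ∈ Set.Icc 1 (κ * m ^ 3 * (Nat.log 2 m + 1) ^ 2)) →
      (∀ i, B i ∈ Set.Icc 1 (κ * m ^ 3 * (Nat.log 2 m + 1) ^ 2)) →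
      (∀ i, C i ∈ Set.Icc 1 (κ * m ^ 3 * (Nat.log 2 m + 1) ^ 2)) →
      WordRAM.SolvesWithin P (threeSumInput w A B C) ⌊K * (m : ℝ) ^ (2 - ε)⌋₊ fun s =>
        (s.reg 0).toNat = if ∃ i j k, A i + B j = C k then 1 else 0

/-- The 3SUM conjecture, for randomized algorithms and universe size `U = O(m³ log² m)`. -/
def ThreeSumConjecture : Prop :=
  ∃ κ : ℕ, ∀ ε : ℝ, 0 < ε → ¬ ∃ (P : WordRAM.Cmd) (K : ℝ), SolvesThreeSum κ P ε K

/-! Grammar compression -/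

/-- The rule number `i` of a straight-line program: a letter, or the concatenation of two
previous rules. -/
inductive SLPRule (σ : Type) (i : ℕ) where
  | letter (a : σ)
  | concat (j k : Fin i)

/-- A straight-line program of size `n`, that is, with `n` rules. -/
def SLP (σ : Type) (n : ℕ) := (i : Fin n) → SLPRule σ i

/-- The sequence that the rule number `i` produces. -/
def SLP.expand {σ : Type} {n : ℕ} (G : SLP σ n) (i : Fin n) : List σ :=
  match G i with
  | .letter a => [a]
  | .concat j k => G.expand ⟨j, j.2.trans i.2⟩ ++ G.expand ⟨k, k.2.trans i.2⟩
termination_by i.val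

/-- The last rule produces the vector `v`. -/
def SLP.Generates {σ : Type} {n N : ℕ} (G : SLP σ n) (v : Fin N → σ) : Prop :=
  ∃ h : 0 < n, G.expand ⟨n - 1, Nat.sub_lt h Nat.one_pos⟩ = List.ofFn v

/-! A rule is encoded by three words: `(0, a, 0)` for a letter, `(1, j, k)` for a concatenation. -/

def SLPRule.kind {σ : Type} {i : ℕ} : SLPRule σ i → ℕ
  | .letter _ => 0
  | .concat _ _ => 1

def SLPRule.fst {i : ℕ} : SLPRule (Fin 2) i → ℕ
  | .letter a => a
  | .concat j _ => j

def SLPRule.snd {i : ℕ} : SLPRule (Fin 2) i → ℕ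
  | .letter _ => 0
  | .concat _ k => k

/-! Compressed matrix-vector multiplication -/

/-- The input: `N` and `n` in the registers `0` and `1`; the first, second and third words of the
rules of the matrix in the arrays `0`, `1`, `2` (rule `r` of row `i` in cell `i * n + r`), those of
the rules of the vector in the arrays `3`, `4`, `5`; zeros elsewhere. -/
def matVecInput (w : ℕ) {N n : ℕ} (G : Fin N → SLP (Fin 2) n) (H : SLP (Fin 2) n) :
    WordRAM.State w where
  reg := fun r => match r with
    | 0 => BitVec.ofNat w N
    | 1 => BitVec.ofNat w n
    | _ => 0
  arr := fun a => match a with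
    | 0 => WordRAM.arrayOf fun p : Fin (N * n) => (G p.divNat p.modNat).kind
    | 1 => WordRAM.arrayOf fun p : Fin (N * n) => (G p.divNat p.modNat).fst
    | 2 => WordRAM.arrayOf fun p : Fin (N * n) => (G p.divNat p.modNat).snd
    | 3 => WordRAM.arrayOf fun r => (H r).kind
    | 4 => WordRAM.arrayOf fun r => (H r).fst
    | 5 => WordRAM.arrayOf fun r => (H r).snd
    | _ => fun _ => 0

/-- The product `M v` over the integers of a 0/1-matrix and a 0/1-vector. -/
def binaryMulVec {N : ℕ} (M : Matrix (Fin N) (Fin N) (Fin 2)) (v : Fin N → Fin 2) : Fin N → ℕ :=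
  (M.map fun a => (a : ℕ)) *ᵥ fun j => (v j : ℕ)

/-- `P` is a randomized algorithm (with words of `O(log N)` bits) that computes `M v`, in at most
`K * N * n ^ (2 - ε)` steps, for all `N × N` 0/1-matrices `M` and 0/1-vectors `v` that are given by
straight-line programs of size `n` for the rows of `M` and for `v`, where
`c₁ * N ^ (1/5) ≤ n ≤ c₂ * N ^ (1/5)`; it leaves the product in the array `0`. -/
def SolvesCompressedMatVec (c₁ c₂ : ℝ) (P : WordRAM.Cmd) (ε K : ℝ) : Prop :=
  ∃ c : ℕ, ∀ N n w : ℕ, 1 ≤ N →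
    c₁ * (N : ℝ) ^ (1 / 5 : ℝ) ≤ n → n ≤ c₂ * (N : ℝ) ^ (1 / 5 : ℝ) →
    c * (Nat.log 2 N + 1) ≤ w →
    ∀ (M : Matrix (Fin N) (Fin N) (Fin 2)) (v : Fin N → Fin 2)
      (G : Fin N → SLP (Fin 2) n) (H : SLP (Fin 2) n),
      (∀ i, (G i).Generates (M i)) → H.Generates v →
      WordRAM.SolvesWithin P (matVecInput w G H) ⌊K * (N * (n : ℝ) ^ (2 - ε))⌋₊ fun s =>
        ∀ i : Fin N, (s.arr 0 (BitVec.ofNat w i)).toNat = binaryMulVec M v i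

/-! A program `P` for compressed matrices with time `O(N n^(2-ε))` is turned into a program that
solves 3SUM in truly subquadratic time, for every `κ` (`exists_solvesThreeSum`); this contradicts
the conjecture.

Blocks. The three sets are sorted and cut into `g` blocks of `b` consecutive elements. A triple of
blocks can contain a solution only if the intervals that the blocks span are compatible, and by a
domination argument at most `4 g²` of the `g³` triples are (`Blocks.sum_relevant_le`). These triples
are grouped into `M` batches of `N` triples with a common block of `B`, where `M N ≤ 5 g²`. One
batch is one instance: each row of the matrix encodes a block of `A` and a block of `C`, the vector
encodes the block of `B`.

Encoding. Let `q` be random in `[Q, 2Q)`. A row consists of one slot per element `a` of its block of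
`A`; the slot is the indicator word of the numbers `c mod q` and `c mod q + q`, for `c` in the block
of `C`, shifted by `q - (a mod q)`. Every slot of the vector is the indicator word of the numbers `b
mod q + q`. Two ones meet exactly if `a + b ≡ c` modulo `q` (`meets_iff_congruent`), so the nonzero
entries of the product are the rows with a solution modulo `q`. The slots of a vector share one
binary tree, and a shift costs logarithmically many rules; hence `O(b log m)` rules describe a
vector whose length is of order `b Q` (`writeSLP_spec`). With `u = ⌊log₂ m⌋ / 32` and `t = 2^(4u)`
the choice is `b = t / (256 (u+1))`, `Q = t⁴ / 8`, `n = D t`, `N = j⁵ t⁵`; the ratio `D / j` is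
placed between `c₁` and `c₂`.

False rows. If a row has a solution modulo `q` but no solution, then `q` divides one of at most `b³`
nonzero differences, each with few divisors (`exists_card_divisors_pow_le`). On average at most a
quarter of `thr = N / √t` rows are false, so at least `3/4` of the moduli give fewer than `thr`
false rows (`three_mul_le_card_goodModuli`). At most `thr` nonzero rows are listed, and each is
searched exactly in time `O(b²)`. The error is therefore one-sided. A round for the batch with a
solution succeeds with probability `3/4 · 2/3 = 1/2`, and two rounds with probability `3/4`.

Time. The total is `M (N n + N n^(2-ε) + thr b²)`, up to constants, hence `O(g² (n + n^(2-ε) + b² /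
√t))` with `g = O(m (u+1) / t)`. This is `m² (u+1)² t^(-δ)` for a `δ > 0`, and `t` is about
`m^(1/8)`.

Machine level. `H` is a Hoare logic with time bounds on memories of natural numbers, `Pr` its
version with probabilities. The program `P` is moved to other registers and arrays and made to
record the positions it writes to, so that its memory can be cleared after each call in time
proportional to its running time. -/

namespace WordRAM

open scoped ENNReal

/-! ### Sure termination and expectations over runs -/

variable {w : ℕ}

/-- Every run from `c` halts within `T` steps in a state satisfying `Φ`. -/
def Sure : ℕ → Config w → (State w → Prop) → Prop
  | 0, c, Φ => c.1 = [] ∧ Φ c.2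
  | T + 1, c, Φ => ∀ c' ∈ (step c).support, Sure T c' Φ

/-- The expectation of `ν` at the halting state, where runs longer than `T` count as zero. -/
noncomputable def expect : ℕ → Config w → (State w → ℝ≥0∞) → ℝ≥0∞
  | 0, c, ν => open Classical in if c.1 = [] then ν c.2 else 0
  | T + 1, c, ν => ∑' c', step c c' * expect T c' ν

theorem sure_iff_run (T : ℕ) (c : Config w) (Φ : State w → Prop) :
    Sure T c Φ ↔ ∀ c' ∈ (run T c).support, c'.1 = [] ∧ Φ c'.2 := by
  induction T generalizing c with
  | zero => simp [Sure, run]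
  | succ T ih =>
    simp only [Sure, run, PMF.mem_support_bind_iff, ih]
    constructor
    · rintro h c' ⟨a, ha, hc⟩; exact h a ha c' hc
    · intro h a ha c' hc; exact h c' ⟨a, ha, hc⟩

theorem step_nil (s : State w) : step (([], s) : Config w) = PMF.pure ([], s) := rfl

theorem Sure.nil {T : ℕ} {s : State w} {Φ : State w → Prop} :
    Sure T ([], s) Φ ↔ Φ s := by
  induction T with
  | zero => simp [Sure]
  | succ T ih => simp [Sure, step_nil, ih]

theorem expect_nil {T : ℕ} {s : State w} {ν : State w → ℝ≥0∞} :
    expect T ([], s) ν = ν s := by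
  induction T with
  | zero => simp [expect]
  | succ T ih =>
    simp only [expect, step_nil, PMF.pure_apply, ite_mul, one_mul, zero_mul]
    rw [tsum_eq_single ([], s) (fun b hb => if_neg hb), if_pos rfl, ih]

theorem Sure.mono {T T' : ℕ} {c : Config w} {Φ Ψ : State w → Prop} (h : Sure T c Φ) (hT : T ≤ T')
    (hΦ : ∀ s, Φ s → Ψ s) : Sure T' c Ψ := by
  induction T generalizing c T' with
  | zero =>
    obtain ⟨k, s⟩ := c
    obtain ⟨h1, h2⟩ := h
    simp only at h1 h2
    subst h1
    exact Sure.nil.2 (hΦ _ h2)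
  | succ T ih =>
    obtain ⟨T', rfl⟩ := Nat.exists_eq_add_of_le' (Nat.one_le_iff_ne_zero.2 (by omega : T' ≠ 0))
    intro c' hc'
    exact ih (h c' hc') (by omega)

theorem expect_mono_time {T T' : ℕ} {c : Config w} {ν : State w → ℝ≥0∞} (hT : T ≤ T') :
    expect T c ν ≤ expect T' c ν := by
  induction T generalizing c T' with
  | zero =>
    obtain ⟨k, s⟩ := c
    by_cases hk : k = []
    · subst hk; rw [expect_nil, expect_nil]
    · simp [expect, hk]
  | succ T ih =>
    obtain ⟨T', rfl⟩ := Nat.exists_eq_add_of_le' (Nat.one_le_iff_ne_zero.2 (by omega : T' ≠ 0))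
    simp only [expect]
    exact ENNReal.tsum_le_tsum fun c' => by gcongr; exact ih (by omega)

theorem expect_mono {T : ℕ} {c : Config w} {Φ : State w → Prop} {ν ν' : State w → ℝ≥0∞}
    (h : Sure T c Φ) (hν : ∀ s, Φ s → ν s ≤ ν' s) : expect T c ν ≤ expect T c ν' := by
  induction T generalizing c with
  | zero => obtain ⟨h1, h2⟩ := h; simp [expect, h1, hν _ h2]
  | succ T ih =>
    simp only [expect]
    refine ENNReal.tsum_le_tsum fun c' => ?_
    by_cases hc : step c c' = 0
    · simp [hc]
    · gcongr
      exact ih (h c' ((PMF.mem_support_iff _ _).2 hc))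

theorem expect_mono' {T : ℕ} {c : Config w} {ν ν' : State w → ℝ≥0∞}
    (hν : ∀ s, ν s ≤ ν' s) : expect T c ν ≤ expect T c ν' := by
  induction T generalizing c with
  | zero => simp only [expect]; split_ifs <;> simp [hν]
  | succ T ih =>
    simp only [expect]
    exact ENNReal.tsum_le_tsum fun c' => by gcongr; exact ih

/-- Sure termination is what makes the total mass of the counted runs equal to `1`; without it the
truncated expectation could be smaller. -/
theorem Sure.le_expect {T : ℕ} {c : Config w} {Φ : State w → Prop} {ν : State w → ℝ≥0∞}
    {ρ : ℝ≥0∞} (h : Sure T c Φ) (hν : ∀ s, Φ s → ρ ≤ ν s) : ρ ≤ expect T c ν := by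
  induction T generalizing c with
  | zero => obtain ⟨h1, h2⟩ := h; simp [expect, h1, hν _ h2]
  | succ T ih =>
    simp only [expect]
    calc ρ = ∑' c', step c c' * ρ := by rw [ENNReal.tsum_mul_right, PMF.tsum_coe, one_mul]
      _ ≤ _ := by
        refine ENNReal.tsum_le_tsum fun c' => ?_
        by_cases hc : step c c' = 0
        · simp [hc]
        · gcongr
          exact ih (h c' ((PMF.mem_support_iff _ _).2 hc))

/-- Linearity, needed to combine the success probabilities of two attempts in `Pr.twice`. -/
theorem expect_add_mul {T : ℕ} {c : Config w} {ν ν' : State w → ℝ≥0∞} (a : ℝ≥0∞) :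
    expect T c (fun s => ν s + a * ν' s) = expect T c ν + a * expect T c ν' := by
  induction T generalizing c with
  | zero => simp only [expect]; split_ifs <;> simp
  | succ T ih =>
    simp only [expect, ih, mul_add, ENNReal.tsum_add, ← ENNReal.tsum_mul_left]
    congr 1
    exact tsum_congr fun c' => by ring

/-- A step looks only at the top of the stack, so commands below it are inert. This is the basis of
sequential composition. -/
theorem step_append (p : Cmd) (k k₂ : List Cmd) (s : State w) :
    step ((p :: (k ++ k₂), s) : Config w)
      = (step ((p :: k, s) : Config w)).map (fun c => (c.1 ++ k₂, c.2)) := by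
  cases p <;> simp only [step, PMF.pure_map, PMF.map_comp, List.cons_append] <;> first | rfl | skip
  all_goals split_ifs <;> rfl

theorem Sure.append {T₁ T₂ : ℕ} {k₁ k₂ : List Cmd} {s : State w} {Φ Ψ : State w → Prop}
    (h : Sure T₁ (k₁, s) Φ) (h' : ∀ s', Φ s' → Sure T₂ (k₂, s') Ψ) :
    Sure (T₁ + T₂) (k₁ ++ k₂, s) Ψ := by
  induction T₁ generalizing k₁ s with
  | zero =>
    obtain ⟨h1, h2⟩ := h
    simp only at h1 h2
    subst h1
    simpa using h' s h2
  | succ T₁ ih =>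
    cases k₁ with
    | nil => exact (h' s (Sure.nil.1 h)).mono (by omega) fun _ h => h
    | cons p k =>
      rw [Nat.succ_add]
      intro c' hc'
      rw [List.cons_append, step_append, PMF.mem_support_map_iff] at hc'
      obtain ⟨⟨k', s'⟩, hc, rfl⟩ := hc'
      exact ih (h _ hc)

/-- Only an inequality: runs of the first part that exceed `T₁` count as zero on the left, and runs
that end early leave additional time for the second part on the right. -/
theorem expect_append {T₁ T₂ : ℕ} {k₁ k₂ : List Cmd} {s : State w} {ν : State w → ℝ≥0∞} :
    expect T₁ (k₁, s) (fun s' => expect T₂ (k₂, s') ν) ≤ expect (T₁ + T₂) (k₁ ++ k₂, s) ν := by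
  induction T₁ generalizing k₁ s with
  | zero =>
    by_cases hk : k₁ = []
    · subst hk; simp [expect]
    · simp [expect, hk]
  | succ T₁ ih =>
    cases k₁ with
    | nil => rw [expect_nil]; exact expect_mono_time (by omega)
    | cons p k =>
      rw [Nat.succ_add]
      simp only [expect]
      rw [List.cons_append, step_append]
      have : ∀ (μ : PMF (Config w)) (f : Config w → Config w) (F : Config w → ℝ≥0∞),
          ∑' c', μ.map f c' * F c' = ∑' c, μ c * F (f c) := by
        intro μ f F
        classical
        simp only [PMF.map_apply, ← ENNReal.tsum_mul_right]
        rw [ENNReal.tsum_comm]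
        refine tsum_congr fun c => ?_
        rw [tsum_eq_single (f c)]
        · simp
        · intro b hb; simp [hb]
      rw [this]
      exact ENNReal.tsum_le_tsum fun c' => by gcongr; exact ih

-- The recursive notions `Sure` and `expect` are enough to prove `SolvesWithin`; the converse
-- direction is given by `SolvesWithin.sure` and `SolvesWithin.le_expect`.
open Classical in
theorem solvesWithin_of {P : Cmd} {s : State w} {T : ℕ} {good Φ : State w → Prop}
    (h : Sure T ([P], s) Φ)
    (h' : 2 / 3 ≤ expect T ([P], s) (fun s => if good s then 1 else 0)) :
    SolvesWithin P s T good := by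
  refine ⟨fun c hc => ((sure_iff_run _ _ _).1 h c hc).1, h'.trans ?_⟩
  clear h h'
  generalize ([P], s) = c
  induction T generalizing c with
  | zero =>
    simp only [expect, run, PMF.toOuterMeasure_pure_apply, Set.mem_ofPred_eq]
    split_ifs <;> simp
  | succ T ih =>
    simp only [expect, run, PMF.toOuterMeasure_bind_apply]
    exact ENNReal.tsum_le_tsum fun c' => by gcongr; exact ih c'

theorem SolvesWithin.sure {P : Cmd} {s : State w} {T : ℕ} {good : State w → Prop}
    (h : SolvesWithin P s T good) : Sure T ([P], s) (fun _ => True) :=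
  (sure_iff_run _ _ _).2 fun c hc => ⟨h.1 c hc, trivial⟩

open Classical in
theorem SolvesWithin.le_expect {P : Cmd} {s : State w} {T : ℕ} {good : State w → Prop}
    (h : SolvesWithin P s T good) :
    2 / 3 ≤ expect T ([P], s) (fun s => if good s then 1 else 0) := by
  refine h.2.trans ?_
  have := h.sure
  clear h
  revert this
  generalize ([P], s) = c
  induction T generalizing c with
  | zero =>
    rintro ⟨h1, -⟩
    simp only [expect, run, PMF.toOuterMeasure_pure_apply, Set.mem_ofPred_eq, h1, if_true]
    exact le_rfl
  | succ T ih =>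
    intro h
    simp only [expect, run, PMF.toOuterMeasure_bind_apply]
    refine ENNReal.tsum_le_tsum fun c' => ?_
    by_cases hc : step c c' = 0
    · simp [hc]
    · gcongr
      exact ih c' (h c' ((PMF.mem_support_iff _ _).2 hc))

theorem sure_of_step {T : ℕ} {c c' : Config w} {Φ : State w → Prop} (hs : step c = PMF.pure c') :
    Sure (T + 1) c Φ ↔ Sure T c' Φ := by
  simp [Sure, hs]

theorem expect_of_step {T : ℕ} {c c' : Config w} {ν : State w → ℝ≥0∞} (hs : step c = PMF.pure c') :
    expect (T + 1) c ν = expect T c' ν := by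
  simp only [expect, hs, PMF.pure_apply, ite_mul, one_mul, zero_mul]
  rw [tsum_eq_single c' (fun b hb => if_neg hb), if_pos rfl]

theorem randomWord_apply (x : BitVec w) : randomWord w x = ((2 : ℝ≥0∞) ^ w)⁻¹ := by
  rw [randomWord, PMF.map_apply, tsum_eq_single x.toFin]
  · simp
  · intro b hb
    have : x ≠ BitVec.ofFin b := by rintro rfl; exact hb rfl
    simp [this]

theorem sure_rand {T r : ℕ} {k : List Cmd} {s : State w} {Φ : State w → Prop} :
    Sure (T + 1) (.rand r :: k, s) Φ ↔ ∀ x, Sure T (k, s.setReg r x) Φ := by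
  have hsupp : ∀ x : BitVec w, x ∈ (randomWord w).support := fun x => by
    rw [PMF.mem_support_iff, randomWord_apply]
    simp
  simp only [Sure, step, PMF.mem_support_map_iff]
  constructor
  · intro h x; exact h _ ⟨x, hsupp x, rfl⟩
  · rintro h c' ⟨x, -, rfl⟩; exact h x

theorem expect_rand {T r : ℕ} {k : List Cmd} {s : State w} {ν : State w → ℝ≥0∞} :
    expect (T + 1) (.rand r :: k, s) ν
      = ∑ x : BitVec w, ((2 : ℝ≥0∞) ^ w)⁻¹ * expect T (k, s.setReg r x) ν := by
  classical
  simp only [expect, step, PMF.map_apply, ← ENNReal.tsum_mul_right]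
  rw [ENNReal.tsum_comm, tsum_fintype]
  refine Finset.sum_congr rfl fun x _ => ?_
  rw [tsum_eq_single (k, s.setReg r x)]
  · simp [randomWord_apply]
  · intro b hb; simp [hb]

/-! ### Memory with natural numbers as cells -/

/-- The memory of the machine, with natural numbers instead of words. -/
@[ext] structure Mem where
  R : ℕ → ℕ
  A : ℕ → ℕ → ℕ

namespace Mem

def setR (σ : Mem) (r x : ℕ) : Mem := ⟨Function.update σ.R r x, σ.A⟩

def setA (σ : Mem) (a i x : ℕ) : Mem :=
  ⟨σ.R, Function.update σ.A a (Function.update (σ.A a) i x)⟩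

@[simp] theorem setR_R (σ : Mem) (r x r' : ℕ) : (σ.setR r x).R r' = if r' = r then x else σ.R r' :=
  Function.update_apply ..

@[simp] theorem setR_A (σ : Mem) (r x : ℕ) : (σ.setR r x).A = σ.A := rfl

@[simp] theorem setA_R (σ : Mem) (a i x : ℕ) : (σ.setA a i x).R = σ.R := rfl

@[simp] theorem setA_A (σ : Mem) (a i x a' : ℕ) :
    (σ.setA a i x).A a' = if a' = a then Function.update (σ.A a) i x else σ.A a' :=
  Function.update_apply ..

end Mem

/-- The cells of a state as natural numbers. -/
def view (s : State w) : Mem where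
  R := fun r => (s.reg r).toNat
  -- Numbers from `2 ^ w` on are not addresses; reading them as `0` makes arrays into total
  -- functions on `ℕ`.
  A := fun a i => if i < 2 ^ w then (s.arr a (BitVec.ofNat w i)).toNat else 0

theorem view_setReg (s : State w) (r : ℕ) (x : BitVec w) :
    view (s.setReg r x) = (view s).setR r x.toNat := by
  ext r'
  · simp only [view, State.setReg, Mem.setR, Function.update_apply]
    split_ifs <;> rfl
  · rfl

theorem view_setArr (s : State w) (a : ℕ) (i x : BitVec w) :
    view (s.setArr a i x) = (view s).setA a i.toNat x.toNat := by
  ext a' j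
  · rfl
  · simp only [view, State.setArr, Mem.setA, Function.update_apply]
    by_cases ha : a' = a
    · subst ha
      simp only [if_true, Function.update_apply]
      by_cases hj : j < 2 ^ w
      · simp only [hj, if_true]
        by_cases hji : j = i.toNat
        · subst hji; simp
        · rw [if_neg hji, if_neg]
          rintro rfl
          exact hji (by simp [Nat.mod_eq_of_lt hj])
      · rw [if_neg hj, if_neg, if_neg hj]
        rintro rfl
        exact hj i.isLt
    · simp [ha]

theorem view_R_lt (s : State w) (r : ℕ) : (view s).R r < 2 ^ w := (s.reg r).isLt

theorem view_A_lt (s : State w) (a i : ℕ) : (view s).A a i < 2 ^ w := by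
  simp only [view]
  split_ifs
  · exact BitVec.isLt _
  · positivity

namespace Operand

def ev (σ : Mem) : Operand → ℕ
  | .reg r => σ.R r
  | .const k => k

@[simp] theorem ev_reg (σ : Mem) (r : ℕ) : (Operand.reg r).ev σ = σ.R r := rfl
@[simp] theorem ev_const (σ : Mem) (k : ℕ) : (Operand.const k).ev σ = k := rfl

/-- A constant fits into a word. -/
def Fits (w : ℕ) : Operand → Prop
  | .reg _ => True
  | .const k => k < 2 ^ w

@[simp] theorem fits_reg (r : ℕ) : (Operand.reg r).Fits w := trivial
@[simp] theorem fits_const (k : ℕ) : (Operand.const k).Fits w ↔ k < 2 ^ w := Iff.rfl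

def regs : Operand → List ℕ
  | .reg r => [r]
  | .const _ => []

theorem eval_toNat {x : Operand} (s : State w) (h : x.Fits w) :
    (x.eval s).toNat = x.ev (view s) := by
  cases x with
  | reg r => rfl
  | const k => simpa [eval] using Nat.mod_eq_of_lt h

theorem ev_lt {x : Operand} (s : State w) (h : x.Fits w) : x.ev (view s) < 2 ^ w := by
  rw [← eval_toNat s h]; exact BitVec.isLt _

theorem eval_ne_zero {x : Operand} (s : State w) (h : x.Fits w) :
    x.eval s ≠ 0 ↔ x.ev (view s) ≠ 0 := by
  rw [← eval_toNat s h, ne_eq, ne_eq, ← BitVec.toNat_inj]; simp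

end Operand

namespace Op

/-- The operation on natural numbers. -/
def nat : Op → ℕ → ℕ → ℕ
  | .add, a, b => a + b
  | .sub, a, b => a - b
  | .mul, a, b => a * b
  | .div, a, b => a / b
  | .mod, a, b => a % b
  | .and, a, b => a &&& b
  | .or, a, b => a ||| b
  | .xor, a, b => a ^^^ b
  | .shl, a, b => a * 2 ^ b
  | .shr, a, b => a / 2 ^ b
  | .lt, a, b => if a < b then 1 else 0
  | .eq, a, b => if a = b then 1 else 0

/-- The operation neither overflows nor truncates. -/
def Fits (w : ℕ) : Op → ℕ → ℕ → Prop
  | .add, a, b => a + b < 2 ^ w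
  | .sub, a, b => b ≤ a
  | .mul, a, b => a * b < 2 ^ w
  | .shl, a, b => a * 2 ^ b < 2 ^ w
  | _, _, _ => True

theorem eval_toNat {op : Op} (hw : 0 < w) {a b : BitVec w} (h : op.Fits w a.toNat b.toNat) :
    (op.eval a b).toNat = op.nat a.toNat b.toNat := by
  have h1 : 1 < 2 ^ w := Nat.one_lt_two_pow hw.ne'
  cases op <;> simp only [eval, nat, Fits] at h ⊢
  · rw [BitVec.toNat_add, Nat.mod_eq_of_lt h]
  · rw [BitVec.toNat_sub_of_le h]
  · rw [BitVec.toNat_mul, Nat.mod_eq_of_lt h]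
  · rw [BitVec.toNat_udiv]
  · rw [BitVec.toNat_umod]
  · rw [BitVec.toNat_and]
  · rw [BitVec.toNat_or]
  · rw [BitVec.toNat_xor]
  · rw [BitVec.toNat_shiftLeft, Nat.shiftLeft_eq, Nat.mod_eq_of_lt h]
  · rw [BitVec.toNat_ushiftRight, Nat.shiftRight_eq_div_pow]
  · split_ifs <;> simp [Nat.mod_eq_of_lt h1]
  · simp only [BitVec.toNat_inj]
    split_ifs <;> simp [Nat.mod_eq_of_lt h1]

end Op

/-! ### A Hoare logic with running times -/

/-- Started on the memory `σ`, the program `p` always halts within `T` steps and establishes `Φ`. -/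
def H (w : ℕ) (p : Cmd) (σ : Mem) (T : ℕ) (Φ : Mem → Prop) : Prop :=
  ∀ s : State w, view s = σ → Sure T ([p], s) (fun s' => Φ (view s'))

namespace H

variable {p q : Cmd} {σ : Mem} {T T₁ T₂ T' : ℕ} {Φ Ψ : Mem → Prop}

theorem mono (h : H w p σ T Φ) (hT : T ≤ T') (hΦ : ∀ σ', Φ σ' → Ψ σ') : H w p σ T' Ψ :=
  fun s hs => (h s hs).mono hT fun _ => hΦ _

theorem time (h : H w p σ T Φ) (hT : T ≤ T') : H w p σ T' Φ := h.mono hT fun _ => id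

theorem seq (h : H w p σ T₁ (fun σ' => H w q σ' T₂ Φ)) : H w (.seq p q) σ (T₁ + T₂ + 1) Φ := by
  intro s hs
  rw [sure_of_step (c' := ([p, q], s)) rfl]
  exact (h s hs).append (k₂ := [q]) fun s' h' => h' s' rfl

end H

/-- The sequential composition of a list of programs. -/
def block : List Cmd → Cmd
  | [] => .skip
  | p :: ps => .seq p (block ps)

/-- The weakest precondition of a program without loops and random words. -/
def wp (w : ℕ) : Cmd → (Mem → Prop) → Mem → Prop
  | .skip, Φ, σ => Φ σ
  | .set r op x y, Φ, σ => x.Fits w ∧ y.Fits w ∧ op.Fits w (x.ev σ) (y.ev σ) ∧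
      Φ (σ.setR r (op.nat (x.ev σ) (y.ev σ)))
  | .load r a x, Φ, σ => x.Fits w ∧ Φ (σ.setR r (σ.A a (x.ev σ)))
  | .store a x y, Φ, σ => x.Fits w ∧ y.Fits w ∧ Φ (σ.setA a (x.ev σ) (y.ev σ))
  | .rand _, _, _ => False
  | .seq p q, Φ, σ => wp w p (wp w q Φ) σ
  | .branch x p q, Φ, σ => x.Fits w ∧ (x.ev σ ≠ 0 → wp w p Φ σ) ∧ (x.ev σ = 0 → wp w q Φ σ)
  | .loop _ _, _, _ => False

theorem wp_block_nil {Φ : Mem → Prop} {σ : Mem} : wp w (block []) Φ σ = Φ σ := rfl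

theorem wp_block_cons {p : Cmd} {ps : List Cmd} {Φ : Mem → Prop} {σ : Mem} :
    wp w (block (p :: ps)) Φ σ = wp w p (wp w (block ps) Φ) σ := rfl

/-- The running time of a program without loops. -/
def cost : Cmd → ℕ
  | .skip => 1
  | .set .. => 1
  | .load .. => 1
  | .store .. => 1
  | .rand _ => 1
  | .seq p q => cost p + cost q + 1
  | .branch _ p q => max (cost p) (cost q) + 1
  -- The value does not matter, because `wp` is false for loops.
  | .loop _ _ => 0

theorem H.skip {σ : Mem} {Φ : Mem → Prop} (h : Φ σ) : H w .skip σ 1 Φ := by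
  intro s hs
  rw [sure_of_step (c' := ([], s)) rfl, Sure.nil, hs]
  exact h

theorem H.branch {x : Operand} {p q : Cmd} {σ : Mem} {T : ℕ} {Φ : Mem → Prop} (hx : x.Fits w)
    (h₁ : x.ev σ ≠ 0 → H w p σ T Φ) (h₂ : x.ev σ = 0 → H w q σ T Φ) :
    H w (.branch x p q) σ (T + 1) Φ := by
  intro s hs
  by_cases h : x.eval s ≠ 0
  · rw [sure_of_step (c' := ([p], s)) (by simp only [step, if_pos h])]
    exact h₁ (hs ▸ (Operand.eval_ne_zero s hx).1 h) s hs
  · rw [sure_of_step (c' := ([q], s)) (by simp only [step, if_neg h])]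
    rw [Operand.eval_ne_zero s hx, not_not, hs] at h
    exact h₂ h s hs

/-- The conditions `Fits` exclude overflow and truncation, so words behave as natural numbers.
Straight-line code is thereby verified by simplification and linear arithmetic. -/
theorem H.of_wp (hw : 0 < w) {p : Cmd} {σ : Mem} {Φ : Mem → Prop} (h : wp w p Φ σ) :
    H w p σ (cost p) Φ := by
  induction p generalizing σ Φ with
  | skip => exact H.skip h
  | set r op x y =>
    obtain ⟨hx, hy, ho, h⟩ := h
    intro s hs
    subst hs
    rw [cost, ← zero_add 1, sure_of_step (c' := ([], _)) rfl, Sure.nil, view_setReg,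
      Op.eval_toNat hw, Operand.eval_toNat s hx, Operand.eval_toNat s hy]
    · exact h
    · rw [Operand.eval_toNat s hx, Operand.eval_toNat s hy]; exact ho
  | load r a x =>
    obtain ⟨hx, h⟩ := h
    intro s hs
    subst hs
    rw [cost, ← zero_add 1, sure_of_step (c' := ([], _)) rfl, Sure.nil, view_setReg]
    have hl := Operand.ev_lt s hx
    have : (view s).A a (x.ev (view s)) = (s.arr a (x.eval s)).toNat := by
      simp only [view] at hl ⊢
      rw [if_pos hl]
      congr 2
      apply BitVec.eq_of_toNat_eq
      rw [Operand.eval_toNat s hx, BitVec.toNat_ofNat, Nat.mod_eq_of_lt hl]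
      rfl
    rwa [← this]
  | store a x y =>
    obtain ⟨hx, hy, h⟩ := h
    intro s hs
    subst hs
    rw [cost, ← zero_add 1, sure_of_step (c' := ([], _)) rfl, Sure.nil, view_setArr,
      Operand.eval_toNat s hx, Operand.eval_toNat s hy]
    exact h
  | rand r => exact h.elim
  | seq p q ihp ihq => exact H.seq ((ihp h).mono le_rfl fun σ' h' => ihq h')
  | branch x p q ihp ihq =>
    exact H.branch h.1 (fun hx => (ihp (h.2.1 hx)).time (le_max_left _ _))
      (fun hx => (ihq (h.2.2 hx)).time (le_max_right _ _))
  | loop x p => exact h.elim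

theorem H.of_wp' (hw : 0 < w) {p : Cmd} {σ : Mem} {T : ℕ} {Φ : Mem → Prop} (hT : cost p ≤ T)
    (h : wp w p Φ σ) : H w p σ T Φ := (H.of_wp hw h).time hT

theorem H.cons {p : Cmd} {ps : List Cmd} {σ : Mem} {T₁ T₂ : ℕ} {Φ : Mem → Prop}
    (h : H w p σ T₁ (fun σ' => H w (block ps) σ' T₂ Φ)) :
    H w (block (p :: ps)) σ (T₁ + T₂ + 1) Φ := H.seq h

theorem H.bind {p : Cmd} {ps : List Cmd} {σ : Mem} {T T₁ T₂ : ℕ} {Φ Ψ : Mem → Prop}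
    (h : H w p σ T₁ Ψ) (h' : ∀ σ', Ψ σ' → H w (block ps) σ' T₂ Φ) (hT : T₁ + T₂ + 1 ≤ T) :
    H w (block (p :: ps)) σ T Φ := (H.cons (h.mono le_rfl h')).time hT

theorem H.start (hw : 0 < w) {p : Cmd} {ps : List Cmd} {σ : Mem} {T T₂ : ℕ} {Φ : Mem → Prop}
    (h : wp w p (fun σ' => H w (block ps) σ' T₂ Φ) σ) (hT : cost p + T₂ + 1 ≤ T) :
    H w (block (p :: ps)) σ T Φ := (H.cons (H.of_wp hw h)).time hT

theorem H.nil {σ : Mem} {Φ : Mem → Prop} (h : Φ σ) : H w (block []) σ 1 Φ := H.skip h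

theorem H.last {p : Cmd} {σ : Mem} {T T' : ℕ} {Φ : Mem → Prop}
    (h : H w p σ T Φ) (hT : T + 2 ≤ T') : H w (block [p]) σ T' Φ :=
  H.bind h (fun _ => H.nil) hT

/-- Induction on the number of remaining rounds. The time of a round may depend on its number, which
allows amortized bounds; each test of the condition costs one step. -/
theorem H.loop {x : Operand} {p : Cmd} {σ₀ : Mem} {lo hi : ℕ} {t : ℕ → ℕ} {Inv : ℕ → Mem → Prop}
    (hx : x.Fits w) (hle : lo ≤ hi) (h₀ : Inv lo σ₀)
    (hbody : ∀ k σ, lo ≤ k → k < hi → Inv k σ → x.ev σ ≠ 0 ∧ H w p σ (t k) (Inv (k + 1)))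
    (hend : ∀ σ, Inv hi σ → x.ev σ = 0) :
    H w (.loop x p) σ₀ (∑ k ∈ Finset.Ico lo hi, (t k + 1) + 1) (Inv hi) := by
  obtain ⟨d, rfl⟩ := Nat.exists_eq_add_of_le hle
  clear hle
  induction d generalizing lo σ₀ with
  | zero =>
    intro s hs
    subst hs
    have : ¬ x.eval s ≠ 0 := by rw [Operand.eval_ne_zero s hx, not_not]; exact hend _ h₀
    rw [sure_of_step (c' := ([], s)) (by simp only [step, if_neg this]), Sure.nil]
    exact h₀
  | succ d ih =>
    intro s hs
    subst hs
    obtain ⟨h1, h2⟩ := hbody lo _ le_rfl (by omega) h₀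
    rw [← Operand.eval_ne_zero s hx] at h1
    rw [sure_of_step (c' := ([p, .loop x p], s)) (by simp only [step, if_pos h1])]
    rw [Finset.sum_eq_sum_Ico_succ_bot (by omega)]
    have e : lo + (d + 1) = lo + 1 + d := by omega
    have := (h2 s rfl).append (k₂ := [.loop x p]) (fun s' h' =>
      ih (σ₀ := view s') (lo := lo + 1) h'
        (fun k σ h1 h2 h3 => by
          have := hbody k σ (by omega) (by omega) h3; exact this)
        (fun σ h => hend σ (by rwa [e])) s' rfl)
    rw [e]
    exact this.mono (by omega) fun _ h => h

/-! ### The cells that a program may change -/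

def modR : Cmd → List ℕ
  | .set r .. => [r]
  | .load r .. => [r]
  | .rand r => [r]
  | .seq p q => modR p ++ modR q
  | .branch _ p q => modR p ++ modR q
  | .loop _ p => modR p
  | _ => []

def modA : Cmd → List ℕ
  | .store a .. => [a]
  | .seq p q => modA p ++ modA q
  | .branch _ p q => modA p ++ modA q
  | .loop _ p => modA p
  | _ => []

/-- The program `p` may have changed the memory `σ` to `σ'`. -/
def Frame (p : Cmd) (σ σ' : Mem) : Prop :=
  (∀ r, r ∉ modR p → σ'.R r = σ.R r) ∧ (∀ a, a ∉ modA p → σ'.A a = σ.A a)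

/-- A command is replaced on the stack only by its own parts, so the set of cells that the stack can
write never grows. Specifications therefore need to mention only the cells that change. -/
theorem Sure.frame {T : ℕ} {k : List Cmd} {s : State w} {Φ : State w → Prop}
    (h : Sure T (k, s) Φ) :
    Sure T (k, s) (fun s' => Φ s' ∧ (∀ r, (∀ c ∈ k, r ∉ modR c) → s'.reg r = s.reg r) ∧
      (∀ a, (∀ c ∈ k, a ∉ modA c) → s'.arr a = s.arr a)) := by
  induction T generalizing k s with
  | zero => exact ⟨h.1, h.2, fun _ _ => rfl, fun _ _ => rfl⟩
  | succ T ih =>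
    cases k with
    | nil => rw [Sure.nil] at h ⊢; exact ⟨h, fun _ _ => rfl, fun _ _ => rfl⟩
    | cons p k =>
      cases p with
      | rand r =>
        rw [sure_rand] at h ⊢
        intro x
        refine (ih (h x)).mono le_rfl ?_
        rintro s' ⟨h1, h2, h3⟩
        refine ⟨h1, fun r' hr' => ?_, fun a ha => ?_⟩
        · simp only [List.mem_cons, forall_eq_or_imp, modR] at hr'
          exact (h2 r' hr'.2).trans (Function.update_of_ne (by simpa using hr'.1) _ _)
        · simp only [List.mem_cons, forall_eq_or_imp] at ha
          exact h3 a ha.2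
      | set r op x y =>
        rw [sure_of_step rfl] at h ⊢
        refine (ih h).mono le_rfl ?_
        rintro s' ⟨h1, h2, h3⟩
        refine ⟨h1, fun r' hr' => ?_, fun a ha => ?_⟩
        · simp only [List.mem_cons, forall_eq_or_imp, modR] at hr'
          exact (h2 r' hr'.2).trans (Function.update_of_ne (by simpa using hr'.1) _ _)
        · simp only [List.mem_cons, forall_eq_or_imp] at ha
          exact h3 a ha.2
      | load r a x =>
        rw [sure_of_step rfl] at h ⊢
        refine (ih h).mono le_rfl ?_
        rintro s' ⟨h1, h2, h3⟩
        refine ⟨h1, fun r' hr' => ?_, fun a ha => ?_⟩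
        · simp only [List.mem_cons, forall_eq_or_imp, modR] at hr'
          exact (h2 r' hr'.2).trans (Function.update_of_ne (by simpa using hr'.1) _ _)
        · simp only [List.mem_cons, forall_eq_or_imp] at ha
          exact h3 a ha.2
      | store a x y =>
        rw [sure_of_step rfl] at h ⊢
        refine (ih h).mono le_rfl ?_
        rintro s' ⟨h1, h2, h3⟩
        refine ⟨h1, fun r' hr' => ?_, fun a' ha => ?_⟩
        · simp only [List.mem_cons, forall_eq_or_imp] at hr'
          exact h2 r' hr'.2
        · simp only [List.mem_cons, forall_eq_or_imp, modA] at ha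
          exact (h3 a' ha.2).trans (Function.update_of_ne (by simpa using ha.1) _ _)
      | skip =>
        rw [sure_of_step rfl] at h ⊢
        refine (ih h).mono le_rfl ?_
        rintro s' ⟨h1, h2, h3⟩
        exact ⟨h1, fun r hr => h2 r fun c hc => hr c (List.mem_cons_of_mem _ hc),
          fun r hr => h3 r fun c hc => hr c (List.mem_cons_of_mem _ hc)⟩
      | seq p q =>
        rw [sure_of_step rfl] at h ⊢
        refine (ih h).mono le_rfl ?_
        rintro s' ⟨h1, h2, h3⟩
        refine ⟨h1, fun r hr => h2 r ?_, fun r hr => h3 r ?_⟩ <;>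
        · simp only [List.mem_cons, forall_eq_or_imp, modR, modA, List.mem_append, not_or] at hr ⊢
          exact ⟨hr.1.1, hr.1.2, hr.2⟩
      | branch x p q =>
        by_cases hx : x.eval s ≠ 0
        · rw [sure_of_step (c' := (p :: k, s)) (by simp only [step, if_pos hx])] at h ⊢
          refine (ih h).mono le_rfl ?_
          rintro s' ⟨h1, h2, h3⟩
          refine ⟨h1, fun r hr => h2 r ?_, fun r hr => h3 r ?_⟩ <;>
          · simp only [List.mem_cons, forall_eq_or_imp, modR, modA, List.mem_append, not_or] at hr ⊢
            exact ⟨hr.1.1, hr.2⟩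
        · rw [sure_of_step (c' := (q :: k, s)) (by simp only [step, if_neg hx])] at h ⊢
          refine (ih h).mono le_rfl ?_
          rintro s' ⟨h1, h2, h3⟩
          refine ⟨h1, fun r hr => h2 r ?_, fun r hr => h3 r ?_⟩ <;>
          · simp only [List.mem_cons, forall_eq_or_imp, modR, modA, List.mem_append, not_or] at hr ⊢
            exact ⟨hr.1.2, hr.2⟩
      | loop x p =>
        by_cases hx : x.eval s ≠ 0
        · rw [sure_of_step (c' := (p :: .loop x p :: k, s)) (by simp only [step, if_pos hx])] at h ⊢
          refine (ih h).mono le_rfl ?_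
          rintro s' ⟨h1, h2, h3⟩
          refine ⟨h1, fun r hr => h2 r ?_, fun r hr => h3 r ?_⟩ <;>
          · simp only [List.mem_cons, forall_eq_or_imp, modR, modA] at hr ⊢
            exact ⟨hr.1, hr.1, hr.2⟩
        · rw [sure_of_step (c' := (k, s)) (by simp only [step, if_neg hx])] at h ⊢
          refine (ih h).mono le_rfl ?_
          rintro s' ⟨h1, h2, h3⟩
          exact ⟨h1, fun r hr => h2 r fun c hc => hr c (List.mem_cons_of_mem _ hc),
            fun r hr => h3 r fun c hc => hr c (List.mem_cons_of_mem _ hc)⟩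

theorem H.frame {p : Cmd} {σ : Mem} {T : ℕ} {Φ : Mem → Prop} (h : H w p σ T Φ) :
    H w p σ T (fun σ' => Φ σ' ∧ Frame p σ σ') := by
  intro s hs
  subst hs
  refine (h s rfl).frame.mono le_rfl ?_
  rintro s' ⟨h1, h2, h3⟩
  simp only [List.mem_singleton, forall_eq] at h2 h3
  exact ⟨h1, fun r hr => by simp only [view, h2 r hr], fun a ha => by simp only [view, h3 a ha]⟩

/-! ### Loops over an interval -/

/-- Repeat `p` while register `i` is less than `n`, and increase this register after each round.
Register `99` holds the loop condition. -/
def forTo (i : ℕ) (n : Operand) (p : Cmd) : Cmd :=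
  .seq (.set 99 .lt (.reg i) n)
    (.loop (.reg 99) (.seq p (.seq (.set i .add (.reg i) (.const 1)) (.set 99 .lt (.reg i) n))))

/-- The condition `hstab` says that the invariant ignores the counter and the flag. The body may
overwrite register `99`, as nested loops do, since the flag is recomputed after the body. Besides
the body a round costs five steps: two sequencings, the increment, the comparison and the test. -/
theorem H.forTo (hw : 0 < w) {i : ℕ} {n : Operand} {p : Cmd} {σ₀ : Mem} {lo hi : ℕ} {t : ℕ → ℕ}
    {Inv : ℕ → Mem → Prop} (hfit : n.Fits w)
    (hi₁ : i ∉ 99 :: modR p) (hn₁ : ∀ r ∈ n.regs, r ∉ i :: 99 :: modR p)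
    (hlo : σ₀.R i = lo) (hhi : n.ev σ₀ = hi) (hle : lo ≤ hi) (h₀ : Inv lo σ₀)
    (hstab : ∀ k σ v v', Inv k σ → Inv k ((σ.setR i v).setR 99 v'))
    (hbody : ∀ k σ, lo ≤ k → k < hi → Inv k σ → σ.R i = k → Frame (forTo i n p) σ₀ σ →
      H w p σ (t k) (Inv (k + 1))) :
    H w (forTo i n p) σ₀ (∑ k ∈ Finset.Ico lo hi, (t k + 5) + 3)
      (fun σ => Inv hi σ ∧ σ.R i = hi ∧ Frame (forTo i n p) σ₀ σ) := by
  have h1w : 1 < 2 ^ w := Nat.one_lt_two_pow hw.ne'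
  have hmod : modR (WordRAM.forTo i n p) = 99 :: (modR p ++ [i, 99]) := by simp [WordRAM.forTo, modR]
  have hmodA : modA (WordRAM.forTo i n p) = modA p := by simp [WordRAM.forTo, modA]
  simp only [List.mem_cons, not_or] at hi₁ hn₁
  have hnn : ∀ σ, Frame (WordRAM.forTo i n p) σ₀ σ → n.ev σ = hi := by
    intro σ hσ
    rw [← hhi]
    cases n with
    | const k => rfl
    | reg r =>
      refine hσ.1 r ?_
      have := hn₁ r (by simp [Operand.regs])
      simp [hmod, this]
  have hns : ∀ σ v v', n.ev ((Mem.setR σ i v).setR 99 v') = n.ev σ := by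
    intro σ v v'
    cases n with
    | const k => rfl
    | reg r =>
      have := hn₁ r (by simp [Operand.regs])
      simp [this]
  have hns1 : ∀ σ v, n.ev (Mem.setR σ i v) = n.ev σ := by
    intro σ v
    cases n with
    | const k => rfl
    | reg r =>
      have := hn₁ r (by simp [Operand.regs])
      simp [this]
  let J : ℕ → Mem → Prop := fun k σ => Inv k σ ∧ σ.R i = k ∧ Frame (WordRAM.forTo i n p) σ₀ σ ∧
    σ.R 99 = if k < hi then 1 else 0
  have hi9 : ¬ i = 99 := hi₁.1
  have hFr : ∀ σ v v', Frame (WordRAM.forTo i n p) σ₀ σ →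
      Frame (WordRAM.forTo i n p) σ₀ ((σ.setR i v).setR 99 v') := by
    intro σ v v' h
    refine ⟨fun r hr => ?_, h.2⟩
    rw [← h.1 r hr]
    simp only [hmod, List.mem_cons, List.mem_append, not_or] at hr
    simp [hr.1, hr.2.2.1]
  -- Writing the counter's own value changes nothing, so `hstab` also covers the initial assignment
  -- to the flag alone.
  have hi0 : Mem.setR σ₀ i lo = σ₀ := by
    ext r
    · simp only [Mem.setR_R]; split_ifs with h
      · rw [h, hlo]
      · rfl
    · rfl
  have key := H.loop (w := w) (x := .reg 99)
    (p := .seq p (.seq (.set i .add (.reg i) (.const 1)) (.set 99 .lt (.reg i) n)))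
    (σ₀ := σ₀.setR 99 (if lo < hi then 1 else 0)) (lo := lo) (hi := hi) (t := fun k => t k + 4)
    (Inv := J) trivial hle
    ⟨by
      have := hstab lo σ₀ lo (if lo < hi then 1 else 0) h₀
      rwa [hi0] at this, by simp [hi9, hlo],
      by
        have := hFr σ₀ lo (if lo < hi then 1 else 0) ⟨fun _ _ => rfl, fun _ _ => rfl⟩
        rwa [hi0] at this, by simp⟩
    (by
      rintro k σ hk1 hk2 ⟨hI, hik, hfr, h99⟩
      refine ⟨by simp [h99, hk2], ?_⟩
      have hb := (hbody k σ hk1 hk2 hI hik hfr).frame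
      refine (H.seq (T₁ := t k) (T₂ := 3) (hb.mono le_rfl ?_)).time (by omega)
      rintro σ' ⟨hI', hf'⟩
      have hfr' : Frame (WordRAM.forTo i n p) σ₀ σ' := by
        refine ⟨fun r hr => ?_, fun a ha => ?_⟩
        · rw [← hfr.1 r hr]; exact hf'.1 r (by simp [hmod] at hr; tauto)
        · rw [← hfr.2 a ha]; exact hf'.2 a (by rwa [hmodA] at ha)
      have hik' : σ'.R i = k := by rw [hf'.1 i hi₁.2, hik]
      intro s hs
      -- The bound is a word, so increasing a counter below it cannot overflow.
      have hlt : hi < 2 ^ w := by rw [← hnn σ' hfr', ← hs]; exact Operand.ev_lt s hfit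
      refine H.of_wp' hw (by simp [cost]) ?_ s hs
      refine ⟨trivial, by simpa using h1w, ?_, trivial, hfit, trivial, ?_⟩
      · simp only [Op.Fits, Operand.ev_reg, Operand.ev_const, hik']; omega
      · have e1 : n.ev (σ'.setR i (k + 1)) = hi := by rw [hns1, hnn σ' hfr']
        simp only [Op.nat, Operand.ev_reg, Operand.ev_const, hik', e1]
        refine ⟨hstab _ _ _ _ hI', by simp [hi9], hFr _ _ _ hfr', by simp⟩)
    (by rintro σ ⟨-, -, -, h⟩; simpa using h)
  have hset : H w (.set 99 .lt (.reg i) n) σ₀ 1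
      (fun σ => H w (.loop (.reg 99) (.seq p (.seq (.set i .add (.reg i) (.const 1))
        (.set 99 .lt (.reg i) n)))) σ (∑ k ∈ Finset.Ico lo hi, (t k + 5) + 1) (J hi)) := by
    refine H.of_wp' hw (by simp [cost]) ⟨trivial, hfit, trivial, ?_⟩
    simp only [Op.nat, Operand.ev_reg, hlo, hhi]
    exact key
  refine (H.seq hset).mono (by omega) ?_
  · rintro σ ⟨a, b, c, -⟩; exact ⟨a, b, c⟩

theorem H.forTo_const (hw : 0 < w) {i : ℕ} {n : Operand} {p : Cmd} {σ₀ : Mem} {lo hi : ℕ} {t : ℕ}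
    {Inv : ℕ → Mem → Prop} (hfit : n.Fits w)
    (hi₁ : i ∉ 99 :: modR p) (hn₁ : ∀ r ∈ n.regs, r ∉ i :: 99 :: modR p)
    (hlo : σ₀.R i = lo) (hhi : n.ev σ₀ = hi) (hle : lo ≤ hi) (h₀ : Inv lo σ₀)
    (hstab : ∀ k σ v v', Inv k σ → Inv k ((σ.setR i v).setR 99 v'))
    (hbody : ∀ k σ, lo ≤ k → k < hi → Inv k σ → σ.R i = k → Frame (WordRAM.forTo i n p) σ₀ σ →
      H w p σ t (Inv (k + 1))) :
    H w (WordRAM.forTo i n p) σ₀ ((hi - lo) * (t + 5) + 3)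
      (fun σ => Inv hi σ ∧ σ.R i = hi ∧ Frame (WordRAM.forTo i n p) σ₀ σ) := by
  have := H.forTo hw (t := fun _ => t) hfit hi₁ hn₁ hlo hhi hle h₀ hstab hbody
  simpa using this

/-! ### Searching a triple of blocks -/

/-- One round of the search with two pointers, for the summand in register `40`: the pointers
`41` into `B` and `42` into `C` are limited by the registers `35` and `37`. -/
def scanStep : Cmd :=
  block [.set 43 .lt (.reg 41) (.reg 35), .set 44 .lt (.reg 42) (.reg 37),
    .branch (.reg 43) (.branch (.reg 44)
      (block [.load 45 1 (.reg 41), .set 45 .add (.reg 40) (.reg 45), .load 46 2 (.reg 42),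
        .set 47 .eq (.reg 45) (.reg 46), .set 43 .lt (.reg 45) (.reg 46),
        .branch (.reg 47) (.set 1 .add (.const 1) (.const 0))
          (.branch (.reg 43) (.set 41 .add (.reg 41) (.const 1))
              (.set 42 .add (.reg 42) (.const 1)))])
      .skip) .skip]

/-- Search for `A x + B y = C z`, where `x`, `y`, `z` range over the intervals that are given by
the registers `32`–`37`; register `1` is set to `1` if there is a solution. -/
def search : Cmd :=
  block [block [.set 48 .sub (.reg 35) (.reg 34), .set 49 .sub (.reg 37) (.reg 36),
    .set 48 .add (.reg 48) (.reg 49), .set 38 .add (.reg 32) (.const 0)],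
    forTo 38 (.reg 33)
      (block [block [.load 40 0 (.reg 38), .set 41 .add (.reg 34) (.const 0),
        .set 42 .add (.reg 36) (.const 0), .set 39 .add (.const 0) (.const 0)],
        forTo 39 (.reg 48) scanStep])]

/-- `A x + B y = C z` has a solution with `x`, `y`, `z` in the given intervals. -/
def HasSum (σ : Mem) (xl xh yl yh zl zh : ℕ) : Prop :=
  ∃ x y z, xl ≤ x ∧ x < xh ∧ yl ≤ y ∧ y < yh ∧ zl ≤ z ∧ z < zh ∧ σ.A 0 x + σ.A 1 y = σ.A 2 z

/-- The invariant: unless a solution has been found, each solution lies at or to the right of both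
pointers, and the pointers have made `k` moves in total. After as many moves as both ranges have
elements this leaves no room for a solution. If a pointer has reached its limit there is no solution
left, and idle rounds are harmless. -/
theorem scan_spec (hw : 2 ≤ w) {σ : Mem} {X yl yh zl zh U : ℕ} (hX : σ.R 40 = X)
    (h41 : σ.R 41 = yl) (h42 : σ.R 42 = zl) (h35 : σ.R 35 = yh) (h37 : σ.R 37 = zh)
    (h39 : σ.R 39 = 0) (h48 : σ.R 48 = (yh - yl) + (zh - zl)) (hy : yl ≤ yh) (hz : zl ≤ zh)
    (hU : 2 * U < 2 ^ w) (hXU : X ≤ U) (hBU : ∀ y, σ.A 1 y ≤ U)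
    (hyw : yh < 2 ^ w) (hzw : zh < 2 ^ w)
    (hB : ∀ y y', y ≤ y' → y' < yh → σ.A 1 y ≤ σ.A 1 y')
    (hC : ∀ z z', z ≤ z' → z' < zh → σ.A 2 z ≤ σ.A 2 z') :
    H w (forTo 39 (.reg 48) scanStep) σ (((yh - yl) + (zh - zl)) * 30 + 3) (fun σ' =>
      ((∃ y z, yl ≤ y ∧ y < yh ∧ zl ≤ z ∧ z < zh ∧ X + σ.A 1 y = σ.A 2 z) → σ'.R 1 = 1) ∧
      (σ'.R 1 = σ.R 1 ∨ σ'.R 1 = 1 ∧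
        ∃ y z, yl ≤ y ∧ y < yh ∧ zl ≤ z ∧ z < zh ∧ X + σ.A 1 y = σ.A 2 z)) := by
  have h4 : 4 ≤ 2 ^ w := le_trans (by norm_num) (Nat.pow_le_pow_right two_pos hw)
  set S : Prop := ∃ y z, yl ≤ y ∧ y < yh ∧ zl ≤ z ∧ z < zh ∧ X + σ.A 1 y = σ.A 2 z with hS
  refine (H.forTo_const (by omega) (lo := 0) (hi := (yh - yl) + (zh - zl)) (t := 25)
    (Inv := fun k σ' => yl ≤ σ'.R 41 ∧ zl ≤ σ'.R 42 ∧ (σ'.R 1 = σ.R 1 ∨ σ'.R 1 = 1 ∧ S) ∧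
      (σ'.R 1 = 1 ∨ ∀ y z, yl ≤ y → y < yh → zl ≤ z → z < zh → X + σ.A 1 y = σ.A 2 z →
        σ'.R 41 ≤ y ∧ σ'.R 42 ≤ z ∧ σ'.R 41 + σ'.R 42 = yl + zl + k)) (Operand.fits_reg _) (by decide)
    (by decide) h39 h48 (by omega) ⟨h41.ge, h42.ge, Or.inl rfl, Or.inr ?_⟩ ?_ ?_).mono le_rfl ?_
  · intro y z h1 h2 h3 h4 h5
    exact ⟨by omega, by omega, by omega⟩
  · intro k σ v v' h
    simpa using h
  · rintro k σ' - hk ⟨i1, i2, i3, i4⟩ h39' hF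
    have e40 : σ'.R 40 = X := (hF.1 40 (by decide)).trans hX
    have e35 : σ'.R 35 = yh := (hF.1 35 (by decide)).trans h35
    have e37 : σ'.R 37 = zh := (hF.1 37 (by decide)).trans h37
    have eA : σ'.A = σ.A := by funext a; exact hF.2 a (by simp [forTo, scanStep, modA, block])
    refine H.of_wp' (by omega) (by decide) ?_
    generalize hp : σ'.R 41 = p at *
    generalize hq : σ'.R 42 = q at *
    have hBp := hBU p
    simp [scanStep, block, wp, Op.nat, Op.Fits, e40, e35, e37, eA, hp, hq]
    -- It suffices that the round moves exactly one pointer and does not pass a solution;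
    -- monotonicity of `B` and `C` shows this in either case.
    have step : ∀ p' q', (∀ y z, yl ≤ y → y < yh → zl ≤ z → z < zh → X + σ.A 1 y = σ.A 2 z →
        p ≤ y → q ≤ z → p' ≤ y ∧ q' ≤ z ∧ p' + q' = p + q + 1) →
        (σ'.R 1 = 1 ∨ ∀ y z, yl ≤ y → y < yh → zl ≤ z → z < zh → X + σ.A 1 y = σ.A 2 z →
          p' ≤ y ∧ q' ≤ z ∧ p' + q' = yl + zl + (k + 1)) := by
      intro p' q' h
      rcases i4 with i4 | i4
      · exact Or.inl i4
      · refine Or.inr fun y z h1 h2 h3 h4 h5 => ?_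
        obtain ⟨j1, j2, j3⟩ := i4 y z h1 h2 h3 h4 h5
        have := h y z h1 h2 h3 h4 h5 j1 j2
        omega
    refine ⟨fun c1 => ⟨fun c2 => ⟨by omega, fun h => ⟨by omega, i1, i2, Or.inr ?_⟩, fun h =>
      ⟨fun h' => ⟨by omega, by omega, by omega, i2, i3, step _ _ ?_⟩,
        fun h' => ⟨by omega, by omega, i1, by omega, i3, step _ _ ?_⟩⟩⟩,
      fun c2 => ⟨i1, i2, i3, step _ _ ?_⟩⟩, fun c1 => ⟨i1, i2, i3, step _ _ ?_⟩⟩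
    · exact ⟨p, q, i1, c1, i2, c2, h⟩
    · intro y z h1 h2 h3 h4 h5 h6 h7
      have := hC q z h7 h4
      rcases h6.eq_or_lt with rfl | h6 <;> omega
    · intro y z h1 h2 h3 h4 h5 h6 h7
      have := hB p y h6 h2
      rcases h7.eq_or_lt with rfl | h7 <;> omega
    · intro y z h1 h2 h3 h4 h5 h6 h7; omega
    · intro y z h1 h2 h3 h4 h5 h6 h7; omega
  · rintro σ' ⟨⟨i1, i2, i3, i4⟩, -, -⟩
    refine ⟨?_, i3⟩
    rintro ⟨y, z, h1, h2, h3, h4, h5⟩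
    rcases i4 with h | h
    · exact h
    · have := h y z h1 h2 h3 h4 h5
      omega

theorem search_spec (hw : 2 ≤ w) {σ : Mem} {xl xh yl yh zl zh U : ℕ} (h32 : σ.R 32 = xl)
    (h33 : σ.R 33 = xh) (h34 : σ.R 34 = yl) (h35 : σ.R 35 = yh) (h36 : σ.R 36 = zl)
    (h37 : σ.R 37 = zh) (hx : xl ≤ xh) (hy : yl ≤ yh) (hz : zl ≤ zh)
    (hU : 2 * U < 2 ^ w) (hAU : ∀ x, σ.A 0 x ≤ U) (hBU : ∀ y, σ.A 1 y ≤ U)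
    (hxw : xh < 2 ^ w) (hyz : yh + zh < 2 ^ w)
    (hB : ∀ y y', y ≤ y' → y' < yh → σ.A 1 y ≤ σ.A 1 y')
    (hC : ∀ z z', z ≤ z' → z' < zh → σ.A 2 z ≤ σ.A 2 z') :
    H w search σ ((xh - xl) * (((yh - yl) + (zh - zl)) * 30 + 20) + 20) (fun σ' =>
      (HasSum σ xl xh yl yh zl zh → σ'.R 1 = 1) ∧
      (σ'.R 1 = σ.R 1 ∨ σ'.R 1 = 1 ∧ HasSum σ xl xh yl yh zl zh)) := by
  have h4 : 4 ≤ 2 ^ w := le_trans (by norm_num) (Nat.pow_le_pow_right two_pos hw)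
  have hinit : ∀ (Ψ : Mem → Prop), (∀ σ', σ'.A = σ.A → (∀ r, r ≠ 48 → r ≠ 49 → r ≠ 38 →
      σ'.R r = σ.R r) → σ'.R 48 = (yh - yl) + (zh - zl) → σ'.R 38 = xl → Ψ σ') →
      wp w (block [.set 48 .sub (.reg 35) (.reg 34), .set 49 .sub (.reg 37) (.reg 36),
    .set 48 .add (.reg 48) (.reg 49), .set 38 .add (.reg 32) (.const 0)]) Ψ σ := by
    intro Ψ hΨ
    simp [block, wp, Op.nat, Op.Fits, h32, h34, h35, h36, h37, hy, hz]
    refine ⟨by omega, by omega, hΨ _ ?_ ?_ ?_ ?_⟩ <;> simp +contextual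
  refine (H.cons (T₁ := 9) (T₂ := (xh - xl) * (((yh - yl) + (zh - zl)) * 30 + 20) + 5)
    (H.of_wp' (by omega) (by decide) (hinit _ fun σ₁ eA eR e48 e38 => ?_))).time (by omega)
  refine (H.cons ((H.forTo_const (by omega) (lo := xl) (hi := xh)
    (t := ((yh - yl) + (zh - zl)) * 30 + 15)
    (Inv := fun k σ' => (HasSum σ xl k yl yh zl zh → σ'.R 1 = 1) ∧
      (σ'.R 1 = σ.R 1 ∨ σ'.R 1 = 1 ∧ HasSum σ xl k yl yh zl zh))
    (Operand.fits_reg _) (by decide) (by decide) e38 (by simp [eR, h33]) hx ⟨?_, ?_⟩ ?_ ?_).mono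
    le_rfl fun σ' h' => H.nil ⟨h'.1.1, h'.1.2⟩)).time (by ring_nf; omega)
  · rintro ⟨x, y, z, h⟩; omega
  · exact Or.inl (by simp [eR])
  · intro k σ v v' h
    simpa using h
  · rintro k σ₂ hk1 hk2 ⟨i1, i2⟩ h38 hF
    have fR : ∀ r, r ∉ modR (forTo 38 (.reg 33)
      (block [block [.load 40 0 (.reg 38), .set 41 .add (.reg 34) (.const 0),
        .set 42 .add (.reg 36) (.const 0), .set 39 .add (.const 0) (.const 0)],
        forTo 39 (.reg 48) scanStep])) → σ₂.R r = σ₁.R r := hF.1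
    have fA : σ₂.A = σ.A := by
      funext a; rw [← eA]
      exact hF.2 a (by simp [forTo, scanStep, modA, block])
    have e34 : σ₂.R 34 = yl := by rw [fR 34 (by decide), eR _ (by decide) (by decide) (by decide), h34]
    have e35 : σ₂.R 35 = yh := by rw [fR 35 (by decide), eR _ (by decide) (by decide) (by decide), h35]
    have e36 : σ₂.R 36 = zl := by rw [fR 36 (by decide), eR _ (by decide) (by decide) (by decide), h36]
    have e37 : σ₂.R 37 = zh := by rw [fR 37 (by decide), eR _ (by decide) (by decide) (by decide), h37]
    have e48' := (fR 48 (by decide)).trans e48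
    refine (H.cons (T₁ := 9) (T₂ := ((yh - yl) + (zh - zl)) * 30 + 5)
      (H.of_wp' (by omega) (by decide) ?_)).time (by omega)
    simp [block, wp, Op.nat, Op.Fits, h38, e34, e36, fA]
    refine ⟨by omega, by omega, ?_⟩
    refine H.last (H.mono (scan_spec hw (X := σ.A 0 k) (yl := yl) (zl := zl) (yh := yh) (zh := zh)
      (U := U) ?_ ?_ ?_ ?_ ?_ ?_ ?_ hy hz hU (hAU _) ?_ (by omega) (by omega) ?_ ?_) le_rfl
      fun σ' h' => ?_) le_rfl
    · simp
    · simp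
    · simp
    · simp [e35]
    · simp [e37]
    · simp
    · simp [e48']
    · simpa [fA] using hBU
    · simpa [fA] using hB
    · simpa [fA] using hC
    simp only [Mem.setR_A, fA, Mem.setR_R] at h'
    obtain ⟨j1, j2⟩ := h'
    have hmono : HasSum σ xl k yl yh zl zh → HasSum σ xl (k + 1) yl yh zl zh := by
      rintro ⟨x, y, z, h1, h2, h3⟩
      exact ⟨x, y, z, h1, by omega, h3⟩
    constructor
    · rintro ⟨x, y, z, h1, h2, h3, h4, h5, h6, h7⟩
      rcases (Nat.lt_succ_iff.1 h2).eq_or_lt with rfl | h2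
      · exact j1 ⟨y, z, h3, h4, h5, h6, h7⟩
      · have := i1 ⟨x, y, z, h1, h2, h3, h4, h5, h6, h7⟩
        rcases j2 with j2 | j2
        · simpa [this] using j2
        · exact j2.1
    · rcases j2 with j2 | ⟨j2, y, z, h1, h2, h3, h4, h5⟩
      · simp at j2
        rw [j2]
        exact i2.imp id (And.imp id hmono)
      · exact Or.inr ⟨j2, k, y, z, hk1, by omega, h1, h2, h3, h4, h5⟩

/-! ### Sorting -/

/-- The list of the first `n` values of `f`. -/
def firstValues (f : ℕ → ℕ) (n : ℕ) : List ℕ := (List.range n).map f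

theorem firstValues_succ (f : ℕ → ℕ) (n : ℕ) :
    firstValues f (n + 1) = firstValues f n ++ [f n] := by
  simp [firstValues, List.range_succ]

@[simp] theorem length_firstValues (f : ℕ → ℕ) (n : ℕ) : (firstValues f n).length = n := by
  simp [firstValues]

theorem firstValues_congr {f g : ℕ → ℕ} {n : ℕ} (h : ∀ i < n, f i = g i) :
    firstValues f n = firstValues g n :=
  List.map_congr_left fun i hi => h i (List.mem_range.1 hi)

theorem firstValues_update (f : ℕ → ℕ) (n x : ℕ) :
    firstValues (Function.update f n x) n = firstValues f n :=
  firstValues_congr fun _ hi => Function.update_of_ne hi.ne _ _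

/-- Append to the array `3` the entries of the array `a` whose bit number `51` is `β`. -/
def sortPass (a β : ℕ) : Cmd :=
  block [.load 54 a (.reg 53), .set 55 .shr (.reg 54) (.reg 51), .set 55 .mod (.reg 55) (.const 2),
    .set 55 .eq (.reg 55) (.const β),
    .branch (.reg 55) (block [.store 3 (.reg 52) (.reg 54), .set 52 .add (.reg 52) (.const 1)])
      .skip]

/-- One round of radix sort. -/
def sortRound (a : ℕ) : Cmd :=
  block [block [.set 52 .add (.const 0) (.const 0), .set 53 .add (.const 0) (.const 0)],
    forTo 53 (.reg 0) (sortPass a 0),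
    .set 53 .add (.const 0) (.const 0),
    forTo 53 (.reg 0) (sortPass a 1),
    .set 53 .add (.const 0) (.const 0),
    forTo 53 (.reg 0) (block [.load 54 3 (.reg 53), .store a (.reg 53) (.reg 54)])]

/-- Sort the array `a`, whose entries have at most as many bits as register `50` says. -/
def sortArray (a : ℕ) : Cmd :=
  block [.set 51 .add (.const 0) (.const 0), forTo 51 (.reg 50) (sortRound a)]

theorem sortPass_spec (hw : 2 ≤ w) {σ : Mem} {a β m t : ℕ} {l : List ℕ} (ha : a ≠ 3) (hβ : β < 2)
    (hm : σ.R 0 = m) (h51 : σ.R 51 = t) (h53 : σ.R 53 = 0) (h52 : σ.R 52 = l.length)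
    (hl : firstValues (σ.A 3) l.length = l) (hlm : l.length + m < 2 ^ w) :
    H w (forTo 53 (.reg 0) (sortPass a β)) σ (m * 25 + 3) (fun σ' =>
      (σ'.R 52 = (l ++ (firstValues (σ.A a) m).filter (fun x => x / 2 ^ t % 2 = β)).length ∧
      firstValues (σ'.A 3) (σ'.R 52) =
        l ++ (firstValues (σ.A a) m).filter (fun x => x / 2 ^ t % 2 = β)) ∧
      Frame (forTo 53 (.reg 0) (sortPass a β)) σ σ') := by
  have h4 : 4 ≤ 2 ^ w := le_trans (by norm_num) (Nat.pow_le_pow_right two_pos hw)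
  refine H.mono (H.forTo_const (by omega) (lo := 0) (hi := m) (t := 20)
    (Inv := fun k σ' => σ'.R 52 =
        (l ++ (firstValues (σ.A a) k).filter (fun x => x / 2 ^ t % 2 = β)).length ∧
      firstValues (σ'.A 3) (σ'.R 52) =
        l ++ (firstValues (σ.A a) k).filter (fun x => x / 2 ^ t % 2 = β))
    (Operand.fits_reg _) (by simp [sortPass, block, modR]) (by simp [sortPass, block, modR,
      Operand.regs]) h53 hm (Nat.zero_le _) ?_ ?_ ?_) (by simp) fun σ' h => ⟨h.1, h.2.2⟩
  · simp [firstValues, h52]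
    simpa [firstValues] using hl
  · intro k σ v v' h
    simpa using h
  · rintro k σ' - hk ⟨i1, i2⟩ h53 hF
    have e51 : σ'.R 51 = t := (hF.1 51 (by simp [sortPass, forTo, block, modR])).trans h51
    have ea : σ'.A a = σ.A a := hF.2 a (by simp [sortPass, forTo, block, modA, ha])
    have hlen : σ'.R 52 ≤ l.length + k := by
      rw [i1, List.length_append]
      have := (List.filter_sublist (p := fun x => decide (x / 2 ^ t % 2 = β))
        (l := firstValues (σ.A a) k)).length_le
      simp at this
      omega
    refine H.of_wp' (by omega) (T := 20) (by simp [cost, sortPass, block]) ?_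
    generalize hp : σ'.R 52 = p at *
    simp [sortPass, block, wp, Op.nat, Op.Fits, e51, h53, ea, hp, firstValues_succ,
      List.filter_append]
    refine ⟨by omega, by omega, fun h => ?_, fun h => ?_⟩
    · simp [h, firstValues_update, i2]
      simp at i1
      omega
    · simp [h, i2]
      simp at i1
      omega

/-- The correctness of radix sort: filtering is stable, so within equal values of bit `t` the order
by the lower bits persists, and between the two parts bit `t` decides. -/
theorem pairwise_filter_bit {t : ℕ} {l : List ℕ}
    (h : l.Pairwise fun x y => x % 2 ^ t ≤ y % 2 ^ t) :
    (l.filter (fun x => x / 2 ^ t % 2 = 0) ++ l.filter (fun x => x / 2 ^ t % 2 = 1)).Pairwise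
      fun x y => x % 2 ^ (t + 1) ≤ y % 2 ^ (t + 1) := by
  simp only [Nat.mod_pow_succ]
  rw [List.pairwise_append]
  refine ⟨?_, ?_, ?_⟩
  · refine (h.filter _).imp_of_mem fun hx hy hxy => ?_
    simp only [List.mem_filter, decide_eq_true_eq] at hx hy
    rw [hx.2, hy.2]; omega
  · refine (h.filter _).imp_of_mem fun hx hy hxy => ?_
    simp only [List.mem_filter, decide_eq_true_eq] at hx hy
    rw [hx.2, hy.2]; omega
  · intro x hx y hy
    simp only [List.mem_filter, decide_eq_true_eq] at hx hy
    rw [hx.2, hy.2]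
    have := Nat.mod_lt x (Nat.two_pow_pos t)
    omega

theorem perm_filter_bit (t : ℕ) (l : List ℕ) :
    (l.filter (fun x => x / 2 ^ t % 2 = 0) ++ l.filter (fun x => x / 2 ^ t % 2 = 1)).Perm l := by
  have := List.filter_append_perm (fun x => decide (x / 2 ^ t % 2 = 0)) l
  refine List.Perm.trans (List.Perm.of_eq ?_) this
  congr 1
  refine List.filter_congr fun x _ => ?_
  have : x / 2 ^ t % 2 < 2 := Nat.mod_lt _ two_pos
  rw [← decide_not, decide_eq_decide]
  omega

theorem sortRound_spec (hw : 2 ≤ w) {σ : Mem} {a m t : ℕ} (ha : a ≠ 3)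
    (hm : σ.R 0 = m) (h51 : σ.R 51 = t) (hmw : m + m < 2 ^ w) :
    H w (sortRound a) σ (m * 70 + 30) (fun σ' =>
      firstValues (σ'.A a) m = (firstValues (σ.A a) m).filter (fun x => x / 2 ^ t % 2 = 0) ++
        (firstValues (σ.A a) m).filter (fun x => x / 2 ^ t % 2 = 1) ∧
      ∀ i, m ≤ i → σ'.A a i = σ.A a i) := by
  have h4 : 4 ≤ 2 ^ w := le_trans (by norm_num) (Nat.pow_le_pow_right two_pos hw)
  have hf : ∀ (l : List ℕ) (p : ℕ → Bool), (l.filter p).length ≤ l.length :=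
    fun l p => List.filter_sublist.length_le
  refine H.start (T₂ := m * 70 + 20) (by omega) ?_ (by simp [cost, block]; omega)
  simp [wp_block_cons, wp_block_nil, wp, Op.nat, Op.Fits]
  refine (H.bind (ps := [_, _, _, _]) (sortPass_spec hw (β := 0) (m := m) (t := t) (l := []) ha
    (by omega) ?_ ?_ ?_ ?_ ?_ ?_) ?_ (T₂ := m * 45 + 15) (by omega))
  · simp [hm]
  · simp [h51]
  · simp
  · simp
  · simp [firstValues]
  · simp; omega
  rintro σ₁ ⟨⟨e52, e3⟩, hF₁⟩
  have e0₁ := hF₁.1 0 (by simp [forTo, sortPass, block, modR])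
  have e51₁ := hF₁.1 51 (by simp [forTo, sortPass, block, modR])
  have ea₁ := hF₁.2 a (by simp [forTo, sortPass, block, modA, ha])
  simp [hm, h51] at e0₁ e51₁ ea₁ e52 e3
  refine H.start (T₂ := m * 45 + 12) (by omega) ?_ (by simp [cost]; omega)
  simp only [wp, Op.nat, Op.Fits, Operand.fits_const, Operand.ev_const]
  have hlen₁ := hf (firstValues (σ.A a) m) (fun x => x / 2 ^ t % 2 = 0)
  simp at hlen₁
  refine ⟨by omega, by omega, by omega, H.bind (ps := [_, _]) (sortPass_spec hw (β := 1) (m := m)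
    (t := t) (l := (firstValues (σ.A a) m).filter (fun x => x / 2 ^ t % 2 = 0)) ha
    (by omega) ?_ ?_ ?_ ?_ ?_ ?_) ?_ (T₂ := m * 20 + 8) (by omega)⟩
  · simp [e0₁]
  · simp [e51₁]
  · simp
  · simp [e52]
  · simp [← e52, e3]
  · omega
  rintro σ₂ ⟨⟨f52, f3⟩, hF₂⟩
  have e0₂ := hF₂.1 0 (by simp [forTo, sortPass, block, modR])
  have ea₂ := hF₂.2 a (by simp [forTo, sortPass, block, modA, ha])
  simp [e0₁, ea₁] at e0₂ ea₂ f52 f3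
  have hp := (perm_filter_bit t (firstValues (σ.A a) m)).length_eq
  simp at hp
  rw [f52, hp] at f3
  refine H.start (T₂ := m * 20 + 5) (by omega) ?_ (by simp [cost]; omega)
  simp only [wp, Op.nat, Op.Fits, Operand.fits_const, Operand.ev_const]
  refine ⟨by omega, by omega, by omega, H.last (H.mono (H.forTo_const (by omega) (lo := 0)
    (hi := m) (t := 10)
    (Inv := fun k σ' => (∀ i < k, σ'.A a i = σ₂.A 3 i) ∧ (∀ i, m ≤ i → σ'.A a i = σ.A a i))
    (Operand.fits_reg _) (by simp [block, modR]) (by simp [block, modR,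
      Operand.regs]) ?_ ?_ (Nat.zero_le _) ?_ ?_ ?_) le_rfl ?_) (by omega)⟩
  · simp
  · simp [e0₂]
  · simp [ea₂]
  · intro k σ v v' h
    simpa using h
  · rintro k σ₃ - hk ⟨i1, i2⟩ h53 hF
    have e3 := hF.2 3 (by simp [forTo, block, modA, Ne.symm ha])
    simp at e3
    refine H.of_wp' (by omega) (T := 10) (by simp [cost, block]) ?_
    simp [block, wp, h53, e3]
    refine ⟨fun i hi => ?_, fun i hi => ?_⟩
    · rcases hi.eq_or_lt with rfl | hi
      · simp
      · rw [Function.update_of_ne hi.ne, i1 i hi]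
    · rw [Function.update_of_ne (by omega), i2 i hi]
  · rintro σ' ⟨⟨i1, i2⟩, -, -⟩
    exact ⟨by rw [firstValues_congr i1, f3], i2⟩

theorem sortArray_spec (hw : 2 ≤ w) {σ : Mem} {a m L : ℕ} (ha : a ≠ 3)
    (hm : σ.R 0 = m) (h50 : σ.R 50 = L) (hmw : m + m < 2 ^ w)
    (hL : ∀ x ∈ firstValues (σ.A a) m, x < 2 ^ L) :
    H w (sortArray a) σ (L * (m * 70 + 40) + 10) (fun σ' =>
      ((firstValues (σ'.A a) m).Perm (firstValues (σ.A a) m) ∧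
      (firstValues (σ'.A a) m).Pairwise (· ≤ ·) ∧
      ∀ i, m ≤ i → σ'.A a i = σ.A a i) ∧ Frame (sortArray a) σ σ') := by
  have h4 : 4 ≤ 2 ^ w := le_trans (by norm_num) (Nat.pow_le_pow_right two_pos hw)
  refine H.frame (H.start (T₂ := L * (m * 70 + 40) + 5) (by omega) ?_ (by simp [cost]; omega))
  simp only [wp, Op.nat, Op.Fits, Operand.fits_const, Operand.ev_const]
  refine ⟨by omega, by omega, by omega, H.last (H.mono (H.forTo_const (by omega) (lo := 0)
    (hi := L) (t := m * 70 + 30)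
    (Inv := fun k σ' => (firstValues (σ'.A a) m).Perm (firstValues (σ.A a) m) ∧
      (firstValues (σ'.A a) m).Pairwise (fun x y => x % 2 ^ k ≤ y % 2 ^ k) ∧
      ∀ i, m ≤ i → σ'.A a i = σ.A a i)
    (Operand.fits_reg _) (by simp [sortRound, sortPass, forTo, block, modR])
    (by simp [sortRound, sortPass, forTo, block, modR, Operand.regs])
    ?_ ?_ (Nat.zero_le _) ?_ ?_ ?_) le_rfl ?_) (by rw [Nat.sub_zero, mul_add, mul_add, mul_add]; omega)⟩
  · simp
  · simp [h50]
  · simp [Nat.mod_one, List.pairwise_iff_getElem]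
  · intro k σ v v' h
    simpa using h
  · rintro k σ' - hk ⟨i1, i2, i3⟩ h51 hF
    have e0 := hF.1 0 (by simp [forTo, sortRound, sortPass, block, modR])
    simp [hm] at e0
    refine (sortRound_spec hw ha e0 h51 hmw).mono le_rfl ?_
    rintro σ'' ⟨j1, j2⟩
    rw [j1]
    exact ⟨(perm_filter_bit _ _).trans i1, pairwise_filter_bit i2,
      fun i hi => (j2 i hi).trans (i3 i hi)⟩
  -- All entries have at most `L` bits, so after `L` rounds the order modulo `2 ^ L` is the order
  -- itself.
  · rintro σ' ⟨⟨i1, i2, i3⟩, -, -⟩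
    refine ⟨i1, i2.imp_of_mem fun hx hy h => ?_, i3⟩
    rwa [Nat.mod_eq_of_lt (hL _ (i1.mem_iff.1 hx)), Nat.mod_eq_of_lt (hL _ (i1.mem_iff.1 hy))] at h

/-! ### Straight-line programs in arrays -/

/-- The words of the rules of a straight-line program. -/
@[ext] structure Rules where
  K : ℕ → ℕ
  F : ℕ → ℕ
  S : ℕ → ℕ

namespace Rules

/-- Rule number `i` is well formed. -/
def Valid (R : Rules) (i : ℕ) : Prop :=
  (R.K i = 0 ∧ R.F i < 2 ∧ R.S i = 0) ∨ (R.K i = 1 ∧ R.F i < i ∧ R.S i < i)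

/-- The sequence that rule number `i` produces. -/
def word (R : Rules) (i : ℕ) : List (Fin 2) :=
  if _h : R.K i = 1 ∧ R.F i < i ∧ R.S i < i then R.word (R.F i) ++ R.word (R.S i)
  else [if R.F i = 1 then 1 else 0]
termination_by i
decreasing_by exacts [_h.2.1, _h.2.2]

/-- The straight-line program that is formed by the first `n` rules. -/
def toSLP (R : Rules) (n : ℕ) : SLP (Fin 2) n := fun i =>
  if h : R.K i = 1 ∧ R.F i < i ∧ R.S i < i then .concat ⟨R.F i, h.2.1⟩ ⟨R.S i, h.2.2⟩
  else .letter (if R.F i = 1 then 1 else 0)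

theorem expand_toSLP (R : Rules) (n : ℕ) (i : Fin n) : (R.toSLP n).expand i = R.word i := by
  obtain ⟨i, hi⟩ := i
  induction i using Nat.strong_induction_on with
  | _ i ih =>
    rw [SLP.expand, word]
    by_cases h : R.K i = 1 ∧ R.F i < i ∧ R.S i < i
    · simp only [toSLP, h, and_self, dite_true]
      rw [ih _ h.2.1, ih _ h.2.2]
    · simp only [toSLP, h, dite_false]

/-- Rules that are not well formed are read as letters. For well-formed rules the encoding of the
decoded rule gives back the original words, so the arrays are literally the input that the program
for matrices expects. -/
theorem toSLP_kind (R : Rules) {n : ℕ} (i : Fin n) (h : R.Valid i) :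
    (R.toSLP n i).kind = R.K i := by
  by_cases h' : R.K i = 1 ∧ R.F i < i ∧ R.S i < i
  · simp [toSLP, SLPRule.kind, h']
  · simp only [toSLP, dif_neg h']
    rcases h with h | h
    · rw [h.1]; rfl
    · exact absurd h h'

theorem toSLP_fst (R : Rules) {n : ℕ} (i : Fin n) (h : R.Valid i) :
    (R.toSLP n i).fst = R.F i := by
  unfold toSLP
  split_ifs with h' h''
  · simp [SLPRule.fst]
  · simp [SLPRule.fst, h'']
  · rcases h with h | h
    · simp only [SLPRule.fst]
      have := h.2.1
      simp
      omega
    · exact absurd h h'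

theorem toSLP_snd (R : Rules) {n : ℕ} (i : Fin n) (h : R.Valid i) :
    (R.toSLP n i).snd = R.S i := by
  by_cases h' : R.K i = 1 ∧ R.F i < i ∧ R.S i < i
  · simp [toSLP, SLPRule.snd, h']
  · simp only [toSLP, dif_neg h']
    rcases h with h | h
    · rw [h.2.2]; rfl
    · exact absurd h h'

/-- The first `c` rules agree. -/
def Agree (c : ℕ) (R R' : Rules) : Prop := ∀ i < c, R'.K i = R.K i ∧ R'.F i = R.F i ∧ R'.S i = R.S i

theorem Agree.refl (c : ℕ) (R : Rules) : Agree c R R := fun _ _ => ⟨rfl, rfl, rfl⟩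

theorem Agree.trans {c c' : ℕ} {R R' R'' : Rules} (h : Agree c R R') (h' : Agree c' R' R'')
    (hc : c ≤ c') : Agree c R R'' := fun i hi =>
  ⟨(h' i (by omega)).1.trans (h i hi).1, (h' i (by omega)).2.1.trans (h i hi).2.1,
    (h' i (by omega)).2.2.trans (h i hi).2.2⟩

/-- Rules refer only to earlier rules; appending rules does not change what has been generated. -/
theorem Agree.word {c : ℕ} {R R' : Rules} (h : Agree c R R') {i : ℕ} (hi : i < c) :
    R'.word i = R.word i := by
  induction i using Nat.strong_induction_on with
  | _ i ih =>
    obtain ⟨h1, h2, h3⟩ := h i hi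
    rw [Rules.word, Rules.word.eq_1 R]
    by_cases hc : R.K i = 1 ∧ R.F i < i ∧ R.S i < i
    · rw [dif_pos hc, dif_pos (by rwa [h1, h2, h3]), h2, h3, ih _ hc.2.1 (hc.2.1.trans hi),
        ih _ hc.2.2 (hc.2.2.trans hi)]
    · rw [dif_neg hc, dif_neg (by rwa [h1, h2, h3]), h2]

theorem Agree.valid {c : ℕ} {R R' : Rules} (h : Agree c R R') {i : ℕ} (hi : i < c)
    (hv : R.Valid i) : R'.Valid i := by
  obtain ⟨h1, h2, h3⟩ := h i hi
  rwa [Valid, h1, h2, h3]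

/-- Write rule number `c`. -/
def put (R : Rules) (c k x y : ℕ) : Rules :=
  ⟨Function.update R.K c k, Function.update R.F c x, Function.update R.S c y⟩

theorem agree_put (R : Rules) (c k x y : ℕ) : Agree c R (R.put c k x y) := fun i hi => by
  simp [put, Function.update_of_ne hi.ne]

theorem word_put (R : Rules) {c x y : ℕ} (hx : x < c) (hy : y < c) :
    (R.put c 1 x y).word c = R.word x ++ R.word y := by
  rw [word, dif_pos (by simp [put, hx, hy])]
  have h1 : (R.put c 1 x y).F c = x := by simp [put]
  have h2 : (R.put c 1 x y).S c = y := by simp [put]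
  rw [h1, h2, (agree_put R c 1 x y).word hx, (agree_put R c 1 x y).word hy]

/-- The first `c` rules are well formed; rule `0` is the letter `1`, and rule `i + 1` produces
`2 ^ i` zeros for `i < m`. -/
structure Ok (R : Rules) (c m : ℕ) : Prop where
  valid : ∀ i < c, R.Valid i
  lt : m < c
  one : R.K 0 = 0 ∧ R.F 0 = 1
  zero : R.K 1 = 0 ∧ R.F 1 = 0
  pow : ∀ i, 0 < i → i < m → R.K (i + 1) = 1 ∧ R.F (i + 1) = i ∧ R.S (i + 1) = i
  pos : 0 < m

theorem Ok.put {R : Rules} {c m x y : ℕ} (h : R.Ok c m) (hx : x < c) (hy : y < c) :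
    (R.put c 1 x y).Ok (c + 1) m := by
  have ha := agree_put R c 1 x y
  have hlt := h.lt
  have hpos := h.pos
  refine ⟨fun i hi => ?_, by omega, ?_, ?_, ?_, h.pos⟩
  · rcases (Nat.lt_succ_iff.1 hi).eq_or_lt with rfl | hi
    · right; simp [Rules.put, hx, hy]
    · exact ha.valid hi (h.valid i hi)
  · rw [(ha 0 (by omega)).1, (ha 0 (by omega)).2.1]; exact h.one
  · rw [(ha 1 (by omega)).1, (ha 1 (by omega)).2.1]; exact h.zero
  · intro i hi him
    obtain ⟨h1, h2, h3⟩ := ha (i + 1) (by omega)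
    rw [h1, h2, h3]; exact h.pow i hi him

theorem Ok.word_zero {R : Rules} {c m : ℕ} (h : R.Ok c m) {i : ℕ} (hi : i < m) :
    R.word (i + 1) = List.replicate (2 ^ i) 0 := by
  induction i with
  | zero => rw [word, dif_neg (by simp [h.zero.1])]; simp [h.zero.2]
  | succ i ih =>
    obtain ⟨h1, h2, h3⟩ := h.pow (i + 1) (by omega) hi
    rw [word, dif_pos (by rw [h1, h2, h3]; omega), h2, h3, ih (by omega), List.replicate_append_replicate]
    congr 1; ring

theorem Ok.word_one {R : Rules} {c m : ℕ} (h : R.Ok c m) : R.word 0 = [1] := by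
  rw [word, dif_neg (by simp [h.one.1])]; simp [h.one.2]

/-- `p` is the position of a `1` in `l`. -/
def IsOne (l : List (Fin 2)) (p : ℕ) : Prop := l[p]? = some 1

theorem isOne_append {l l' : List (Fin 2)} {p : ℕ} :
    IsOne (l ++ l') p ↔ IsOne l p ∨ ∃ p', p = l.length + p' ∧ IsOne l' p' := by
  unfold IsOne
  rw [List.getElem?_append]
  split_ifs with h
  · constructor
    · exact Or.inl
    · rintro (h' | ⟨p', rfl, -⟩)
      · exact h'
      · omega
  · rw [List.getElem?_eq_none (l := l) (by omega)]
    constructor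
    · intro h'; exact Or.inr ⟨p - l.length, by omega, h'⟩
    · rintro (h' | ⟨p', rfl, h'⟩)
      · simp at h'
      · simpa using h'

theorem not_isOne_replicate {k p : ℕ} : ¬ IsOne (List.replicate k 0) p := by
  unfold IsOne
  intro h
  obtain ⟨h1, h2⟩ := List.getElem?_eq_some_iff.1 h
  simp at h2

theorem isOne_append_replicate {l : List (Fin 2)} {k p : ℕ} :
    IsOne (l ++ List.replicate k 0) p ↔ IsOne l p := by
  rw [isOne_append]
  simp [not_isOne_replicate]

/-- Rule `i` is the root of a binary tree of height `l` for the indicator function of `P`. -/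
def Trie (R : Rules) : ℕ → ℕ → (ℕ → Prop) → Prop
  -- The leaves are the shared rules `0` and `1`, which produce the letters `1` and `0` under `Ok`.
  | 0, i, P => (i = 0 ∧ P 0) ∨ (i = 1 ∧ ¬ P 0)
  | l + 1, i, P => R.K i = 1 ∧ R.F i < i ∧ R.S i < i ∧ R.Trie l (R.F i) P ∧
      R.Trie l (R.S i) (fun p => P (p + 2 ^ l))

theorem Trie.congr {R : Rules} {l i : ℕ} {P P' : ℕ → Prop} (h : R.Trie l i P)
    (hP : ∀ p < 2 ^ l, P p ↔ P' p) : R.Trie l i P' := by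
  induction l generalizing i P P' with
  | zero => simpa [Trie, ← hP 0 (by simp)] using h
  | succ l ih =>
    obtain ⟨h1, h2, h3, h4, h5⟩ := h
    rw [pow_succ] at hP
    exact ⟨h1, h2, h3, ih h4 fun p hp => hP p (by omega), ih h5 fun p hp => hP _ (by omega)⟩

theorem Trie.agree {R R' : Rules} {c l i : ℕ} {P : ℕ → Prop} (h : R.Trie l i P) (ha : Agree c R R')
    (hi : i < c) : R'.Trie l i P := by
  induction l generalizing i P with
  | zero => exact h
  | succ l ih =>
    obtain ⟨h1, h2, h3, h4, h5⟩ := h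
    obtain ⟨e1, e2, e3⟩ := ha i hi
    exact ⟨by rw [e1, h1], by rw [e2]; exact h2, by rw [e3]; exact h3,
      by rw [e2]; exact ih h4 (h2.trans hi), by rw [e3]; exact ih h5 (h3.trans hi)⟩

/-- The rules for powers of two many zeros serve a second time as the trees of the empty set, so the
insertions can start without further rules. -/
theorem Ok.trie_zero {R : Rules} {c m : ℕ} (h : R.Ok c m) {l : ℕ} (hl : l < m) :
    R.Trie l (l + 1) (fun _ => False) := by
  induction l with
  | zero => right; simp
  | succ l ih =>
    obtain ⟨h1, h2, h3⟩ := h.pow (l + 1) (by omega) hl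
    exact ⟨h1, by omega, by omega, by rw [h2]; exact ih (by omega), by rw [h3]; exact ih (by omega)⟩

theorem Trie.word {R : Rules} {c m l i : ℕ} {P : ℕ → Prop} (ho : R.Ok c m) (h : R.Trie l i P) :
    (R.word i).length = 2 ^ l ∧ ∀ p, IsOne (R.word i) p ↔ p < 2 ^ l ∧ P p := by
  induction l generalizing i P with
  | zero =>
    rcases h with ⟨rfl, h⟩ | ⟨rfl, h⟩
    · rw [ho.word_one]
      refine ⟨rfl, fun p => ?_⟩
      cases p <;> simp [IsOne, h]
    · have := ho.word_zero ho.pos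
      rw [zero_add] at this
      rw [this]
      refine ⟨rfl, fun p => ?_⟩
      cases p <;> simp [IsOne, h]
  | succ l ih =>
    obtain ⟨h1, h2, h3, h4, h5⟩ := h
    obtain ⟨i1, i2⟩ := ih h4
    obtain ⟨j1, j2⟩ := ih h5
    rw [Rules.word, dif_pos ⟨h1, h2, h3⟩, List.length_append, i1, j1]
    refine ⟨by ring, fun p => ?_⟩
    simp only [isOne_append, i2, j2, i1]
    rw [pow_succ]
    constructor
    · rintro (⟨h, h'⟩ | ⟨p, rfl, h, h'⟩)
      · exact ⟨by omega, h'⟩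
      · exact ⟨by omega, by rwa [add_comm]⟩
    · rintro ⟨h, h'⟩
      by_cases hp : p < 2 ^ l
      · exact Or.inl ⟨hp, h'⟩
      · exact Or.inr ⟨p - 2 ^ l, by omega, by omega, by rwa [Nat.sub_add_cancel (by omega)]⟩

/-- The first position of the subtree of height `l` on the path to `x`. -/
def start (x l : ℕ) : ℕ := x / 2 ^ l * 2 ^ l

/-- The first position of the sibling of this subtree. -/
def sibStart (x l : ℕ) : ℕ :=
  if x / 2 ^ l % 2 = 0 then start x l + 2 ^ l else start x l - 2 ^ l

theorem start_succ (x l : ℕ) :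
    start x l = start x (l + 1) + x / 2 ^ l % 2 * 2 ^ l := by
  unfold start
  have := Nat.div_add_mod (x / 2 ^ l) 2
  rw [Nat.div_div_eq_div_mul, ← pow_succ] at this
  nth_rewrite 1 [← this]
  ring

/-- Bit `l` of `x` decides which child lies on the path to `x`; the other child is the sibling,
whose positions start at `sibStart x l`. -/
theorem Trie.descend {R : Rules} {l i x : ℕ} {P : ℕ → Prop}
    (h : R.Trie (l + 1) i (fun p => P (p + start x (l + 1)))) :
    R.F i < i ∧ R.S i < i ∧
    (x / 2 ^ l % 2 = 0 → R.Trie l (R.F i) (fun p => P (p + start x l)) ∧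
      R.Trie l (R.S i) (fun p => P (p + sibStart x l))) ∧
    (x / 2 ^ l % 2 ≠ 0 → R.Trie l (R.S i) (fun p => P (p + start x l)) ∧
      R.Trie l (R.F i) (fun p => P (p + sibStart x l))) := by
  obtain ⟨h1, h2, h3, h4, h5⟩ := h
  have hs := start_succ x l
  refine ⟨h2, h3, fun hb => ?_, fun hb => ?_⟩
  · rw [hb, zero_mul, add_zero] at hs
    rw [sibStart, if_pos hb, hs]
    refine ⟨h4, h5.congr fun p _ => ?_⟩
    rw [add_comm (start _ _), ← add_assoc]
  · have hb' : x / 2 ^ l % 2 = 1 := by omega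
    rw [hb', one_mul] at hs
    rw [sibStart, if_neg hb, hs, Nat.add_sub_cancel]
    refine ⟨h5.congr fun p _ => ?_, h4⟩
    rw [add_comm (start _ _), ← add_assoc]

/-- The number `x` lies among the positions of the subtree on its path, not among those of the
sibling. The old sibling thus also serves the enlarged set, and one new rule per level suffices. -/
theorem Trie.ascend {R R' : Rules} {c l i j x : ℕ} {P : ℕ → Prop}
    (hi : i < c) (hj : j < c)
    (h : R.Trie l i (fun p => P (p + start x l) ∨ p + start x l = x))
    (h' : R.Trie l j (fun p => P (p + sibStart x l)))
    (hy : R.put c 1 (if x / 2 ^ l % 2 = 0 then i else j) (if x / 2 ^ l % 2 = 0 then j else i) = R') :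
    R'.Trie (l + 1) c (fun p => P (p + start x (l + 1)) ∨ p + start x (l + 1) = x) := by
  subst hy
  have hs := start_succ x l
  have hdm := Nat.div_add_mod x (2 ^ l)
  have hlt := Nat.mod_lt x (Nat.two_pow_pos l)
  rw [mul_comm] at hdm
  change start x l + _ = _ at hdm
  have ha := fun k a b => agree_put R c k a b
  by_cases hb : x / 2 ^ l % 2 = 0
  · simp only [hb, if_true, sibStart] at h' ⊢
    rw [hb, zero_mul, add_zero] at hs
    rw [← hs]
    refine ⟨by simp [Rules.put], by simp [Rules.put, hi], by simp [Rules.put, hj], ?_, ?_⟩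
    · simpa [Rules.put] using h.agree (ha 1 i j) hi
    · have := h'.agree (ha 1 i j) hj
      simp only [Rules.put, Function.update_self] at this ⊢
      refine this.congr fun p hp => ?_
      rw [add_assoc p (2 ^ l), add_comm (2 ^ l)]
      refine ⟨Or.inl, fun h => h.resolve_right ?_⟩
      omega
  · have hb' : x / 2 ^ l % 2 = 1 := by omega
    simp only [hb, if_false, sibStart] at h' ⊢
    rw [hb', one_mul] at hs
    rw [hs, Nat.add_sub_cancel] at h'
    refine ⟨by simp [Rules.put], by simp [Rules.put, hj], by simp [Rules.put, hi], ?_, ?_⟩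
    · have := h'.agree (ha 1 j i) hj
      simp only [Rules.put, Function.update_self] at this ⊢
      refine this.congr fun p hp => ?_
      refine ⟨Or.inl, fun h => h.resolve_right ?_⟩
      omega
    · have := h.agree (ha 1 j i) hi
      simp only [Rules.put, Function.update_self] at this ⊢
      refine this.congr fun p hp => ?_
      rw [add_assoc p (2 ^ l), add_comm (2 ^ l), ← hs]

end Rules

/-! ### Writing straight-line programs -/

/-- The rules in the arrays `10`, `11`, `12`. -/
def rules (σ : Mem) : Rules := ⟨σ.A 10, σ.A 11, σ.A 12⟩

/-- Write rule number `c` for the concatenation of two rules, where `c` is the content of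
register `62`, and increase `c`. -/
def emit (x y : Operand) : Cmd :=
  block [.store 10 (.reg 62) (.const 1), .store 11 (.reg 62) x, .store 12 (.reg 62) y,
    .set 62 .add (.reg 62) (.const 1)]

/-- Append as many zeros as register `70` says to the word of the rule in register `63`. -/
def appendZeros : Cmd :=
  block [.set 71 .add (.const 0) (.const 0),
    forTo 71 (.reg 17) (block [.set 72 .shr (.reg 70) (.reg 71), .set 72 .mod (.reg 72) (.const 2),
      .branch (.reg 72) (block [.set 72 .add (.reg 71) (.const 1), .set 73 .add (.reg 62) (.const 0),
        emit (.reg 63) (.reg 72), .set 63 .add (.reg 73) (.const 0)]) .skip])]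

theorem rules_setR (σ : Mem) (r x : ℕ) : rules (σ.setR r x) = rules σ := rfl

/-- Binary expansion: after `k` rounds the last `k` bits of `y` are processed and `y % 2 ^ k` zeros
appended. Bit `k` contributes rule `k + 1`, which produces `2 ^ k` zeros, so at most `m` rules are
written. -/
theorem appendZeros_spec (hw : 2 ≤ w) {σ : Mem} {c m acc y : ℕ} (h62 : σ.R 62 = c)
    (h63 : σ.R 63 = acc) (h70 : σ.R 70 = y) (h17 : σ.R 17 = m) (ho : (rules σ).Ok c m)
    (hacc : acc < c) (hy : y < 2 ^ m) (hc : c + m < 2 ^ w) :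
    H w appendZeros σ (m * 30 + 10) (fun σ' =>
      ((rules σ').Ok (σ'.R 62) m ∧ σ'.R 63 < σ'.R 62 ∧ c ≤ σ'.R 62 ∧ σ'.R 62 ≤ c + m ∧
      (rules σ').word (σ'.R 63) = (rules σ).word acc ++ List.replicate y 0 ∧
      Rules.Agree c (rules σ) (rules σ')) ∧ Frame appendZeros σ σ') := by
  have hw0 : w ≠ 0 := by omega
  have h4 : 4 ≤ 2 ^ w := le_trans (by norm_num) (Nat.pow_le_pow_right two_pos hw)
  refine H.frame (H.start (T₂ := m * 30 + 5) (by omega) ?_ (by simp [cost]; omega))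
  simp only [wp, Op.nat, Op.Fits, Operand.fits_const, Operand.ev_const]
  refine ⟨by omega, by omega, by omega, H.last (H.mono (H.forTo_const (by omega) (lo := 0)
    (hi := m) (t := 25)
    (Inv := fun k σ' => (rules σ').Ok (σ'.R 62) m ∧ σ'.R 63 < σ'.R 62 ∧ c ≤ σ'.R 62 ∧
      σ'.R 62 ≤ c + k ∧
      (rules σ').word (σ'.R 63) = (rules σ).word acc ++ List.replicate (y % 2 ^ k) 0 ∧
      Rules.Agree c (rules σ) (rules σ'))
    (Operand.fits_reg _) (by decide) (by decide)
    ?_ ?_ (Nat.zero_le _) ?_ ?_ ?_) le_rfl ?_) (by rw [Nat.sub_zero])⟩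
  · simp
  · simp [h17]
  · simp [h62, h63, rules_setR, Nat.mod_one, Rules.Agree.refl, hacc, ho]
  · intro k σ v v' h
    simpa [rules_setR] using h
  · rintro k σ₁ - hk ⟨i1, i2, i3, i4, i5, i6⟩ h71 hF
    have e70 := hF.1 70 (by decide)
    simp [h70] at e70
    have hmod := Nat.mod_pow_succ (x := y) (b := 2) (k := k)
    have hlt : y / 2 ^ k % 2 < 2 := Nat.mod_lt _ two_pos
    refine H.of_wp' (by omega) (T := 25) (by decide) ?_
    generalize hp : σ₁.R 62 = p at *
    generalize ha : σ₁.R 63 = a at *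
    simp [emit, hw0, wp_block_cons, wp_block_nil, wp, Op.nat, Op.Fits, e70, h71, hp, ha]
    refine ⟨by omega, fun hb => ⟨by omega, by omega, by omega, ?_⟩, fun hb => ?_⟩
    · have hr : ∀ σ' : Mem, σ'.A = (((σ₁.setA 10 p 1).setA 11 p a).setA 12 p (k + 1)).A →
          rules σ' = (rules σ₁).put p 1 a (k + 1) := by
        intro σ' h
        simp [rules, h, Rules.put]
      rw [hr _ (by simp [Mem.setA, Mem.setR])]
      have hk1 := i1.lt
      refine ⟨by omega, i1.put i2 (by omega), by omega, by omega, ?_, i6.trans (Rules.agree_put _ _ _ _ _) i3⟩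
      rw [Rules.word_put _ i2 (by omega), i5, i1.word_zero hk, hmod, hb, mul_one,
        List.append_assoc, List.replicate_append_replicate]
    · rw [hmod, hb]
      simp only [rules_setR]
      exact ⟨i1, i2, i3, by omega, by simpa using i5, i6⟩
  · rintro σ' ⟨⟨i1, i2, i3, i4, i5, i6⟩, -, -⟩
    rw [Nat.mod_eq_of_lt hy] at i5
    exact ⟨i1, i2, i3, i4, i5, i6⟩

/-- Write the rule for the letter `1`, and rules for powers of two many zeros. -/
def writePowers : Cmd :=
  block [block [.store 10 (.const 0) (.const 0), .store 11 (.const 0) (.const 1),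
      .store 12 (.const 0) (.const 0), .store 10 (.const 1) (.const 0),
      .store 11 (.const 1) (.const 0), .store 12 (.const 1) (.const 0),
      .set 62 .add (.reg 17) (.const 1), .set 71 .add (.const 1) (.const 0)],
    forTo 71 (.reg 17) (block [.set 72 .add (.reg 71) (.const 1), .store 10 (.reg 72) (.const 1),
      .store 11 (.reg 72) (.reg 71), .store 12 (.reg 72) (.reg 71)])]

theorem writePowers_spec (hw : 2 ≤ w) {σ : Mem} {m : ℕ} (h17 : σ.R 17 = m) (hm : 0 < m)
    (hmw : m + 1 < 2 ^ w) :
    H w writePowers σ (m * 20 + 30) (fun σ' =>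
      ((rules σ').Ok (m + 1) m ∧ σ'.R 62 = m + 1) ∧ Frame writePowers σ σ') := by
  have hw0 : w ≠ 0 := by omega
  have h4 : 4 ≤ 2 ^ w := le_trans (by norm_num) (Nat.pow_le_pow_right two_pos hw)
  refine H.frame (H.start (T₂ := m * 20 + 5) (by omega) ?_ (by simp [cost, block]; omega))
  simp [hw0, hmw, wp_block_cons, wp_block_nil, wp, Op.nat, Op.Fits, h17]
  refine (H.last (H.mono (H.forTo_const (by omega) (lo := 1)
    (hi := m) (t := 10)
    (Inv := fun k σ' => (rules σ').Ok (k + 1) k ∧ σ'.R 62 = m + 1)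
    (Operand.fits_reg _) (by decide) (by decide)
    ?_ ?_ hm ?_ ?_ ?_) le_rfl fun σ' h => h.1) ?_)
  · simp
  · simp [h17]
  · refine ⟨⟨?_, ?_, ?_, ?_, ?_, ?_⟩, ?_⟩
    · intro i hi
      left
      interval_cases i <;> simp [rules]
    · omega
    · simp [rules]
    · simp [rules]
    · intro i h1 h2; omega
    · omega
    · simp
  · intro k σ v v' h
    simpa [rules_setR] using h
  · rintro k σ₁ hk1 hk ⟨i1, i2⟩ h71 hF
    refine H.of_wp' (by omega) (T := 10) (by decide) ?_
    simp [hw0, wp_block_cons, wp_block_nil, wp, Op.nat, Op.Fits, h71]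
    refine ⟨by omega, ?_, i2⟩
    have hr : ∀ σ' : Mem, σ'.A = (((σ₁.setA 10 (k + 1) 1).setA 11 (k + 1) k).setA 12 (k + 1) k).A →
          rules σ' = (rules σ₁).put (k + 1) 1 k k := by
      intro σ' h
      simp [rules, h, Rules.put]
    rw [hr _ (by simp [Mem.setA, Mem.setR])]
    have := i1.put (x := k) (y := k) (by omega) (by omega)
    refine ⟨this.valid, by omega, this.one, this.zero, fun i hi1 hi2 => ?_, by omega⟩
    rcases (Nat.lt_succ_iff.1 hi2).eq_or_lt with rfl | hi2
    · simp [Rules.put]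
    · exact this.pow i hi1 hi2
  · omega

/-- Copy `x` into register `r`. -/
def mov (r : ℕ) (x : Operand) : Cmd := .set r .or x (.const 0)

/-- The operation `or` with `0` cannot overflow, so copying carries no condition apart from the size
of a constant. -/
theorem wp_mov {r : ℕ} {x : Operand} {Φ : Mem → Prop} {σ : Mem} (hx : x.Fits w) :
    wp w (mov r x) Φ σ = Φ (σ.setR r (x.ev σ)) := by
  simp [mov, wp, hx, Op.nat, Op.Fits]

/-- One step down in the tree, along the path to the number in register `75`. -/
def descendStep : Cmd :=
  block [.set 78 .sub (.reg 6) (.reg 77), .set 78 .sub (.reg 78) (.const 1),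
    .set 79 .shr (.reg 75) (.reg 78), .set 79 .mod (.reg 79) (.const 2),
    .load 80 11 (.reg 76), .load 81 12 (.reg 76),
    .branch (.reg 79) (block [.store 9 (.reg 78) (.reg 80), mov 76 (.reg 81)])
      (block [.store 9 (.reg 78) (.reg 81), mov 76 (.reg 80)])]

/-- One step up in the tree, where the path is copied. -/
def ascendStep : Cmd :=
  block [.set 79 .shr (.reg 75) (.reg 77), .set 79 .mod (.reg 79) (.const 2),
    .load 80 9 (.reg 77), mov 81 (.reg 62),
    .branch (.reg 79) (emit (.reg 80) (.reg 76)) (emit (.reg 76) (.reg 80)), mov 76 (.reg 81)]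

/-- Insert the number in register `75` into the tree with the root in register `65`. -/
def insertOne : Cmd :=
  block [block [.load 75 8 (.reg 74), mov 76 (.reg 65), mov 77 (.const 0)],
    forTo 77 (.reg 6) descendStep,
    block [mov 76 (.const 0), mov 77 (.const 0)],
    forTo 77 (.reg 6) ascendStep,
    mov 65 (.reg 76)]

/-- Build a tree for the set of numbers in the array `8`. -/
def buildTrie : Cmd :=
  block [block [.set 65 .add (.reg 6) (.const 1), mov 74 (.const 0)],
    forTo 74 (.reg 61) insertOne]

/-- The loop counts the depth; the node reached in round `k` has height `h - k`. Cell `l` of the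
array `9` keeps the sibling of height `l` for the way back. -/
theorem descend_spec (hw : 2 ≤ w) {σ : Mem} {c h x root : ℕ} {P : ℕ → Prop} (h75 : σ.R 75 = x)
    (h76 : σ.R 76 = root) (h77 : σ.R 77 = 0) (h6 : σ.R 6 = h) (hx : x < 2 ^ h)
    (ht : (rules σ).Trie h root P) (hroot : root < c) :
    H w (forTo 77 (.reg 6) descendStep) σ (h * 30 + 3) (fun σ' =>
      (∀ l < h, σ'.A 9 l < c ∧ (rules σ).Trie l (σ'.A 9 l) (fun p => P (p + Rules.sibStart x l))) ∧
      Rules.Trie (rules σ) 0 (σ'.R 76) (fun p => P (p + x))) := by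
  have hw0 : w ≠ 0 := by omega
  have h4 : 4 ≤ 2 ^ w := le_trans (by norm_num) (Nat.pow_le_pow_right two_pos hw)
  have hst : Rules.start x h = 0 := by simp [Rules.start, Nat.div_eq_of_lt hx]
  refine H.mono (H.forTo_const (by omega) (lo := 0) (hi := h) (t := 25)
    (Inv := fun k σ' => σ'.R 76 < c ∧ (rules σ).Trie (h - k) (σ'.R 76)
        (fun p => P (p + Rules.start x (h - k))) ∧
      ∀ l, h - k ≤ l → l < h → σ'.A 9 l < c ∧
        (rules σ).Trie l (σ'.A 9 l) (fun p => P (p + Rules.sibStart x l)))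
    (Operand.fits_reg _) (by decide) (by decide)
    h77 h6 (Nat.zero_le _) ?_ ?_ ?_) (by rw [Nat.sub_zero]) ?_
  · simp only [Nat.sub_zero, hst, add_zero, h76]
    exact ⟨hroot, ht, fun l h1 h2 => by omega⟩
  · intro k σ v v' h
    simpa using h
  · rintro k σ₁ - hk ⟨i1, i2, i3⟩ h77 hF
    have e75 := hF.1 75 (by decide)
    have e6 := hF.1 6 (by decide)
    have eF := hF.2 11 (by decide)
    have eS := hF.2 12 (by decide)
    rw [h75] at e75
    rw [h6] at e6
    generalize ha : σ₁.R 76 = a at *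
    obtain ⟨l, hl⟩ : ∃ l, h - k = l + 1 := ⟨h - k - 1, by omega⟩
    have hl' : h - (k + 1) = l := by omega
    rw [hl] at i2 i3
    obtain ⟨j1, j2, j3, j4⟩ := i2.descend
    change σ.A 11 a < a at j1
    change σ.A 12 a < a at j2
    refine H.of_wp' (by omega) (T := 25) (by decide) ?_
    simp [descendStep, hw0, wp_block_cons, wp_block_nil, wp, wp_mov, Op.nat, Op.Fits, e75, h77, ha,
      e6, hl, eF, eS, hl']
    refine ⟨by omega, by omega, fun hb => ⟨by omega, (j4 (by omega)).1, ?_⟩,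
      fun hb => ⟨by omega, (j3 (by omega)).1, ?_⟩⟩
    · intro l' h1 h2
      rcases h1.eq_or_lt with rfl | h1
      · simp only [Function.update_self]
        exact ⟨by omega, (j4 (by omega)).2⟩
      · rw [Function.update_of_ne h1.ne']
        exact i3 l' h1 h2
    · intro l' h1 h2
      rcases h1.eq_or_lt with rfl | h1
      · simp only [Function.update_self]
        exact ⟨by omega, (j3 (by omega)).2⟩
      · rw [Function.update_of_ne h1.ne']
        exact i3 l' h1 h2
  · rintro σ' ⟨⟨i1, i2, i3⟩, -, -⟩
    simp only [Nat.sub_self] at i2 i3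
    exact ⟨fun l hl => i3 l (by omega) hl, by simpa [Rules.start] using i2⟩

/-- The way up starts at rule `0`, the letter `1`, as the new leaf at position `x`. Each level
writes one rule that joins the copied child with the stored sibling, so exactly `h` rules are added,
even if `x` was already present. -/
theorem ascend_spec (hw : 2 ≤ w) {σ : Mem} {c m h x : ℕ} {P : ℕ → Prop} (h75 : σ.R 75 = x)
    (h76 : σ.R 76 = 0) (h77 : σ.R 77 = 0) (h6 : σ.R 6 = h) (hx : x < 2 ^ h) (h62 : σ.R 62 = c)
    (ho : (rules σ).Ok c m) (hc : c + h < 2 ^ w)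
    (hs : ∀ l < h, σ.A 9 l < c ∧
      (rules σ).Trie l (σ.A 9 l) (fun p => P (p + Rules.sibStart x l))) :
    H w (forTo 77 (.reg 6) ascendStep) σ (h * 30 + 3) (fun σ' =>
      (rules σ').Ok (c + h) m ∧ σ'.R 62 = c + h ∧ σ'.R 76 < c + h ∧
      (rules σ').Trie h (σ'.R 76) (fun p => P p ∨ p = x) ∧
      Rules.Agree c (rules σ) (rules σ')) := by
  have hw0 : w ≠ 0 := by omega
  have h4 : 4 ≤ 2 ^ w := le_trans (by norm_num) (Nat.pow_le_pow_right two_pos hw)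
  have hst : Rules.start x h = 0 := by simp [Rules.start, Nat.div_eq_of_lt hx]
  have hm := ho.lt
  refine H.mono (H.forTo_const (by omega) (lo := 0) (hi := h) (t := 25)
    (Inv := fun k σ' => (rules σ').Ok (c + k) m ∧ σ'.R 62 = c + k ∧ σ'.R 76 < c + k ∧
      (rules σ').Trie k (σ'.R 76)
        (fun p => P (p + Rules.start x k) ∨ p + Rules.start x k = x) ∧
      Rules.Agree c (rules σ) (rules σ'))
    (Operand.fits_reg _) (by decide) (by decide)
    h77 h6 (Nat.zero_le _) ?_ ?_ ?_) (by rw [Nat.sub_zero]) ?_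
  · refine ⟨ho, h62, by omega, ?_, Rules.Agree.refl _ _⟩
    rw [h76]
    left
    simp [Rules.start]
  · intro k σ v v' h
    simpa [rules_setR] using h
  · rintro k σ₁ - hk ⟨i1, i2, i3, i4, i5⟩ h77 hF
    have e75 := hF.1 75 (by decide)
    have e9 := hF.2 9 (by decide)
    rw [h75] at e75
    generalize ha : σ₁.R 76 = a at *
    obtain ⟨s1, s2⟩ := hs k hk
    have s2' := s2.agree i5 s1
    refine H.of_wp' (by omega) (T := 25) (by decide) ?_
    have hr : ∀ (a b : ℕ) (σ' : Mem),
        σ'.A = (((σ₁.setA 10 (c + k) 1).setA 11 (c + k) a).setA 12 (c + k) b).A →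
          rules σ' = (rules σ₁).put (c + k) 1 a b := by
      intro a b σ' h
      simp [rules, h, Rules.put]
    simp [ascendStep, emit, hw0, wp_block_cons, wp_block_nil, wp, wp_mov, Op.nat, Op.Fits, e75, h77,
      ha, e9, i2, add_assoc]
    refine ⟨by omega, fun hb => ⟨by omega, ?_⟩, fun hb => ⟨by omega, ?_⟩⟩
    · rw [hr (σ.A 9 k) a _ (by simp [Mem.setA, Mem.setR])]
      exact ⟨i1.put (by omega) i3, i4.ascend i3 (by omega) s2' (by simp [hb]),
        i5.trans (Rules.agree_put _ _ _ _ _) (by omega)⟩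
    · rw [hr a (σ.A 9 k) _ (by simp [Mem.setA, Mem.setR])]
      exact ⟨i1.put i3 (by omega), i4.ascend i3 (by omega) s2' (by simp [hb]),
        i5.trans (Rules.agree_put _ _ _ _ _) (by omega)⟩
  · rintro σ' ⟨⟨i1, i2, i3, i4, i5⟩, -, -⟩
    exact ⟨i1, i2, i3, by simpa [hst] using i4, i5⟩

theorem insertOne_spec (hw : 2 ≤ w) {σ : Mem} {c m h e root : ℕ} {P : ℕ → Prop}
    (h74 : σ.R 74 = e) (h65 : σ.R 65 = root) (h6 : σ.R 6 = h) (hx : σ.A 8 e < 2 ^ h)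
    (h62 : σ.R 62 = c) (ho : (rules σ).Ok c m) (hc : c + h < 2 ^ w)
    (ht : (rules σ).Trie h root P) (hroot : root < c) :
    H w insertOne σ (h * 60 + 30) (fun σ' =>
      (rules σ').Ok (c + h) m ∧ σ'.R 62 = c + h ∧ σ'.R 65 < c + h ∧
      (rules σ').Trie h (σ'.R 65) (fun p => P p ∨ p = σ.A 8 e) ∧
      Rules.Agree c (rules σ) (rules σ')) := by
  have hw0 : w ≠ 0 := by omega
  have h4 : 4 ≤ 2 ^ w := le_trans (by norm_num) (Nat.pow_le_pow_right two_pos hw)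
  refine H.start (T₂ := h * 60 + 20) (by omega) ?_ (by simp [cost, block, mov]; omega)
  simp [wp_block_cons, wp_block_nil, wp, wp_mov, h74, h65]
  refine H.bind (H.frame (descend_spec hw (c := c) (h := h) (x := σ.A 8 e) (root := root) (P := P)
    ?_ ?_ ?_ ?_ hx ?_ hroot)) ?_ (T₂ := h * 30 + 13) (by omega)
  · simp
  · simp
  · simp
  · simp [h6]
  · simpa [rules_setR] using ht
  rintro σ₁ ⟨⟨i1, -⟩, hF⟩
  have e75 := hF.1 75 (by decide)
  have e6 := hF.1 6 (by decide)
  have e62 := hF.1 62 (by decide)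
  have er : rules σ₁ = rules σ := by
    have eK := hF.2 10 (by decide)
    have eF := hF.2 11 (by decide)
    have eS := hF.2 12 (by decide)
    simp [rules, eK, eF, eS]
  simp at e75
  simp [h6] at e6
  simp [h62] at e62
  refine H.start (T₂ := h * 30 + 7) (by omega) ?_ (by simp [cost, block, mov]; omega)
  simp [wp_block_cons, wp_block_nil, wp_mov]
  refine H.bind (ascend_spec hw (c := c) (m := m) (h := h) (x := σ.A 8 e) (P := P)
    ?_ ?_ ?_ ?_ hx ?_ ?_ hc ?_) ?_ (T₂ := 3) (by omega)
  · simp [e75]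
  · simp
  · simp
  · simp [e6]
  · simp [e62]
  · rwa [rules_setR, rules_setR, er]
  · rw [rules_setR, rules_setR, er]; exact i1
  rintro σ₂ ⟨j1, j2, j3, j4, j5⟩
  rw [rules_setR, rules_setR, er] at j5
  refine H.of_wp' (by omega) (by simp [cost, block, mov]) ?_
  simp [wp_block_cons, wp_block_nil, wp_mov, rules_setR]
  exact ⟨j1, j2, j3, j4, j5⟩

/-- The root starts as rule `h + 1`, the empty tree. Each insertion copies one path and leaves the
old rules untouched, which gives `h` rules per number. -/
theorem buildTrie_spec (hw : 2 ≤ w) {σ : Mem} {c m h ne : ℕ}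
    (h61 : σ.R 61 = ne) (h6 : σ.R 6 = h) (hx : ∀ e < ne, σ.A 8 e < 2 ^ h)
    (h62 : σ.R 62 = c) (ho : (rules σ).Ok c m) (hhm : h < m) (hc : c + ne * h < 2 ^ w) :
    H w buildTrie σ (ne * (h * 60 + 35) + 15) (fun σ' =>
      ((rules σ').Ok (c + ne * h) m ∧ σ'.R 62 = c + ne * h ∧ σ'.R 65 < c + ne * h ∧
      (rules σ').Trie h (σ'.R 65) (fun p => ∃ e < ne, p = σ.A 8 e) ∧
      Rules.Agree c (rules σ) (rules σ')) ∧ Frame buildTrie σ σ') := by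
  have hw0 : w ≠ 0 := by omega
  have h4 : 4 ≤ 2 ^ w := le_trans (by norm_num) (Nat.pow_le_pow_right two_pos hw)
  have hmc := ho.lt
  refine H.frame (H.start (T₂ := ne * (h * 60 + 35) + 6) (by omega) ?_
    (by simp [cost, block, mov]; omega))
  simp [wp_block_cons, wp_block_nil, wp, wp_mov, h6, Op.nat, Op.Fits]
  refine ⟨by omega, by omega, H.last (H.mono (H.forTo_const (by omega) (lo := 0) (hi := ne)
    (t := h * 60 + 30)
    (Inv := fun k σ' => (rules σ').Ok (c + k * h) m ∧ σ'.R 62 = c + k * h ∧ σ'.R 65 < c + k * h ∧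
      (rules σ').Trie h (σ'.R 65) (fun p => ∃ e < k, p = σ.A 8 e) ∧
      Rules.Agree c (rules σ) (rules σ'))
    (Operand.fits_reg _) (by decide) (by decide)
    ?_ ?_ (Nat.zero_le _) ?_ ?_ ?_) le_rfl fun σ' h' => h'.1) (by rw [Nat.sub_zero]; ring_nf; omega)⟩
  · simp
  · simp [h61]
  · simp [rules_setR, h62, ho, Rules.Agree.refl]
    exact ⟨by omega, ho.trie_zero hhm⟩
  · intro k σ v v' h
    simpa [rules_setR] using h
  · rintro k σ₁ - hk ⟨i1, i2, i3, i4, i5⟩ h74 hF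
    have e6 := hF.1 6 (by decide)
    have e8 := hF.2 8 (by decide)
    simp [h6] at e6
    simp at e8
    have hle : (k + 1) * h ≤ ne * h := Nat.mul_le_mul_right _ hk
    rw [add_mul, one_mul] at hle
    refine (insertOne_spec hw (P := fun p => ∃ e < k, p = σ.A 8 e) h74 rfl e6 (by rw [e8]; exact hx k hk) i2 i1 (by omega) i4
      i3).mono le_rfl ?_
    rintro σ₂ ⟨j1, j2, j3, j4, j5⟩
    rw [add_mul, one_mul, ← add_assoc]
    refine ⟨j1, j2, j3, j4.congr fun p _ => ?_, i5.trans j5 (by omega)⟩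
    rw [e8]
    constructor
    · rintro (⟨e, he, rfl⟩ | rfl)
      · exact ⟨e, by omega, rfl⟩
      · exact ⟨k, by omega, rfl⟩
    · rintro ⟨e, he, rfl⟩
      rcases (Nat.lt_succ_iff.1 he).eq_or_lt with rfl | he
      · exact Or.inr rfl
      · exact Or.inl ⟨e, he, rfl⟩

/-- Append a slot: a copy of the tree, preceded by `q - x` and followed by `x` zeros, where `x` is
entry number `82` of the array `7`. -/
def appendSlot : Cmd :=
  block [block [.load 83 7 (.reg 82), .set 70 .sub (.reg 4) (.reg 83)],
    appendZeros,
    block [mov 73 (.reg 62), emit (.reg 63) (.reg 65), mov 63 (.reg 73), mov 70 (.reg 83),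
      .set 64 .add (.reg 64) (.reg 84)],
    appendZeros]

/-- Write a straight-line program with `n` rules for a vector of length `N` that consists of one
slot for each entry of the array `7`; the tree is given by the array `8`. -/
def writeSLP : Cmd :=
  block [writePowers, buildTrie,
    block [mov 63 (.const 1), mov 64 (.const 1), mov 82 (.const 0), .set 84 .shl (.const 1) (.reg 6),
      .set 84 .add (.reg 84) (.reg 4)],
    forTo 82 (.reg 60) appendSlot,
    block [.set 70 .sub (.reg 7) (.const 1), .set 70 .sub (.reg 70) (.reg 64)],
    appendZeros,
    .set 85 .sub (.reg 8) (.const 1),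
    forTo 62 (.reg 85) (block [.store 10 (.reg 62) (.const 0), .store 11 (.reg 62) (.const 0),
      .store 12 (.reg 62) (.const 0)]),
    block [.store 10 (.reg 85) (.const 1), .store 11 (.reg 85) (.reg 63),
      .store 12 (.reg 85) (.const 1)]]

theorem rules_put (σ : Mem) (c k x y : ℕ) :
    rules (((σ.setA 10 c k).setA 11 c x).setA 12 c y) = (rules σ).put c k x y := by
  simp [rules, Rules.put]

/-- A slot has length `2 ^ h + q` whatever the shift is, because the zeros before and after the tree
add up to `q`. Its `2 m + 1` rules are two runs of zeros and one concatenation with the shared tree.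
-/
theorem appendSlot_spec (hw : 2 ≤ w) {σ : Mem} {c m h k x q acc root W len : ℕ} {P : ℕ → Prop}
    (h82 : σ.R 82 = k) (hx : σ.A 7 k = x) (h4 : σ.R 4 = q) (hxq : x ≤ q) (hqm : q < 2 ^ m)
    (h62 : σ.R 62 = c) (h63 : σ.R 63 = acc) (h65 : σ.R 65 = root) (h17 : σ.R 17 = m)
    (h84 : σ.R 84 = W) (h64 : σ.R 64 = len) (hlen : len + W < 2 ^ w)
    (ho : (rules σ).Ok c m) (hacc : acc < c) (hroot : root < c)
    (ht : (rules σ).Trie h root P) (hc : c + (2 * m + 1) < 2 ^ w) :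
    H w appendSlot σ (m * 60 + 60) (fun σ' =>
      (rules σ').Ok (σ'.R 62) m ∧ σ'.R 63 < σ'.R 62 ∧ c ≤ σ'.R 62 ∧ σ'.R 62 ≤ c + (2 * m + 1) ∧
      σ'.R 64 = len + W ∧ Rules.Agree c (rules σ) (rules σ') ∧
      ((rules σ').word (σ'.R 63)).length = ((rules σ).word acc).length + (2 ^ h + q) ∧
      ∀ p, Rules.IsOne ((rules σ').word (σ'.R 63)) p ↔ Rules.IsOne ((rules σ).word acc) p ∨
        ∃ e < 2 ^ h, P e ∧ p = ((rules σ).word acc).length + (q - x) + e) := by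
  have hw0 : w ≠ 0 := by omega
  refine H.start (T₂ := m * 60 + 50) (by omega) ?_ (by simp [cost, block]; omega)
  simp [wp_block_cons, wp_block_nil, wp, Op.nat, Op.Fits, h82, hx, h4]
  refine ⟨hxq, H.bind (appendZeros_spec hw (c := c) (m := m) (acc := acc) (y := q - x)
    (by simp [h62]) (by simp [h63]) (by simp) (by simp [h17]) (by rwa [rules_setR, rules_setR])
    hacc (by omega) (by omega)) ?_ (T₂ := m * 30 + 35) (by omega)⟩
  rintro σ₁ ⟨⟨i1, i2, i3, i4, i5, i6⟩, hF⟩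
  have e65 := hF.1 65 (by decide)
  have e83 := hF.1 83 (by decide)
  have e64 := hF.1 64 (by decide)
  have e84 := hF.1 84 (by decide)
  have e17 := hF.1 17 (by decide)
  simp [h65] at e65
  simp at e83
  simp [h64] at e64
  simp [h84] at e84
  simp [h17] at e17
  simp only [rules_setR] at i5 i6
  generalize hp : σ₁.R 62 = p at *
  generalize ha : σ₁.R 63 = a at *
  have hpw : p < 2 ^ w := by omega
  refine H.start (T₂ := m * 30 + 14) (by omega) ?_ (by simp [cost, block, emit, mov]; omega)
  simp [emit, hw0, wp_block_cons, wp_block_nil, wp, wp_mov, Op.nat, Op.Fits, hp, ha, e65, e83, e64,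
    e84]
  refine ⟨by omega, hlen, H.last (H.mono (appendZeros_spec hw (c := p + 1) (m := m) (acc := p) (y := x)
    (by simp) (by simp) (by simp) (by simp [e17]) ?_ (by omega) (by omega) (by omega)) le_rfl ?_)
    (by omega)⟩
  · simp only [rules_setR, rules_put]
    exact i1.put i2 (by omega)
  rintro σ₂ ⟨⟨j1, j2, j3, j4, j5, j6⟩, hF₂⟩
  have f64 := hF₂.1 64 (by decide)
  simp at f64
  simp only [rules_setR, rules_put] at j5 j6
  obtain ⟨t1, t2⟩ := Rules.Trie.word i1 (ht.agree i6 hroot)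
  refine ⟨j1, j2, by omega, by omega, f64, (i6.trans (Rules.agree_put _ _ _ _ _) i3).trans j6
    (by omega), ?_, ?_⟩
  · rw [j5, Rules.word_put _ i2 (by omega), i5]
    simp [t1]
    omega
  · intro p'
    rw [j5, Rules.word_put _ i2 (by omega), i5, Rules.isOne_append_replicate, Rules.isOne_append,
      Rules.isOne_append_replicate]
    refine or_congr Iff.rfl ?_
    simp only [t2, List.length_append, List.length_replicate]
    constructor
    · rintro ⟨e, rfl, h1, h2⟩; exact ⟨e, h1, h2, rfl⟩
    · rintro ⟨e, h1, h2, rfl⟩; exact ⟨e, rfl, h1, h2⟩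

/-- A word is never empty, so the accumulated word starts with the zero of rule `1`; this is the `1`
in the positions. The program must have exactly `n` rules with the last one generating the vector:
unused rules become letters, and rule `n - 1` appends one final zero, whence the `2` in `hN`. The
summands of `hn` are the powers, the tree, the slots, the padding and the last rule. -/
theorem writeSLP_spec (hw : 2 ≤ w) {σ : Mem} {N n m h q nx ne : ℕ} (h7 : σ.R 7 = N) (h8 : σ.R 8 = n)
    (h17 : σ.R 17 = m) (h6 : σ.R 6 = h) (h4 : σ.R 4 = q) (h60 : σ.R 60 = nx) (h61 : σ.R 61 = ne)
    (hX : ∀ i < nx, σ.A 7 i ≤ q) (hE : ∀ i < ne, σ.A 8 i < 2 ^ h) (hhm : h < m) (hqm : q < 2 ^ m)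
    (hNm : N < 2 ^ m) (hmw : 2 ^ m < 2 ^ w) (hnw : n < 2 ^ w)
    (hN : 2 + nx * (2 ^ h + q) ≤ N) (hWw : 2 ^ h + q < 2 ^ w)
    (hn : m + 1 + ne * h + nx * (2 * m + 1) + m + 1 ≤ n) :
    H w writeSLP σ (m * 80 + ne * (h * 60 + 35) + nx * (m * 60 + 65) + n * 20 + 150) (fun σ' =>
      ((∀ i < n, (rules σ').Valid i) ∧ ((rules σ').word (n - 1)).length = N ∧
      ∀ p, Rules.IsOne ((rules σ').word (n - 1)) p ↔
        ∃ i < nx, ∃ e < ne, p = 1 + i * (2 ^ h + q) + (q - σ.A 7 i) + σ.A 8 e) ∧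
      Frame writeSLP σ σ') := by
  have hw0 : w ≠ 0 := by omega
  have hc4 : 4 ≤ 2 ^ w := le_trans (by norm_num) (Nat.pow_le_pow_right two_pos hw)
  refine H.frame (H.bind (writePowers_spec hw h17 (by omega) (by omega)) ?_
    (T₂ := m * 60 + ne * (h * 60 + 35) + nx * (m * 60 + 65) + n * 20 + 119) (by omega))
  rintro σ₁ ⟨⟨i1, i2⟩, hF₁⟩
  refine H.bind (buildTrie_spec hw (ne := ne) (h := h) ((hF₁.1 61 (by decide)).trans h61)
    ((hF₁.1 6 (by decide)).trans h6) (by rw [hF₁.2 8 (by decide)]; exact hE) i2 i1 hhm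
    (by omega)) ?_
    (T₂ := m * 60 + nx * (m * 60 + 65) + n * 20 + 103) (by omega)
  rw [hF₁.2 8 (by decide)]
  rintro σ₂ ⟨⟨j1, j2, j3, j4, -⟩, hF₂⟩
  have fR : ∀ r, r ∉ modR writePowers → r ∉ modR buildTrie → σ₂.R r = σ.R r := fun r h h' =>
    (hF₂.1 r h').trans (hF₁.1 r h)
  have fA : σ₂.A 7 = σ.A 7 := (hF₂.2 7 (by decide)).trans (hF₁.2 7 (by decide))
  set c₁ := m + 1 + ne * h with hc₁
  set W := 2 ^ h + q with hWdef
  refine H.start (T₂ := m * 60 + nx * (m * 60 + 65) + n * 20 + 90) (by omega) ?_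
    (by simp [cost, block, mov]; omega)
  simp [hw0, wp_block_cons, wp_block_nil, wp, wp_mov, Op.nat, Op.Fits, fR 6 (by decide) (by decide),
    fR 4 (by decide) (by decide), h6, h4]
  refine ⟨by omega, hWw, H.bind (H.forTo_const (by omega) (lo := 0) (hi := nx) (t := m * 60 + 60)
    (Inv := fun k σ' => (rules σ').Ok (σ'.R 62) m ∧ σ'.R 63 < σ'.R 62 ∧
      σ'.R 62 ≤ c₁ + k * (2 * m + 1) ∧ c₁ ≤ σ'.R 62 ∧ Rules.Agree c₁ (rules σ₂) (rules σ') ∧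
      σ'.R 64 = 1 + k * W ∧
      ((rules σ').word (σ'.R 63)).length = 1 + k * W ∧
      ∀ p, Rules.IsOne ((rules σ').word (σ'.R 63)) p ↔
        ∃ i < k, ∃ e < ne, p = 1 + i * W + (q - σ.A 7 i) + σ.A 8 e)
    (Operand.fits_reg _) (by decide) (by decide)
    ?_ ?_ (Nat.zero_le _) ?_ ?_ ?_) ?_ (T₂ := m * 30 + n * 20 + 80) (by rw [Nat.sub_zero]; ring_nf; omega)⟩
  · simp
  · simp [fR 60 (by decide) (by decide), h60]
  · have h1 : (rules σ₂).word 1 = [0] := by simpa using j1.word_zero (i := 0) (by omega)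
    simp only [rules_setR]
    simp [j2, h1, j1, Rules.Agree.refl]
    refine ⟨by omega, fun p h => ?_⟩
    exact Rules.not_isOne_replicate (k := 1) h
  · intro k σ v v' h
    simpa [rules_setR] using h
  · rintro k σ₃ - hk ⟨k1, k2, k3, k4, k5, k6, k7, k8⟩ h82 hF
    have e65 := hF.1 65 (by decide)
    have e4 := hF.1 4 (by decide)
    have e84 := hF.1 84 (by decide)
    have e17 := hF.1 17 (by decide)
    have eX := hF.2 7 (by decide)
    simp at e65
    simp [fR 4 (by decide) (by decide), h4] at e4
    simp at e84
    simp [fR 17 (by decide) (by decide), h17] at e17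
    simp [fA] at eX
    have hle : (k + 1) * W ≤ nx * W := Nat.mul_le_mul_right _ hk
    rw [add_mul, one_mul] at hle
    have hle2 : (k + 1) * (2 * m + 1) ≤ nx * (2 * m + 1) := Nat.mul_le_mul_right _ hk
    rw [add_mul, one_mul] at hle2
    refine (appendSlot_spec hw h82 (by rw [eX]) e4 (hX k hk) hqm rfl rfl e65 e17 e84 k6
      (by omega) k1 k2 (by omega) (j4.agree k5 j3) (by omega)).mono le_rfl ?_
    rintro σ₄ ⟨l1, l2, l3, l4, l5, l6, l7, l8⟩
    refine ⟨l1, l2, ?_, by omega, k5.trans l6 k4, ?_, ?_, fun p => ?_⟩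
    · rw [add_mul, one_mul]; omega
    · rw [l5, add_mul, one_mul, add_assoc]
    · rw [l7, k7, add_mul, one_mul, add_assoc]
    · rw [l8, k8, k7]
      constructor
      · rintro (⟨i, hi, h⟩ | ⟨e, he, ⟨e', he', rfl⟩, rfl⟩)
        · exact ⟨i, by omega, h⟩
        · exact ⟨k, by omega, e', he', rfl⟩
      · rintro ⟨i, hi, e, he, rfl⟩
        rcases (Nat.lt_succ_iff.1 hi).eq_or_lt with rfl | hi
        · exact Or.inr ⟨_, hE e he, ⟨e, he, rfl⟩, rfl⟩
        · exact Or.inl ⟨i, hi, e, he, rfl⟩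
  rintro σ₃ ⟨⟨k1, k2, k3, k4, k5, k6, k7, k8⟩, -, hF₃⟩
  have e7 := hF₃.1 7 (by decide)
  have e8 := hF₃.1 8 (by decide)
  have e17 := hF₃.1 17 (by decide)
  simp [fR 7 (by decide) (by decide), h7] at e7
  simp [fR 8 (by decide) (by decide), h8] at e8
  simp [fR 17 (by decide) (by decide), h17] at e17
  refine H.start (T₂ := m * 30 + n * 20 + 70) (by omega) ?_ (by simp [cost, block]; omega)
  simp [hw0, wp_block_cons, wp_block_nil, wp, Op.nat, Op.Fits, e7, k6]
  refine ⟨by omega, by omega, H.bind (appendZeros_spec hw (m := m) (y := N - 1 - (1 + nx * W)) rfl rfl ?_ ?_ ?_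
    ?_ (by omega) ?_) ?_ (T₂ := n * 20 + 50) (by omega)⟩
  · simp
  · simp [e17]
  · simpa [rules_setR] using k1
  · simpa using k2
  · simp; omega
  rintro σ₄ ⟨⟨l1, l2, l3, l4, l5, -⟩, hF₄⟩
  simp [rules_setR] at l3 l4 l5
  have f8 := hF₄.1 8 (by decide)
  simp [e8] at f8
  refine H.start (T₂ := n * 20 + 40) (by omega) ?_ (by simp [cost]; omega)
  simp [hw0, wp, Op.nat, Op.Fits, f8]
  refine ⟨by omega, H.bind (H.forTo_const (by omega) (lo := σ₄.R 62) (hi := n - 1) (t := 10)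
    (Inv := fun k σ' => (∀ i < k, (rules σ').Valid i) ∧ Rules.Agree (σ₄.R 62) (rules σ₄) (rules σ'))
    (Operand.fits_reg _) (by decide) (by decide)
    ?_ ?_ ?_ ?_ ?_ ?_) ?_ (T₂ := 11) ?_⟩
  · simp
  · simp
  · omega
  · exact ⟨l1.valid, Rules.Agree.refl _ _⟩
  · intro k σ v v' h
    simpa [rules_setR] using h
  · rintro k σ₅ hk1 hk ⟨m1, m2⟩ h62 hF
    refine H.of_wp' (by omega) (T := 10) (by decide) ?_
    simp [wp_block_cons, wp_block_nil, wp, h62]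
    rw [rules_put]
    have ha := Rules.agree_put (rules σ₅) k 0 0 0
    refine ⟨fun i hi => ?_, m2.trans ha hk1⟩
    rcases hi.eq_or_lt with rfl | hi
    · left; simp [Rules.put]
    · exact ha.valid hi (m1 i hi)
  · rintro σ₅ ⟨⟨m1, m2⟩, -, hF₅⟩
    have g63 := hF₅.1 63 (by decide)
    have g85 := hF₅.1 85 (by decide)
    simp at g63 g85
    refine H.of_wp' (by omega) (by simp [cost, block]) ?_
    simp [hw0, wp_block_cons, wp_block_nil, wp, g63, g85]
    rw [rules_put]
    have hlt := l1.lt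
    have ha := Rules.agree_put (rules σ₅) (n - 1) 1 (σ₄.R 63) 1
    have hz : (rules σ₄).word 1 = [0] := by simpa using l1.word_zero (i := 0) (by omega)
    have hword : ((rules σ₅).put (n - 1) 1 (σ₄.R 63) 1).word (n - 1) =
        ((rules σ₃).word (σ₃.R 63) ++ List.replicate (N - 1 - (1 + nx * W)) 0) ++
          List.replicate 1 0 := by
      rw [Rules.word_put _ (by omega) (by omega), m2.word l2, m2.word (by omega), l5, hz]
      rfl
    refine ⟨fun i hi => ?_, ?_, fun p => ?_⟩
    · by_cases hin : i = n - 1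
      · subst hin
        right
        simp [Rules.put]; omega
      · exact ha.valid (by omega) (m1 i (by omega))
    · rw [hword]; simp [k7]; omega
    · rw [hword, Rules.isOne_append_replicate, Rules.isOne_append_replicate, k8]
  · have : (n - 1 - σ₄.R 62) ≤ n := by omega
    omega

/-! ### Listing the relevant triples of blocks -/

/-- The data of the blocks: the first elements of the blocks of `A`, `B`, `C`, with large numbers
at the end. -/
structure Blocks (g : ℕ) (α β γ : ℕ → ℕ) : Prop where
  pos : 0 < g
  monoA : ∀ i i', i ≤ i' → i' ≤ g → α i ≤ α i'
  monoB : ∀ i i', i ≤ i' → i' ≤ g → β i ≤ β i'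
  monoC : ∀ i i', i ≤ i' → i' ≤ g → γ i ≤ γ i'
  top : ∀ i j, i ≤ g → j ≤ g → α i + β j < γ g

section
variable (α β γ : ℕ → ℕ)

/-- The blocks `i`, `j`, `k` of `A`, `B`, `C` may contain a solution. -/
def Relevant (j i k : ℕ) : Prop :=
  γ k < α (i + 1) + β (j + 1) ∧ α i + β j < γ (k + 1)

/-- The first block of `C` that is relevant for the blocks `i` and `j`. -/
noncomputable def firstBlock (j i : ℕ) : ℕ := sInf {k | α i + β j < γ (k + 1)}

/-- The first block of `C` beyond the relevant ones. -/
noncomputable def endBlock (j i : ℕ) : ℕ :=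
  sInf {k | firstBlock α β γ j i ≤ k ∧ α (i + 1) + β (j + 1) ≤ γ k}

/-- The first block for the previous `i`. -/
noncomputable def prevBlock (j i : ℕ) : ℕ := if i = 0 then 0 else firstBlock α β γ j (i - 1)

end

/-! ### Counting the relevant triples -/

namespace Blocks

variable {g : ℕ} {α β γ : ℕ → ℕ} {i j k : ℕ}

theorem first_mem (hB : Blocks g α β γ) (hi : i < g) (hj : j < g) :
    α i + β j < γ (firstBlock α β γ j i + 1) := by
  have : firstBlock α β γ j i ∈ {k | α i + β j < γ (k + 1)} :=
    Nat.sInf_mem ⟨g - 1, by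
      have := hB.pos
      show _ < γ (g - 1 + 1)
      rw [Nat.sub_add_cancel hB.pos]
      exact hB.top _ _ hi.le hj.le⟩
  exact this

theorem of_lt_first (hk : k < firstBlock α β γ j i) : γ (k + 1) ≤ α i + β j := by
  have := Nat.notMem_of_lt_sInf hk
  simpa using this

theorem first_lt (hB : Blocks g α β γ) (hi : i < g) (hj : j < g) : firstBlock α β γ j i < g := by
  have hg := hB.pos
  have : firstBlock α β γ j i ≤ g - 1 := Nat.sInf_le (by
      show _ < γ (g - 1 + 1)
      rw [Nat.sub_add_cancel hB.pos]
      exact hB.top _ _ hi.le hj.le)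
  omega

theorem end_mem (hB : Blocks g α β γ) (hi : i < g) (hj : j < g) :
    firstBlock α β γ j i ≤ endBlock α β γ j i ∧
      α (i + 1) + β (j + 1) ≤ γ (endBlock α β γ j i) := by
  have : endBlock α β γ j i ∈ {k | firstBlock α β γ j i ≤ k ∧ α (i + 1) + β (j + 1) ≤ γ k} :=
    Nat.sInf_mem ⟨g, (hB.first_lt hi hj).le, (hB.top _ _ hi hj).le⟩
  exact this

theorem end_le (hB : Blocks g α β γ) (hi : i < g) (hj : j < g) : endBlock α β γ j i ≤ g :=
  Nat.sInf_le ⟨(hB.first_lt hi hj).le, (hB.top _ _ hi hj).le⟩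

theorem of_lt_end (h : firstBlock α β γ j i ≤ k) (hk : k < endBlock α β γ j i) :
    γ k < α (i + 1) + β (j + 1) := by
  have := Nat.notMem_of_lt_sInf hk
  simp only [Set.mem_ofPred_eq, not_and, not_le] at this
  exact this h

/-- By monotonicity of `γ`, one of the two conditions bounds `k` from below and the other from
above; the relevant blocks of `C` form an interval. -/
theorem relevant_iff (hB : Blocks g α β γ) (hi : i < g) (hj : j < g) (hk : k < g) :
    Relevant α β γ j i k ↔ firstBlock α β γ j i ≤ k ∧ k < endBlock α β γ j i := by
  constructor
  · rintro ⟨h1, h2⟩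
    constructor
    · by_contra! h
      have := of_lt_first h
      omega
    · by_contra! h
      have := hB.monoC _ _ h hk.le
      have := (hB.end_mem hi hj).2
      omega
  · rintro ⟨h1, h2⟩
    exact ⟨of_lt_end h1 h2, (hB.first_mem hi hj).trans_le (hB.monoC _ _ (by omega) (by omega))⟩

/-- For fixed `j` the first relevant block moves only upwards with `i`, so its search can resume
where the previous one ended. -/
theorem prev_le (hB : Blocks g α β γ) (hi : i < g) (hj : j < g) :
    prevBlock α β γ j i ≤ firstBlock α β γ j i := by
  unfold prevBlock
  split_ifs with h
  · exact Nat.zero_le _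
  · by_contra! hlt
    have h1 := of_lt_first hlt
    have h2 := hB.monoA (i - 1) i (by omega) hi.le
    have := hB.first_mem hi hj
    omega

/-- The moves of the pointer telescope: for each `j` they number at most `g` in total. -/
theorem sum_steps_le (hB : Blocks g α β γ) (hj : j < g) :
    ∑ i ∈ Finset.range g, (firstBlock α β γ j i - prevBlock α β γ j i) ≤ g := by
  have : ∀ n ≤ g, ∑ i ∈ Finset.range n, (firstBlock α β γ j i - prevBlock α β γ j i)
      ≤ prevBlock α β γ j n := by
    intro n hn
    induction n with
    | zero => simp
    | succ n ih =>
      rw [Finset.sum_range_succ]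
      have h1 := ih (by omega)
      have h2 := hB.prev_le (j := j) (i := n) (by omega) hj
      have h3 : prevBlock α β γ j (n + 1) = firstBlock α β γ j n := by simp [prevBlock]
      omega
  refine (this g le_rfl).trans ?_
  have := hB.pos
  rw [prevBlock, if_neg (by omega)]
  exact (hB.first_lt (by omega) hj).le

/-- On a line in direction `(1, 1, -1)` at most one triple `(i, j, k)` is relevant. If `k < k'` on
the same line, then `i' < i` and `j' < j`, so `α i + β j < γ (k+1) ≤ γ k' < α (i'+1) + β (j'+1) ≤ α
i + β j`, which is absurd. -/
theorem sum_relevant_le (hB : Blocks g α β γ) :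
    ∑ j ∈ Finset.range g, ∑ i ∈ Finset.range g, (endBlock α β γ j i - firstBlock α β γ j i)
      ≤ 4 * g ^ 2 := by
  classical
  have e : ∑ j ∈ Finset.range g, ∑ i ∈ Finset.range g,
      (endBlock α β γ j i - firstBlock α β γ j i) =
      ((Finset.range g ×ˢ Finset.range g).sigma fun x =>
        Finset.Ico (firstBlock α β γ x.1 x.2) (endBlock α β γ x.1 x.2)).card := by
    rw [Finset.card_sigma, Finset.sum_product]
    simp
  rw [e]
  have hc : 4 * g ^ 2 = (Finset.range (2 * g) ×ˢ Finset.range (2 * g)).card := by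
    simp; ring
  rw [hc]
  -- The two sums identify the line; both are below `2 g`.
  refine Finset.card_le_card_of_injOn (fun x => (x.1.2 + x.2, x.1.1 + x.2)) ?_ ?_
  · rintro ⟨⟨j, i⟩, k⟩ h
    simp only [Finset.coe_sigma, Set.mem_sigma_iff, Finset.mem_coe, Finset.mem_product,
      Finset.mem_range, Finset.mem_Ico] at h ⊢
    have := hB.end_le h.1.2 h.1.1
    omega
  · have key : ∀ i j k i' j' k', i < g → j < g → i' < g → j' < g →
        firstBlock α β γ j i ≤ k → k < endBlock α β γ j i →
        firstBlock α β γ j' i' ≤ k' → k' < endBlock α β γ j' i' →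
        i + k = i' + k' → j + k = j' + k' → ¬ k < k' := by
      intro i j k i' j' k' hi hj hi' hj' h1 h2 h3 h4 h5 h6 hlt
      have e1 := hB.end_le hi hj
      have e2 := hB.end_le hi' hj'
      have r1 := (hB.relevant_iff hi hj (by omega)).2 ⟨h1, h2⟩
      have r2 := (hB.relevant_iff hi' hj' (by omega)).2 ⟨h3, h4⟩
      have m1 := hB.monoC (k + 1) k' (by omega) (by omega)
      have m2 := hB.monoA (i' + 1) i (by omega) (by omega)
      have m3 := hB.monoB (j' + 1) j (by omega) (by omega)
      have := r1.2
      have := r2.1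
      omega
    rintro ⟨⟨j, i⟩, k⟩ h ⟨⟨j', i'⟩, k'⟩ h' heq
    simp only [Finset.coe_sigma, Set.mem_sigma_iff, Finset.mem_coe, Finset.mem_product,
      Finset.mem_range, Finset.mem_Ico, Prod.mk.injEq] at h h' heq
    have k1 := key i j k i' j' k' h.1.2 h.1.1 h'.1.2 h'.1.1 h.2.1 h.2.2 h'.2.1 h'.2.2 heq.1 heq.2
    have k2 := key i' j' k' i j k h'.1.2 h'.1.1 h.1.2 h.1.1 h'.2.1 h'.2.2 h.2.1 h.2.2 heq.1.symm
      heq.2.symm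
    obtain rfl : k = k' := by omega
    obtain rfl : i = i' := by omega
    obtain rfl : j = j' := by omega
    rfl

end Blocks

/-! ### The program that lists the triples in batches -/

/-- Test whether the block after block number `23` starts beyond register `25`. -/
def testFirst : Cmd :=
  block [.set 28 .add (.reg 23) (.const 1), .load 27 16 (.reg 28), .set 99 .lt (.reg 25) (.reg 27),
    .set 99 .sub (.const 1) (.reg 99)]

/-- Test whether block number `24` starts before register `26`. -/
def testEnd : Cmd := block [.load 27 16 (.reg 24), .set 99 .lt (.reg 27) (.reg 26)]

/-- List the relevant triples for fixed blocks of `A` and `B`. -/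
def listRow : Cmd :=
  block [block [.load 25 14 (.reg 22), .load 27 15 (.reg 21), .set 25 .add (.reg 25) (.reg 27),
      .set 28 .add (.reg 22) (.const 1), .load 26 14 (.reg 28), .set 28 .add (.reg 21) (.const 1),
      .load 27 15 (.reg 28), .set 26 .add (.reg 26) (.reg 27), testFirst],
    .loop (.reg 99) (block [.set 23 .add (.reg 23) (.const 1), testFirst]),
    block [mov 24 (.reg 23), testEnd],
    .loop (.reg 99) (block [.store 4 (.reg 20) (.reg 22), .store 5 (.reg 20) (.reg 24),
      .set 27 .div (.reg 20) (.reg 7), .store 6 (.reg 27) (.reg 21),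
      .set 20 .add (.reg 20) (.const 1), .set 24 .add (.reg 24) (.const 1), testEnd])]

/-- List the relevant triples for a fixed block of `B`, and go on to the next batch. -/
def listBatch : Cmd :=
  block [block [mov 22 (.const 0), mov 23 (.const 0)],
    forTo 22 (.reg 9) listRow,
    block [.set 20 .div (.reg 20) (.reg 7), .set 20 .add (.reg 20) (.const 1),
      .set 20 .mul (.reg 20) (.reg 7)]]

/-- List the relevant triples of blocks in the arrays `4`, `5`, in batches of equal size with a
common block of `B`, which is recorded in the array `6`; count the batches in register `11`. -/
def listTriples : Cmd :=
  block [block [mov 20 (.const 0), mov 21 (.const 0)],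
    forTo 21 (.reg 9) listBatch,
    .set 11 .div (.reg 20) (.reg 7)]

/-- The lists contain numbers of blocks only. -/
def InRange (g : ℕ) (σ : Mem) : Prop := ∀ p, σ.A 4 p < g ∧ σ.A 5 p < g ∧ σ.A 6 p < g

/-- The pointer in register `23` enters at the first block for `i - 1` and leaves at that for `i`.
The time charges the moves of the pointer and the listed triples separately, so that both can be
summed. An entry of the array `6` may be overwritten for a batch already begun, but only by the same
`j`. -/
theorem listRow_spec (hw : 2 ≤ w) {σ : Mem} {g i j p N : ℕ} {α β γ : ℕ → ℕ}
    (hα : σ.A 14 = α) (hβ : σ.A 15 = β) (hγ : σ.A 16 = γ)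
    (hB : Blocks g α β γ) (h21 : σ.R 21 = j) (h22 : σ.R 22 = i)
    (h23 : σ.R 23 = prevBlock α β γ j i)
    (h20 : σ.R 20 = p) (h7 : σ.R 7 = N) (hi : i < g) (hj : j < g) (hg : γ g < 2 ^ w)
    (hgw : g + 1 < 2 ^ w) (hp : p + g + 1 < 2 ^ w) (hr : InRange g σ) :
    H w listRow σ ((firstBlock α β γ j i - prevBlock α β γ j i) * 20 +
      (endBlock α β γ j i - firstBlock α β γ j i) * 30 + 70) (fun σ' =>
      σ'.R 23 = firstBlock α β γ j i ∧
      σ'.R 20 = p + (endBlock α β γ j i - firstBlock α β γ j i) ∧ InRange g σ' ∧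
      (∀ p' < p, σ'.A 4 p' = σ.A 4 p' ∧ σ'.A 5 p' = σ.A 5 p') ∧
      (∀ b, σ'.A 6 b = σ.A 6 b ∨ σ'.A 6 b = j) ∧
      (∀ b, b < p / N → σ'.A 6 b = σ.A 6 b) ∧
      ∀ d < endBlock α β γ j i - firstBlock α β γ j i, σ'.A 4 (p + d) = i ∧
        σ'.A 5 (p + d) = firstBlock α β γ j i + d ∧ σ'.A 6 ((p + d) / N) = j) := by
  have hw0 : w ≠ 0 := by omega
  have h4 : 4 ≤ 2 ^ w := le_trans (by norm_num) (Nat.pow_le_pow_right two_pos hw)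
  have hs := hB.first_lt hi hj
  have hs' := hB.first_mem hi hj
  have hps := hB.prev_le hi hj
  obtain ⟨he1, he2⟩ := hB.end_mem hi hj
  have he := hB.end_le hi hj
  have ht1 := hB.top (i + 1) (j + 1) hi hj
  have ht2 := hB.top i j hi.le hj.le
  set s := firstBlock α β γ j i with hsdef
  set e := endBlock α β γ j i with hedef
  set s₀ := prevBlock α β γ j i with hs₀
  set x := α i + β j with hx
  set y := α (i + 1) + β (j + 1) with hy
  refine H.start (T₂ := (s - s₀) * 20 + (e - s) * 30 + 30) (by omega) ?_
    (by simp [cost, block, testFirst]; omega)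
  simp [hw0, testFirst, wp_block_cons, wp_block_nil, wp, Op.nat, Op.Fits, h22, h21, hα, hβ, hγ,
    h23, ← hx, ← hy]
  refine ⟨by omega, by omega, by omega, by omega, by omega, by split_ifs <;> omega,
    H.bind (H.frame (H.loop (lo := s₀) (hi := s) (t := fun _ => 15)
    (Inv := fun k σ' => σ'.R 23 = k ∧ (σ'.R 99 = 0 ↔ x < γ (k + 1)) ∧ σ'.R 25 = x ∧ σ'.A = σ.A)
    (Operand.fits_reg _) hps ?_ ?_ ?_)) ?_ (T₂ := (e - s) * 30 + 20) ?_⟩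
  · simp; exact ⟨h23, by split_ifs with hc <;> simp [hc]⟩
  · rintro k σ₁ hk1 hk ⟨i1, i2, i3, i4⟩
    have := Blocks.of_lt_first hk
    refine ⟨by simp [i2]; omega, H.of_wp' (by omega) (by decide) ?_⟩
    simp [hw0, wp_block_cons, wp_block_nil, wp, Op.nat, Op.Fits, i1, i3, i4, hγ]
    exact ⟨by omega, by omega, by split_ifs <;> omega, by split_ifs with hc <;> simp [hc]⟩
  · rintro σ₁ ⟨i1, i2, i3, i4⟩
    simpa using i2.2 hs'
  · rintro σ₁ ⟨⟨i1, i2, i3, i4⟩, hF⟩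
    have e26 := hF.1 26 (by decide)
    have e22 := hF.1 22 (by decide)
    have e21 := hF.1 21 (by decide)
    have e20 := hF.1 20 (by decide)
    have e7 := hF.1 7 (by decide)
    simp at e26 e22 e21 e20 e7
    rw [h22] at e22; rw [h21] at e21; rw [h20] at e20; rw [h7] at e7
    refine H.start (T₂ := (e - s) * 30 + 6) (by omega) ?_ (by simp [cost, block, testEnd, mov]; omega)
    simp [testEnd, wp_block_cons, wp_block_nil, wp, wp_mov, Op.nat, Op.Fits, i1, i4, hγ, e26]
    refine H.last (H.mono (H.loop (lo := s) (hi := e) (t := fun _ => 25)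
      (Inv := fun k σ' => σ'.R 24 = k ∧ σ'.R 23 = s ∧ (σ'.R 99 = 0 ↔ y ≤ γ k) ∧ σ'.R 26 = y ∧
        σ'.A 16 = γ ∧
        σ'.R 22 = i ∧ σ'.R 21 = j ∧ σ'.R 20 = p + (k - s) ∧ σ'.R 7 = N ∧ InRange g σ' ∧
        (∀ p' < p, σ'.A 4 p' = σ.A 4 p' ∧ σ'.A 5 p' = σ.A 5 p') ∧
        (∀ b, σ'.A 6 b = σ.A 6 b ∨ σ'.A 6 b = j) ∧
        (∀ b, b < p / N → σ'.A 6 b = σ.A 6 b) ∧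
        ∀ d < k - s, σ'.A 4 (p + d) = i ∧ σ'.A 5 (p + d) = s + d ∧ σ'.A 6 ((p + d) / N) = j)
      (Operand.fits_reg _) he1 ?_ ?_ ?_) le_rfl ?_) (by simp; omega)
    · simp [e22, e21, e20, e7, i1, i4, hγ]
      exact ⟨e26, fun p => by simpa [i4] using hr p⟩
    · rintro k σ₂ hk1 hk ⟨j1, j2, j3, j4, j5, j6, j7, j8, j9, j10, j11, j12, j13, j14⟩
      have := Blocks.of_lt_end hk1 hk
      refine ⟨by simp [j3]; omega, H.of_wp' (by omega) (by decide) ?_⟩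
      simp [hw0, wp_block_cons, wp_block_nil, wp, Op.nat, Op.Fits, j1, j2, j4, j5, j6, j7, j8, j9]
      refine ⟨by omega, by omega, by omega, ?_, ?_, ?_, ?_, ?_⟩
      · intro p'
        obtain ⟨r1, r2, r3⟩ := j10 p'
        simp [Function.update_apply]
        refine ⟨?_, ?_, ?_⟩ <;> split_ifs <;> omega
      · intro p' hp'
        rw [Function.update_of_ne (by omega), Function.update_of_ne (by omega)]
        exact j11 p' hp'
      · intro b
        simp only [Function.update_apply]
        split_ifs
        · exact Or.inr rfl
        · exact j12 b
      · intro b hb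
        rw [Function.update_of_ne]
        · exact j13 b hb
        · have := Nat.div_le_div_right (c := N) (show p ≤ p + (k - s) by omega)
          omega
      · intro d hd
        simp only [Function.update_apply]
        by_cases hdk : d = k - s
        · subst hdk
          simp
          omega
        · obtain ⟨r1, r2, r3⟩ := j14 d (by omega)
          rw [if_neg (by omega), if_neg (by omega), r1, r2, r3]
          simp
    · rintro σ₂ ⟨j1, j2, j3, j4, j5, j6, j7, j8, j9, j10, j11, j12, j13, j14⟩
      simpa using j3.2 he2
    · rintro σ₂ ⟨j1, j2, j3, j4, j5, j6, j7, j8, j9, j10, j11, j12, j13, j14⟩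
      exact ⟨j2, j8, j10, j11, j12, j13, j14⟩
  · simp
    omega

/-- At the end the position is advanced to the next multiple of `N`, so that the next block of `B`
begins a new batch. At most `N` cells are skipped; by `InRange` they hold numbers of blocks too, so
every row of a batch is meaningful. -/
theorem listBatch_spec (hw : 2 ≤ w) {σ : Mem} {g j p N : ℕ} {α β γ : ℕ → ℕ}
    (hα : σ.A 14 = α) (hβ : σ.A 15 = β) (hγ : σ.A 16 = γ)
    (hB : Blocks g α β γ) (h21 : σ.R 21 = j) (h9 : σ.R 9 = g)
    (h20 : σ.R 20 = p) (h7 : σ.R 7 = N) (hj : j < g) (hg : γ g < 2 ^ w) (hN : 0 < N)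
    (hp : p + ∑ i ∈ Finset.range g, (endBlock α β γ j i - firstBlock α β γ j i) + g + N + 1 < 2 ^ w)
    (hr : InRange g σ) :
    H w listBatch σ (∑ i ∈ Finset.range g, ((firstBlock α β γ j i - prevBlock α β γ j i) * 20 +
      (endBlock α β γ j i - firstBlock α β γ j i) * 30 + 75) + 30) (fun σ' =>
      p ≤ σ'.R 20 ∧ N ∣ σ'.R 20 ∧
      σ'.R 20 ≤ p + ∑ i ∈ Finset.range g, (endBlock α β γ j i - firstBlock α β γ j i) + N ∧
      InRange g σ' ∧
      (∀ p' < p, σ'.A 4 p' = σ.A 4 p' ∧ σ'.A 5 p' = σ.A 5 p') ∧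
      (∀ b, b < p / N → σ'.A 6 b = σ.A 6 b) ∧
      ∀ i < g, ∀ k < g, Relevant α β γ j i k → ∃ p' < σ'.R 20, σ'.A 4 p' = i ∧
        σ'.A 5 p' = k ∧ σ'.A 6 (p' / N) = j) := by
  have hw0 : w ≠ 0 := by omega
  refine H.start (T₂ := ∑ i ∈ Finset.range g, ((firstBlock α β γ j i - prevBlock α β γ j i) * 20 +
      (endBlock α β γ j i - firstBlock α β γ j i) * 30 + 75) + 20) (by omega) ?_
    (by simp [cost, block, mov]; omega)
  simp [wp_block_cons, wp_block_nil, wp_mov]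
  refine H.bind (H.forTo (by omega) (lo := 0) (hi := g) (t := fun i =>
      (firstBlock α β γ j i - prevBlock α β γ j i) * 20 +
      (endBlock α β γ j i - firstBlock α β γ j i) * 30 + 70)
    (Inv := fun n σ' => σ'.R 23 = prevBlock α β γ j n ∧
      σ'.R 20 = p + ∑ i ∈ Finset.range n, (endBlock α β γ j i - firstBlock α β γ j i) ∧
      InRange g σ' ∧
      (∀ p' < p, σ'.A 4 p' = σ.A 4 p' ∧ σ'.A 5 p' = σ.A 5 p') ∧
      (∀ b, b < p / N → σ'.A 6 b = σ.A 6 b) ∧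
      ∀ i < n, ∀ k < g, Relevant α β γ j i k → ∃ p' < σ'.R 20, σ'.A 4 p' = i ∧
        σ'.A 5 p' = k ∧ σ'.A 6 (p' / N) = j)
    (Operand.fits_reg _) (by decide) (by decide)
    ?_ ?_ (Nat.zero_le _) ?_ ?_ ?_) ?_ (T₂ := 10) (by rw [← Finset.range_eq_Ico]; simp only [Nat.add_assoc, Nat.reduceAdd]; exact Nat.add_le_add_left (by norm_num) _)
  · simp
  · simp [h9]
  · simp [prevBlock, h20]
    exact hr
  · intro k σ v v' h
    simpa [InRange] using h
  · rintro n σ₁ - hn ⟨i1, i2, i3, i4, i5, i6⟩ h22 hF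
    have e21 := hF.1 21 (by decide)
    have e7 := hF.1 7 (by decide)
    have e14 := hF.2 14 (by decide)
    have e15 := hF.2 15 (by decide)
    have e16 := hF.2 16 (by decide)
    simp [h21] at e21
    simp [h7] at e7
    simp [hα] at e14
    simp [hβ] at e15
    simp [hγ] at e16
    have hle : ∑ i ∈ Finset.range (n + 1), (endBlock α β γ j i - firstBlock α β γ j i) ≤
        ∑ i ∈ Finset.range g, (endBlock α β γ j i - firstBlock α β γ j i) :=
      Finset.sum_le_sum_of_subset (Finset.range_subset_range.2 hn)
    rw [Finset.sum_range_succ] at hle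
    refine (listRow_spec hw e14 e15 e16 hB e21 h22 i1 i2 e7 hn hj hg (by omega) (by omega) i3).mono
      le_rfl ?_
    rintro σ₂ ⟨j1, j2, j3, j4, j5, j6, j7⟩
    have hpN : p / N ≤ (p + ∑ i ∈ Finset.range n,
      (endBlock α β γ j i - firstBlock α β γ j i)) / N := Nat.div_le_div_right (by omega)
    refine ⟨by simp [prevBlock, j1], by rw [j2, Finset.sum_range_succ, add_assoc], j3,
      fun p' hp' => ?_, fun b hb => ?_, ?_⟩
    · rw [(j4 p' (by omega)).1, (j4 p' (by omega)).2]; exact i4 p' hp'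
    · rw [j6 b (by omega)]; exact i5 b hb
    · intro i hi k hk hrel
      rcases (Nat.lt_succ_iff.1 hi).eq_or_lt with rfl | hi
      · obtain ⟨h1, h2⟩ := (hB.relevant_iff hn hj hk).1 hrel
        obtain ⟨r1, r2, r3⟩ := j7 (k - firstBlock α β γ j i) (by omega)
        exact ⟨_, by omega, r1, by omega, r3⟩
      · obtain ⟨p', h1, h2, h3, h4⟩ := i6 i hi k hk hrel
        refine ⟨p', by omega, ?_, ?_, ?_⟩
        · rw [(j4 p' (by omega)).1, h2]
        · rw [(j4 p' (by omega)).2, h3]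
        · rcases j5 (p' / N) with h | h
          · rw [h, h4]
          · exact h
  · rintro σ₁ ⟨⟨i1, i2, i3, i4, i5, i6⟩, -, hF⟩
    have e7 := hF.1 7 (by decide)
    simp [h7] at e7
    refine H.of_wp' (by omega) (by simp [cost, block]) ?_
    set S := ∑ i ∈ Finset.range g, (endBlock α β γ j i - firstBlock α β γ j i) with hS
    have h1 := Nat.div_add_mod (p + S) N
    have h2 := Nat.mod_lt (p + S) hN
    have h3 : (p + S) / N ≤ p + S := Nat.div_le_self _ _
    rw [mul_comm] at h1
    simp [hw0, wp_block_cons, wp_block_nil, wp, Op.nat, Op.Fits, e7, i2, add_mul]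
    refine ⟨by omega, by omega, by omega, by omega, i3, i4, i5, ?_⟩
    intro i hi k hk hrel
    obtain ⟨p', q1, q2⟩ := i6 i hi k hk hrel
    exact ⟨p', by omega, q2⟩

/-- At most `4 g²` triples are listed, and each of the `g` blocks of `B` wastes at most `N` cells.
Hence the number of batches times `N` is at most `4 g² + g N`. -/
theorem listTriples_spec (hw : 2 ≤ w) {σ : Mem} {g N : ℕ} {α β γ : ℕ → ℕ}
    (hα : σ.A 14 = α) (hβ : σ.A 15 = β) (hγ : σ.A 16 = γ)
    (hB : Blocks g α β γ) (h9 : σ.R 9 = g) (h7 : σ.R 7 = N) (hg : γ g < 2 ^ w) (hN : 0 < N)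
    (hp : 4 * g ^ 2 + g * N + g + 1 < 2 ^ w) (hr : InRange g σ) :
    H w listTriples σ (300 * g ^ 2 + 100) (fun σ' =>
      (σ'.R 11 * N ≤ 4 * g ^ 2 + g * N ∧ InRange g σ' ∧
      ∀ j < g, ∀ i < g, ∀ k < g, Relevant α β γ j i k → ∃ b < σ'.R 11, ∃ r < N,
        σ'.A 6 b = j ∧ σ'.A 4 (b * N + r) = i ∧ σ'.A 5 (b * N + r) = k) ∧
      Frame listTriples σ σ') := by
  have hw0 : w ≠ 0 := by omega
  have hgpos := hB.pos
  have hgg : g ≤ g ^ 2 := by nlinarith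
  have hsum := hB.sum_relevant_le
  -- The time sums to `20 g²` for the pointer, `30 · 4 g²` for the triples, `75 g²` for the rounds
  -- of the inner loop and `35 g` for the outer loop.
  have hT : ∑ j ∈ Finset.range g, (∑ i ∈ Finset.range g,
      ((firstBlock α β γ j i - prevBlock α β γ j i) * 20 +
      (endBlock α β γ j i - firstBlock α β γ j i) * 30 + 75) + 35) ≤ 230 * g ^ 2 + 35 * g := by
    simp only [Finset.sum_add_distrib, ← Finset.sum_mul]
    have : ∑ j ∈ Finset.range g, ∑ i ∈ Finset.range g,
        (firstBlock α β γ j i - prevBlock α β γ j i) ≤ ∑ j ∈ Finset.range g, g :=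
      Finset.sum_le_sum fun j hj => hB.sum_steps_le (Finset.mem_range.1 hj)
    simp only [Finset.sum_const, Finset.card_range, smul_eq_mul] at this ⊢
    rw [pow_two] at *
    nlinarith
  refine H.frame (H.start (T₂ := 300 * g ^ 2 + 90) (by omega) ?_
    (by simp [cost, block, mov]; omega))
  simp [wp_block_cons, wp_block_nil, wp_mov]
  refine H.bind (H.forTo (by omega) (lo := 0) (hi := g) (t := fun j =>
      ∑ i ∈ Finset.range g, ((firstBlock α β γ j i - prevBlock α β γ j i) * 20 +
      (endBlock α β γ j i - firstBlock α β γ j i) * 30 + 75) + 30)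
    (Inv := fun n σ' => N ∣ σ'.R 20 ∧
      σ'.R 20 ≤ ∑ j ∈ Finset.range n, (∑ i ∈ Finset.range g,
        (endBlock α β γ j i - firstBlock α β γ j i) + N) ∧
      InRange g σ' ∧
      ∀ j < n, ∀ i < g, ∀ k < g, Relevant α β γ j i k → ∃ p' < σ'.R 20, σ'.A 4 p' = i ∧
        σ'.A 5 p' = k ∧ σ'.A 6 (p' / N) = j)
    (Operand.fits_reg _) (by decide) (by decide)
    ?_ ?_ (Nat.zero_le _) ?_ ?_ ?_) ?_ (T₂ := 5) ?_
  · simp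
  · simp [h9]
  · simp
    exact hr
  · intro k σ v v' h
    simpa [InRange] using h
  · rintro n σ₁ - hn ⟨i1, i2, i3, i4⟩ h21 hF
    have e9 := hF.1 9 (by decide)
    have e7 := hF.1 7 (by decide)
    have e14 := hF.2 14 (by decide)
    have e15 := hF.2 15 (by decide)
    have e16 := hF.2 16 (by decide)
    simp [h9] at e9
    simp [h7] at e7
    simp [hα] at e14
    simp [hβ] at e15
    simp [hγ] at e16
    have hle : ∑ j ∈ Finset.range (n + 1), (∑ i ∈ Finset.range g,
        (endBlock α β γ j i - firstBlock α β γ j i) + N) ≤ 4 * g ^ 2 + g * N := by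
      refine (Finset.sum_le_sum_of_subset (Finset.range_subset_range.2 hn)).trans ?_
      rw [Finset.sum_add_distrib]
      simpa using hsum
    rw [Finset.sum_range_succ] at hle
    refine (listBatch_spec hw e14 e15 e16 hB h21 e9 rfl e7 hn hg hN (by omega) i3).mono
      le_rfl ?_
    rintro σ₂ ⟨j1, j2, j3, j4, j5, j6, j7⟩
    refine ⟨j2, by rw [Finset.sum_range_succ]; omega, j4, ?_⟩
    intro j hj i hi k hk hrel
    rcases (Nat.lt_succ_iff.1 hj).eq_or_lt with rfl | hj
    · exact j7 i hi k hk hrel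
    · obtain ⟨p', h1, h2, h3, h4⟩ := i4 j hj i hi k hk hrel
      refine ⟨p', by omega, ?_, ?_, ?_⟩
      · rw [(j5 p' (by omega)).1, h2]
      · rw [(j5 p' (by omega)).2, h3]
      · rw [j6 (p' / N) (Nat.div_lt_div_of_lt_of_dvd i1 h1), h4]
  · rintro σ₁ ⟨⟨⟨M, i1⟩, i2, i3, i4⟩, -, hF⟩
    have e7 := hF.1 7 (by decide)
    simp [h7] at e7
    rw [Finset.sum_add_distrib] at i2
    simp at i2
    refine H.of_wp' (by omega) (by simp [cost, block]) ?_
    simp [wp_block_cons, wp_block_nil, wp, Op.nat, Op.Fits, e7, i1, Nat.mul_div_cancel_left M hN]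
    refine ⟨by rw [mul_comm]; omega, i3, ?_⟩
    intro j hj i hi k hk hrel
    obtain ⟨p', q1, q2, q3, q4⟩ := i4 j hj i hi k hk hrel
    refine ⟨p' / N, ?_, p' % N, Nat.mod_lt _ hN, q4, ?_, ?_⟩
    · rw [i1] at q1; exact Nat.div_lt_of_lt_mul q1
    · rw [Nat.div_add_mod']; exact q2
    · rw [Nat.div_add_mod']; exact q3
  · rw [← Finset.range_eq_Ico]
    simp only [Nat.add_assoc, Nat.reduceAdd] at hT ⊢
    exact (Nat.add_le_add_right hT _).trans (by omega)

/-! ### Probabilities -/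

open Classical in
/-- Started on the memory `σ`, the program `p` halts within `T` steps and establishes `Φ` with
probability at least `ρ`. -/
def Pr (w : ℕ) (p : Cmd) (σ : Mem) (T : ℕ) (Φ : Mem → Prop) (ρ : ℝ≥0∞) : Prop :=
  ∀ s : State w, view s = σ → ρ ≤ expect T ([p], s) (fun s' => if Φ (view s') then 1 else 0)

namespace Pr

variable {p q : Cmd} {ps : List Cmd} {σ : Mem} {T T₁ T₂ T' : ℕ} {Φ Ψ : Mem → Prop} {ρ : ℝ≥0∞}

theorem of_H (h : H w p σ T Φ) : Pr w p σ T Φ 1 := fun s hs =>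
  (h s hs).le_expect fun s' h' => by rw [if_pos h']

theorem weaken {ρ' : ℝ≥0∞} (h : Pr w p σ T Φ ρ) (hρ : ρ' ≤ ρ) : Pr w p σ T Φ ρ' :=
  fun s hs => hρ.trans (h s hs)

theorem mono (h : Pr w p σ T Φ ρ) (hT : T ≤ T') (hΦ : ∀ σ', Φ σ' → Ψ σ') : Pr w p σ T' Ψ ρ := by
  classical
  refine fun s hs => (h s hs).trans ((expect_mono_time hT).trans (expect_mono' fun s' => ?_))
  by_cases h' : Φ (view s')
  · rw [if_pos h', if_pos (hΦ _ h')]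
  · rw [if_neg h']; exact zero_le

/-- What holds surely can be added to an event without loss of probability; in this way frame
conditions enter probabilistic statements. -/
theorem and_H (h : Pr w p σ T Φ ρ) (h' : H w p σ T Ψ) : Pr w p σ T (fun σ' => Φ σ' ∧ Ψ σ') ρ := by
  classical
  refine fun s hs => (h s hs).trans (expect_mono (h' s hs) fun s' hs' => ?_)
  simp [hs']

theorem seq_expect {s : State w} (h : expect T₁ ([p], s) (fun s' =>
      expect T₂ ([q], s') fun s'' => open Classical in if Φ (view s'') then 1 else 0) ≥ ρ) :
    ρ ≤ expect (T₁ + T₂ + 1) ([.seq p q], s)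
      (fun s'' => open Classical in if Φ (view s'') then 1 else 0) := by
  rw [expect_of_step (c' := ([p, q], s)) rfl]
  exact le_trans h (expect_append (k₁ := [p]) (k₂ := [q]))

theorem seq_right (h : H w p σ T₁ Ψ) (h' : ∀ σ', Ψ σ' → Pr w q σ' T₂ Φ ρ) :
    Pr w (.seq p q) σ (T₁ + T₂ + 1) Φ ρ := fun s hs =>
  seq_expect ((h s hs).le_expect fun s' hs' => h' _ hs' s' rfl)

theorem seq_left (h : Pr w p σ T₁ Ψ ρ) (h' : ∀ σ', Ψ σ' → H w q σ' T₂ Φ) :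
    Pr w (.seq p q) σ (T₁ + T₂ + 1) Φ ρ := by
  classical
  refine fun s hs => seq_expect ((h s hs).trans (expect_mono' fun s' => ?_))
  by_cases h1 : Ψ (view s')
  · rw [if_pos h1]; exact of_H (h' _ h1) s' rfl
  · rw [if_neg h1]; exact zero_le

theorem bind_right (h : H w p σ T₁ Ψ) (h' : ∀ σ', Ψ σ' → Pr w (block ps) σ' T₂ Φ ρ)
    (hT : T₁ + T₂ + 1 ≤ T) : Pr w (block (p :: ps)) σ T Φ ρ :=
  (seq_right h h').mono hT fun _ => id

theorem bind_left (h : Pr w p σ T₁ Ψ ρ) (h' : ∀ σ', Ψ σ' → H w (block ps) σ' T₂ Φ)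
    (hT : T₁ + T₂ + 1 ≤ T) : Pr w (block (p :: ps)) σ T Φ ρ :=
  (seq_left h h').mono hT fun _ => id

theorem start (hw : 0 < w) (h : wp w p (fun σ' => Pr w (block ps) σ' T₂ Φ ρ) σ)
    (hT : cost p + T₂ + 1 ≤ T) : Pr w (block (p :: ps)) σ T Φ ρ :=
  bind_right (H.of_wp hw h) (fun _ h' => h') hT

/-- Two attempts. -/
theorem twice {a : ℝ≥0∞} (hp : Pr w p σ T₁ Φ a) (hp' : H w p σ T₁ Ψ)
    (hq : ∀ σ', Ψ σ' → Pr w q σ' T₂ Φ a) (hq' : ∀ σ', Φ σ' → H w q σ' T₂ Φ) (ha : a ≤ 1) :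
    Pr w (.seq p q) σ (T₁ + T₂ + 1) Φ (a + (1 - a) * a) := by
  classical
  intro s hs
  refine seq_expect ?_
  -- After the first attempt the chance of final success is `1` where `Φ` holds already, since the
  -- second attempt preserves it, and at least `a` elsewhere: in both cases at least `a + (1 - a) ·
  -- [Φ]`.
  calc a + (1 - a) * a ≤ expect T₁ ([p], s) (fun _ => a) + (1 - a) *
        expect T₁ ([p], s) (fun s' => if Φ (view s') then 1 else 0) := by
        gcongr
        · exact (hp' s hs).le_expect fun _ _ => le_rfl
        · exact hp s hs
    _ = expect T₁ ([p], s) (fun s' => a + (1 - a) * if Φ (view s') then 1 else 0) :=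
        (expect_add_mul _).symm
    _ ≤ _ := expect_mono (hp' s hs) fun s' hs' => by
        by_cases h : Φ (view s')
        · rw [if_pos h, mul_one, add_tsub_cancel_of_le ha]
          exact of_H (hq' _ h) s' rfl
        · rw [if_neg h, mul_zero, add_zero]
          exact hq _ hs' s' rfl

/-- Only the round `mid` may fail to reach its goal: `Inv` holds surely before it, `Inv'` holds with
probability `ρ` after it and is then kept surely. In the application `mid` is the batch that
contains a solution. -/
theorem loop {x : Operand} {p : Cmd} {σ₀ : Mem} {lo mid hi : ℕ} {t : ℕ → ℕ}
    {Inv Inv' : ℕ → Mem → Prop} (hx : x.Fits w) (hlo : lo ≤ mid) (hhi : mid < hi) (h₀ : Inv lo σ₀)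
    (hbody : ∀ k σ, lo ≤ k → k < mid → Inv k σ → x.ev σ ≠ 0 ∧ H w p σ (t k) (Inv (k + 1)))
    (hmid : ∀ σ, Inv mid σ → x.ev σ ≠ 0 ∧ Pr w p σ (t mid) (Inv' (mid + 1)) ρ)
    (hbody' : ∀ k σ, mid < k → k < hi → Inv' k σ → x.ev σ ≠ 0 ∧ H w p σ (t k) (Inv' (k + 1)))
    (hend : ∀ σ, Inv' hi σ → x.ev σ = 0) :
    Pr w (.loop x p) σ₀ (∑ k ∈ Finset.Ico lo hi, (t k + 1) + 1) (Inv' hi) ρ := by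
  classical
  obtain ⟨d, rfl⟩ := Nat.exists_eq_add_of_le hlo
  clear hlo
  induction d generalizing lo σ₀ with
  | zero =>
    intro s hs
    subst hs
    rw [add_zero] at hhi
    simp only [add_zero] at hmid hbody'
    obtain ⟨h1, h2⟩ := hmid _ h₀
    rw [← Operand.eval_ne_zero s hx] at h1
    rw [expect_of_step (c' := ([p, .loop x p], s)) (by simp only [step, if_pos h1]),
      Finset.sum_eq_sum_Ico_succ_bot hhi, add_assoc]
    have h3 := (h2 s rfl).trans (expect_mono' (ν' := fun s' => expect
        (∑ k ∈ Finset.Ico (lo + 1) hi, (t k + 1) + 1) ([.loop x p], s')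
        (fun s'' => if Inv' hi (view s'') then 1 else 0)) fun s' => by
      by_cases h : Inv' (lo + 1) (view s')
      · rw [if_pos h]
        exact of_H (H.loop hx hhi h (fun k σ h1 => hbody' k σ h1) hend) s' rfl
      · rw [if_neg h]; exact zero_le)
    refine h3.trans ((expect_append (k₁ := [p]) (k₂ := [.loop x p])).trans (expect_mono_time ?_))
    omega
  | succ d ih =>
    intro s hs
    subst hs
    obtain ⟨h1, h2⟩ := hbody lo _ le_rfl (by omega) h₀
    rw [← Operand.eval_ne_zero s hx] at h1
    rw [expect_of_step (c' := ([p, .loop x p], s)) (by simp only [step, if_pos h1]),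
      Finset.sum_eq_sum_Ico_succ_bot (by omega), add_assoc]
    have e : lo + (d + 1) = lo + 1 + d := by omega
    have h3 := (h2 s rfl).le_expect (ν := fun s' => expect
        (∑ k ∈ Finset.Ico (lo + 1) hi, (t k + 1) + 1) ([.loop x p], s')
        (fun s'' => if Inv' hi (view s'') then 1 else 0)) fun s' h' => ih (σ₀ := view s')
      (lo := lo + 1) h' (by omega) (fun k σ h1 h2 h3 => hbody k σ (by omega) (by omega) h3)
      (fun σ h => by have := hmid σ; rw [e] at this; exact this h)
      (fun k σ h => hbody' k σ (by omega)) s' rfl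
    refine h3.trans ((expect_append (k₁ := [p]) (k₂ := [.loop x p])).trans (expect_mono_time ?_))
    omega

/-- A random word that belongs to `S` with probability at least `a`. -/
theorem rand {r : ℕ} {S : Finset ℕ} {a b : ℝ≥0∞} (hS : ∀ x ∈ S, x < 2 ^ w)
    (ha : a * 2 ^ w ≤ S.card) (h : ∀ x ∈ S, Pr w (block ps) (σ.setR r x) T Φ b) :
    Pr w (block (.rand r :: ps)) σ (T + 2) Φ (a * b) := by
  classical
  intro s hs
  subst hs
  rw [expect_of_step (c' := ([.rand r, block ps], s)) rfl, expect_rand]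
  calc a * b ≤ ∑ x ∈ S, ((2 : ℝ≥0∞) ^ w)⁻¹ * b := by
        rw [Finset.sum_const, nsmul_eq_mul, ← mul_assoc, ← div_eq_mul_inv]
        gcongr
        rw [ENNReal.le_div_iff_mul_le (by simp) (by simp)]
        exact ha
    -- Distinct numbers below `2 ^ w` are distinct words.
    _ = ∑ x ∈ S.image (BitVec.ofNat w), ((2 : ℝ≥0∞) ^ w)⁻¹ * b := by
        rw [Finset.sum_const, Finset.sum_const, Finset.card_image_of_injOn]
        intro x hx y hy hxy
        have := congrArg BitVec.toNat hxy
        simpa [Nat.mod_eq_of_lt (hS x hx), Nat.mod_eq_of_lt (hS y hy)] using this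
    _ ≤ ∑ x ∈ S.image (BitVec.ofNat w), ((2 : ℝ≥0∞) ^ w)⁻¹ *
        expect T ([block ps], s.setReg r x) (fun s' => if Φ (view s') then 1 else 0) := by
        refine Finset.sum_le_sum fun x hx => ?_
        obtain ⟨y, hy, rfl⟩ := Finset.mem_image.1 hx
        gcongr
        refine h y hy _ ?_
        rw [view_setReg, BitVec.toNat_ofNat, Nat.mod_eq_of_lt (hS y hy)]
    _ ≤ _ := Finset.sum_le_sum_of_subset (Finset.subset_univ _)

end Pr

theorem H.rand {r : ℕ} {ps : List Cmd} {σ : Mem} {T : ℕ} {Φ : Mem → Prop}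
    (h : ∀ x < 2 ^ w, H w (block ps) (σ.setR r x) T Φ) :
    H w (block (.rand r :: ps)) σ (T + 2) Φ := by
  intro s hs
  subst hs
  rw [sure_of_step (c' := ([.rand r, block ps], s)) rfl, sure_rand]
  exact fun x => h x.toNat x.isLt _ (view_setReg _ _ _)

/-! ### Moving a program to other registers and arrays -/

/-- The operand for the moved program. -/
def Operand.shift : Operand → Operand
  | .reg r => .reg (r + 100)
  | .const k => .const k

/-- The program `p` on the registers `100, 101, …` and the arrays `30, 31, …`, where the array `13`
of length `R 98` records the positions of the cells that were written. -/
def relocate : Cmd → Cmd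
  | .skip => .skip
  | .set r op x y => .set (r + 100) op x.shift y.shift
  | .load r a x => .load (r + 100) (a + 30) x.shift
  | .store a x y => .seq (.store (a + 30) x.shift y.shift)
      (.seq (.store 13 (.reg 98) x.shift) (.set 98 .add (.reg 98) (.const 1)))
  | .rand r => .rand (r + 100)
  | .seq p q => .seq (relocate p) (relocate q)
  | .branch x p q => .branch x.shift (relocate p) (relocate q)
  | .loop x p => .loop x.shift (relocate p)

/-- The state `t` of the moved program, which was started in `t₀`, simulates the state `s`. -/
structure Sim (t₀ : State w) (c : ℕ) (s t : State w) : Prop where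
  reg : ∀ r, t.reg (r + 100) = s.reg r
  arr : ∀ a, t.arr (a + 30) = s.arr a
  lowReg : ∀ r < 100, r ≠ 98 → t.reg r = t₀.reg r
  lowArr : ∀ a < 30, a ≠ 13 → t.arr a = t₀.arr a
  count : (t.reg 98).toNat ≤ c
  log : ∀ a i, t.arr (a + 30) i ≠ t₀.arr (a + 30) i →
    ∃ j : BitVec w, j.toNat < (t.reg 98).toNat ∧ t.arr 13 j = i

namespace Sim

variable {t₀ s t : State w} {c : ℕ}

theorem eval (h : Sim t₀ c s t) (x : Operand) : x.shift.eval t = x.eval s := by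
  cases x with
  | reg r => exact h.reg r
  | const k => rfl

theorem mono {c' : ℕ} (h : Sim t₀ c s t) (hc : c ≤ c') : Sim t₀ c' s t :=
  { h with count := h.count.trans hc }

theorem setReg (h : Sim t₀ c s t) (r : ℕ) (x : BitVec w) :
    Sim t₀ c (s.setReg r x) (t.setReg (r + 100) x) where
  reg r' := by simp [State.setReg, Function.update_apply, h.reg]
  arr := h.arr
  lowReg r' hr hr' := by
    simp only [State.setReg]
    rw [Function.update_of_ne (by omega), h.lowReg r' hr hr']
  lowArr := h.lowArr
  count := by
    simp only [State.setReg]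
    rw [Function.update_of_ne (by omega)]
    exact h.count
  log a i hi := by
    simp only [State.setReg] at hi ⊢
    rw [Function.update_of_ne (by omega)]
    exact h.log a i hi

/-- The position just written is recorded at the end of the log, and earlier entries of the log stay
in place. The counter must not overflow, which is why the number of steps has to stay below `2 ^ w`.
-/
theorem store (h : Sim t₀ c s t) (hc : c + 1 < 2 ^ w) (a : ℕ) (x y : BitVec w) :
    Sim t₀ (c + 1) (s.setArr a x y)
      (((t.setArr (a + 30) x y).setArr 13 (t.reg 98) x).setReg 98 (t.reg 98 + BitVec.ofNat w 1)) := by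
  have hcnt := h.count
  have e : (t.reg 98 + BitVec.ofNat w 1).toNat = (t.reg 98).toNat + 1 := by
    rw [BitVec.toNat_add, BitVec.toNat_ofNat, Nat.add_mod_mod, Nat.mod_eq_of_lt (by omega)]
  refine ⟨fun r => ?_, fun b => ?_, fun r hr hr' => ?_, fun b hb hb' => ?_, ?_, fun b i hi => ?_⟩
  · simp only [State.setReg, State.setArr]
    rw [Function.update_of_ne (by omega), h.reg]
  · simp only [State.setReg, State.setArr]
    rw [Function.update_of_ne (by omega)]
    simp [Function.update_apply, h.arr]
  · simp only [State.setReg, State.setArr]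
    rw [Function.update_of_ne hr', h.lowReg r hr hr']
  · simp only [State.setReg, State.setArr]
    rw [Function.update_of_ne hb', Function.update_of_ne (by omega), h.lowArr b hb hb']
  · simp only [State.setReg, Function.update_self, e]
    omega
  · simp only [State.setReg, State.setArr, Function.update_self, e] at hi ⊢
    rw [Function.update_of_ne (by omega)] at hi
    rw [Function.update_of_ne (by omega)]
    by_cases hbi : b = a ∧ i = x
    · exact ⟨t.reg 98, by omega, by simp [hbi.2]⟩
    · have : t.arr (b + 30) i ≠ t₀.arr (b + 30) i := by
        by_cases hb : b = a
        · subst hb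
          rwa [Function.update_self, Function.update_of_ne (by tauto)] at hi
        · rwa [Function.update_of_ne (by omega)] at hi
      obtain ⟨j, hj, hji⟩ := h.log b i this
      refine ⟨j, by omega, ?_⟩
      have hne : j ≠ t.reg 98 := by rintro rfl; omega
      rw [Function.update_of_ne hne]
      simpa using hji

/-- A step of the program corresponds to at most five steps of the moved program. -/
theorem step (h : Sim t₀ c s t) (hc : c + 1 < 2 ^ w) (p : Cmd) (k : List Cmd) :
    (∃ r, p = .rand r) ∨ ∃ k' s' t', WordRAM.step (p :: k, s) = PMF.pure (k', s') ∧
      Sim t₀ (c + 1) s' t' ∧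
      (∀ T Φ, Sure T (k'.map relocate, t') Φ → Sure (T + 5) ((p :: k).map relocate, t) Φ) ∧
      ∀ T ν, expect T (k'.map relocate, t') ν ≤ expect (T + 5) ((p :: k).map relocate, t) ν := by
  have one : ∀ k' s' t', WordRAM.step (p :: k, s) = PMF.pure (k', s') → Sim t₀ c s' t' →
      WordRAM.step ((p :: k).map relocate, t) = PMF.pure (k'.map relocate, t') →
      ∃ k' s' t', WordRAM.step (p :: k, s) = PMF.pure (k', s') ∧ Sim t₀ (c + 1) s' t' ∧
      (∀ T Φ, Sure T (k'.map relocate, t') Φ → Sure (T + 5) ((p :: k).map relocate, t) Φ) ∧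
      ∀ T ν, expect T (k'.map relocate, t') ν ≤ expect (T + 5) ((p :: k).map relocate, t) ν := by
    intro k' s' t' h1 h2 h3
    refine ⟨k', s', t', h1, h2.mono (by omega), fun T Φ hS => ?_, fun T ν => ?_⟩
    · exact ((sure_of_step h3).2 hS).mono (by omega) fun _ h => h
    · rw [← expect_of_step h3]; exact expect_mono_time (by omega)
  cases p with
  | rand r => exact Or.inl ⟨r, rfl⟩
  | skip => exact Or.inr (one k s t rfl h rfl)
  | set r op x y =>
    refine Or.inr (one k _ (t.setReg (r + 100) (op.eval (x.eval s) (y.eval s))) rfl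
      (h.setReg r _) ?_)
    simp only [List.map_cons, relocate, WordRAM.step, h.eval]
  | load r a x =>
    refine Or.inr (one k _ (t.setReg (r + 100) (s.arr a (x.eval s))) rfl (h.setReg r _) ?_)
    simp only [List.map_cons, relocate, WordRAM.step, h.eval, h.arr]
  | seq p q => exact Or.inr (one (p :: q :: k) s t rfl h rfl)
  | branch x p q =>
    refine Or.inr (one (if x.eval s ≠ 0 then p :: k else q :: k) s t ?_ h ?_)
    · simp only [WordRAM.step]; split_ifs <;> rfl
    · simp only [List.map_cons, relocate, WordRAM.step, h.eval]; split_ifs <;> rfl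
  | loop x p =>
    refine Or.inr (one (if x.eval s ≠ 0 then p :: .loop x p :: k else k) s t ?_ h ?_)
    · simp only [WordRAM.step]; split_ifs <;> rfl
    · simp only [List.map_cons, relocate, WordRAM.step, h.eval]; split_ifs <;> rfl
  -- This is the case that needs five steps: two sequencings, two stores and the increment of the
  -- counter.
  | store a x y =>
    refine Or.inr ⟨k, _, _, rfl, h.store hc a (x.eval s) (y.eval s), fun T Φ hS => ?_, fun T ν => ?_⟩
    all_goals
      simp only [List.map_cons, relocate]
      first
      | rw [sure_of_step rfl, sure_of_step rfl, sure_of_step rfl, sure_of_step rfl, sure_of_step rfl]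
      | rw [expect_of_step rfl, expect_of_step rfl, expect_of_step rfl, expect_of_step rfl,
          expect_of_step rfl]
      have e1 : x.shift.eval (t.setArr (a + 30) (x.shift.eval t) (y.shift.eval t)) = x.eval s := by
        rw [← h.eval x]; cases x <;> rfl
      rw [e1, h.eval x, h.eval y]
    · exact hS
    · exact le_rfl

end Sim

theorem Sure.relocate {T c : ℕ} {k : List Cmd} {t₀ s t : State w} {Φ : State w → Prop}
    (h : Sure T (k, s) Φ) (hS : Sim t₀ c s t) (hc : c + T < 2 ^ w) :
    Sure (5 * T) (k.map WordRAM.relocate, t) (fun t' => ∃ s', Φ s' ∧ Sim t₀ (c + T) s' t') := by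
  induction T generalizing k s t c with
  | zero =>
    obtain ⟨h1, h2⟩ := h
    simp only at h1 h2
    subst h1
    exact Sure.nil.2 ⟨s, h2, hS⟩
  | succ T ih =>
    cases k with
    | nil => exact Sure.nil.2 ⟨s, Sure.nil.1 h, hS.mono (by omega)⟩
    | cons p k =>
      obtain ⟨r, rfl⟩ | ⟨k', s', t', h1, h2, h3, -⟩ := hS.step (by omega) p k
      · rw [sure_rand] at h
        refine Sure.mono (T := 5 * T + 1) (sure_rand.2 fun x => ?_) (by omega) fun _ h => h
        exact (ih (h x) (hS.setReg r x) (by omega)).mono le_rfl fun t' ⟨s', h1, h2⟩ =>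
          ⟨s', h1, h2.mono (by omega)⟩
      · rw [sure_of_step h1] at h
        refine h3 _ _ ((ih h h2 (by omega)).mono le_rfl fun t' ⟨s', h1, h2⟩ =>
          ⟨s', h1, h2.mono (by omega)⟩)

/-- Both programs draw the same random words, so the two sums over the words are compared term by
term. -/
theorem expect_relocate {T c : ℕ} {k : List Cmd} {t₀ s t : State w} {ν ν' : State w → ℝ≥0∞}
    (hν : ∀ s' t' c', Sim t₀ c' s' t' → ν s' ≤ ν' t') (hS : Sim t₀ c s t) (hc : c + T < 2 ^ w) :
    expect T (k, s) ν ≤ expect (5 * T) (k.map relocate, t) ν' := by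
  induction T generalizing k s t c with
  | zero =>
    by_cases hk : k = []
    · subst hk; rw [expect_nil]; exact (hν _ _ _ hS).trans (expect_nil (T := 0)).ge
    · simp [expect, hk]
  | succ T ih =>
    cases k with
    | nil => rw [expect_nil, List.map_nil, expect_nil]; exact hν _ _ _ hS
    | cons p k =>
      obtain ⟨r, rfl⟩ | ⟨k', s', t', h1, h2, -, h3⟩ := hS.step (by omega) p k
      · rw [expect_rand]
        refine le_trans ?_ (expect_mono_time (show 5 * T + 1 ≤ _ by omega))
        rw [List.map_cons, WordRAM.relocate, expect_rand]
        refine Finset.sum_le_sum fun x _ => ?_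
        gcongr
        exact ih (hS.setReg r x) (by omega)
      · rw [expect_of_step h1]
        exact (ih h2 (by omega)).trans (h3 _ _)

/-! ### Calling the moved program -/

/-- The rules that start in the given position of the array `a` and its two successors. -/
def rulesAt (σ : Mem) (a i : ℕ) : Rules :=
  ⟨fun p => σ.A a (i + p), fun p => σ.A (a + 1) (i + p), fun p => σ.A (a + 2) (i + p)⟩

/-- The `1`s of the vector are found among the `1`s of the row. -/
def Meets (σ : Mem) (n r : ℕ) : Prop :=
  ∃ p, Rules.IsOne ((rulesAt σ 30 (r * n)).word (n - 1)) p ∧ Rules.IsOne ((rulesAt σ 33 0).word (n - 1)) p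

/-- The memory contains an input of the moved program. -/
structure Input (N n : ℕ) (σ : Mem) : Prop where
  regN : σ.R 100 = N
  regn : σ.R 101 = n
  reg_zero : ∀ r, 102 ≤ r → σ.R r = 0
  row_zero : ∀ a, 30 ≤ a → a < 33 → ∀ p, N * n ≤ p → σ.A a p = 0
  vec_zero : ∀ a, 33 ≤ a → a < 36 → ∀ p, n ≤ p → σ.A a p = 0
  arr_zero : ∀ a, 36 ≤ a → ∀ p, σ.A a p = 0
  row_valid : ∀ r < N, ∀ p < n, (rulesAt σ 30 (r * n)).Valid p
  row_length : ∀ r < N, ((rulesAt σ 30 (r * n)).word (n - 1)).length = N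
  vec_valid : ∀ p < n, (rulesAt σ 33 0).Valid p
  vec_length : ((rulesAt σ 33 0).word (n - 1)).length = N

/-- The memory after a call of the moved program. -/
structure Called (T : ℕ) (σ σ' : Mem) : Prop where
  lowReg : ∀ r < 100, r ≠ 98 → σ'.R r = σ.R r
  lowArr : ∀ a < 30, a ≠ 13 → σ'.A a = σ.A a
  count : σ'.R 98 ≤ T
  log : ∀ a, 30 ≤ a → ∀ i, σ'.A a i ≠ σ.A a i → ∃ j < σ'.R 98, σ'.A 13 j = i

theorem arr_eq_arrayOf {s : State w} {a n : ℕ} {f : Fin n → ℕ}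
    (h : ∀ p : Fin n, (p : ℕ) < 2 ^ w → (view s).A a p = f p) (h0 : ∀ p, n ≤ p → (view s).A a p = 0) :
    s.arr a = arrayOf f := by
  funext i
  have hi : (view s).A a i.toNat = (s.arr a i).toNat := by simp [view, i.isLt]
  apply BitVec.eq_of_toNat_eq
  rw [← hi, arrayOf]
  split_ifs with h'
  · rw [BitVec.toNat_ofNat, ← h ⟨_, h'⟩ i.isLt, Nat.mod_eq_of_lt (view_A_lt _ _ _)]
  · rw [h0 _ (by omega)]; rfl

/-- The vector that is generated by the rules. -/
def Rules.vec (R : Rules) (n N : ℕ) (j : Fin N) : Fin 2 := (R.word (n - 1))[(j : ℕ)]?.getD 0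

theorem Rules.generates_vec {R : Rules} {n N : ℕ} (hn : 0 < n) (h : (R.word (n - 1)).length = N) :
    (R.toSLP n).Generates (R.vec n N) := by
  refine ⟨hn, ?_⟩
  rw [Rules.expand_toSLP]
  refine List.ext_getElem (by simp [h]) fun i h1 h2 => ?_
  simp [Rules.vec, h1]

theorem Rules.vec_eq_one {R : Rules} {n N : ℕ} {j : Fin N} :
    R.vec n N j = 1 ↔ Rules.IsOne (R.word (n - 1)) j := by
  rw [Rules.vec, Rules.IsOne]
  cases (R.word (n - 1))[(j : ℕ)]? <;> simp

/-- Only whether an entry of the product vanishes is ever used, not its value. -/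
theorem binaryMulVec_ne_zero {N : ℕ} (M : Matrix (Fin N) (Fin N) (Fin 2)) (v : Fin N → Fin 2)
    (i : Fin N) : binaryMulVec M v i ≠ 0 ↔ ∃ j, M i j = 1 ∧ v j = 1 := by
  have h2 : ∀ x : Fin 2, (x : ℕ) ≠ 0 ↔ x = 1 := by decide
  simp only [binaryMulVec, Matrix.mulVec, dotProduct, Matrix.map_apply]
  rw [ne_eq, Finset.sum_eq_zero_iff]
  simp [← h2]

theorem Rules.exists_vec_iff {R S : Rules} {n N : ℕ} (hR : (R.word (n - 1)).length = N) :
    (∃ j, R.vec n N j = 1 ∧ S.vec n N j = 1) ↔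
      ∃ p, Rules.IsOne (R.word (n - 1)) p ∧ Rules.IsOne (S.word (n - 1)) p := by
  simp only [Rules.vec_eq_one]
  constructor
  · rintro ⟨j, h⟩; exact ⟨j, h⟩
  · rintro ⟨p, h1, h2⟩
    have : p < N := by
      rw [← hR]
      by_contra hp
      simp [Rules.IsOne, List.getElem?_eq_none (not_lt.1 hp)] at h1
    exact ⟨⟨p, this⟩, h1, h2⟩

namespace Input

variable {N n : ℕ} {σ : Mem}

/-- The part of the memory that the moved program sees. -/
def part (s : State w) : State w := ⟨fun r => s.reg (r + 100), fun a => s.arr (a + 30)⟩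

/-- The correctness of the program for matrices applies only to its exact input state, with zeros in
every other cell. This is the reason for the zero conditions in `Input` and for clearing the memory
after each call. -/
theorem part_eq {s : State w} (h : Input N n (view s)) :
    part s = matVecInput w (fun r : Fin N => (rulesAt (view s) 30 (r * n)).toSLP n)
      ((rulesAt (view s) 33 0).toSLP n) := by
  have hdm : ∀ p : Fin (N * n), (p.divNat : ℕ) * n + p.modNat = p := fun p => by
    simp only [Fin.coe_divNat, Fin.coe_modNat]; exact Nat.div_add_mod' _ _
  rw [part, matVecInput]
  congr 1
  · funext r
    match r with
    | 0 => exact BitVec.eq_of_toNat_eq (by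
        have := h.regN
        simp only [← this, BitVec.toNat_ofNat, Nat.mod_eq_of_lt (view_R_lt _ _)]; rfl)
    | 1 => exact BitVec.eq_of_toNat_eq (by
        have := h.regn
        simp only [← this, BitVec.toNat_ofNat, Nat.mod_eq_of_lt (view_R_lt _ _)]; rfl)
    | r + 2 => exact BitVec.eq_of_toNat_eq (h.reg_zero (r + 2 + 100) (by omega))
  · funext a
    match a with
    | 0 =>
      refine arr_eq_arrayOf (fun p _ => ?_) (h.row_zero 30 (by omega) (by omega))
      rw [Rules.toSLP_kind _ _ (h.row_valid _ p.divNat.2 _ p.modNat.2)]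
      simp [rulesAt, -Fin.coe_divNat, -Fin.coe_modNat, hdm]
    | 1 =>
      refine arr_eq_arrayOf (fun p _ => ?_) (h.row_zero 31 (by omega) (by omega))
      rw [Rules.toSLP_fst _ _ (h.row_valid _ p.divNat.2 _ p.modNat.2)]
      simp [rulesAt, -Fin.coe_divNat, -Fin.coe_modNat, hdm]
    | 2 =>
      refine arr_eq_arrayOf (fun p _ => ?_) (h.row_zero 32 (by omega) (by omega))
      rw [Rules.toSLP_snd _ _ (h.row_valid _ p.divNat.2 _ p.modNat.2)]
      simp [rulesAt, -Fin.coe_divNat, -Fin.coe_modNat, hdm]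
    | 3 =>
      refine arr_eq_arrayOf (fun p _ => ?_) (h.vec_zero 33 (by omega) (by omega))
      rw [Rules.toSLP_kind _ _ (h.vec_valid _ p.2)]
      simp [rulesAt]
    | 4 =>
      refine arr_eq_arrayOf (fun p _ => ?_) (h.vec_zero 34 (by omega) (by omega))
      rw [Rules.toSLP_fst _ _ (h.vec_valid _ p.2)]
      simp [rulesAt]
    | 5 =>
      refine arr_eq_arrayOf (fun p _ => ?_) (h.vec_zero 35 (by omega) (by omega))
      rw [Rules.toSLP_snd _ _ (h.vec_valid _ p.2)]
      simp [rulesAt]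
    | a + 6 =>
      funext i
      have := h.arr_zero (a + 6 + 30) (by omega) i.toNat
      apply BitVec.eq_of_toNat_eq
      simpa [view, i.isLt] using this

theorem sim {s : State w} (hc : (view s).R 98 = 0) : Sim s 0 (part s) s where
  reg _ := rfl
  arr _ := rfl
  lowReg _ _ _ := rfl
  lowArr _ _ _ := rfl
  count := hc.le
  log _ _ h := absurd rfl h

end Input

theorem Sim.called {t₀ s t : State w} {c : ℕ} (h : Sim t₀ c s t) : Called c (view t₀) (view t) where
  lowReg r hr hr' := by simp only [view, h.lowReg r hr hr']
  lowArr a ha ha' := by simp only [view, h.lowArr a ha ha']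
  count := h.count
  log a ha i hi := by
    simp only [view] at hi ⊢
    split_ifs at hi with hiw
    · obtain ⟨b, rfl⟩ := Nat.exists_eq_add_of_le' ha
      obtain ⟨j, h1, h2⟩ := h.log b (BitVec.ofNat w i) (fun h => hi (by rw [h]))
      refine ⟨j.toNat, h1, ?_⟩
      simp [j.isLt, h2, Nat.mod_eq_of_lt hiw]
    · exact absurd rfl hi

/-- `P` solves all instances of the given size. -/
def SolvesSize (P : Cmd) (w N n T : ℕ) : Prop :=
  ∀ (M : Matrix (Fin N) (Fin N) (Fin 2)) (v : Fin N → Fin 2)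
      (G : Fin N → SLP (Fin 2) n) (H : SLP (Fin 2) n),
      (∀ i, (G i).Generates (M i)) → H.Generates v →
      SolvesWithin P (matVecInput w G H) T fun s =>
        ∀ i : Fin N, (s.arr 0 (BitVec.ofNat w i)).toNat = binaryMulVec M v i

theorem Input.solves {P : Cmd} {N n T : ℕ} {s : State w} (h : Input N n (view s)) (hn : 0 < n)
    (hP : SolvesSize P w N n T) :
    SolvesWithin P (Input.part s) T fun s' => ∀ i : Fin N, (s'.arr 0 (BitVec.ofNat w i)).toNat =
      binaryMulVec (Matrix.of fun r : Fin N => (rulesAt (view s) 30 (r * n)).vec n N)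
        ((rulesAt (view s) 33 0).vec n N) i := by
  rw [h.part_eq]
  exact hP _ _ _ _ (fun i => Rules.generates_vec hn (h.row_length i i.2))
    (Rules.generates_vec hn h.vec_length)

theorem H.relocate {P : Cmd} {N n T : ℕ} {σ : Mem} (h : Input N n σ) (hn : 0 < n)
    (hP : SolvesSize P w N n T) (hT : T < 2 ^ w) (hc : σ.R 98 = 0) :
    H w (relocate P) σ (5 * T) (Called T σ) := by
  intro s hs
  subst hs
  refine ((h.solves hn hP).sure.relocate (Input.sim hc) (by omega)).mono le_rfl ?_
  rintro t ⟨s', -, hS⟩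
  simpa using hS.called

/-- The first `N` cells of the array `30` now hold the product, and a nonzero entry means a common
`1` of the row and the vector. -/
theorem Pr.relocate {P : Cmd} {N n T : ℕ} {σ : Mem} (h : Input N n σ) (hn : 0 < n)
    (hP : SolvesSize P w N n T) (hT : T < 2 ^ w) (hc : σ.R 98 = 0) :
    Pr w (relocate P) σ (5 * T) (fun σ' => ∀ r < N, σ'.A 30 r ≠ 0 ↔ Meets σ n r) (2 / 3) := by
  classical
  intro s hs
  subst hs
  have hN : N < 2 ^ w := by rw [← h.regN]; exact view_R_lt _ _
  refine (h.solves hn hP).le_expect.trans (expect_relocate ?_ (Input.sim hc) (by omega))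
  intro s' t c hS
  split_ifs with h1 h2 h2
  · exact le_rfl
  · refine absurd (fun r hr => ?_) h2
    have : (view t).A 30 r = (s'.arr 0 (BitVec.ofNat w r)).toNat := by
      simp [view, hr.trans hN, ← hS.arr]
    rw [this, h1 ⟨r, hr⟩, binaryMulVec_ne_zero]
    exact Rules.exists_vec_iff (h.row_length r hr)
  · exact zero_le
  · exact le_rfl

/-! ### Preparing the input of the moved program -/

/-- The interval of block number `x`. -/
def bounds (x lo hi : ℕ) : Cmd :=
  block [.set lo .mul (.reg x) (.reg 10), .set hi .add (.reg lo) (.reg 10),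
    .set 99 .lt (.reg 0) (.reg hi), .branch (.reg 99) (mov hi (.reg 0)) .skip]

/-- The intervals of the blocks `83`, `93`, `84` of `A`, `B`, `C`. -/
def locate : Cmd := block [bounds 83 32 33, bounds 93 34 35, bounds 84 36 37]

/-- The numbers modulo `q` that make up a row. -/
def fillRow : Cmd :=
  block [block [.set 60 .sub (.reg 33) (.reg 32), mov 85 (.const 0)],
    forTo 85 (.reg 60) (block [.set 86 .add (.reg 32) (.reg 85), .load 86 0 (.reg 86),
      .set 86 .mod (.reg 86) (.reg 4), .store 7 (.reg 85) (.reg 86)]),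
    block [mov 61 (.const 0), .set 87 .sub (.reg 37) (.reg 36), mov 85 (.const 0)],
    forTo 85 (.reg 87) (block [.set 86 .add (.reg 36) (.reg 85), .load 86 2 (.reg 86),
      .set 86 .mod (.reg 86) (.reg 4), .store 8 (.reg 61) (.reg 86),
      .set 61 .add (.reg 61) (.const 1), .set 86 .add (.reg 86) (.reg 4),
      .store 8 (.reg 61) (.reg 86), .set 61 .add (.reg 61) (.const 1)])]

/-- The numbers modulo `q` that make up the vector. -/
def fillVec : Cmd :=
  block [block [mov 60 (.reg 10), mov 85 (.const 0)],
    forTo 85 (.reg 60) (block [.store 7 (.reg 85) (.reg 4)]),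
    block [.set 61 .sub (.reg 35) (.reg 34), mov 85 (.const 0)],
    forTo 85 (.reg 61) (block [.set 86 .add (.reg 34) (.reg 85), .load 86 1 (.reg 86),
      .set 86 .mod (.reg 86) (.reg 4), .set 86 .add (.reg 86) (.reg 4),
      .store 8 (.reg 85) (.reg 86)])]

/-- Copy the rules to the arrays `a`, `a + 1`, `a + 2`, at the position in register `87`. -/
def copyRules (a : ℕ) : Cmd :=
  block [mov 85 (.const 0),
    forTo 85 (.reg 8) (block [.set 88 .add (.reg 87) (.reg 85),
      .load 86 10 (.reg 85), .store a (.reg 88) (.reg 86),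
      .load 86 11 (.reg 85), .store (a + 1) (.reg 88) (.reg 86),
      .load 86 12 (.reg 85), .store (a + 2) (.reg 88) (.reg 86)])]

theorem locate_spec (hw : 2 ≤ w) {σ : Mem} {m b i j k : ℕ} (h0 : σ.R 0 = m) (h10 : σ.R 10 = b)
    (h93 : σ.R 93 = j) (h83 : σ.R 83 = i) (h84 : σ.R 84 = k) (hi : i * b + b < 2 ^ w)
    (hj : j * b + b < 2 ^ w) (hk : k * b + b < 2 ^ w) :
    H w locate σ 50 (fun σ' => (σ'.R 32 = i * b ∧ σ'.R 33 = min (i * b + b) m ∧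
      σ'.R 34 = j * b ∧ σ'.R 35 = min (j * b + b) m ∧
      σ'.R 36 = k * b ∧ σ'.R 37 = min (k * b + b) m) ∧ Frame locate σ σ') := by
  have hw0 : w ≠ 0 := by omega
  have step : ∀ {σ : Mem} {x lo hi i : ℕ} {Φ : Mem → Prop}, σ.R 0 = m → σ.R 10 = b → σ.R x = i →
      i * b + b < 2 ^ w → lo ≠ 0 → lo ≠ 10 → hi ≠ 0 → lo ≠ 99 → hi ≠ 99 → lo ≠ hi →
      (∀ σ', σ'.A = σ.A → (∀ r, r ≠ 99 → r ≠ lo → r ≠ hi → σ'.R r = σ.R r) →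
        σ'.R lo = i * b → σ'.R hi = min (i * b + b) m → Φ σ') → wp w (bounds x lo hi) Φ σ := by
    intro σ x lo hi i Φ h0 h10 hx hib n1 n2 n3 n4 n5 n6 hΦ
    simp [bounds, wp_block_cons, wp_block_nil, wp, wp_mov, Op.nat, Op.Fits, h0, h10, hx,
      n1.symm, n2.symm, n3.symm]
    refine ⟨by omega, hib, fun h => hΦ _ ?_ ?_ ?_ ?_, fun h => hΦ _ ?_ ?_ ?_ ?_⟩ <;>
      simp +contextual [n4, n5, n6] <;> omega
  refine H.frame (H.of_wp' (by omega) (by decide) ?_)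
  simp only [locate, wp_block_cons]
  refine step h0 h10 h83 hi (by decide) (by decide) (by decide) (by decide) (by decide)
    (by decide) fun σ₁ a1 a2 a3 a4 => ?_
  refine step ((a2 0 (by decide) (by decide) (by decide)).trans h0)
    ((a2 10 (by decide) (by decide) (by decide)).trans h10)
    ((a2 93 (by decide) (by decide) (by decide)).trans h93) hj (by decide) (by decide) (by decide)
    (by decide) (by decide) (by decide) fun σ₂ b1 b2 b3 b4 => ?_
  refine step ((b2 0 (by decide) (by decide) (by decide)).trans
      ((a2 0 (by decide) (by decide) (by decide)).trans h0))
    ((b2 10 (by decide) (by decide) (by decide)).trans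
      ((a2 10 (by decide) (by decide) (by decide)).trans h10))
    ((b2 84 (by decide) (by decide) (by decide)).trans
      ((a2 84 (by decide) (by decide) (by decide)).trans h84)) hk (by decide) (by decide)
    (by decide) (by decide) (by decide) (by decide) fun σ₃ c1 c2 c3 c4 => ?_
  refine ⟨?_, ?_, ?_, ?_, c3, c4⟩
  · rw [c2, b2, a3] <;> decide
  · rw [c2, b2, a4] <;> decide
  · rw [c2, b3] <;> decide
  · rw [c2, b4] <;> decide

/-- Each residue of `C` is entered twice, as `c` and as `c + q`, because for residues `a`, `b`, `c`
the congruence `a + b ≡ c` means `a + b = c` or `a + b = c + q`. -/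
theorem fillRow_spec (hw : 2 ≤ w) {σ : Mem} {xl xh zl zh q : ℕ} (h32 : σ.R 32 = xl)
    (h33 : σ.R 33 = xh) (h36 : σ.R 36 = zl) (h37 : σ.R 37 = zh) (h4 : σ.R 4 = q) (hq : 0 < q)
    (hx : xl ≤ xh) (hz : zl ≤ zh) (hxw : xh < 2 ^ w) (hzw : 2 * zh + 2 < 2 ^ w)
    (hqw : 2 * q < 2 ^ w) :
    H w fillRow σ ((xh - xl) * 20 + (zh - zl) * 30 + 40) (fun σ' => (σ'.R 60 = xh - xl ∧
      σ'.R 61 = 2 * (zh - zl) ∧ (∀ i < xh - xl, σ'.A 7 i = σ.A 0 (xl + i) % q) ∧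
      ∀ z < zh - zl, σ'.A 8 (2 * z) = σ.A 2 (zl + z) % q ∧
        σ'.A 8 (2 * z + 1) = σ.A 2 (zl + z) % q + q) ∧ Frame fillRow σ σ') := by
  have hw0 : w ≠ 0 := by omega
  refine H.frame (H.start (T₂ := (xh - xl) * 20 + (zh - zl) * 30 + 30) (by omega) ?_
    (by simp [cost, block, mov]; omega))
  simp [wp_block_cons, wp_block_nil, wp, wp_mov, Op.nat, Op.Fits, h32, h33]
  refine ⟨hx, H.bind (H.forTo_const (by omega) (lo := 0) (hi := xh - xl) (t := 15)
    (Inv := fun k σ' => ∀ i < k, σ'.A 7 i = σ.A 0 (xl + i) % q)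
    (Operand.fits_reg _) (by decide) (by decide) ?_ ?_ (Nat.zero_le _) ?_ ?_ ?_) ?_
    (T₂ := (zh - zl) * 30 + 20) (by omega)⟩
  · simp
  · simp
  · simp
  · intro k σ' v v' h
    simpa using h
  · rintro k σ₁ - hk i1 h85 hF
    have e32 := hF.1 32 (by decide)
    have e4 := hF.1 4 (by decide)
    have e0 := hF.2 0 (by decide)
    simp [h32] at e32
    simp [h4] at e4
    simp at e0
    refine H.of_wp' (by omega) (by decide) ?_
    simp [wp_block_cons, wp_block_nil, wp, Op.nat, Op.Fits, e32, e4, e0, h85]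
    refine ⟨by omega, fun i hi => ?_⟩
    rw [Function.update_apply]
    split_ifs with h
    · rw [h]
    · exact i1 i (by omega)
  · rintro σ₁ ⟨i1, -, hF⟩
    have e36 := hF.1 36 (by decide)
    have e37 := hF.1 37 (by decide)
    have e60 := hF.1 60 (by decide)
    have e4 := hF.1 4 (by decide)
    have e2 := hF.2 2 (by decide)
    simp [h36] at e36
    simp [h37] at e37
    simp at e60
    simp [h4] at e4
    simp at e2
    refine H.start (T₂ := (zh - zl) * 30 + 8) (by omega) ?_ (by simp [cost, block, mov]; omega)
    simp [wp_block_cons, wp_block_nil, wp, wp_mov, Op.nat, Op.Fits, e36, e37]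
    refine ⟨hz, H.last (H.mono (H.forTo_const (by omega) (lo := 0) (hi := zh - zl) (t := 25)
      (Inv := fun k σ' => σ'.R 61 = 2 * k ∧
        ∀ z < k, σ'.A 8 (2 * z) = σ.A 2 (zl + z) % q ∧ σ'.A 8 (2 * z + 1) = σ.A 2 (zl + z) % q + q)
      (Operand.fits_reg _) (by decide) (by decide) ?_ ?_ (Nat.zero_le _) ?_ ?_ ?_) le_rfl ?_)
      (by omega)⟩
    · simp
    · simp
    · simp
    · intro k σ' v v' h
      simpa using h
    · rintro k σ₂ - hk ⟨j1, j2⟩ h85 hF'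
      have f36 := hF'.1 36 (by decide)
      have f4 := hF'.1 4 (by decide)
      have f2 := hF'.2 2 (by decide)
      simp [e36] at f36
      simp [e4] at f4
      simp [e2] at f2
      have hmod := Nat.mod_lt (σ.A 2 (zl + k)) hq
      refine H.of_wp' (by omega) (by decide) ?_
      simp [hw0, wp_block_cons, wp_block_nil, wp, Op.nat, Op.Fits, f36, f4, f2, h85, j1]
      refine ⟨by omega, by omega, by omega, by omega, by omega, fun z hz => ?_⟩
      by_cases hzk : z = k
      · subst hzk
        rw [Function.update_of_ne (by omega), Function.update_self, Function.update_self]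
        exact ⟨rfl, rfl⟩
      · rw [Function.update_of_ne (by omega), Function.update_of_ne (by omega),
          Function.update_of_ne (by omega), Function.update_of_ne (by omega)]
        exact j2 z (by omega)
    · rintro σ₂ ⟨⟨j1, j2⟩, -, hF'⟩
      have f60 := hF'.1 60 (by decide)
      have f7 := hF'.2 7 (by decide)
      simp [e60] at f60
      simp at f7
      exact ⟨f60, j1, by rw [f7]; exact i1, j2⟩

/-- The entry `q` in the array `7` means that no zeros precede the tree in a slot. The vector has
`b` slots even if a block of `A` is shorter; the extra slots meet only zeros of the row. -/
theorem fillVec_spec (hw : 2 ≤ w) {σ : Mem} {yl yh b q : ℕ} (h34 : σ.R 34 = yl)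
    (h35 : σ.R 35 = yh) (h10 : σ.R 10 = b) (h4 : σ.R 4 = q) (hq : 0 < q)
    (hy : yl ≤ yh) (hyw : yh < 2 ^ w) (hqw : 2 * q < 2 ^ w) :
    H w fillVec σ (b * 20 + (yh - yl) * 30 + 40) (fun σ' => (σ'.R 60 = b ∧
      σ'.R 61 = yh - yl ∧ (∀ i < b, σ'.A 7 i = q) ∧
      ∀ y < yh - yl, σ'.A 8 y = σ.A 1 (yl + y) % q + q) ∧ Frame fillVec σ σ') := by
  have hw0 : w ≠ 0 := by omega
  refine H.frame (H.start (T₂ := b * 20 + (yh - yl) * 30 + 30) (by omega) ?_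
    (by simp [cost, block, mov]; omega))
  simp [wp_block_cons, wp_block_nil, wp_mov, h10]
  refine H.bind (H.forTo_const (by omega) (lo := 0) (hi := b) (t := 15)
    (Inv := fun k σ' => ∀ i < k, σ'.A 7 i = q)
    (Operand.fits_reg _) (by decide) (by decide) ?_ ?_ (Nat.zero_le _) ?_ ?_ ?_) ?_
    (T₂ := (yh - yl) * 30 + 20) (by omega)
  · simp
  · simp
  · simp
  · intro k σ' v v' h
    simpa using h
  · rintro k σ₁ - hk i1 h85 hF
    have e4 := hF.1 4 (by decide)
    simp [h4] at e4
    refine H.of_wp' (by omega) (by decide) ?_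
    simp [wp_block_cons, wp_block_nil, wp, e4, h85]
    intro i hi
    rw [Function.update_apply]
    split_ifs with h
    · rfl
    · exact i1 i (by omega)
  · rintro σ₁ ⟨i1, -, hF⟩
    have e34 := hF.1 34 (by decide)
    have e35 := hF.1 35 (by decide)
    have e60 := hF.1 60 (by decide)
    have e4 := hF.1 4 (by decide)
    have e1 := hF.2 1 (by decide)
    simp [h34] at e34
    simp [h35] at e35
    simp at e60
    simp [h4] at e4
    simp at e1
    refine H.start (T₂ := (yh - yl) * 30 + 8) (by omega) ?_ (by simp [cost, block, mov]; omega)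
    simp [wp_block_cons, wp_block_nil, wp, wp_mov, Op.nat, Op.Fits, e34, e35]
    refine ⟨hy, H.last (H.mono (H.forTo_const (by omega) (lo := 0) (hi := yh - yl) (t := 25)
      (Inv := fun k σ' => ∀ y < k, σ'.A 8 y = σ.A 1 (yl + y) % q + q)
      (Operand.fits_reg _) (by decide) (by decide) ?_ ?_ (Nat.zero_le _) ?_ ?_ ?_) le_rfl ?_)
      (by omega)⟩
    · simp
    · simp
    · simp
    · intro k σ' v v' h
      simpa using h
    · rintro k σ₂ - hk j2 h85 hF'
      have f34 := hF'.1 34 (by decide)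
      have f4 := hF'.1 4 (by decide)
      have f1 := hF'.2 1 (by decide)
      simp [e34] at f34
      simp [e4] at f4
      simp [e1] at f1
      have hmod := Nat.mod_lt (σ.A 1 (yl + k)) hq
      refine H.of_wp' (by omega) (by decide) ?_
      simp [wp_block_cons, wp_block_nil, wp, Op.nat, Op.Fits, f34, f4, f1, h85]
      refine ⟨by omega, by omega, fun y hy => ?_⟩
      rw [Function.update_apply]
      split_ifs with h
      · rw [h]
      · exact j2 y (by omega)
    · rintro σ₂ ⟨j2, -, hF'⟩
      have f60 := hF'.1 60 (by decide)
      have f61 := hF'.1 61 (by decide)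
      have f7 := hF'.2 7 (by decide)
      simp [e60] at f60
      simp at f7 f61
      exact ⟨f60, f61, by rw [f7]; exact i1, j2⟩

theorem copyRules_spec (hw : 2 ≤ w) {σ : Mem} {a n p : ℕ} (ha : 13 ≤ a) (h8 : σ.R 8 = n)
    (h87 : σ.R 87 = p) (hp : p + n < 2 ^ w) :
    H w (copyRules a) σ (n * 30 + 20) (fun σ' => ((rules σ).Agree n (rulesAt σ' a p) ∧
      ∀ a' x, x < p ∨ p + n ≤ x → σ'.A a' x = σ.A a' x) ∧ Frame (copyRules a) σ σ') := by
  have hw0 : w ≠ 0 := by omega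
  refine H.frame (H.start (T₂ := n * 30 + 10) (by omega) ?_ (by simp [cost, mov]; omega))
  simp [wp_mov]
  refine H.last (H.mono (H.forTo_const (by omega) (lo := 0) (hi := n) (t := 25)
    (Inv := fun k σ' => (rules σ).Agree k (rulesAt σ' a p) ∧
      (∀ a' x, x < p ∨ p + n ≤ x → σ'.A a' x = σ.A a' x))
    (Operand.fits_reg _) (by simp [block, modR]) (by simp [block, modR, Operand.regs]) ?_ ?_ (Nat.zero_le _) ?_ ?_ ?_) le_rfl ?_) (by omega)
  · simp
  · simp [h8]
  · exact ⟨fun i hi => absurd hi (by omega), fun _ _ _ => rfl⟩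
  · intro k σ' v v' h
    exact h
  · rintro k σ₁ - hk ⟨i1, i2⟩ h85 hF
    have hA : ∀ c, c ≠ a → c ≠ a + 1 → c ≠ a + 2 → σ₁.A c = σ.A c := fun c h1 h2 h3 => by
      have := hF.2 c (by simp [forTo, block, modA, h1, h2, h3])
      simpa using this
    have e87 := hF.1 87 (by simp [forTo, block, modR])
    simp [h87] at e87
    refine H.of_wp' (by omega) (by simp [block, cost]) ?_
    have n1 : ¬ (11 = a) := by omega
    have n2 : ¬ (12 = a) := by omega
    have n3 : ¬ (12 = a + 1) := by omega
    simp [wp_block_cons, wp_block_nil, wp, Op.nat, Op.Fits, h85, e87, n1, n2, n3,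
      hA 10 (by omega) (by omega) (by omega), hA 11 (by omega) (by omega) (by omega),
      hA 12 (by omega) (by omega) (by omega)]
    refine ⟨by omega, fun i hi => ?_, fun a' x hx => ?_⟩
    · simp [rulesAt, rules]
      by_cases h : i = k
      · subst h; simp
      · have := i1 i (by omega)
        simpa [h, Function.update_apply, rulesAt, rules] using this
    · split_ifs with h1 h2 h3
      all_goals
        first
        | rw [Function.update_of_ne (by omega)]
        | skip
        try subst h1
        try subst h2
        try subst h3
        exact i2 _ x hx
  · rintro σ₁ ⟨i1, -⟩
    exact i1

/-- Write the straight-line program of the vector of batch number `5`. -/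
def writeVec : Cmd :=
  block [block [.load 93 6 (.reg 5), mov 83 (.const 0), mov 84 (.const 0)], locate, fillVec,
    writeSLP, mov 87 (.const 0), copyRules 33]

/-- Write the straight-line program of row number `15` of the matrix of batch number `5`. -/
def writeRow : Cmd :=
  block [block [.set 89 .mul (.reg 5) (.reg 7), .set 89 .add (.reg 89) (.reg 15),
      .load 83 4 (.reg 89), .load 84 5 (.reg 89)], locate, fillRow, writeSLP,
    .set 87 .mul (.reg 15) (.reg 8), copyRules 30]

/-- Write the input of the moved program. -/
def prepare : Cmd :=
  block [writeVec, mov 15 (.const 0), forTo 15 (.reg 7) writeRow,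
    block [mov 98 (.const 0), mov 100 (.reg 7), mov 101 (.reg 8)]]

/-- The parameters of the reduction: the size `m` of the sets, the dimension `N` and the size `n` of
the programs, the number `g` and the size `b` of the blocks, the number `M` of batches, the bound `Q`
for the modulus, which has `h - 2` bits, the number `thr` of rows that are examined, the number `H` of
bits of `N`, and the bound `U` for the numbers. -/
structure Params where
  (m N n h g b M Q thr H U : ℕ)

namespace Params

/-- The beginning of a block. -/
def lo (S : Params) (i : ℕ) : ℕ := i * S.b

/-- The end of a block. -/
def hi (S : Params) (i : ℕ) : ℕ := min (i * S.b + S.b) S.m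

/-- In `length_le` the factor `6 Q` bounds the length `2 ^ h + q` of a slot, since `2 ^ h = 4 Q` and
`q < 2 Q`. In `size_le` the tree has `2 b` numbers of `h` bits, as needed for the rows, and there
are `b` slots. The bounds by `2 ^ w` prevent overflow of addresses and sums. -/
structure Good (w : ℕ) (S : Params) : Prop where
  two_le : 2 ≤ w
  block_lt : ∀ i < S.g, i * S.b < S.m
  g_pos : 0 < S.g
  m_lt : 2 * S.m + S.b + 2 < 2 ^ w
  U_lt : 2 * S.U < 2 ^ w
  Q_pos : 0 < S.Q
  pow_h : 2 ^ S.h = 4 * S.Q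
  h_lt : S.h < S.H
  Q_lt : 2 * S.Q ≤ 2 ^ S.H
  N_lt : S.N < 2 ^ S.H
  H_lt : 2 ^ S.H < 2 ^ w
  length_le : 2 + S.b * (6 * S.Q) ≤ S.N
  size_le : S.H + 1 + 2 * S.b * S.h + S.b * (2 * S.H + 1) + S.H + 1 ≤ S.n
  MN_lt : S.M * S.N + S.N < 2 ^ w
  Nn_lt : S.N * S.n + S.n < 2 ^ w
  thr_lt : S.thr < 2 ^ w

end Params

/-- The registers and arrays contain the parameters, the sorted sets and the lists of blocks. -/
structure Setup (S : Params) (σ : Mem) : Prop where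
  R0 : σ.R 0 = S.m
  R6 : σ.R 6 = S.h
  R7 : σ.R 7 = S.N
  R8 : σ.R 8 = S.n
  R9 : σ.R 9 = S.g
  R10 : σ.R 10 = S.b
  R11 : σ.R 11 = S.M
  R12 : σ.R 12 = S.Q
  R13 : σ.R 13 = S.thr
  R17 : σ.R 17 = S.H
  inRange : InRange S.g σ
  A_le : ∀ x, σ.A 0 x ≤ S.U
  B_le : ∀ x, σ.A 1 x ≤ S.U
  B_mono : ∀ x y, x ≤ y → y < S.m → σ.A 1 x ≤ σ.A 1 y
  C_mono : ∀ x y, x ≤ y → y < S.m → σ.A 2 x ≤ σ.A 2 y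

/-- The cells that are not changed while a batch is processed. -/
def Same (σ σ' : Mem) : Prop :=
  (∀ r ∈ [0, 4, 5, 6, 7, 8, 9, 10, 11, 12, 13, 17], σ'.R r = σ.R r) ∧
    ∀ a ∈ [0, 1, 2, 4, 5, 6], σ'.A a = σ.A a

theorem Same.refl (σ : Mem) : Same σ σ := ⟨fun _ _ => rfl, fun _ _ => rfl⟩

theorem Same.trans {σ σ' σ'' : Mem} (h : Same σ σ') (h' : Same σ' σ'') : Same σ σ'' :=
  ⟨fun r hr => (h'.1 r hr).trans (h.1 r hr), fun a ha => (h'.2 a ha).trans (h.2 a ha)⟩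

theorem Same.frame {p : Cmd} {σ σ' : Mem} (h : Frame p σ σ')
    (hR : ∀ r ∈ [0, 4, 5, 6, 7, 8, 9, 10, 11, 12, 13, 17], r ∉ modR p)
    (hA : ∀ a ∈ [0, 1, 2, 4, 5, 6], a ∉ modA p) : Same σ σ' :=
  ⟨fun r hr => h.1 r (hR r hr), fun a ha => h.2 a (hA a ha)⟩

theorem Setup.same {S : Params} {σ σ' : Mem} (h : Setup S σ) (hs : Same σ σ') : Setup S σ' := by
  have hR := hs.1
  have hA := hs.2
  simp only [List.mem_cons, List.not_mem_nil, or_false, forall_eq_or_imp, forall_eq] at hR hA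
  obtain ⟨r0, r4, r5, r6, r7, r8, r9, r10, r11, r12, r13, r17⟩ := hR
  obtain ⟨a0, a1, a2, a4, a5, a6⟩ := hA
  refine ⟨r0.trans h.R0, r6.trans h.R6, r7.trans h.R7, r8.trans h.R8, r9.trans h.R9,
    r10.trans h.R10, r11.trans h.R11, r12.trans h.R12, r13.trans h.R13, r17.trans h.R17, ?_, ?_, ?_,
    ?_, ?_⟩
  · intro p; rw [a4, a5, a6]; exact h.inRange p
  · rw [a0]; exact h.A_le
  · rw [a1]; exact h.B_le
  · rw [a1]; exact h.B_mono
  · rw [a2]; exact h.C_mono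

/-- The part of the memory that the moved program uses is empty outside the input. -/
structure Clean (N n : ℕ) (σ : Mem) : Prop where
  reg_zero : ∀ r, 102 ≤ r → σ.R r = 0
  row_zero : ∀ a, 30 ≤ a → a < 33 → ∀ p, N * n ≤ p → σ.A a p = 0
  vec_zero : ∀ a, 33 ≤ a → a < 36 → ∀ p, n ≤ p → σ.A a p = 0
  arr_zero : ∀ a, 36 ≤ a → ∀ p, σ.A a p = 0

theorem Clean.congr {N n : ℕ} {σ σ' : Mem} (h : Clean N n σ) (hR : ∀ r, 102 ≤ r → σ'.R r = σ.R r)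
    (hA : ∀ a, 30 ≤ a → σ'.A a = σ.A a) : Clean N n σ' where
  reg_zero r hr := by rw [hR r hr, h.reg_zero r hr]
  row_zero a h1 h2 := by rw [hA a h1]; exact h.row_zero a h1 h2
  vec_zero a h1 h2 := by rw [hA a (by omega)]; exact h.vec_zero a h1 h2
  arr_zero a h1 := by rw [hA a (by omega)]; exact h.arr_zero a h1

/-- The position `p` of the row for the blocks `i` of `A` and `k` of `C` contains a `1`. -/
def RowOne (S : Params) (σ : Mem) (q i k p : ℕ) : Prop :=
  ∃ x < S.hi i - S.lo i, ∃ z < S.hi k - S.lo k, ∃ e < 2,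
    p = 1 + x * (2 ^ S.h + q) + (q - σ.A 0 (S.lo i + x) % q) + (σ.A 2 (S.lo k + z) % q + e * q)

/-- The position `p` of the vector for the block `j` of `B` contains a `1`. -/
def VecOne (S : Params) (σ : Mem) (q j p : ℕ) : Prop :=
  ∃ x < S.b, ∃ y < S.hi j - S.lo j, p = 1 + x * (2 ^ S.h + q) + (σ.A 1 (S.lo j + y) % q + q)

/-- There is a solution modulo `q` in the blocks `i`, `j`, `k`. -/
def Congruent (S : Params) (σ : Mem) (q i j k : ℕ) : Prop :=
  ∃ x y z, S.lo i ≤ x ∧ x < S.hi i ∧ S.lo j ≤ y ∧ y < S.hi j ∧ S.lo k ≤ z ∧ z < S.hi k ∧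
    (σ.A 0 x + σ.A 1 y) % q = σ.A 2 z % q

theorem add_mod_eq_iff {a b c q : ℕ} (ha : a < q) (hb : b < q) (hc : c < q) :
    (a + b) % q = c ↔ c = a + b ∨ c + q = a + b := by
  rcases lt_or_ge (a + b) q with h | h
  · rw [Nat.mod_eq_of_lt h]; omega
  · rw [Nat.mod_eq_sub_mod h, Nat.mod_eq_of_lt (by omega)]; omega

/-- Equal positions lie in the same slot, because the offsets are less than the slot length. Within
a slot the equation is `(q - a) + c + e q = b + q` for the residues, that is `c + e q = a + b`, and
`e ∈ {0, 1}` covers all cases of the congruence. -/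
theorem meets_iff_congruent {S : Params} (hS : S.Good w) {σ : Mem} {q i j k : ℕ} (hq : S.Q ≤ q)
    (hq2 : q < 2 * S.Q) :
    (∃ p, RowOne S σ q i k p ∧ VecOne S σ q j p) ↔ Congruent S σ q i j k := by
  have hQ := hS.Q_pos
  have hh := hS.pow_h
  have hq0 : 0 < q := by omega
  constructor
  · rintro ⟨p, ⟨x, hx, z, hz, e, he, rfl⟩, x', hx', y, hy, h⟩
    refine ⟨S.lo i + x, S.lo j + y, S.lo k + z, by omega, by omega, by omega, by omega, by omega,
      by omega, ?_⟩
    have h1 := Nat.mod_lt (σ.A 0 (S.lo i + x)) hq0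
    have h2 := Nat.mod_lt (σ.A 1 (S.lo j + y)) hq0
    have h3 := Nat.mod_lt (σ.A 2 (S.lo k + z)) hq0
    rw [Nat.add_mod, add_mod_eq_iff h1 h2 h3]
    set a := σ.A 0 (S.lo i + x) % q
    set b := σ.A 1 (S.lo j + y) % q
    set c := σ.A 2 (S.lo k + z) % q
    have heq : e * q ≤ q := by
      have : e ≤ 1 := by omega
      nlinarith
    -- Uniqueness of division by the slot length; `2 q ≤ 2 ^ h` keeps the offsets small enough.
    have hxx : x = x' := by
      have key : ∀ x x' d d' : ℕ, d < 2 ^ S.h + q → x * (2 ^ S.h + q) + d = x' * (2 ^ S.h + q) + d' →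
          x' ≤ x := by
        intro x x' d d' hd h
        by_contra hc
        have : (x + 1) * (2 ^ S.h + q) ≤ x' * (2 ^ S.h + q) := Nat.mul_le_mul_right _ (by omega)
        rw [add_mul] at this
        omega
      exact le_antisymm (key x' x (b + q) ((q - a) + (c + e * q)) (by omega) (by omega))
        (key x x' ((q - a) + (c + e * q)) (b + q) (by omega) (by omega))
    subst hxx
    obtain rfl | rfl : e = 0 ∨ e = 1 := by omega
    · left; omega
    · right; omega
  · rintro ⟨x, y, z, hx, hx', hy, hy', hz, hz', h⟩
    have h1 := Nat.mod_lt (σ.A 0 x) hq0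
    have h2 := Nat.mod_lt (σ.A 1 y) hq0
    have h3 := Nat.mod_lt (σ.A 2 z) hq0
    rw [Nat.add_mod, add_mod_eq_iff h1 h2 h3] at h
    have hxb : x - S.lo i < S.b := by
      have h5 : S.hi i ≤ S.lo i + S.b := min_le_left _ _
      omega
    have ex : S.lo i + (x - S.lo i) = x := by omega
    have ey : S.lo j + (y - S.lo j) = y := by omega
    have ez : S.lo k + (z - S.lo k) = z := by omega
    refine ⟨_, ?_, x - S.lo i, hxb, y - S.lo j, by omega, rfl⟩
    rcases h with h | h
    · refine ⟨x - S.lo i, by omega, z - S.lo k, by omega, 0, by omega, ?_⟩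
      rw [ex, ey, ez]; omega
    · refine ⟨x - S.lo i, by omega, z - S.lo k, by omega, 1, by omega, ?_⟩
      rw [ex, ey, ez]; omega

namespace Params.Good

variable {S : Params}

theorem lo_le_hi (hS : S.Good w) {i : ℕ} (hi : i < S.g) : S.lo i ≤ S.hi i := by
  have := hS.block_lt i hi
  exact le_min (Nat.le_add_right _ _) this.le

theorem hi_le (_ : S.Good w) (i : ℕ) : S.hi i ≤ S.m := min_le_right _ _

theorem hi_sub_lo_le (_ : S.Good w) (i : ℕ) : S.hi i - S.lo i ≤ S.b := by
  simp only [lo, hi]; omega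

theorem length_le' (hS : S.Good w) {q x : ℕ} (hq : q < 2 * S.Q) (hx : x ≤ S.b) :
    2 + x * (2 ^ S.h + q) ≤ S.N := by
  have h1 := hS.length_le
  have h2 : x * (2 ^ S.h + q) ≤ S.b * (6 * S.Q) :=
    Nat.mul_le_mul hx (by rw [hS.pow_h]; omega)
  omega

theorem size_le' (hS : S.Good w) {x e : ℕ} (hx : x ≤ S.b) (he : e ≤ 2 * S.b) :
    S.H + 1 + e * S.h + x * (2 * S.H + 1) + S.H + 1 ≤ S.n := by
  have h1 := hS.size_le
  have h2 : x * (2 * S.H + 1) ≤ S.b * (2 * S.H + 1) := Nat.mul_le_mul_right _ hx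
  have h3 : e * S.h ≤ 2 * S.b * S.h := Nat.mul_le_mul_right _ he
  omega

theorem h_pos (hS : S.Good w) : 0 < S.h := by
  have h1 := hS.pow_h
  have h2 := hS.Q_pos
  rcases Nat.eq_zero_or_pos S.h with h | h
  · rw [h] at h1; omega
  · exact h

/-- Writing a program takes constant time per rule, up to lower terms, and `size_le` bounds the
number of rules by `n`. -/
theorem time_le (hS : S.Good w) {x e : ℕ} (hx : x ≤ S.b) (he : e ≤ 2 * S.b) :
    S.H * 80 + e * (S.h * 60 + 35) + x * (S.H * 60 + 65) + S.n * 20 + 150 + S.b * 50 + 150 ≤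
      S.n * 500 := by
  have h1 := hS.size_le
  have h2 : x * (S.H * 60 + 65) ≤ S.b * (S.H * 60 + 65) := Nat.mul_le_mul_right _ hx
  have h3 : e * (S.h * 60 + 35) ≤ 2 * S.b * (S.h * 60 + 35) := Nat.mul_le_mul_right _ he
  have e1 : S.b * (S.H * 60 + 65) = 60 * (S.b * S.H) + 65 * S.b := by ring
  have e2 : 2 * S.b * (S.h * 60 + 35) = 120 * (S.b * S.h) + 70 * S.b := by ring
  have e3 : 2 * S.b * S.h = 2 * (S.b * S.h) := by ring
  have e4 : S.b * (2 * S.H + 1) = 2 * (S.b * S.H) + S.b := by ring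
  omega

end Params.Good

theorem rulesAt_of_agree {σ σ' : Mem} {a n p N : ℕ} (hn : 0 < n)
    (h : (rules σ).Agree n (rulesAt σ' a p)) (hv : ∀ i < n, (rules σ).Valid i)
    (hl : ((rules σ).word (n - 1)).length = N) :
    (∀ i < n, (rulesAt σ' a p).Valid i) ∧ ((rulesAt σ' a p).word (n - 1)).length = N ∧
    (rulesAt σ' a p).word (n - 1) = (rules σ).word (n - 1) := by
  have e := h.word (show n - 1 < n by omega)
  exact ⟨fun i hi => h.valid hi (hv i hi), by rw [e, hl], e⟩

theorem writeVec_spec {S : Params} (hS : S.Good w) {σ : Mem} (hσ : Setup S σ) {q : ℕ}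
    (h4 : σ.R 4 = q) (hq : S.Q ≤ q) (hq2 : q < 2 * S.Q) (hc : Clean S.N S.n σ) :
    H w writeVec σ (S.n * 600) (fun σ' =>
      (σ'.R 93 = σ.A 6 (σ.R 5) ∧ Clean S.N S.n σ' ∧ (∀ p < S.n, (rulesAt σ' 33 0).Valid p) ∧
      ((rulesAt σ' 33 0).word (S.n - 1)).length = S.N ∧
      ∀ p, Rules.IsOne ((rulesAt σ' 33 0).word (S.n - 1)) p ↔ VecOne S σ q (σ.A 6 (σ.R 5)) p) ∧
      Frame writeVec σ σ') := by
  have hw := hS.two_le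
  have hw0 : w ≠ 0 := by omega
  have hp4 : 4 ≤ 2 ^ w := le_trans (by norm_num) (Nat.pow_le_pow_right two_pos hw)
  set j := σ.A 6 (σ.R 5) with hj
  have hjg : j < S.g := (hσ.inRange _).2.2
  have hQ := hS.Q_pos
  have hh := hS.pow_h
  have hm := hS.m_lt
  have hQH := hS.Q_lt
  have hHw := hS.H_lt
  have hhH := hS.h_lt
  have hhp := hS.h_pos
  have h2h : 2 ^ S.h ≤ 2 ^ (S.H - 1) := Nat.pow_le_pow_right two_pos (by omega)
  have h2H : 2 ^ S.H = 2 * 2 ^ (S.H - 1) := by rw [← pow_succ']; congr 1; omega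
  have hloj := hS.lo_le_hi hjg
  have hhij := hS.hi_le j
  have hbj := hS.hi_sub_lo_le j
  have hNH := hS.N_lt
  have hNn := hS.Nn_lt
  have hn1 := hS.size_le
  have ht := hS.time_le le_rfl (show S.hi j - S.lo j ≤ 2 * S.b by omega)
  have hlt := hS.block_lt j hjg
  refine H.frame (H.start (T₂ := S.n * 600 - 20) (by omega) ?_
    (by simp [cost, block, mov]; omega))
  simp [wp_block_cons, wp_block_nil, wp, wp_mov, ← hj]
  refine H.bind (locate_spec hw (m := S.m) (b := S.b) (i := 0) (j := j) (k := 0) (by simp [hσ.R0])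
    (by simp [hσ.R10]) (by simp) (by simp) (by simp) (by omega) (by omega) (by omega)) ?_
    (T₂ := S.n * 600 - 80) (by omega)
  rintro σ₁ ⟨⟨-, -, a34, a35, -, -⟩, hF₁⟩
  have fR : ∀ r, r < 32 → σ₁.R r = σ.R r := fun r hr => by
    have := hF₁.1 r (by simp [locate, bounds, block, modR, mov]; omega)
    rw [this]
    simp only [Mem.setR_R]
    rw [if_neg (by omega), if_neg (by omega), if_neg (by omega)]
  have fA : ∀ a, σ₁.A a = σ.A a := fun a => hF₁.2 a (by simp [locate, bounds, block, modA, mov])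
  have f93 : σ₁.R 93 = j := by rw [hF₁.1 93 (by decide)]; simp
  change σ₁.R 34 = S.lo j at a34
  change σ₁.R 35 = S.hi j at a35
  refine H.bind (fillVec_spec hw a34 a35 ((fR 10 (by omega)).trans hσ.R10)
    ((fR 4 (by omega)).trans h4) (by omega) hloj (by omega) (by omega)) ?_
    (T₂ := S.n * 600 - 80 - (S.b * 20 + (S.hi j - S.lo j) * 30 + 41)) (by omega)
  rintro σ₂ ⟨⟨b60, b61, b7, b8⟩, hF₂⟩
  rw [fA] at b8
  have gR : ∀ r, r < 32 → σ₂.R r = σ.R r := fun r hr => by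
    rw [hF₂.1 r (by simp [fillVec, forTo, block, modR, mov]; omega), fR r hr]
  have g93 : σ₂.R 93 = j := by rw [hF₂.1 93 (by decide), f93]
  refine H.bind (writeSLP_spec hw (N := S.N) (n := S.n) (m := S.H) (h := S.h) (q := q)
    ((gR 7 (by omega)).trans hσ.R7) ((gR 8 (by omega)).trans hσ.R8) ((gR 17 (by omega)).trans hσ.R17)
    ((gR 6 (by omega)).trans hσ.R6) ((gR 4 (by omega)).trans h4) b60 b61
    (fun i hi => (b7 i hi).le) (fun y hy => ?_) hhH (by omega) hNH hHw (by omega)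
    (hS.length_le' hq2 le_rfl) (by omega) (hS.size_le' le_rfl (by omega))) ?_
    (T₂ := S.n * 40 + 60) (by omega)
  · have := Nat.mod_lt (σ.A 1 (S.lo j + y)) (show 0 < q by omega)
    rw [b8 y hy]; omega
  rintro σ₃ ⟨⟨c1, c2, c3⟩, hF₃⟩
  refine H.start (T₂ := S.n * 40 + 50) (by omega) ?_ (by simp [cost, mov]; omega)
  rw [wp_mov (by simp)]
  have hF₃8 : σ₃.R 8 = S.n := by rw [hF₃.1 8 (by decide), gR 8 (by omega), hσ.R8]
  refine H.last (H.mono (copyRules_spec hw (a := 33) (n := S.n) (p := 0) (by omega) (by simp [hF₃8])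
    (by simp) (by omega)) le_rfl ?_) (by omega)
  rintro σ₄ ⟨⟨d1, d2⟩, hF₄⟩
  obtain ⟨v1, v2, v3⟩ := rulesAt_of_agree (by omega) d1 c1 c2
  have k93 : σ₄.R 93 = j := by
    rw [hF₄.1 93 (by decide), Mem.setR_R, if_neg (by decide), hF₃.1 93 (by decide), g93]
  have kR : ∀ r, 102 ≤ r → σ₄.R r = σ.R r := fun r hr => by
    have h1 : ∀ l : List ℕ, (∀ x ∈ l, x < 102) → r ∉ l := fun l hl h => by have := hl r h; omega
    rw [hF₄.1 r (h1 _ (by decide)), Mem.setR_R, if_neg (by omega), hF₃.1 r (h1 _ (by decide)),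
      hF₂.1 r (h1 _ (by decide)), hF₁.1 r (h1 _ (by decide))]
    simp only [Mem.setR_R]
    rw [if_neg (by omega), if_neg (by omega), if_neg (by omega)]
  have kA3 : ∀ a, 13 ≤ a → σ₃.A a = σ.A a := fun a ha => by
    have h1 : ∀ l : List ℕ, (∀ x ∈ l, x < 13) → a ∉ l := fun l hl h => by have := hl a h; omega
    rw [hF₃.2 a (h1 _ (by decide)), hF₂.2 a (h1 _ (by decide)), fA]
  refine ⟨k93, ⟨fun r hr => by rw [kR r hr, hc.reg_zero r hr], fun a h1 h2 p hp => ?_,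
    fun a h1 h2 p hp => ?_, fun a h1 p => ?_⟩, v1, v2, fun p => ?_⟩
  · have h1' : ∀ l : List ℕ, (∀ x ∈ l, 33 ≤ x) → a ∉ l := fun l hl h => by have := hl a h; omega
    rw [hF₄.2 a (h1' _ (by decide)), Mem.setR_A, kA3 a (by omega)]
    exact hc.row_zero a h1 h2 p hp
  · rw [d2 a p (by omega), Mem.setR_A, kA3 a (by omega)]
    exact hc.vec_zero a h1 h2 p hp
  · have h1' : ∀ l : List ℕ, (∀ x ∈ l, x < 36) → a ∉ l := fun l hl h => by have := hl a h; omega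
    rw [hF₄.2 a (h1' _ (by decide)), Mem.setR_A, kA3 a (by omega)]
    exact hc.arr_zero a h1 p
  · rw [v3, rules_setR, c3]
    constructor
    · rintro ⟨x, hx, y, hy, rfl⟩
      exact ⟨x, hx, y, hy, by rw [b7 x hx, b8 y hy]; omega⟩
    · rintro ⟨x, hx, y, hy, rfl⟩
      exact ⟨x, hx, y, hy, by rw [b7 x hx, b8 y hy]; omega⟩

/-- The row number `r` is written. -/
def RowWritten (S : Params) (σ : Mem) (q i k : ℕ) (σ' : Mem) (r : ℕ) : Prop :=
  (∀ p < S.n, (rulesAt σ' 30 (r * S.n)).Valid p) ∧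
  ((rulesAt σ' 30 (r * S.n)).word (S.n - 1)).length = S.N ∧
  ∀ p, Rules.IsOne ((rulesAt σ' 30 (r * S.n)).word (S.n - 1)) p ↔ RowOne S σ q i k p

theorem writeRow_spec {S : Params} (hS : S.Good w) {σ : Mem} (hσ : Setup S σ) {q r : ℕ}
    (h4 : σ.R 4 = q) (hq : S.Q ≤ q) (hq2 : q < 2 * S.Q) (h15 : σ.R 15 = r) (hr : r < S.N)
    (h5 : σ.R 5 < S.M) (h93 : σ.R 93 < S.g) :
    H w writeRow σ (S.n * 600) (fun σ' =>
      RowWritten S σ q (σ.A 4 (σ.R 5 * S.N + r)) (σ.A 5 (σ.R 5 * S.N + r)) σ' r ∧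
      ∀ a, 30 ≤ a → ∀ x, x < r * S.n ∨ r * S.n + S.n ≤ x → σ'.A a x = σ.A a x) := by
  have hw := hS.two_le
  have hw0 : w ≠ 0 := by omega
  have hp4 : 4 ≤ 2 ^ w := le_trans (by norm_num) (Nat.pow_le_pow_right two_pos hw)
  set P := σ.R 5 * S.N + r with hP
  set i := σ.A 4 P with hi
  set k := σ.A 5 P with hk
  have hig : i < S.g := (hσ.inRange _).1
  have hkg : k < S.g := (hσ.inRange _).2.1
  have hQ := hS.Q_pos
  have hh := hS.pow_h
  have hm := hS.m_lt
  have hQH := hS.Q_lt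
  have hHw := hS.H_lt
  have hhH := hS.h_lt
  have hhp := hS.h_pos
  have h2h : 2 ^ S.h ≤ 2 ^ (S.H - 1) := Nat.pow_le_pow_right two_pos (by omega)
  have h2H : 2 ^ S.H = 2 * 2 ^ (S.H - 1) := by rw [← pow_succ']; congr 1; omega
  have hloi := hS.lo_le_hi hig
  have hhii := hS.hi_le i
  have hbi := hS.hi_sub_lo_le i
  have hlok := hS.lo_le_hi hkg
  have hhik := hS.hi_le k
  have hbk := hS.hi_sub_lo_le k
  have hNH := hS.N_lt
  have hNn := hS.Nn_lt
  have hn1 := hS.size_le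
  have ht := hS.time_le hbi (show 2 * (S.hi k - S.lo k) ≤ 2 * S.b by omega)
  have hltj := hS.block_lt _ h93
  have hlti := hS.block_lt i hig
  have hltk := hS.block_lt k hkg
  have hMN := hS.MN_lt
  have h5N : σ.R 5 * S.N ≤ S.M * S.N := Nat.mul_le_mul_right _ h5.le
  have hrn : r * S.n ≤ S.N * S.n := Nat.mul_le_mul_right _ hr.le
  refine H.start (T₂ := S.n * 600 - 20) (by omega) ?_
    (by simp [cost, block]; omega)
  simp [wp_block_cons, wp_block_nil, wp, Op.nat, Op.Fits, hσ.R7, h15, ← hP, ← hi, ← hk]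
  refine ⟨by omega, by omega, ?_⟩
  refine H.bind (locate_spec hw (m := S.m) (b := S.b) (i := i) (j := σ.R 93) (k := k)
    (σ := (((σ.setR 89 (σ.R 5 * S.N)).setR 89 P).setR 83 i).setR 84 k) (by simp [hσ.R0])
    (by simp [hσ.R10]) (by simp) (by simp) (by simp) (by omega) (by omega) (by omega)) ?_
    (T₂ := S.n * 600 - 80) (by omega)
  rintro σ₁ ⟨⟨a32, a33, -, -, a36, a37⟩, hF₁⟩
  have fR : ∀ r, r < 32 → σ₁.R r = σ.R r := fun r hr => by
    have := hF₁.1 r (by simp [locate, bounds, block, modR, mov]; omega)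
    rw [this]
    simp only [Mem.setR_R]
    rw [if_neg (by omega), if_neg (by omega), if_neg (by omega), if_neg (by omega)]
  have fA : ∀ a, σ₁.A a = σ.A a := fun a => hF₁.2 a (by simp [locate, bounds, block, modA, mov])
  change σ₁.R 32 = S.lo i at a32
  change σ₁.R 33 = S.hi i at a33
  change σ₁.R 36 = S.lo k at a36
  change σ₁.R 37 = S.hi k at a37
  refine H.bind (fillRow_spec hw a32 a33 a36 a37
    ((fR 4 (by omega)).trans h4) (by omega) hloi hlok (by omega) (by omega) (by omega)) ?_
    (T₂ := S.n * 600 - 80 - ((S.hi i - S.lo i) * 20 + (S.hi k - S.lo k) * 30 + 41)) (by omega)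
  rintro σ₂ ⟨⟨b60, b61, b7, b8⟩, hF₂⟩
  rw [fA] at b8 b7
  -- Entry `y` belongs to the element number `y / 2` of the block of `C`, and `y % 2` says whether
  -- `q` is added.
  have b8' : ∀ y < 2 * (S.hi k - S.lo k),
      σ₂.A 8 y = σ.A 2 (S.lo k + y / 2) % q + y % 2 * q := fun y hy => by
    obtain ⟨c1, c2⟩ := b8 (y / 2) (by omega)
    rcases Nat.mod_two_eq_zero_or_one y with h | h
    · rw [h, show y = 2 * (y / 2) by omega, c1]; simp
    · rw [h]
      conv_lhs => rw [show y = 2 * (y / 2) + 1 by omega]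
      rw [c2]; simp
  have gR : ∀ r, r < 32 → σ₂.R r = σ.R r := fun r hr => by
    rw [hF₂.1 r (by simp [fillRow, forTo, block, modR, mov]; omega), fR r hr]
  refine H.bind (writeSLP_spec hw (N := S.N) (n := S.n) (m := S.H) (h := S.h) (q := q)
    ((gR 7 (by omega)).trans hσ.R7) ((gR 8 (by omega)).trans hσ.R8) ((gR 17 (by omega)).trans hσ.R17)
    ((gR 6 (by omega)).trans hσ.R6) ((gR 4 (by omega)).trans h4) b60 b61
    (fun i hi => ?_) (fun y hy => ?_) hhH (by omega) hNH hHw (by omega)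
    (hS.length_le' hq2 hbi) (by omega) (hS.size_le' hbi (by omega))) ?_
    (T₂ := S.n * 40 + 60) (by omega)
  · rw [b7 i hi]
    exact (Nat.mod_lt _ (by omega)).le
  · have h1 := Nat.mod_lt (σ.A 2 (S.lo k + y / 2)) (show 0 < q by omega)
    have h2 : y % 2 * q ≤ 1 * q := Nat.mul_le_mul_right _ (by omega)
    rw [b8' y hy]; omega
  rintro σ₃ ⟨⟨c1, c2, c3⟩, hF₃⟩
  refine H.start (T₂ := S.n * 40 + 50) (by omega) ?_ (by simp [cost]; omega)
  have hF₃8 : σ₃.R 8 = S.n := by rw [hF₃.1 8 (by decide), gR 8 (by omega), hσ.R8]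
  have hF₃15 : σ₃.R 15 = r := by rw [hF₃.1 15 (by decide), gR 15 (by omega), h15]
  simp [wp, Op.nat, Op.Fits, hF₃8, hF₃15]
  refine ⟨by omega, H.last (H.mono (copyRules_spec hw (a := 30) (n := S.n) (p := r * S.n) (by omega)
    (by simp [hF₃8]) (by simp) (by omega)) le_rfl ?_) (by omega)⟩
  rintro σ₄ ⟨⟨d1, d2⟩, hF₄⟩
  obtain ⟨v1, v2, v3⟩ := rulesAt_of_agree (by omega) d1 c1 c2
  have kA3 : ∀ a, 13 ≤ a → σ₃.A a = σ.A a := fun a ha => by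
    have h1 : ∀ l : List ℕ, (∀ x ∈ l, x < 13) → a ∉ l := fun l hl h => by have := hl a h; omega
    rw [hF₃.2 a (h1 _ (by decide)), hF₂.2 a (h1 _ (by decide)), fA]
  refine ⟨⟨v1, v2, fun p => ?_⟩, fun a ha x hx => ?_⟩
  · rw [v3, rules_setR, c3]
    constructor
    · rintro ⟨x, hx, y, hy, rfl⟩
      exact ⟨x, hx, y / 2, by omega, y % 2, by omega, by rw [b7 x hx, b8' y hy]⟩
    · rintro ⟨x, hx, z, hz, e, he, rfl⟩
      refine ⟨x, hx, 2 * z + e, by omega, ?_⟩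
      rw [b7 x hx, b8' _ (by omega), show (2 * z + e) / 2 = z by omega, show (2 * z + e) % 2 = e by omega]
  · rw [d2 a x hx, Mem.setR_A, kA3 a (by omega)]

-- The rows occupy disjoint ranges of the arrays, so writing row `r` preserves the earlier rows.
-- Whatever an earlier batch left inside these ranges is overwritten; outside, `Clean` provides the
-- zeros.
set_option maxRecDepth 10000 in
theorem prepare_spec {S : Params} (hS : S.Good w) {σ : Mem} (hσ : Setup S σ) {q : ℕ}
    (h4 : σ.R 4 = q) (hq : S.Q ≤ q) (hq2 : q < 2 * S.Q) (hc : Clean S.N S.n σ) (h5 : σ.R 5 < S.M) :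
    H w prepare σ ((S.N + 1) * (S.n * 600 + 10) + 40) (fun σ' =>
      (Input S.N S.n σ' ∧ σ'.R 98 = 0 ∧ ∀ r < S.N, Meets σ' S.n r ↔
        Congruent S σ q (σ.A 4 (σ.R 5 * S.N + r)) (σ.A 6 (σ.R 5)) (σ.A 5 (σ.R 5 * S.N + r))) ∧
      Frame prepare σ σ') := by
  have hw := hS.two_le
  have hw0 : w ≠ 0 := by omega
  have hn1 := hS.size_le
  have hn : 0 < S.n := by omega
  have hp4 : 4 ≤ 2 ^ w := le_trans (by norm_num) (Nat.pow_le_pow_right two_pos hw)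
  have e0 : (S.N + 1) * (S.n * 600 + 10) = S.N * (S.n * 600 + 5) + S.N * 5 + S.n * 600 + 10 := by ring
  refine H.frame (H.bind (writeVec_spec hS hσ h4 hq hq2 hc) ?_ (T₂ := S.N * (S.n * 600 + 5) + 30)
    (by omega))
  rintro σ₁ ⟨⟨a1, a2, a3, a4, a5⟩, hF₁⟩
  have s1 : Same σ σ₁ := Same.frame hF₁ (by decide) (by decide)
  refine H.start (T₂ := S.N * (S.n * 600 + 5) + 20) (by omega) ?_ (by simp [cost, mov]; omega)
  rw [wp_mov (by simp)]
  set σ₂ := σ₁.setR 15 (Operand.ev σ₁ (.const 0)) with hσ₂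
  have s2 : Same σ σ₂ := s1.trans ⟨by simp [hσ₂], by simp [hσ₂]⟩
  have hset₂ := hσ.same s2
  have c2 : Clean S.N S.n σ₂ := a2.congr (fun r hr => by
    simp only [hσ₂, Mem.setR_R]; rw [if_neg (by omega)]) fun _ _ => rfl
  refine H.bind (H.forTo_const (by omega) (lo := 0) (hi := S.N) (t := S.n * 600)
    (Inv := fun k σ' => (∀ r < k, RowWritten S σ q (σ.A 4 (σ.R 5 * S.N + r))
      (σ.A 5 (σ.R 5 * S.N + r)) σ' r) ∧
      (∀ a, 30 ≤ a → ∀ x, S.N * S.n ≤ x → σ'.A a x = σ₂.A a x))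
    (Operand.fits_reg _) (by decide) (by decide) ?_ ?_ (Nat.zero_le _) ?_ ?_ ?_) ?_
    (T₂ := 15) (by rw [Nat.sub_zero]; omega)
  · simp [hσ₂]
  · simp [hset₂.R7]
  · exact ⟨fun r hr => absurd hr (by omega), fun _ _ _ _ => rfl⟩
  · intro k σ' v v' h
    exact h
  · rintro r σ₃ - hr ⟨i1, i2⟩ h15 hF
    have s3 : Same σ σ₃ := s2.trans (Same.frame hF (by decide) (by decide))
    have e5 : σ₃.R 5 = σ.R 5 := s3.1 5 (by decide)
    have e4 := s3.2 4 (by decide)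
    have e5' := s3.2 5 (by decide)
    have := writeRow_spec hS (hσ.same s3) (q := q) (r := r) ((s3.1 4 (by decide)).trans h4) hq hq2 h15 hr
      (by rwa [e5])
      (by
        rw [hF.1 93 (by decide), hσ₂, Mem.setR_R, if_neg (by decide), a1]
        exact (hσ.inRange _).2.2)
    rw [e5, e4, e5'] at this
    have hrN : r * S.n + S.n ≤ S.N * S.n := by rw [← Nat.succ_mul]; exact Nat.mul_le_mul_right _ hr
    refine H.mono this le_rfl ?_
    rintro σ₄ ⟨j1, j2⟩
    refine ⟨fun r' hr' => ?_, fun a ha x hx => ?_⟩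
    · rcases (Nat.lt_succ_iff.1 hr').eq_or_lt with rfl | h
      · refine ⟨j1.1, j1.2.1, fun p => ?_⟩
        rw [j1.2.2 p, RowOne, RowOne, s3.2 0 (by decide), s3.2 2 (by decide)]
      · have hrr : r' * S.n + S.n ≤ r * S.n := by
          rw [← Nat.succ_mul]; exact Nat.mul_le_mul_right _ h
        obtain ⟨k1, k2, k3⟩ := i1 r' h
        have hA : (rulesAt σ₃ 30 (r' * S.n)).Agree S.n (rulesAt σ₄ 30 (r' * S.n)) := fun x hx =>
          ⟨j2 _ (by omega) _ (by omega), j2 _ (by omega) _ (by omega), j2 _ (by omega) _ (by omega)⟩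
        have e := hA.word (show S.n - 1 < S.n by omega)
        exact ⟨fun i hi => hA.valid hi (k1 i hi), by rw [e]; exact k2, fun p => by rw [e]; exact k3 p⟩
    · rw [j2 a ha x (by omega), i2 a ha x hx]
  · rintro σ₃ ⟨⟨i1, i2⟩, -, hF⟩
    have hFR : ∀ r, 100 ≤ r → σ₃.R r = σ₂.R r := fun r hr => by
      have h1 : ∀ l : List ℕ, (∀ x ∈ l, x < 100) → r ∉ l := fun l hl h => by have := hl r h; omega
      exact hF.1 r (h1 _ (by decide))
    have hFA : ∀ a, 33 ≤ a → σ₃.A a = σ₂.A a := fun a ha => by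
      have h1 : ∀ l : List ℕ, (∀ x ∈ l, x < 33) → a ∉ l := fun l hl h => by have := hl a h; omega
      exact hF.2 a (h1 _ (by decide))
    have s3 : Same σ σ₃ := s2.trans (Same.frame hF (by decide) (by decide))
    have hset := hσ.same s3
    have hv : rulesAt σ₃ 33 0 = rulesAt σ₁ 33 0 := by
      simp only [rulesAt, hFA 33 le_rfl, hFA (33 + 1) (by omega), hFA (33 + 2) (by omega), hσ₂, Mem.setR_A]
    refine H.of_wp' (by omega) (by simp [cost, block, mov]) ?_
    simp only [wp_block_cons, wp_block_nil, wp_mov (Operand.fits_reg _),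
      wp_mov (show (Operand.const 0).Fits w by simp)]
    refine ⟨⟨by simp [hset.R7], by simp [hset.R8], fun r hr => ?_, ?_, ?_, ?_, ?_, ?_, ?_, ?_⟩, by simp, ?_⟩
    · simp only [Mem.setR_R]
      rw [if_neg (by omega), if_neg (by omega), if_neg (by omega), hFR r (by omega), c2.reg_zero r hr]
    · intro a h1 h2 p hp
      simp only [Mem.setR_A]
      rw [i2 a h1 p hp, c2.row_zero a h1 h2 p hp]
    · intro a h1 h2 p hp
      simp only [Mem.setR_A]
      rw [hFA a h1, c2.vec_zero a h1 h2 p hp]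
    · intro a h1 p
      simp only [Mem.setR_A]
      rw [hFA a (by omega), c2.arr_zero a h1 p]
    · exact fun r hr => (i1 r hr).1
    · exact fun r hr => (i1 r hr).2.1
    · change ∀ p < S.n, (rulesAt σ₃ 33 0).Valid p
      rw [hv]; exact a3
    · change ((rulesAt σ₃ 33 0).word (S.n - 1)).length = S.N
      rw [hv]; exact a4
    · intro r hr
      rw [← meets_iff_congruent hS hq hq2]
      refine exists_congr fun p => ?_
      refine and_congr ((i1 r hr).2.2 p) ?_
      change Rules.IsOne ((rulesAt σ₃ 33 0).word (S.n - 1)) p ↔ _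
      rw [hv, a5]

/-! ### Evaluating the output of the moved program -/

/-- List the rows whose product with the vector is not zero, up to the number in register `13`. -/
def collect : Cmd :=
  block [block [mov 16 (.const 0), mov 15 (.const 0)],
    forTo 15 (.reg 7) (block [.load 90 30 (.reg 15),
      .branch (.reg 90) (block [.set 91 .lt (.reg 16) (.reg 13),
        .branch (.reg 91) (block [.store 18 (.reg 16) (.reg 15),
          .set 16 .add (.reg 16) (.const 1)]) .skip]) .skip])]

/-- Search the triples of blocks of the listed rows. -/
def examine : Cmd :=
  block [block [mov 15 (.const 0), .load 93 6 (.reg 5)],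
    forTo 15 (.reg 16) (block [block [.load 94 18 (.reg 15), .set 89 .mul (.reg 5) (.reg 7),
      .set 89 .add (.reg 89) (.reg 94), .load 83 4 (.reg 89), .load 84 5 (.reg 89)],
      locate, search])]

/-- Clear the cell number `92` of the arrays `30, …, 29 + n`. -/
def clearCells (n : ℕ) : Cmd :=
  block ((List.range n).map fun a => .store (30 + a) (.reg 92) (.const 0))

/-- Clear the registers `100, …, 99 + n`. -/
def clearRegs (n : ℕ) : Cmd := block ((List.range n).map fun r => mov (100 + r) (.const 0))

/-- Clear the memory of the moved program. -/
def clear (nr na : ℕ) : Cmd :=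
  block [mov 91 (.const 0),
    forTo 91 (.reg 98) (block [.load 92 13 (.reg 91), clearCells na]), clearRegs nr]

/-- The listed rows increase strictly, hence are distinct, and either every nonzero row is listed or
the list is full. The counting of false rows in `finish_spec` needs both facts. -/
theorem collect_spec (hw : 2 ≤ w) {σ : Mem} {N thr : ℕ} (h7 : σ.R 7 = N) (h13 : σ.R 13 = thr)
    (ht : thr < 2 ^ w) :
    H w collect σ (N * 25 + 20) (fun σ' => (σ'.R 16 ≤ thr ∧
      (∀ x < σ'.R 16, σ'.A 18 x < N ∧ σ.A 30 (σ'.A 18 x) ≠ 0) ∧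
      (∀ x y, x < y → y < σ'.R 16 → σ'.A 18 x < σ'.A 18 y) ∧
      ∀ r < N, σ.A 30 r ≠ 0 → (∃ x < σ'.R 16, σ'.A 18 x = r) ∨ σ'.R 16 = thr) ∧
      Frame collect σ σ') := by
  have hw0 : w ≠ 0 := by omega
  refine H.frame (H.start (T₂ := N * 25 + 10) (by omega) ?_ (by simp [cost, block, mov]; omega))
  simp [wp_block_cons, wp_block_nil, wp_mov]
  refine H.last (H.mono (H.forTo_const (by omega) (lo := 0) (hi := N) (t := 20)
    (Inv := fun k σ' => σ'.R 16 ≤ thr ∧ (∀ x < σ'.R 16, σ'.A 18 x < k ∧ σ.A 30 (σ'.A 18 x) ≠ 0) ∧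
      (∀ x y, x < y → y < σ'.R 16 → σ'.A 18 x < σ'.A 18 y) ∧
      ∀ r < k, σ.A 30 r ≠ 0 → (∃ x < σ'.R 16, σ'.A 18 x = r) ∨ σ'.R 16 = thr)
    (Operand.fits_reg _) (by decide) (by decide) ?_ ?_ (Nat.zero_le _) ?_ ?_ ?_) le_rfl ?_) (by omega)
  · simp
  · simp [h7]
  · simp
  · intro k σ' v v' h
    simpa using h
  · rintro k σ₁ - hk ⟨i1, i2, i3, i4⟩ h15 hF
    have e13 := hF.1 13 (by decide)
    have e30 := hF.2 30 (by decide)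
    simp [h13] at e13
    simp at e30
    refine H.of_wp' (by omega) (by decide) ?_
    simp [hw0, wp_block_cons, wp_block_nil, wp, Op.nat, Op.Fits, e13, e30, h15]
    refine ⟨fun h => ⟨fun hlt => ⟨by omega, hlt, ?_, ?_, ?_⟩, fun hge => ⟨i1, ?_, i3, ?_⟩⟩,
      fun h => ⟨i1, ?_, i3, ?_⟩⟩
    · intro x hx
      rw [Function.update_apply]
      split_ifs with hxe
      · exact ⟨by omega, h⟩
      · obtain ⟨a, b⟩ := i2 x (by omega)
        exact ⟨by omega, b⟩
    · intro x y hxy hy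
      rw [Function.update_of_ne (by omega), Function.update_apply]
      split_ifs with hye
      · exact (i2 x (by omega)).1
      · exact i3 x y hxy (by omega)
    · intro r hr hr0
      rcases eq_or_ne r k with rfl | hrk
      · exact Or.inl ⟨σ₁.R 16, by omega, Function.update_self ..⟩
      · rcases i4 r (by omega) hr0 with ⟨x, hx, h⟩ | h
        · exact Or.inl ⟨x, by omega, by rw [Function.update_of_ne (by omega)]; exact h⟩
        · omega
    · exact fun x hx => ⟨by have := (i2 x hx).1; omega, (i2 x hx).2⟩
    · exact fun r _ _ => Or.inr (by omega)
    · exact fun x hx => ⟨by have := (i2 x hx).1; omega, (i2 x hx).2⟩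
    · intro r hr hr0
      refine i4 r ?_ hr0
      rcases eq_or_ne r k with rfl | hrk
      · exact absurd h hr0
      · omega
  · rintro σ₁ ⟨⟨i1, i2, i3, i4⟩, -, -⟩
    exact ⟨i1, i2, i3, i4⟩

/-- There is a solution in the blocks of row number `r` of batch number `5`. -/
def RowSolved (S : Params) (σ : Mem) (r : ℕ) : Prop :=
  HasSum σ (S.lo (σ.A 4 (σ.R 5 * S.N + r))) (S.hi (σ.A 4 (σ.R 5 * S.N + r)))
    (S.lo (σ.A 6 (σ.R 5))) (S.hi (σ.A 6 (σ.R 5)))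
    (S.lo (σ.A 5 (σ.R 5 * S.N + r))) (S.hi (σ.A 5 (σ.R 5 * S.N + r)))

theorem HasSum.congr {σ σ' : Mem} {xl xh yl yh zl zh : ℕ} (h0 : σ'.A 0 = σ.A 0)
    (h1 : σ'.A 1 = σ.A 1) (h2 : σ'.A 2 = σ.A 2) :
    HasSum σ' xl xh yl yh zl zh ↔ HasSum σ xl xh yl yh zl zh := by
  simp only [HasSum, h0, h1, h2]

theorem RowSolved.same {S : Params} {σ σ' : Mem} (h : Same σ σ') {r : ℕ} :
    RowSolved S σ' r ↔ RowSolved S σ r := by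
  unfold RowSolved
  rw [h.1 5 (by decide), h.2 4 (by decide), h.2 5 (by decide), h.2 6 (by decide)]
  exact HasSum.congr (h.2 0 (by decide)) (h.2 1 (by decide)) (h.2 2 (by decide))

/-- At most `thr` triples of blocks are searched exactly, each in time `O(b²)`. Register `1` becomes
`1` only for a genuine solution, which makes the error one-sided. -/
theorem examine_spec {S : Params} (hS : S.Good w) {σ : Mem} (hσ : Setup S σ) {c : ℕ}
    (h16 : σ.R 16 = c) (hc : c ≤ S.thr) (h18 : ∀ x < c, σ.A 18 x < S.N) (h5 : σ.R 5 < S.M) :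
    H w examine σ (S.thr * (S.b * (60 * S.b + 20) + 120) + 20) (fun σ' =>
      (((∃ x < c, RowSolved S σ (σ.A 18 x)) → σ'.R 1 = 1) ∧
      (σ'.R 1 = σ.R 1 ∨ σ'.R 1 = 1 ∧ ∃ x < c, RowSolved S σ (σ.A 18 x))) ∧ Frame examine σ σ') := by
  have hw := hS.two_le
  have hw0 : w ≠ 0 := by omega
  have hm := hS.m_lt
  have hct : c * (S.b * (60 * S.b + 20) + 120) ≤ S.thr * (S.b * (60 * S.b + 20) + 120) :=
    Nat.mul_le_mul_right _ hc
  have hMN := hS.MN_lt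
  have h5N : σ.R 5 * S.N ≤ S.M * S.N := Nat.mul_le_mul_right _ h5.le
  refine H.frame (H.start (T₂ := c * (S.b * (60 * S.b + 20) + 120) + 10) (by omega) ?_
    (by simp [cost, block, mov]; omega))
  simp only [wp_block_cons, wp_block_nil, wp, wp_mov (show (Operand.const 0).Fits w by simp),
    Operand.fits_reg, true_and]
  refine H.last (H.mono (H.forTo_const (by omega) (lo := 0) (hi := c)
    (t := S.b * (60 * S.b + 20) + 115)
    (Inv := fun k σ' => ((∃ x < k, RowSolved S σ (σ.A 18 x)) → σ'.R 1 = 1) ∧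
      (σ'.R 1 = σ.R 1 ∨ σ'.R 1 = 1 ∧ ∃ x < k, RowSolved S σ (σ.A 18 x)))
    (Operand.fits_reg _) (by decide) (by decide) ?_ ?_ (Nat.zero_le _) ?_ ?_ ?_) le_rfl ?_)
    (by rw [Nat.sub_zero]; simp only [Nat.add_assoc, Nat.reduceAdd]; omega)
  · simp
  · simp [h16]
  · simp
  · intro k σ' v v' h
    simpa using h
  · rintro k σ₁ - hk ⟨i1, i2⟩ h15 hF
    have s1 : Same σ σ₁ := by
      refine Same.trans (σ' := (σ.setR 15 0).setR 93 (σ.A 6 (σ.R 5))) ⟨by simp, by simp⟩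
        (Same.frame hF (by decide) (by decide))
    have hset := hσ.same s1
    have e18 := hF.2 18 (by decide)
    simp at e18
    have e93 : σ₁.R 93 = σ.A 6 (σ.R 5) := by rw [hF.1 93 (by decide)]; simp
    have e4 := s1.2 4 (by decide)
    have e5 := s1.2 5 (by decide)
    have er5 := s1.1 5 (by decide)
    have hr := h18 k hk
    have hgi : σ.A 4 (σ.R 5 * S.N + σ.A 18 k) < S.g := (hσ.inRange _).1
    have hgk : σ.A 5 (σ.R 5 * S.N + σ.A 18 k) < S.g := (hσ.inRange _).2.1
    have hgj : σ.A 6 (σ.R 5) < S.g := (hσ.inRange _).2.2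
    have hsolved : RowSolved S σ (σ.A 18 k) ↔
      HasSum σ (S.lo (σ.A 4 (σ.R 5 * S.N + σ.A 18 k))) (S.hi (σ.A 4 (σ.R 5 * S.N + σ.A 18 k)))
      (S.lo (σ.A 6 (σ.R 5))) (S.hi (σ.A 6 (σ.R 5)))
      (S.lo (σ.A 5 (σ.R 5 * S.N + σ.A 18 k))) (S.hi (σ.A 5 (σ.R 5 * S.N + σ.A 18 k))) := Iff.rfl
    set i := σ.A 4 (σ.R 5 * S.N + σ.A 18 k) with hi
    set j := σ.A 6 (σ.R 5) with hj
    set l := σ.A 5 (σ.R 5 * S.N + σ.A 18 k) with hl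
    have b1 := hS.block_lt i hgi
    have b2 := hS.block_lt j hgj
    have b3 := hS.block_lt l hgk
    refine H.start (T₂ := S.b * (60 * S.b + 20) + 95) (by omega) ?_ (by simp [cost, block]; omega)
    simp [wp_block_cons, wp_block_nil, wp, Op.nat, Op.Fits, h15, e18, e4, e5, er5, hset.R7, ← hi, ← hl]
    refine ⟨by omega, by omega, ?_⟩
    refine H.bind (locate_spec hw (m := S.m) (b := S.b) (i := i) (j := j) (k := l)
      (by simp [hset.R0]) (by simp [hset.R10]) (by simp [e93]) (by simp) (by simp) (by omega)
      (by omega) (by omega)) ?_ (T₂ := S.b * (60 * S.b + 20) + 30) (by omega)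
    rintro σ₂ ⟨⟨a32, a33, a34, a35, a36, a37⟩, hF₂⟩
    have fA : ∀ a, σ₂.A a = σ₁.A a := fun a => by
      rw [hF₂.2 a (by simp [locate, bounds, block, modA, mov])]; rfl
    have f1 : σ₂.R 1 = σ₁.R 1 := by rw [hF₂.1 1 (by decide)]; simp
    have t1 : (S.hi i - S.lo i) * (((S.hi j - S.lo j) + (S.hi l - S.lo l)) * 30 + 20) ≤
        S.b * (60 * S.b + 20) := by
      have h1 := hS.hi_sub_lo_le i
      have h2 := hS.hi_sub_lo_le j
      have h3 := hS.hi_sub_lo_le l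
      exact Nat.mul_le_mul h1 (by omega)
    have hhi := hS.hi_le i
    have hhj := hS.hi_le j
    have hhl := hS.hi_le l
    refine H.last (H.mono (search_spec hw (U := S.U) a32 a33 a34 a35 a36 a37 (hS.lo_le_hi hgi)
      (hS.lo_le_hi hgj) (hS.lo_le_hi hgk) hS.U_lt (by rw [fA]; exact hset.A_le)
      (by rw [fA]; exact hset.B_le) (show S.hi i < _ by omega) (show S.hi j + S.hi l < _ by omega)
      (fun y y' h h' => by rw [fA]; exact hset.B_mono y y' h (show y' < S.m from lt_of_lt_of_le h' hhj))
      (fun y y' h h' => by rw [fA]; exact hset.C_mono y y' h (show y' < S.m from lt_of_lt_of_le h' hhl)))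
      le_rfl ?_) (show (S.hi i - S.lo i) * (((S.hi j - S.lo j) + (S.hi l - S.lo l)) * 30 + 20) + 20 + 2
        ≤ _ by omega)
    rintro σ₃ ⟨r1, r2⟩
    change HasSum σ₂ (S.lo i) (S.hi i) (S.lo j) (S.hi j) (S.lo l) (S.hi l) → _ at r1
    change _ ∨ _ ∧ HasSum σ₂ (S.lo i) (S.hi i) (S.lo j) (S.hi j) (S.lo l) (S.hi l) at r2
    rw [HasSum.congr ((fA 0).trans (s1.2 0 (by decide))) ((fA 1).trans (s1.2 1 (by decide)))
      ((fA 2).trans (s1.2 2 (by decide))), ← hsolved] at r1 r2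
    rw [f1] at r2
    refine ⟨?_, ?_⟩
    · intro x hx hs
      rcases hx.eq_or_lt with rfl | h
      · exact r1 hs
      · rcases r2 with r2 | r2
        · rw [r2]; exact i1 ⟨x, h, hs⟩
        · exact r2.1
    · rcases r2 with r2 | r2
      · rw [r2]
        rcases i2 with i2 | ⟨i2, x, hx, hs⟩
        · exact Or.inl i2
        · exact Or.inr ⟨i2, x, by omega, hs⟩
      · exact Or.inr ⟨r2.1, k, by omega, r2.2⟩
  · rintro σ₁ ⟨h, -, -⟩
    exact h

/-! ### Clearing the memory of the moved program -/

theorem clearCells_wp {n : ℕ} {σ : Mem} {Φ : Mem → Prop}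
    (h : ∀ σ', σ'.R = σ.R → (∀ a, a < 30 ∨ 30 + n ≤ a → σ'.A a = σ.A a) →
      (∀ a, 30 ≤ a → ∀ p, σ'.A a p = if a < 30 + n ∧ p = σ.R 92 then 0 else σ.A a p) → Φ σ') :
    wp w (clearCells n) Φ σ := by
  have key : ∀ (l : List ℕ) (σ : Mem) (Φ : Mem → Prop),
      (∀ σ', σ'.R = σ.R → (∀ a, a - 30 ∉ l ∨ a < 30 → σ'.A a = σ.A a) →
      (∀ a, 30 ≤ a → ∀ p, σ'.A a p = if a - 30 ∈ l ∧ p = σ.R 92 then 0 else σ.A a p) → Φ σ') →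
      wp w (block (l.map fun a => .store (30 + a) (.reg 92) (.const 0))) Φ σ := by
    intro l
    induction l with
    | nil => exact fun σ Φ h => h σ rfl (fun _ _ => rfl) (by simp)
    | cons a l ih =>
      intro σ Φ h
      rw [List.map_cons, wp_block_cons]
      refine ⟨trivial, by simp, ih _ _ fun σ' h1 h2 h3 => h σ' h1 (fun b hb => ?_) fun b hb p => ?_⟩
      · rw [h2 b (by simp at hb ⊢; tauto), Mem.setA_A, if_neg]
        rintro rfl
        simp at hb
      · rw [h3 b hb p]
        simp only [Mem.setA_R, Mem.setA_A, Operand.ev_reg, Operand.ev_const, List.mem_cons]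
        by_cases hba : b = 30 + a
        · subst hba
          by_cases hp : p = σ.R 92 <;> simp [hp]
        · have : ¬ b - 30 = a := by omega
          simp [hba, this]
  refine key _ σ Φ fun σ' h1 h2 h3 => h σ' h1 (fun a ha => h2 a ?_) fun a ha p => ?_
  · rw [List.mem_range]; omega
  · rw [h3 a ha p]
    have : a - 30 ∈ List.range n ↔ a < 30 + n := by rw [List.mem_range]; omega
    simp only [this]

theorem clearRegs_wp {n : ℕ} {σ : Mem} {Φ : Mem → Prop}
    (h : ∀ σ', σ'.A = σ.A → (∀ r, σ'.R r = if 100 ≤ r ∧ r < 100 + n then 0 else σ.R r) → Φ σ') :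
    wp w (clearRegs n) Φ σ := by
  have key : ∀ (l : List ℕ) (σ : Mem) (Φ : Mem → Prop),
      (∀ σ', σ'.A = σ.A → (∀ r, σ'.R r = if 100 ≤ r ∧ r - 100 ∈ l then 0 else σ.R r) → Φ σ') →
      wp w (block (l.map fun r => mov (100 + r) (.const 0))) Φ σ := by
    intro l
    induction l with
    | nil => exact fun σ Φ h => h σ rfl (by simp)
    | cons a l ih =>
      intro σ Φ h
      rw [List.map_cons, wp_block_cons, wp_mov (by simp)]
      refine ih _ _ fun σ' h1 h2 => h σ' h1 fun r => ?_
      rw [h2 r]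
      simp only [Mem.setR_R, Operand.ev_const, List.mem_cons]
      by_cases hr : r = 100 + a
      · subst hr; simp
      · have : ¬ (100 ≤ r ∧ r - 100 = a) := by omega
        by_cases h5 : 100 ≤ r
        · have : ¬ r - 100 = a := by omega
          simp [hr, this]
        · simp [hr, h5]
  refine key _ σ Φ fun σ' h1 h2 => h σ' h1 fun r => ?_
  rw [h2 r]
  have : (100 ≤ r ∧ r - 100 ∈ List.range n) ↔ (100 ≤ r ∧ r < 100 + n) := by
    rw [List.mem_range]; omega
  simp only [this]

theorem cost_block (l : List Cmd) {c : ℕ} (h : ∀ p ∈ l, cost p ≤ c) :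
    cost (block l) ≤ l.length * (c + 1) + 1 := by
  induction l with
  | nil => simp [block, cost]
  | cons p l ih =>
    have h1 := h p List.mem_cons_self
    have h2 := ih fun q hq => h q (List.mem_cons_of_mem _ hq)
    rw [block, cost, List.length_cons, Nat.succ_mul]
    omega

theorem modR_block (l : List Cmd) (r : ℕ) : r ∈ modR (block l) ↔ ∃ p ∈ l, r ∈ modR p := by
  induction l with
  | nil => simp [block, modR]
  | cons p l ih => simp [block, modR, ih]

/-- The log contains positions without the names of the arrays, so each recorded position is cleared
in all `na` arrays. As `nr` and `na` depend only on the program, the time is proportional to the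
length of the log. -/
theorem clear_spec (hw : 2 ≤ w) {σ : Mem} {nr na T : ℕ} (hT : σ.R 98 ≤ T) :
    H w (clear nr na) σ (T * (na * 2 + 20) + nr * 2 + 20) (fun σ' =>
      (∀ r < 91, σ'.R r = σ.R r) ∧ (∀ r, 100 ≤ r → σ'.R r = if r < 100 + nr then 0 else σ.R r) ∧
      (∀ a, a < 30 ∨ 30 + na ≤ a → σ'.A a = σ.A a) ∧
      (∀ a p, σ'.A a p = σ.A a p ∨ σ'.A a p = 0) ∧
      ∀ a, 30 ≤ a → a < 30 + na → ∀ j < σ.R 98, σ'.A a (σ.A 13 j) = 0) := by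
  have hw0 : w ≠ 0 := by omega
  have mC : modR (clearCells na) = [] := by
    rw [List.eq_nil_iff_forall_not_mem]
    intro r hr
    rw [clearCells, modR_block] at hr
    simp [modR] at hr
  have cC : cost (clearCells na) ≤ na * 2 + 1 := by
    have := cost_block ((List.range na).map fun a => .store (30 + a) (.reg 92) (.const 0)) (c := 1)
      (by simp [cost])
    simpa [clearCells] using this
  have cR : cost (clearRegs nr) ≤ nr * 2 + 1 := by
    have := cost_block ((List.range nr).map fun r => mov (100 + r) (.const 0)) (c := 1)
      (by simp [cost, mov])
    simpa [clearRegs] using this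
  have mB : modR (block [.load 92 13 (.reg 91), clearCells na]) = [92] := by
    simp [block, modR, mC]
  have hTT : σ.R 98 * (na * 2 + 20) ≤ T * (na * 2 + 20) := Nat.mul_le_mul_right _ hT
  refine H.start (T₂ := σ.R 98 * (na * 2 + 20) + nr * 2 + 10) (by omega) ?_
    (by simp [cost, mov]; omega)
  rw [wp_mov (by simp)]
  refine H.bind (H.forTo_const (by omega) (lo := 0) (hi := σ.R 98) (t := na * 2 + 10)
    (Inv := fun k σ' => (∀ a, a < 30 ∨ 30 + na ≤ a → σ'.A a = σ.A a) ∧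
      (∀ a p, σ'.A a p = σ.A a p ∨ σ'.A a p = 0) ∧
      ∀ a, 30 ≤ a → a < 30 + na → ∀ j < k, σ'.A a (σ.A 13 j) = 0)
    (Operand.fits_reg _) (by rw [mB]; decide) (by rw [mB]; decide) ?_ ?_ (Nat.zero_le _) ?_ ?_ ?_) ?_
    (T₂ := nr * 2 + 4) (by rw [Nat.sub_zero, mul_add, mul_add, mul_add]; omega)
  · simp
  · simp
  · exact ⟨fun _ _ => rfl, fun _ _ => Or.inl rfl, fun _ _ _ j hj => absurd hj (by omega)⟩
  · intro k σ' v v' h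
    exact h
  · rintro k σ₁ - hk ⟨i1, i2, i3⟩ h91 hF
    refine H.of_wp' (by omega) (by simp [block, cost]; omega) ?_
    rw [wp_block_cons]
    refine ⟨trivial, ?_⟩
    rw [wp_block_cons]
    refine clearCells_wp fun σ₂ j1 j2 j3 => ?_
    have e13 : σ₁.A 13 = σ.A 13 := i1 13 (by omega)
    simp [e13, h91] at j1 j2 j3
    refine ⟨fun a ha => (j2 a ha).trans (i1 a ha), fun a p => ?_, fun a h1 h2 j hj => ?_⟩
    · rcases lt_or_ge a 30 with h | h
      · rw [j2 a (Or.inl h)]; exact i2 a p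
      · rw [j3 a h p]
        split_ifs
        · exact Or.inr rfl
        · exact i2 a p
    · rw [j3 a h1]
      split_ifs with h
      · rfl
      · refine i3 a h1 h2 j ?_
        rcases eq_or_ne j k with rfl | hjk
        · exact absurd ⟨h2, rfl⟩ h
        · omega
  · rintro σ₁ ⟨⟨i1, i2, i3⟩, -, hF⟩
    have mF : modR (forTo 91 (.reg 98) (block [.load 92 13 (.reg 91), clearCells na])) =
        [99, 92, 91, 99] := by simp [forTo, modR, mB]
    refine H.of_wp' (T := nr * 2 + 4) (by omega) (by simp [block, cost]; omega) ?_
    rw [wp_block_cons]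
    refine clearRegs_wp fun σ₂ j1 j2 => ?_
    have hR : ∀ r, r ≠ 99 → r ≠ 92 → r ≠ 91 → σ₁.R r = σ.R r := fun r h1 h2 h3 => by
      rw [hF.1 r (by rw [mF]; simp [h1, h2, h3]), Mem.setR_R, if_neg h3]
    refine ⟨fun r hr => ?_, fun r hr => ?_, by rw [j1]; exact i1, by rw [j1]; exact i2,
      by rw [j1]; exact i3⟩
    · rw [j2 r, if_neg (by omega), hR r (by omega) (by omega) (by omega)]
    · rw [j2 r]
      by_cases h : r < 100 + nr
      · rw [if_pos ⟨hr, h⟩, if_pos h]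
      · rw [if_neg (by omega), if_neg h, hR r (by omega) (by omega) (by omega)]

/-- The counterpart of `H.forTo` with one round `mid` that reaches its goal only with probability
`ρ`; it is derived from `Pr.loop`. -/
theorem Pr.forTo (hw : 0 < w) {i : ℕ} {n : Operand} {p : Cmd} {σ₀ : Mem} {lo mid hi t : ℕ}
    {Inv Inv' : ℕ → Mem → Prop} {ρ : ℝ≥0∞} (hfit : n.Fits w)
    (hi₁ : i ∉ 99 :: modR p) (hn₁ : ∀ r ∈ n.regs, r ∉ i :: 99 :: modR p)
    (hlo : σ₀.R i = lo) (hhi : n.ev σ₀ = hi) (hle : lo ≤ mid) (hlt : mid < hi) (h₀ : Inv lo σ₀)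
    (hstab : ∀ k σ v v', Inv k σ → Inv k ((σ.setR i v).setR 99 v'))
    (hstab' : ∀ k σ v v', Inv' k σ → Inv' k ((σ.setR i v).setR 99 v'))
    (hbody : ∀ k σ, lo ≤ k → k < hi → Inv k σ → σ.R i = k → Frame (WordRAM.forTo i n p) σ₀ σ →
      H w p σ t (Inv (k + 1)))
    (hmid : ∀ σ, Inv mid σ → σ.R i = mid → Frame (WordRAM.forTo i n p) σ₀ σ →
      Pr w p σ t (Inv' (mid + 1)) ρ)
    (hbody' : ∀ k σ, lo ≤ k → k < hi → Inv' k σ → σ.R i = k →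
      Frame (WordRAM.forTo i n p) σ₀ σ → H w p σ t (Inv' (k + 1))) :
    Pr w (WordRAM.forTo i n p) σ₀ ((hi - lo) * (t + 5) + 3) (Inv' hi) ρ := by
  have h1w : 1 < 2 ^ w := Nat.one_lt_two_pow hw.ne'
  have hmod : modR (WordRAM.forTo i n p) = 99 :: (modR p ++ [i, 99]) := by simp [WordRAM.forTo, modR]
  have hmodA : modA (WordRAM.forTo i n p) = modA p := by simp [WordRAM.forTo, modA]
  simp only [List.mem_cons, not_or] at hi₁ hn₁
  have hnn : ∀ σ, Frame (WordRAM.forTo i n p) σ₀ σ → n.ev σ = hi := by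
    intro σ hσ
    rw [← hhi]
    cases n with
    | const k => rfl
    | reg r =>
      refine hσ.1 r ?_
      have := hn₁ r (by simp [Operand.regs])
      simp [hmod, this]
  have hns1 : ∀ σ v, n.ev (Mem.setR σ i v) = n.ev σ := by
    intro σ v
    cases n with
    | const k => rfl
    | reg r =>
      have := hn₁ r (by simp [Operand.regs])
      simp [this]
  have hi9 : ¬ i = 99 := hi₁.1
  have hFr : ∀ σ v v', Frame (WordRAM.forTo i n p) σ₀ σ →
      Frame (WordRAM.forTo i n p) σ₀ ((σ.setR i v).setR 99 v') := by
    intro σ v v' h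
    refine ⟨fun r hr => ?_, h.2⟩
    rw [← h.1 r hr]
    simp only [hmod, List.mem_cons, List.mem_append, not_or] at hr
    simp [hr.1, hr.2.2.1]
  have hi0 : Mem.setR σ₀ i lo = σ₀ := by
    ext r
    · simp only [Mem.setR_R]; split_ifs with h
      · rw [h, hlo]
      · rfl
    · rfl
  let J : (ℕ → Mem → Prop) → ℕ → Mem → Prop := fun I k σ => I k σ ∧ σ.R i = k ∧
    Frame (WordRAM.forTo i n p) σ₀ σ ∧ σ.R 99 = if k < hi then 1 else 0
  have hend : ∀ σ, J Inv' hi σ → (Operand.reg 99).ev σ = 0 := by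
    rintro σ ⟨-, -, -, h⟩; simpa using h
  -- the increment of the counter
  have hinc : ∀ (I : ℕ → Mem → Prop) k σ σ', (∀ k σ v v', I k σ → I k ((σ.setR i v).setR 99 v')) →
      k < hi → J I k σ ∨ J Inv k σ → I (k + 1) σ' → Frame p σ σ' →
      H w (.seq (.set i .add (.reg i) (.const 1)) (.set 99 .lt (.reg i) n)) σ' 3 (J I (k + 1)) := by
    intro I k σ σ' hst hk2 hJ hI' hf'
    obtain ⟨hik, hfr⟩ : σ.R i = k ∧ Frame (WordRAM.forTo i n p) σ₀ σ := by
      rcases hJ with h | h <;> exact ⟨h.2.1, h.2.2.1⟩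
    have hfr' : Frame (WordRAM.forTo i n p) σ₀ σ' := by
      refine ⟨fun r hr => ?_, fun a ha => ?_⟩
      · rw [← hfr.1 r hr]; exact hf'.1 r (by simp [hmod] at hr; tauto)
      · rw [← hfr.2 a ha]; exact hf'.2 a (by rwa [hmodA] at ha)
    have hik' : σ'.R i = k := by rw [hf'.1 i hi₁.2, hik]
    intro s hs
    have hlt : hi < 2 ^ w := by rw [← hnn σ' hfr', ← hs]; exact Operand.ev_lt s hfit
    refine H.of_wp' hw (by simp [cost]) ?_ s hs
    refine ⟨trivial, by simpa using h1w, ?_, trivial, hfit, trivial, ?_⟩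
    · simp only [Op.Fits, Operand.ev_reg, Operand.ev_const, hik']; omega
    · have e1 : n.ev (σ'.setR i (k + 1)) = hi := by rw [hns1, hnn σ' hfr']
      simp only [Op.nat, Operand.ev_reg, Operand.ev_const, hik', e1]
      refine ⟨hst _ _ _ _ hI', by simp [hi9], hFr _ _ _ hfr', by simp⟩
  have key := Pr.loop (w := w) (ρ := ρ) (x := .reg 99)
    (p := .seq p (.seq (.set i .add (.reg i) (.const 1)) (.set 99 .lt (.reg i) n)))
    (σ₀ := σ₀.setR 99 (if lo < hi then 1 else 0)) (lo := lo) (mid := mid) (hi := hi)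
    (t := fun _ => t + 4) (Inv := J Inv) (Inv' := J Inv') trivial hle hlt
    ⟨by
      have := hstab lo σ₀ lo (if lo < hi then 1 else 0) h₀
      rwa [hi0] at this, by simp [hi9, hlo],
      by
        have := hFr σ₀ lo (if lo < hi then 1 else 0) ⟨fun _ _ => rfl, fun _ _ => rfl⟩
        rwa [hi0] at this, by simp⟩
    (by
      rintro k σ hk1 hk2 hJ
      refine ⟨by simp [hJ.2.2.2, hk2.trans hlt], ?_⟩
      refine (H.seq (T₁ := t) (T₂ := 3) ((hbody k σ hk1 (hk2.trans hlt) hJ.1 hJ.2.1 hJ.2.2.1).frame.mono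
        le_rfl ?_)).time (by omega)
      rintro σ' ⟨hI', hf'⟩
      exact hinc Inv k σ σ' hstab (hk2.trans hlt) (Or.inl hJ) hI' hf')
    (by
      rintro σ hJ
      refine ⟨by simp [hJ.2.2.2, hlt], ?_⟩
      -- Termination and the frame condition of the round `mid` hold surely, by `hbody`; only `Inv'`
      -- carries the probability.
      refine (Pr.seq_left (T₁ := t) (T₂ := 3) ((hmid σ hJ.1 hJ.2.1 hJ.2.2.1).and_H
        (hbody mid σ hle hlt hJ.1 hJ.2.1 hJ.2.2.1).frame) ?_).mono (by omega) fun _ h => h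
      rintro σ' ⟨hI', -, hf'⟩
      exact hinc Inv' mid σ σ' hstab' hlt (Or.inr hJ) hI' hf')
    (by
      rintro k σ hk1 hk2 hJ
      refine ⟨by simp [hJ.2.2.2, hk2], ?_⟩
      refine (H.seq (T₁ := t) (T₂ := 3) ((hbody' k σ (by omega) hk2 hJ.1 hJ.2.1 hJ.2.2.1).frame.mono
        le_rfl ?_)).time (by omega)
      rintro σ' ⟨hI', hf'⟩
      exact hinc Inv' k σ σ' hstab' hk2 (Or.inl hJ) hI' hf')
    hend
  have hset : H w (.set 99 .lt (.reg i) n) σ₀ 1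
      (fun σ => σ = σ₀.setR 99 (if lo < hi then 1 else 0)) := by
    refine H.of_wp' hw (by simp [cost]) ⟨trivial, hfit, trivial, ?_⟩
    simp only [Op.nat, Operand.ev_reg, hlo, hhi]
  refine (Pr.seq_right hset (fun σ' h => by subst h; exact key)).mono ?_
    fun σ (h : J Inv' hi σ) => h.1
  simp only [Finset.sum_const, Nat.card_Ico, smul_eq_mul, Nat.add_assoc, Nat.reduceAdd]
  omega

/-! ### Processing a batch -/

/-- One attempt to find a solution in batch number `5`, with the modulus in register `4`. -/
def attempt (P : Cmd) (nr na : ℕ) : Cmd :=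
  block [prepare, relocate P, collect, examine, clear nr na]

/-- One attempt to find a solution in batch number `5`, with a random modulus. -/
def round (P : Cmd) (nr na : ℕ) : Cmd :=
  block [.rand 3, block [.set 3 .mod (.reg 3) (.reg 12), .set 4 .add (.reg 3) (.reg 12)],
    attempt P nr na]

/-- The blocks of row number `r` contain a solution modulo `q`. -/
def RowCongruent (S : Params) (σ : Mem) (q r : ℕ) : Prop :=
  Congruent S σ q (σ.A 4 (σ.R 5 * S.N + r)) (σ.A 6 (σ.R 5)) (σ.A 5 (σ.R 5 * S.N + r))

theorem RowSolved.rowCongruent {S : Params} {σ : Mem} {q r : ℕ} (h : RowSolved S σ r) :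
    RowCongruent S σ q r := by
  obtain ⟨x, y, z, h1, h2, h3, h4, h5, h6, h7⟩ := h
  exact ⟨x, y, z, h1, h2, h3, h4, h5, h6, by rw [h7]⟩

open Classical in
/-- The rows that are wrongly taken for rows with a solution. -/
noncomputable def falseRows (S : Params) (σ : Mem) (q : ℕ) : Finset ℕ :=
  (Finset.range S.N).filter fun r => RowCongruent S σ q r ∧ ¬ RowSolved S σ r

/-- The time for an attempt. -/
def Params.time (S : Params) (T nr na : ℕ) : ℕ :=
  (S.N + 1) * (S.n * 600 + 10) + 5 * T + S.N * 25 + S.thr * (S.b * (60 * S.b + 20) + 120) +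
    T * (na * 2 + 20) + nr * 2 + 150

theorem mem_modR_relocate {P : Cmd} {r : ℕ} (h : r ∈ modR (relocate P)) :
    r = 98 ∨ ∃ r' ∈ modR P, r = r' + 100 := by
  induction P with
  | seq p q ihp ihq =>
    simp only [relocate, modR, List.mem_append] at h ⊢
    rcases h with h | h
    · rcases ihp h with h | ⟨r', h1, h2⟩
      · exact Or.inl h
      · exact Or.inr ⟨r', Or.inl h1, h2⟩
    · rcases ihq h with h | ⟨r', h1, h2⟩
      · exact Or.inl h
      · exact Or.inr ⟨r', Or.inr h1, h2⟩
  | branch x p q ihp ihq =>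
    simp only [relocate, modR, List.mem_append] at h ⊢
    rcases h with h | h
    · rcases ihp h with h | ⟨r', h1, h2⟩
      · exact Or.inl h
      · exact Or.inr ⟨r', Or.inl h1, h2⟩
    · rcases ihq h with h | ⟨r', h1, h2⟩
      · exact Or.inl h
      · exact Or.inr ⟨r', Or.inr h1, h2⟩
  | loop x p ih => exact ih h
  | _ => simp [relocate, modR] at h ⊢; try first | exact h | exact Or.inr h

theorem mem_modA_relocate {P : Cmd} {a : ℕ} (h : a ∈ modA (relocate P)) :
    a = 13 ∨ ∃ a' ∈ modA P, a = a' + 30 := by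
  induction P with
  | seq p q ihp ihq =>
    simp only [relocate, modA, List.mem_append] at h ⊢
    rcases h with h | h
    · rcases ihp h with h | ⟨r', h1, h2⟩
      · exact Or.inl h
      · exact Or.inr ⟨r', Or.inl h1, h2⟩
    · rcases ihq h with h | ⟨r', h1, h2⟩
      · exact Or.inl h
      · exact Or.inr ⟨r', Or.inr h1, h2⟩
  | branch x p q ihp ihq =>
    simp only [relocate, modA, List.mem_append] at h ⊢
    rcases h with h | h
    · rcases ihp h with h | ⟨r', h1, h2⟩
      · exact Or.inl h
      · exact Or.inr ⟨r', Or.inl h1, h2⟩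
    · rcases ihq h with h | ⟨r', h1, h2⟩
      · exact Or.inl h
      · exact Or.inr ⟨r', Or.inr h1, h2⟩
  | loop x p ih => exact ih h
  | store a x y => simp [relocate, modA] at h ⊢; tauto
  | _ => simp [relocate, modA] at h

/-- Two arguments. Memory: a changed cell is in the log and therefore cleared, and an unchanged cell
keeps its zero, so the state is clean again. Detection: a row with a solution is nonzero; if it is
not listed, the list holds `thr` distinct rows, and these cannot all be false, so another row with a
solution is examined. -/
theorem finish_spec {P : Cmd} {nr na T q : ℕ} {S : Params} (hS : S.Good w)
    (hnr : ∀ r ∈ modR P, r < nr) (hna : ∀ a ∈ modA P, a < na)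
    {σ σ₁ σ₂ : Mem} (hσ : Setup S σ) (h5 : σ.R 5 < S.M) (h1 : Same σ σ₁) (h11 : σ₁.R 1 = σ.R 1)
    (hI : Input S.N S.n σ₁) (hc : Called T σ₁ σ₂) (hF : Frame (relocate P) σ₁ σ₂) :
    H w (block [collect, examine, clear nr na]) σ₂
      (S.N * 25 + S.thr * (S.b * (60 * S.b + 20) + 120) + T * (na * 2 + 20) + nr * 2 + 80)
      (fun σ' => Same σ σ' ∧ Clean S.N S.n σ' ∧
        (σ'.R 1 = σ.R 1 ∨ σ'.R 1 = 1 ∧ ∃ r < S.N, RowSolved S σ r) ∧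
        ((∀ r < S.N, σ₂.A 30 r ≠ 0 ↔ RowCongruent S σ q r) → (falseRows S σ q).card < S.thr →
          (∃ r < S.N, RowSolved S σ r) → σ'.R 1 = 1)) := by
  classical
  have hw := hS.two_le
  have s2 : Same σ σ₂ := by
    refine h1.trans ⟨fun r hr => ?_, fun a ha => ?_⟩
    · simp at hr
      exact hc.lowReg r (by omega) (by omega)
    · simp at ha
      exact hc.lowArr a (by omega) (by omega)
  have set2 := hσ.same s2
  refine H.bind (collect_spec hw set2.R7 set2.R13 hS.thr_lt) ?_
    (T₂ := S.thr * (S.b * (60 * S.b + 20) + 120) + T * (na * 2 + 20) + nr * 2 + 50) (by omega)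
  rintro σ₃ ⟨⟨c1, c2, c3, c4⟩, hF₃⟩
  have s3 : Same σ σ₃ := s2.trans (Same.frame hF₃ (by decide) (by decide))
  refine H.bind (examine_spec hS (hσ.same s3) rfl c1 (fun x hx => (c2 x hx).1)
    (by rw [s3.1 5 (by decide)]; exact h5)) ?_
    (T₂ := T * (na * 2 + 20) + nr * 2 + 25) (by omega)
  rintro σ₄ ⟨⟨d1, d2⟩, hF₄⟩
  simp only [RowSolved.same s3] at d1 d2
  have s4 : Same σ σ₄ := s3.trans (Same.frame hF₄ (by decide) (by decide))
  have A4 : ∀ a, a = 13 ∨ 30 ≤ a → σ₄.A a = σ₂.A a := fun a ha => by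
    have h1 : ∀ l : List ℕ, (∀ x ∈ l, x < 30 ∧ x ≠ 13) → a ∉ l := fun l hl h => by
      have := hl a h; omega
    rw [hF₄.2 a (h1 _ (by decide)), hF₃.2 a (h1 _ (by decide))]
  have R4 : ∀ r, r = 98 ∨ 100 ≤ r → σ₄.R r = σ₂.R r := fun r hr => by
    have h1 : ∀ l : List ℕ, (∀ x ∈ l, x < 100 ∧ x ≠ 98) → r ∉ l := fun l hl h => by
      have := hl r h; omega
    rw [hF₄.1 r (h1 _ (by decide)), hF₃.1 r (h1 _ (by decide))]
  have e41 : σ₃.R 1 = σ.R 1 := by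
    rw [hF₃.1 1 (by decide), hc.lowReg 1 (by omega) (by omega), h11]
  rw [e41] at d2
  have hcnt : σ₄.R 98 ≤ T := by rw [R4 98 (Or.inl rfl)]; exact hc.count
  refine H.last (H.mono (clear_spec hw (nr := nr) (na := na) hcnt) le_rfl ?_) (by omega)
  rintro σ₅ ⟨f1, f2, f3, f4, f5⟩
  have f51 : σ₅.R 1 = σ₄.R 1 := f1 1 (by omega)
  -- a cell that is zero before the call of the moved program is zero in the end
  have hz : ∀ a, 30 ≤ a → ∀ p, σ₁.A a p = 0 → σ₅.A a p = 0 := by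
    intro a ha p hp
    by_cases hch : σ₂.A a p = σ₁.A a p
    · rcases f4 a p with h | h
      · rw [h, A4 a (Or.inr ha), hch, hp]
      · exact h
    · have hmem : a ∈ modA (relocate P) := by
        by_contra h
        exact hch (by rw [hF.2 a h])
      obtain rfl | ⟨a', ha', rfl⟩ := mem_modA_relocate hmem
      · omega
      · obtain ⟨j, hj, rfl⟩ := hc.log _ ha p hch
        have := hna a' ha'
        have h6 := f5 (a' + 30) ha (by omega) j (by rw [R4 98 (Or.inl rfl)]; exact hj)
        rwa [A4 13 (Or.inl rfl)] at h6
  refine ⟨s4.trans ⟨fun r hr => f1 r ?_, fun a ha => f3 a ?_⟩, ⟨fun r hr => ?_, ?_, ?_, ?_⟩, ?_, ?_⟩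
  · simp at hr; omega
  · simp at ha; omega
  · rw [f2 r (by omega)]
    split_ifs with h
    · rfl
    · rw [R4 r (Or.inr (by omega)), hF.1 r, hI.reg_zero r hr]
      intro hmem
      obtain rfl | ⟨r', hr', rfl⟩ := mem_modR_relocate hmem
      · omega
      · have := hnr r' hr'; omega
  · exact fun a h1 h2 p hp => hz a h1 p (hI.row_zero a h1 h2 p hp)
  · exact fun a h1 h2 p hp => hz a (by omega) p (hI.vec_zero a h1 h2 p hp)
  · exact fun a h1 p => hz a (by omega) p (hI.arr_zero a h1 p)
  · rw [f51]
    rcases d2 with h | ⟨h, x, hx, hs⟩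
    · exact Or.inl h
    · exact Or.inr ⟨h, _, (c2 x hx).1, hs⟩
  · rintro hcong hfalse ⟨r, hr, hs⟩
    rw [f51]
    refine d1 ?_
    rcases c4 r hr ((hcong r hr).2 hs.rowCongruent) with ⟨x, hx, rfl⟩ | hthr
    · exact ⟨x, hx, hs⟩
    · by_contra hno
      push Not at hno
      -- If no examined row had a solution, all `thr` listed rows would be false rows.
      have hsub : (Finset.range S.thr).image (σ₃.A 18) ⊆ falseRows S σ q := by
        intro r' hr'
        obtain ⟨x, hx, rfl⟩ := Finset.mem_image.1 hr'
        have hx' : x < σ₃.R 16 := by rw [hthr]; exact Finset.mem_range.1 hx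
        obtain ⟨k1, k2⟩ := c2 x hx'
        simp only [falseRows, Finset.mem_filter, Finset.mem_range]
        exact ⟨k1, (hcong _ k1).1 k2, hno x hx'⟩
      have hcard := Finset.card_le_card hsub
      rw [Finset.card_image_of_injOn, Finset.card_range] at hcard
      · omega
      · intro x hx y hy hxy
        simp only [Finset.coe_range, Set.mem_Iio, ← hthr] at hx hy
        rcases lt_trichotomy x y with h | h | h
        · have := c3 x y h hy; omega
        · exact h
        · have := c3 y x h hx; omega

/-- The sure part holds for every modulus. Once the modulus has few false rows, the only source of
failure is the program for matrices, with probability at most `1/3`. -/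
theorem attempt_spec {P : Cmd} {nr na T q : ℕ} {S : Params} (hS : S.Good w)
    (hnr : ∀ r ∈ modR P, r < nr) (hna : ∀ a ∈ modA P, a < na) (hP : SolvesSize P w S.N S.n T)
    (hT : T < 2 ^ w) {σ : Mem} (hσ : Setup S σ) (h5 : σ.R 5 < S.M) (h4 : σ.R 4 = q) (hq : S.Q ≤ q)
    (hq2 : q < 2 * S.Q) (hc : Clean S.N S.n σ) :
    H w (attempt P nr na) σ (S.time T nr na - 10) (fun σ' => Same σ σ' ∧ Clean S.N S.n σ' ∧
        (σ'.R 1 = σ.R 1 ∨ σ'.R 1 = 1 ∧ ∃ r < S.N, RowSolved S σ r)) ∧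
    ((falseRows S σ q).card < S.thr → (∃ r < S.N, RowSolved S σ r) →
      Pr w (attempt P nr na) σ (S.time T nr na - 10) (fun σ' => σ'.R 1 = 1) (2 / 3)) := by
  have hn := hS.size_le
  have hF1 : ∀ σ₁, Frame prepare σ σ₁ → σ₁.R 1 = σ.R 1 := fun σ₁ hF => hF.1 1 (by decide)
  have hs1 : ∀ σ₁, Frame prepare σ σ₁ → Same σ σ₁ := fun σ₁ hF =>
    Same.frame hF (by decide) (by decide)
  constructor
  · refine H.bind (prepare_spec hS hσ h4 hq hq2 hc h5) ?_
      (T₂ := S.time T nr na - ((S.N + 1) * (S.n * 600 + 10) + 60)) (by simp only [Params.time]; omega)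
    rintro σ₁ ⟨⟨hI, h98, hM⟩, hF⟩
    refine H.bind (H.relocate hI (by omega) hP hT h98).frame ?_
      (T₂ := S.N * 25 + S.thr * (S.b * (60 * S.b + 20) + 120) + T * (na * 2 + 20) + nr * 2 + 80)
      (by simp only [Params.time]; omega)
    rintro σ₂ ⟨hcall, hF₂⟩
    exact (finish_spec (q := q) hS hnr hna hσ h5 (hs1 _ hF) (hF1 _ hF) hI hcall hF₂).mono le_rfl
      fun σ' h => ⟨h.1, h.2.1, h.2.2.1⟩
  · intro hfalse hsol
    refine Pr.bind_right (prepare_spec hS hσ h4 hq hq2 hc h5) ?_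
      (T₂ := S.time T nr na - ((S.N + 1) * (S.n * 600 + 10) + 60)) (by simp only [Params.time]; omega)
    rintro σ₁ ⟨⟨hI, h98, hM⟩, hF⟩
    refine Pr.bind_left ((Pr.relocate hI (by omega) hP hT h98).and_H
      (H.relocate hI (by omega) hP hT h98).frame) ?_
      (T₂ := S.N * 25 + S.thr * (S.b * (60 * S.b + 20) + 120) + T * (na * 2 + 20) + nr * 2 + 80)
      (by simp only [Params.time]; omega)
    rintro σ₂ ⟨hout, hcall, hF₂⟩
    exact (finish_spec (q := q) hS hnr hna hσ h5 (hs1 _ hF) (hF1 _ hF) hI hcall hF₂).mono le_rfl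
      fun σ' h => h.2.2.2 (fun r hr => (hout r hr).trans (hM r hr)) hfalse hsol

/-- There is a solution. -/
def Solution (m : ℕ) (σ : Mem) : Prop := HasSum σ 0 m 0 m 0 m

theorem RowSolved.solution {S : Params} (hS : S.Good w) {σ : Mem} {r : ℕ} (h : RowSolved S σ r) :
    Solution S.m σ := by
  obtain ⟨x, y, z, h1, h2, h3, h4, h5, h6, h7⟩ := h
  exact ⟨x, y, z, zero_le, h2.trans_le (hS.hi_le _), zero_le, h4.trans_le (hS.hi_le _),
    zero_le, h6.trans_le (hS.hi_le _), h7⟩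

/-- The memory during the processing of the batches, which started with `σ`. -/
structure Running (S : Params) (σ σ' : Mem) : Prop where
  same : ∃ x y, Same ((σ.setR 4 x).setR 5 y) σ'
  clean : Clean S.N S.n σ'
  found : σ'.R 1 = 0 ∨ σ'.R 1 = 1 ∧ Solution S.m σ

theorem Setup.setR45 {S : Params} {σ : Mem} (h : Setup S σ) (x y : ℕ) :
    Setup S ((σ.setR 4 x).setR 5 y) :=
  ⟨h.R0, h.R6, h.R7, h.R8, h.R9, h.R10, h.R11, h.R12, h.R13, h.R17, h.inRange, h.A_le, h.B_le,
    h.B_mono, h.C_mono⟩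

theorem Running.setup {S : Params} {σ σ' : Mem} (h : Running S σ σ') (hσ : Setup S σ) :
    Setup S σ' := by
  obtain ⟨x, y, hs⟩ := h.same
  exact (hσ.setR45 x y).same hs

theorem Same.setR {σ σ' : Mem} (h : Same σ σ') (r x : ℕ) : Same (σ.setR r x) (σ'.setR r x) :=
  ⟨fun r' hr' => by simp only [Mem.setR_R, h.1 r' hr'], h.2⟩

theorem Mem.setR_setR (σ : Mem) (r x y : ℕ) : (σ.setR r x).setR r y = σ.setR r y := by
  ext r'
  · simp only [Mem.setR_R]; split_ifs <;> rfl
  · rfl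

theorem Mem.setR_comm (σ : Mem) {r r' : ℕ} (h : r ≠ r') (x y : ℕ) :
    (σ.setR r x).setR r' y = (σ.setR r' y).setR r x := by
  ext r''
  · simp only [Mem.setR_R]; split_ifs <;> first | rfl | omega
  · rfl

theorem Same.setR_right {σ σ' : Mem} (h : Same σ σ') {r : ℕ}
    (hr : r ∉ [0, 4, 5, 6, 7, 8, 9, 10, 11, 12, 13, 17]) (x : ℕ) : Same σ (σ'.setR r x) :=
  ⟨fun r' hr' => by
    rw [Mem.setR_R, if_neg]
    · exact h.1 r' hr'
    · rintro rfl; exact hr hr', h.2⟩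

theorem Running.setR {S : Params} {σ σ' : Mem} (h : Running S σ σ') {r : ℕ}
    (hr : r ∈ [3, 4, 5, 99]) (x : ℕ) : Running S σ (σ'.setR r x) := by
  obtain ⟨⟨a, b, hs⟩, hc, hf⟩ := h
  refine ⟨?_, hc.congr (fun r' hr' => ?_) fun _ _ => rfl, ?_⟩
  · simp only [List.mem_cons, List.not_mem_nil, or_false] at hr
    rcases hr with rfl | rfl | rfl | rfl
    · exact ⟨a, b, hs.setR_right (by decide) x⟩
    · refine ⟨x, b, ?_⟩
      have := hs.setR 4 x
      rwa [← Mem.setR_comm _ (by decide : (4 : ℕ) ≠ 5), Mem.setR_setR] at this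
    · refine ⟨a, x, ?_⟩
      have := hs.setR 5 x
      rwa [Mem.setR_setR] at this
    · exact ⟨a, b, hs.setR_right (by decide) x⟩
  · rw [Mem.setR_R, if_neg]
    rintro rfl
    simp at hr; omega
  · rw [Mem.setR_R, if_neg]
    · exact hf
    · rintro rfl; simp at hr

/-- The facts about the program and the parameters that are needed to process the batches. -/
structure Callable (w : ℕ) (P : Cmd) (nr na T : ℕ) (S : Params) : Prop where
  good : S.Good w
  regs : ∀ r ∈ modR P, r < nr
  arrs : ∀ a ∈ modA P, a < na
  solves : SolvesSize P w S.N S.n T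
  time_lt : T < 2 ^ w

theorem Same.solution {σ σ' : Mem} (h : Same σ σ') {m : ℕ} : Solution m σ' ↔ Solution m σ :=
  HasSum.congr (h.2 0 (by decide)) (h.2 1 (by decide)) (h.2 2 (by decide))

theorem Running.solution {S : Params} {σ σ' : Mem} (h : Running S σ σ') :
    Solution S.m σ' ↔ Solution S.m σ := by
  obtain ⟨x, y, hs⟩ := h.same
  exact hs.solution

/-- A round with the random word `x`. -/
theorem round_tail {P : Cmd} {nr na T : ℕ} {S : Params} (hC : Callable w P nr na T S) {σ σ' : Mem}
    (hσ : Setup S σ) (hR : Running S σ σ') (h5 : σ'.R 5 < S.M) (x : ℕ) :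
    H w (block [block [.set 3 .mod (.reg 3) (.reg 12), .set 4 .add (.reg 3) (.reg 12)],
      attempt P nr na]) (σ'.setR 3 x) (S.time T nr na) (fun σ'' => Running S σ σ'' ∧
        (σ'.R 1 = 1 → σ''.R 1 = 1)) ∧
    ((falseRows S σ' (x % S.Q + S.Q)).card < S.thr → (∃ r < S.N, RowSolved S σ' r) →
      Pr w (block [block [.set 3 .mod (.reg 3) (.reg 12), .set 4 .add (.reg 3) (.reg 12)],
        attempt P nr na]) (σ'.setR 3 x) (S.time T nr na) (fun σ'' => σ''.R 1 = 1) (2 / 3)) := by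
  have hS := hC.good
  have hw := hS.two_le
  have hset := hR.setup hσ
  have hx := Nat.mod_lt x hS.Q_pos
  have h1 := hS.pow_h
  have h2 : 2 ^ S.h ≤ 2 ^ S.H := Nat.pow_le_pow_right two_pos hS.h_lt.le
  have h3 := hS.H_lt
  set q := x % S.Q + S.Q with hq
  set σ₁ := (((σ'.setR 3 x).setR 3 (x % S.Q)).setR 4 q) with hσ₁
  have hR₁ : Running S σ σ₁ := ((hR.setR (by decide) _).setR (by decide) _).setR (by decide) _
  have e5 : σ₁.R 5 = σ'.R 5 := by simp [hσ₁]
  obtain ⟨t1, t2⟩ := attempt_spec hS hC.regs hC.arrs hC.solves hC.time_lt (hR₁.setup hσ) (by rwa [e5])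
    (show σ₁.R 4 = q by simp [hσ₁]) (by omega) (by omega) hR₁.clean
  have hS10 : 10 ≤ S.time T nr na := by simp only [Params.time]; omega
  have hwp : ∀ Φ : Mem → Prop, Φ σ₁ → wp w (block [.set 3 .mod (.reg 3) (.reg 12),
      .set 4 .add (.reg 3) (.reg 12)]) Φ (σ'.setR 3 x) := by
    intro Φ hΦ
    simp only [wp_block_cons, wp_block_nil, wp, Operand.fits_reg, Operand.ev_reg, Op.nat, Op.Fits,
      Mem.setR_R, hset.R12]
    simp only [reduceIte, Nat.reduceEqDiff, true_and]
    exact ⟨by omega, hΦ⟩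
  have efalse : falseRows S σ₁ q = falseRows S σ' q := rfl
  have esolved : ∀ r, RowSolved S σ₁ r ↔ RowSolved S σ' r := fun _ => Iff.rfl
  rw [efalse] at t2
  simp only [esolved] at t1 t2
  have e1 : σ₁.R 1 = σ'.R 1 := by simp [hσ₁]
  rw [e1] at t1
  constructor
  · refine H.start (T₂ := S.time T nr na - 7) (by omega) (hwp _ (H.last (H.mono t1 le_rfl ?_)
      (by omega))) (by simp only [cost, block]; omega)
    rintro σ₂ ⟨hs, hcl, hf⟩
    obtain ⟨a, b, hs₁⟩ := hR₁.same
    refine ⟨⟨⟨a, b, hs₁.trans hs⟩, hcl, ?_⟩, ?_⟩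
    · rcases hf with h | ⟨h, r, -, hr⟩
      · rw [h]; exact hR.found
      · exact Or.inr ⟨h, hR.solution.1 (hr.solution hS)⟩
    · intro h
      rcases hf with h' | h'
      · rw [h', h]
      · exact h'.1
  · intro hfalse hsol
    refine Pr.start (T₂ := S.time T nr na - 7) (by omega) (hwp _ (Pr.bind_left (t2 hfalse hsol)
      (fun _ h => H.nil h) (T := S.time T nr na - 7) (T₂ := 1) (by omega)))
      (by simp only [cost, block]; omega)

theorem round_spec {P : Cmd} {nr na T : ℕ} {S : Params} (hC : Callable w P nr na T S) {σ σ' : Mem}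
    (hσ : Setup S σ) (hR : Running S σ σ') (h5 : σ'.R 5 < S.M) :
    H w (round P nr na) σ' (S.time T nr na + 2) (fun σ'' => Running S σ σ'' ∧
        (σ'.R 1 = 1 → σ''.R 1 = 1)) :=
  H.rand fun x _ => (round_tail hC hσ hR h5 x).1

/-- Each residue modulo `Q` occurs `K` times below `Q K`. Since `Q` is a power of two dividing `2 ^
w`, reducing a random word gives a uniform modulus. -/
theorem card_residues {Q K : ℕ} (G : Finset ℕ) (hG : ∀ q ∈ G, Q ≤ q ∧ q < 2 * Q) :
    G.card * K ≤ ((Finset.range (Q * K)).filter fun x => x % Q + Q ∈ G).card := by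
  rw [← Finset.card_range K, ← Finset.card_product]
  rw [Finset.card_range]
  refine Finset.card_le_card_of_injOn (fun z => (z.1 - Q) + Q * z.2) ?_ ?_
  · rintro ⟨q, k⟩ h
    simp only [Finset.coe_product, Set.mem_prod, Finset.mem_coe, Finset.mem_range] at h
    obtain ⟨h1, h2⟩ := h
    have := hG q h1
    have h3 : Q * (k + 1) ≤ Q * K := Nat.mul_le_mul_left _ h2
    rw [mul_add] at h3
    simp only [Finset.coe_filter, Finset.mem_range, Set.mem_ofPred_eq]
    refine ⟨by omega, ?_⟩
    rw [Nat.add_mul_mod_self_left, Nat.mod_eq_of_lt (by omega), Nat.sub_add_cancel this.1]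
    exact h1
  · rintro ⟨q, k⟩ h ⟨q', k'⟩ h' heq
    simp only [Finset.coe_product, Set.mem_prod, Finset.mem_coe, Finset.mem_range] at h h'
    have a := hG q h.1
    have a' := hG q' h'.1
    simp only at heq
    have e1 : (q - Q + Q * k) % Q = q - Q := by
      rw [Nat.add_mul_mod_self_left, Nat.mod_eq_of_lt (by omega)]
    have e2 : (q' - Q + Q * k') % Q = q' - Q := by
      rw [Nat.add_mul_mod_self_left, Nat.mod_eq_of_lt (by omega)]
    have e3 : q = q' := by rw [heq, e2] at e1; omega
    subst e3
    have e4 : Q * k = Q * k' := by omega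
    have e5 : k = k' := Nat.eq_of_mul_eq_mul_left (by omega) e4
    rw [e5]

open Classical in
/-- The moduli that lead to few false rows. -/
noncomputable def goodModuli (S : Params) (σ : Mem) : Finset ℕ :=
  (Finset.Ico S.Q (2 * S.Q)).filter fun q => (falseRows S σ q).card < S.thr

/-- A good modulus is drawn with probability at least `3/4`, and the program for matrices is then
correct with probability at least `2/3`; the product is `1/2`. -/
theorem round_prob {P : Cmd} {nr na T : ℕ} {S : Params} (hC : Callable w P nr na T S) {σ σ' : Mem}
    (hσ : Setup S σ) (hR : Running S σ σ') (h5 : σ'.R 5 < S.M) (hQ : S.Q ∣ 2 ^ w)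
    (hgood : 3 * S.Q ≤ 4 * (goodModuli S σ').card) (hsol : ∃ r < S.N, RowSolved S σ' r) :
    Pr w (round P nr na) σ' (S.time T nr na + 2) (fun σ'' => σ''.R 1 = 1) (1 / 2) := by
  classical
  obtain ⟨K, hK⟩ := hQ
  have hcard := card_residues (K := K) (goodModuli S σ') (fun q hq => by
    simp only [goodModuli, Finset.mem_filter, Finset.mem_Ico] at hq
    exact hq.1)
  rw [← hK] at hcard
  set G := (Finset.range (2 ^ w)).filter fun x => x % S.Q + S.Q ∈ goodModuli S σ' with hG
  have h34 : 3 * 2 ^ w ≤ 4 * G.card := by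
    calc 3 * 2 ^ w = 3 * S.Q * K := by rw [hK, mul_assoc]
      _ ≤ 4 * (goodModuli S σ').card * K := Nat.mul_le_mul_right _ hgood
      _ ≤ 4 * G.card := by rw [mul_assoc]; omega
  have hreal : (3 / 4 : ℝ≥0∞) * 2 ^ w ≤ G.card := by
    have h' : (3 * 2 ^ w : ℝ≥0∞) ≤ 4 * G.card := by exact_mod_cast h34
    rw [div_eq_mul_inv, mul_right_comm, ← div_eq_mul_inv]
    exact ENNReal.div_le_of_le_mul' h'
  have hhalf : (3 / 4 : ℝ≥0∞) * (2 / 3) = 1 / 2 := by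
    have h4 : (4 : ℝ≥0∞) = 2 * 2 := by norm_num
    rw [← ENNReal.toReal_eq_toReal_iff' (by finiteness) (by finiteness)]
    simp only [ENNReal.toReal_mul, ENNReal.toReal_div, ENNReal.toReal_ofNat, ENNReal.toReal_one]
    norm_num
  rw [← hhalf]
  refine Pr.rand (S := G) (fun x hx => ?_) hreal fun x hx => ?_
  · simp only [hG, Finset.mem_filter, Finset.mem_range] at hx
    exact hx.1
  · simp only [hG, goodModuli, Finset.mem_filter, Finset.mem_range] at hx
    exact (round_tail hC hσ hR h5 x).2 hx.2.2 hsol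

/-- Process all batches. -/
def batches (P : Cmd) (nr na : ℕ) : Cmd :=
  block [mov 5 (.const 0), forTo 5 (.reg 11) (.seq (round P nr na) (round P nr na))]

theorem not_mem_modR_round {P : Cmd} {nr na r : ℕ} (hr : r ∈ [5, 11]) :
    r ∉ modR (round P nr na) := by
  have hC : ∀ n, r ∉ modR (clearCells n) := fun n h => by
    rw [clearCells, modR_block] at h
    simp [modR] at h
  have hR : ∀ n, r ∉ modR (clearRegs n) := fun n h => by
    rw [clearRegs, modR_block] at h
    simp [modR, mov] at h
    simp at hr
    omega
  have hP : r ∉ modR (relocate P) := fun h => by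
    simp at hr
    rcases mem_modR_relocate h with h | ⟨r', -, h⟩ <;> omega
  simp only [round, attempt, clear, modR_block, List.mem_cons, List.not_mem_nil, or_false,
    exists_eq_or_imp, exists_eq_left, not_or]
  simp only [List.mem_cons, List.not_mem_nil, or_false] at hr
  refine ⟨?_, ?_, ?_, hP, ?_, ?_, ?_, ?_, hR _⟩
  · rcases hr with rfl | rfl <;> decide
  · rcases hr with rfl | rfl <;> decide
  · rcases hr with rfl | rfl <;> decide
  · rcases hr with rfl | rfl <;> decide
  · rcases hr with rfl | rfl <;> decide
  · rcases hr with rfl | rfl <;> decide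
  · simp only [forTo, modR, modR_block, List.mem_cons, List.not_mem_nil, or_false, List.mem_append,
      exists_eq_or_imp, exists_eq_left, not_or]
    refine ⟨?_, ⟨?_, hC _⟩, ?_, ?_⟩ <;> rcases hr with rfl | rfl <;> decide

theorem falseRows_same {S : Params} {σ σ' : Mem} (h : Same σ σ') (q : ℕ) :
    falseRows S σ' q = falseRows S σ q := by
  classical
  unfold falseRows
  refine Finset.filter_congr fun r _ => ?_
  rw [RowSolved.same h]
  unfold RowCongruent Congruent
  rw [h.1 5 (by decide), h.2 0 (by decide), h.2 1 (by decide), h.2 2 (by decide),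
    h.2 4 (by decide), h.2 5 (by decide), h.2 6 (by decide)]

theorem goodModuli_same {S : Params} {σ σ' : Mem} (h : Same σ σ') :
    goodModuli S σ' = goodModuli S σ := by
  unfold goodModuli
  simp only [falseRows_same h]

/-- One batch `β` with a solution is enough: register `1` is never reset, and it is set only for
genuine solutions. No union bound over the batches is needed. -/
theorem batches_spec {P : Cmd} {nr na T : ℕ} {S : Params} (hC : Callable w P nr na T S) {σ : Mem}
    (hσ : Setup S σ) (hc : Clean S.N S.n σ) (h1 : σ.R 1 = 0) :
    H w (batches P nr na) σ (S.M * (2 * S.time T nr na + 10) + 10) (Running S σ) ∧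
    (S.Q ∣ 2 ^ w → ∀ β < S.M, 3 * S.Q ≤ 4 * (goodModuli S (σ.setR 5 β)).card →
      (∃ r < S.N, RowSolved S (σ.setR 5 β) r) →
      Pr w (batches P nr na) σ (S.M * (2 * S.time T nr na + 10) + 10) (fun σ' => σ'.R 1 = 1)
        (2 / 3)) := by
  have hw := hC.good.two_le
  have hR₀ : Running S σ (σ.setR 5 0) := by
    refine ⟨⟨σ.R 4, 0, ?_⟩, hc.congr (fun r' hr' => ?_) fun _ _ => rfl, Or.inl (by simp [h1])⟩
    · have : (σ.setR 4 (σ.R 4)) = σ := by ext r <;> simp [Mem.setR]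
      rw [this]; exact Same.refl _
    · rw [Mem.setR_R, if_neg (by omega)]
  have hm5 : 5 ∉ 99 :: modR (.seq (round P nr na) (round P nr na)) := by
    simp only [modR, List.mem_cons, List.mem_append, not_or]
    exact ⟨by decide, not_mem_modR_round (by decide), not_mem_modR_round (by decide)⟩
  have hm11 : ∀ r ∈ (Operand.reg 11).regs,
      r ∉ 5 :: 99 :: modR (.seq (round P nr na) (round P nr na)) := by
    simp only [Operand.regs, modR, List.mem_cons, List.mem_append, not_or, List.not_mem_nil, or_false,
      forall_eq]
    exact ⟨by decide, by decide, not_mem_modR_round (by decide), not_mem_modR_round (by decide)⟩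
  have hbody : ∀ σ', Running S σ σ' → σ'.R 5 < S.M → H w (.seq (round P nr na) (round P nr na)) σ'
      (2 * S.time T nr na + 5) (fun σ'' => Running S σ σ'' ∧ (σ'.R 1 = 1 → σ''.R 1 = 1)) := by
    intro σ' hR h5
    refine (H.seq (T₁ := S.time T nr na + 2) (T₂ := S.time T nr na + 2)
      ((round_spec hC hσ hR h5).frame.mono le_rfl ?_)).time (by omega)
    rintro σ₂ ⟨⟨hR₂, hf⟩, hF⟩
    have e5 : σ₂.R 5 = σ'.R 5 := hF.1 5 (not_mem_modR_round (by decide))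
    exact (round_spec hC hσ hR₂ (by rwa [e5])).mono le_rfl fun σ₃ h => ⟨h.1, fun h' => h.2 (hf h')⟩
  have h11 : (σ.setR 5 0).R 11 = S.M := by simp [hσ.R11]
  constructor
  · refine H.start (T₂ := S.M * (2 * S.time T nr na + 10) + 5) (by omega) ?_
      (by simp only [cost, mov]; omega)
    rw [wp_mov (by simp)]
    refine H.last (H.mono (H.forTo_const (by omega) (lo := 0) (hi := S.M)
      (t := 2 * S.time T nr na + 5) (Inv := fun _ => Running S σ)
      (Operand.fits_reg _) hm5 hm11 (by simp) h11 (Nat.zero_le _) hR₀ ?_ ?_) le_rfl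
      fun σ' h => h.1) (by rw [Nat.sub_zero])
    · exact fun k σ' v v' h => (h.setR (by decide) v).setR (by decide) v'
    · rintro k σ' - hk hR h5 -
      exact (hbody σ' hR (by omega)).mono le_rfl fun _ h => h.1
  · intro hQ β hβ hgood hsol
    refine Pr.start (T₂ := S.M * (2 * S.time T nr na + 10) + 5) (by omega) ?_
      (by simp only [cost, mov]; omega)
    rw [wp_mov (by simp)]
    refine Pr.bind_left (Pr.forTo (by omega) (lo := 0) (mid := β) (hi := S.M)
      (t := 2 * S.time T nr na + 5) (Inv := fun _ => Running S σ)
      (Inv' := fun _ σ' => σ'.R 1 = 1 ∧ Running S σ σ')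
      (Operand.fits_reg _) hm5 hm11 (by simp) h11 (Nat.zero_le _) hβ hR₀ ?_ ?_ ?_ ?_ ?_)
      (fun σ' h => H.nil h.1) (by rw [Nat.sub_zero])
    · exact fun k σ' v v' h => (h.setR (by decide) v).setR (by decide) v'
    · exact fun k σ' v v' h => ⟨by simpa using h.1, (h.2.setR (by decide) v).setR (by decide) v'⟩
    · rintro k σ' - hk hR h5 -
      exact (hbody σ' hR (by omega)).mono le_rfl fun _ h => h.1
    · rintro σ' hR h5 -
      have step : ∀ σ', Running S σ σ' → σ'.R 5 = β →
          Pr w (round P nr na) σ' (S.time T nr na + 2)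
            (fun σ'' => σ''.R 1 = 1 ∧ Running S σ σ'' ∧ σ''.R 5 = β) (1 / 2) := by
        intro σ' hR h5
        obtain ⟨x, y, hs⟩ := hR.same
        have hy : σ'.R 5 = y := by rw [hs.1 5 (by decide)]; simp
        rw [h5] at hy
        subst hy
        refine ((round_prob hC hσ hR (by omega) hQ ?_ ?_).and_H
          (round_spec hC hσ hR (by omega)).frame).mono le_rfl fun σ'' h =>
            ⟨h.1, h.2.1.1, by rw [h.2.2.1 5 (not_mem_modR_round (by decide)), h5]⟩
        · rw [goodModuli_same hs]; exact hgood
        · obtain ⟨r, hr, h⟩ := hsol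
          exact ⟨r, hr, (RowSolved.same hs).2 h⟩
      have stepH : ∀ σ', Running S σ σ' → σ'.R 5 = β →
          H w (round P nr na) σ' (S.time T nr na + 2)
            (fun σ'' => (Running S σ σ'' ∧ (σ'.R 1 = 1 → σ''.R 1 = 1)) ∧ σ''.R 5 = β) := by
        intro σ' hR h5
        exact (round_spec hC hσ hR (by omega)).frame.mono le_rfl fun σ'' h =>
          ⟨h.1, by rw [h.2.1 5 (not_mem_modR_round (by decide)), h5]⟩
      -- Two rounds of probability `1/2` give `1/2 + 1/2 · 1/2 = 3/4`, which exceeds `2/3`.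
      have := Pr.twice (step σ' hR h5) (stepH σ' hR h5) (fun σ₂ h => step σ₂ h.1.1 h.2)
        (fun σ₂ h => (stepH σ₂ h.2.1 h.2.2).mono le_rfl fun σ₃ h' =>
          ⟨h'.1.2 h.1, h'.1.1, h'.2⟩) (by
            rw [one_div]; exact ENNReal.inv_le_one.2 (by norm_num))
      refine (this.mono (by omega) fun σ₃ h => ⟨h.1, h.2.1⟩).weaken ?_
      have h12 : (1 : ℝ≥0∞) - 1 / 2 = 1 / 2 := by simp
      rw [h12, ← ENNReal.toReal_le_toReal (by finiteness) (by finiteness),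
        ENNReal.toReal_add (by finiteness) (by finiteness)]
      simp only [ENNReal.toReal_mul, ENNReal.toReal_div, ENNReal.toReal_ofNat, ENNReal.toReal_one]
      norm_num
    · rintro k σ' - hk ⟨hf, hR⟩ h5 -
      exact (hbody σ' hR (by omega)).mono le_rfl fun _ h => ⟨h.2 hf, h.1⟩

/-! ### Preparing the sets -/

/-- Compute the binary logarithm of register `0` in register `60`. -/
def logarithm : Cmd :=
  block [mov 60 (.const 0), .set 61 .shr (.reg 0) (.const 1),
    .loop (.reg 61) (block [.set 60 .add (.reg 60) (.const 1), .set 61 .shr (.reg 61) (.const 1)])]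

theorem logarithm_spec (hw : 2 ≤ w) {σ : Mem} {m : ℕ} (hm : 0 < m) (hmw : m < 2 ^ w)
    (h0 : σ.R 0 = m) :
    H w logarithm σ (Nat.log 2 m * 10 + 10)
      (fun σ' => σ'.R 60 = Nat.log 2 m ∧ Frame logarithm σ σ') := by
  have h4 : 4 ≤ 2 ^ w := le_trans (by norm_num) (Nat.pow_le_pow_right two_pos hw)
  have hw0 : w ≠ 0 := by omega
  have hlog : Nat.log 2 m < w := Nat.log_lt_of_lt_pow hm.ne' hmw
  have hww : w < 2 ^ w := Nat.lt_two_pow_self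
  refine H.frame ?_
  refine H.start (T₂ := Nat.log 2 m * 10 + 8) (by omega) ?_ (by simp [cost, mov]; omega)
  rw [wp_mov (by simp)]
  refine H.start (T₂ := Nat.log 2 m * 10 + 6) (by omega) ?_ (by simp [cost]; omega)
  simp only [wp, Op.nat, Op.Fits, Operand.fits_const, Operand.fits_reg, Operand.ev_const,
    Operand.ev_reg, true_and]
  refine ⟨by omega, H.last (H.mono (H.loop (lo := 0) (hi := Nat.log 2 m) (t := fun _ => 5)
    (Inv := fun k σ' => σ'.R 60 = k ∧ σ'.R 61 = m / 2 ^ (k + 1)) trivial (Nat.zero_le _) ?_ ?_ ?_)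
    le_rfl fun σ' h => h.1) ?_⟩
  · simp [h0]
  · rintro k σ' - hk ⟨e60, e61⟩
    constructor
    · rw [Operand.ev_reg, e61]
      have : 2 ^ (k + 1) ≤ m := Nat.pow_le_of_le_log hm.ne' hk
      exact (Nat.div_pos this (by positivity)).ne'
    · refine H.of_wp' (by omega) (by decide) ?_
      simp [block, wp, Op.nat, Op.Fits, e60, e61, hw0]
      refine ⟨by omega, ?_⟩
      rw [Nat.div_div_eq_div_mul, ← pow_succ]
  · rintro σ' ⟨-, e61⟩
    rw [Operand.ev_reg, e61]
    exact Nat.div_eq_of_lt (Nat.lt_pow_succ_log_self one_lt_two m)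
  · simp; omega

/-- The first `m` cells contain the set in increasing order. -/
structure Sorts {m : ℕ} (U : ℕ) (F : Fin m → ℕ) (f : ℕ → ℕ) : Prop where
  lt : ∀ x y, x < y → y < m → f x < f y
  le : ∀ x, f x ≤ U
  range : ∀ v, (∃ x < m, f x = v) ↔ ∃ i, F i = v

theorem mem_firstValues {f : ℕ → ℕ} {n v : ℕ} : v ∈ firstValues f n ↔ ∃ x < n, f x = v := by
  simp [firstValues]

/-- Injectivity makes the sorted list free of repetitions, so weak order becomes strict. The zeros
beyond position `m` keep the bound `U` valid for all positions. -/
theorem Sorts.of_perm {m U : ℕ} {F : Fin m → ℕ} {f f' : ℕ → ℕ} (hF : Function.Injective F)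
    (hU : ∀ i, F i ≤ U) (hf : ∀ i : Fin m, f i = F i) (h0 : ∀ x, m ≤ x → f x = 0)
    (hp : (firstValues f' m).Perm (firstValues f m)) (hs : (firstValues f' m).Pairwise (· ≤ ·))
    (ht : ∀ x, m ≤ x → f' x = f x) : Sorts U F f' := by
  have hr : ∀ v, (∃ x < m, f x = v) ↔ ∃ i, F i = v := fun v =>
    ⟨fun ⟨x, hx, h⟩ => ⟨⟨x, hx⟩, by rw [← hf, ← h]⟩, fun ⟨i, h⟩ => ⟨i, i.2, by rw [hf, h]⟩⟩
  have hr' : ∀ v, (∃ x < m, f' x = v) ↔ ∃ i, F i = v := fun v => by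
    rw [← hr, ← mem_firstValues, ← mem_firstValues, hp.mem_iff]
  have hn : (firstValues f m).Nodup := by
    refine List.Nodup.map_on (fun x hx y hy h => ?_) List.nodup_range
    have := hF (a₁ := ⟨x, List.mem_range.1 hx⟩) (a₂ := ⟨y, List.mem_range.1 hy⟩)
      (by rw [← hf, ← hf]; exact h)
    simpa using this
  have hlt : (firstValues f' m).Pairwise (· < ·) := by
    refine ((List.pairwise_and_iff).2 ⟨hs, hp.nodup_iff.2 hn⟩).imp fun h => lt_of_le_of_ne h.1 h.2
  refine ⟨fun x y hxy hy => ?_, fun x => ?_, hr'⟩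
  · have := List.pairwise_iff_getElem.1 hlt x y (by simp; omega) (by simpa) hxy
    simpa [firstValues] using this
  · rcases lt_or_ge x m with hx | hx
    · obtain ⟨i, hi⟩ := (hr' (f' x)).1 ⟨x, hx, rfl⟩
      rw [← hi]; exact hU i
    · rw [ht x hx, h0 x hx]; exact Nat.zero_le _

/-- Sort the three sets. -/
def sortAll : Cmd := block [sortArray 0, sortArray 1, sortArray 2]

theorem sortAll_spec (hw : 2 ≤ w) {σ : Mem} {m L U : ℕ} {A B C : Fin m → ℕ}
    (hm : σ.R 0 = m) (h50 : σ.R 50 = L) (hmw : m + m < 2 ^ w) (hL : U < 2 ^ L)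
    (hA : Function.Injective A) (hB : Function.Injective B) (hC : Function.Injective C)
    (hAU : ∀ i, A i ≤ U) (hBU : ∀ i, B i ≤ U) (hCU : ∀ i, C i ≤ U)
    (fA : ∀ i : Fin m, σ.A 0 i = A i) (fB : ∀ i : Fin m, σ.A 1 i = B i)
    (fC : ∀ i : Fin m, σ.A 2 i = C i)
    (zA : ∀ x, m ≤ x → σ.A 0 x = 0) (zB : ∀ x, m ≤ x → σ.A 1 x = 0)
    (zC : ∀ x, m ≤ x → σ.A 2 x = 0) :
    H w sortAll σ (3 * (L * (m * 70 + 40)) + 40) (fun σ' =>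
      (Sorts U A (σ'.A 0) ∧ Sorts U B (σ'.A 1) ∧ Sorts U C (σ'.A 2)) ∧ Frame sortAll σ σ') := by
  have hbound : ∀ {f : ℕ → ℕ} {F : Fin m → ℕ}, (∀ i : Fin m, f i = F i) → (∀ i, F i ≤ U) →
      ∀ x ∈ firstValues f m, x < 2 ^ L := by
    intro f F hf hU x hx
    obtain ⟨y, hy, rfl⟩ := mem_firstValues.1 hx
    have := hU ⟨y, hy⟩
    rw [← hf] at this
    exact this.trans_lt hL
  refine H.frame ?_
  refine H.bind (T₂ := 2 * (L * (m * 70 + 40)) + 25) (sortArray_spec hw (by decide) hm h50 hmw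
    (hbound fA hAU)) ?_ (by omega)
  rintro σ₁ ⟨⟨p₁, s₁, t₁⟩, hF₁⟩
  have e1 : σ₁.A 1 = σ.A 1 := hF₁.2 1 (by decide)
  have e2 : σ₁.A 2 = σ.A 2 := hF₁.2 2 (by decide)
  refine H.bind (T₂ := (L * (m * 70 + 40)) + 13) (sortArray_spec hw (by decide)
    ((hF₁.1 0 (by decide)).trans hm) ((hF₁.1 50 (by decide)).trans h50) hmw
    (by rw [e1]; exact hbound fB hBU)) ?_ (by omega)
  rintro σ₂ ⟨⟨p₂, s₂, t₂⟩, hF₂⟩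
  have e2' : σ₂.A 2 = σ.A 2 := (hF₂.2 2 (by decide)).trans e2
  refine H.last (H.mono (sortArray_spec hw (by decide)
    ((hF₂.1 0 (by decide)).trans ((hF₁.1 0 (by decide)).trans hm))
    ((hF₂.1 50 (by decide)).trans ((hF₁.1 50 (by decide)).trans h50)) hmw
    (by rw [e2']; exact hbound fC hCU)) le_rfl ?_) (by omega)
  rintro σ₃ ⟨⟨p₃, s₃, t₃⟩, hF₃⟩
  rw [e1] at p₂ t₂
  rw [e2'] at p₃ t₃
  refine ⟨?_, ?_, Sorts.of_perm hC hCU fC zC p₃ s₃ t₃⟩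
  · rw [hF₃.2 0 (by decide), hF₂.2 0 (by decide)]
    exact Sorts.of_perm hA hAU fA zA p₁ s₁ t₁
  · rw [hF₃.2 1 (by decide)]
    exact Sorts.of_perm hB hBU fB zB p₂ s₂ t₂

/-- Copy the first elements of the blocks of array `a` to the array `a + 14`, followed by the content
of register `e`. -/
def boundary (a e : ℕ) : Cmd :=
  block [mov 66 (.const 0), forTo 66 (.reg 9) (block [.set 67 .mul (.reg 66) (.reg 10),
    .load 68 a (.reg 67), .store (a + 14) (.reg 66) (.reg 68)]), .store (a + 14) (.reg 9) (.reg e)]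

theorem boundary_spec (hw : 2 ≤ w) {σ : Mem} {a e g b : ℕ} (h9 : σ.R 9 = g) (h10 : σ.R 10 = b)
    (he : e ∉ [66, 67, 68, 99]) (hb : ∀ i < g, i * b < 2 ^ w) :
    H w (boundary a e) σ (g * 15 + 15) (fun σ' =>
      ((∀ i < g, σ'.A (a + 14) i = σ.A a (i * b)) ∧ σ'.A (a + 14) g = σ.R e) ∧
      Frame (boundary a e) σ σ') := by
  have h4 : 4 ≤ 2 ^ w := le_trans (by norm_num) (Nat.pow_le_pow_right two_pos hw)
  have hw0 : w ≠ 0 := by omega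
  simp only [List.mem_cons, List.not_mem_nil, or_false, not_or] at he
  refine H.frame ?_
  refine H.start (T₂ := g * 15 + 13) (by omega) ?_ (by simp [cost, mov]; omega)
  rw [wp_mov (by simp)]
  refine H.bind (T₂ := 3) (H.forTo_const (by omega) (lo := 0) (hi := g) (t := 10)
    (Inv := fun k σ' => ∀ i < k, σ'.A (a + 14) i = σ.A a (i * b)) (Operand.fits_reg _)
    (by simp [block, modR]) (by simp [block, modR, Operand.regs]) (by simp) (by simp [h9])
    (Nat.zero_le _) (by simp) ?_ ?_) ?_ (by rw [Nat.sub_zero]; omega)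
  · intro k σ' v v' h
    simpa using h
  · rintro k σ' - hk i1 e66 hF
    have e10 := hF.1 10 (by simp [block, modR, forTo])
    have ea : σ'.A a = σ.A a := hF.2 a (by simp [block, modA, forTo])
    simp [h10] at e10
    have := hb k hk
    refine H.of_wp' (by omega) (by simp [block, cost]) ?_
    simp [block, wp, Op.nat, Op.Fits, e10, e66, ea]
    refine ⟨this, fun i hi => ?_⟩
    rcases hi.eq_or_lt with rfl | hi
    · simp
    · rw [Function.update_of_ne hi.ne, i1 i hi]
  · rintro σ' ⟨i1, -, hF⟩
    have e9 := hF.1 9 (by simp [block, modR, forTo])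
    have ee := hF.1 e (by simp [block, modR, forTo]; omega)
    simp [h9] at e9
    simp [he.1] at ee
    refine H.start (T₂ := 1) (by omega) ?_ (by simp [cost])
    simp [wp, e9, ee]
    refine H.nil ⟨fun i hi => ?_, by simp⟩
    simp
    rw [Function.update_of_ne hi.ne, i1 i hi]

/-- Copy the first elements of all blocks. -/
def boundaries : Cmd := block [boundary 0 65, boundary 1 65, boundary 2 64]

theorem boundaries_spec (hw : 2 ≤ w) {σ : Mem} {g b : ℕ} (h9 : σ.R 9 = g) (h10 : σ.R 10 = b)
    (hb : ∀ i < g, i * b < 2 ^ w) :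
    H w boundaries σ (g * 45 + 60) (fun σ' =>
      ((∀ i < g, σ'.A 14 i = σ.A 0 (i * b)) ∧ (∀ i < g, σ'.A 15 i = σ.A 1 (i * b)) ∧
      (∀ i < g, σ'.A 16 i = σ.A 2 (i * b)) ∧ σ'.A 14 g = σ.R 65 ∧ σ'.A 15 g = σ.R 65 ∧
      σ'.A 16 g = σ.R 64) ∧ Frame boundaries σ σ') := by
  refine H.frame ?_
  refine H.bind (T₂ := g * 30 + 40) (boundary_spec hw h9 h10 (by decide) hb) ?_ (by omega)
  rintro σ₁ ⟨⟨a1, b1⟩, hF₁⟩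
  refine H.bind (T₂ := g * 15 + 20) (boundary_spec hw ((hF₁.1 9 (by decide)).trans h9)
    ((hF₁.1 10 (by decide)).trans h10) (by decide) hb) ?_ (by omega)
  rintro σ₂ ⟨⟨a2, b2⟩, hF₂⟩
  refine H.last (H.mono (boundary_spec hw ((hF₂.1 9 (by decide)).trans
    ((hF₁.1 9 (by decide)).trans h9)) ((hF₂.1 10 (by decide)).trans
    ((hF₁.1 10 (by decide)).trans h10)) (by decide) hb) le_rfl ?_) (by omega)
  rintro σ₃ ⟨⟨a3, b3⟩, hF₃⟩
  simp only [Nat.reduceAdd] at *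
  rw [hF₃.2 14 (by decide), hF₂.2 14 (by decide), hF₃.2 15 (by decide)]
  rw [hF₁.2 1 (by decide), hF₁.1 65 (by decide)] at *
  rw [hF₂.2 2 (by decide), hF₁.2 2 (by decide), hF₂.1 64 (by decide), hF₁.1 64 (by decide)] at *
  exact ⟨a1, a2, a3, b1, b2, b3⟩

/-! ### Most moduli are good -/

/-- If row `r` is false for `q`, then `q` divides the nonzero difference of `A x + B y` and `C z`
for one of the at most `b³` triples of elements in its blocks. Each such difference is at most `2 U`
and has at most `d` divisors. -/
theorem card_filter_falseRows_le {S : Params} (hS : S.Good w) {σ : Mem} (hσ : Setup S σ)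
    (hC : ∀ z, σ.A 2 z ≤ S.U) {d r : ℕ} (hd : ∀ x ≤ 2 * S.U, x.divisors.card ≤ d) :
    ((Finset.Ico S.Q (2 * S.Q)).filter fun q => r ∈ falseRows S σ q).card ≤ S.b ^ 3 * d := by
  classical
  set i := σ.A 4 (σ.R 5 * S.N + r) with hi
  set j := σ.A 6 (σ.R 5) with hj
  set k := σ.A 5 (σ.R 5 * S.N + r) with hk
  -- The absolute difference, as the sum of the two truncated differences, one of which is zero.
  let δ : ℕ × ℕ × ℕ → ℕ := fun t =>
    (σ.A 0 (S.lo i + t.1) + σ.A 1 (S.lo j + t.2.1) - σ.A 2 (S.lo k + t.2.2)) +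
    (σ.A 2 (S.lo k + t.2.2) - (σ.A 0 (S.lo i + t.1) + σ.A 1 (S.lo j + t.2.1)))
  have hsub : ((Finset.Ico S.Q (2 * S.Q)).filter fun q => r ∈ falseRows S σ q) ⊆
      (Finset.range S.b ×ˢ Finset.range S.b ×ˢ Finset.range S.b).biUnion
        fun t => (δ t).divisors := by
    intro q hq
    simp only [Finset.mem_filter, falseRows, RowCongruent, ← hi, ← hj, ← hk] at hq
    obtain ⟨-, -, ⟨x, y, z, h1, h2, h3, h4, h5, h6, h7⟩, hn⟩ := hq
    have b1 := hS.hi_sub_lo_le i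
    have b2 := hS.hi_sub_lo_le j
    have b3 := hS.hi_sub_lo_le k
    refine Finset.mem_biUnion.2 ⟨(x - S.lo i, y - S.lo j, z - S.lo k), ?_, ?_⟩
    · simp only [Finset.mem_product, Finset.mem_range]
      omega
    · have hne : σ.A 0 x + σ.A 1 y ≠ σ.A 2 z := fun h =>
        hn ⟨x, y, z, h1, h2, h3, h4, h5, h6, h⟩
      simp only [δ, Nat.add_sub_cancel' h1, Nat.add_sub_cancel' h3, Nat.add_sub_cancel' h5]
      rw [Nat.mem_divisors]
      refine ⟨?_, by omega⟩
      rcases le_total (σ.A 0 x + σ.A 1 y) (σ.A 2 z) with h | h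
      · rw [Nat.sub_eq_zero_of_le h, zero_add]
        exact (Nat.modEq_iff_dvd' h).1 h7
      · rw [Nat.sub_eq_zero_of_le h, add_zero]
        exact (Nat.modEq_iff_dvd' h).1 h7.symm
  refine (Finset.card_le_card hsub).trans ((Finset.card_biUnion_le_card_mul _ _ d ?_).trans
    (le_of_eq ?_))
  · intro t _
    refine hd _ ?_
    have := hσ.A_le (S.lo i + t.1)
    have := hσ.B_le (S.lo j + t.2.1)
    have := hC (S.lo k + t.2.2)
    simp only [δ]
    omega
  · simp only [Finset.card_product, Finset.card_range]; ring

/-- Markov's inequality by double counting: `thr` times the number of bad moduli is at most the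
number of pairs of a modulus and a false row, hence at most `N b³ d`, which is at most `thr Q / 4`.
-/
theorem three_mul_le_card_goodModuli {S : Params} (hS : S.Good w) {σ : Mem} (hσ : Setup S σ)
    (hC : ∀ z, σ.A 2 z ≤ S.U) {d : ℕ} (hd : ∀ x ≤ 2 * S.U, x.divisors.card ≤ d)
    (hthr : 0 < S.thr) (h : 4 * (S.N * (S.b ^ 3 * d)) ≤ S.thr * S.Q) :
    3 * S.Q ≤ 4 * (goodModuli S σ).card := by
  classical
  have hpart := Finset.card_filter_add_card_filter_not (s := Finset.Ico S.Q (2 * S.Q))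
    (p := fun q => (falseRows S σ q).card < S.thr)
  rw [Nat.card_Ico] at hpart
  set bad := (Finset.Ico S.Q (2 * S.Q)).filter fun q => ¬ (falseRows S σ q).card < S.thr with hbad
  have hcount : S.thr * bad.card ≤ S.N * (S.b ^ 3 * d) := by
    calc S.thr * bad.card = ∑ _q ∈ bad, S.thr := by simp [mul_comm]
      _ ≤ ∑ q ∈ bad, (falseRows S σ q).card := Finset.sum_le_sum fun q hq => by
          simp only [hbad, Finset.mem_filter, not_lt] at hq
          exact hq.2
      _ ≤ ∑ q ∈ Finset.Ico S.Q (2 * S.Q), (falseRows S σ q).card :=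
          Finset.sum_le_sum_of_subset (Finset.filter_subset _ _)
      _ = ∑ q ∈ Finset.Ico S.Q (2 * S.Q), ∑ r ∈ Finset.range S.N,
            if r ∈ falseRows S σ q then 1 else 0 := Finset.sum_congr rfl fun q _ => by
          rw [← Finset.card_filter, Finset.filter_mem_eq_inter, Finset.inter_eq_right.2]
          exact Finset.filter_subset _ _
      _ = ∑ r ∈ Finset.range S.N,
            ((Finset.Ico S.Q (2 * S.Q)).filter fun q => r ∈ falseRows S σ q).card := by
          rw [Finset.sum_comm]
          exact Finset.sum_congr rfl fun r _ => (Finset.card_filter _ _).symm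
      _ ≤ ∑ _r ∈ Finset.range S.N, S.b ^ 3 * d :=
          Finset.sum_le_sum fun r _ => card_filter_falseRows_le hS hσ hC hd
      _ = S.N * (S.b ^ 3 * d) := by simp
  have h4 : 4 * bad.card ≤ S.Q := by
    refine Nat.le_of_mul_le_mul_left ?_ hthr
    calc S.thr * (4 * bad.card) = 4 * (S.thr * bad.card) := by ring
      _ ≤ _ := (Nat.mul_le_mul_left 4 hcount).trans h
  unfold goodModuli
  omega

/-! ### The first elements of the blocks -/

/-- The arrays `14`–`16` contain the first elements of the blocks, followed by large numbers. -/
structure Boundaries (S : Params) (V : ℕ) (σ : Mem) : Prop where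
  A : ∀ i < S.g, σ.A 14 i = σ.A 0 (i * S.b)
  B : ∀ i < S.g, σ.A 15 i = σ.A 1 (i * S.b)
  C : ∀ i < S.g, σ.A 16 i = σ.A 2 (i * S.b)
  endA : σ.A 14 S.g = V
  endB : σ.A 15 S.g = V
  endC : σ.A 16 S.g = 4 * V

theorem boundary_mono {f α : ℕ → ℕ} {g b m U V : ℕ} (hf : ∀ x y, x < y → y < m → f x < f y)
    (hU : ∀ x, f x ≤ U) (hUV : U < V) (hb : ∀ i < g, i * b < m) (hα : ∀ i < g, α i = f (i * b))
    (hg : V ≤ α g) {i i' : ℕ} (h : i ≤ i') (h' : i' ≤ g) : α i ≤ α i' := by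
  rcases h.eq_or_lt with rfl | h
  · exact le_rfl
  rw [hα i (by omega)]
  rcases h'.eq_or_lt with rfl | h'
  · exact (hU _).trans (hUV.le.trans hg)
  · rw [hα i' h']
    rcases (Nat.mul_le_mul_right b h.le).eq_or_lt with h1 | h1
    · rw [h1]
    · exact (hf _ _ h1 (hb _ h')).le

/-- The sentinel `V` exceeds all elements, and the sentinel `4 V` for `C` exceeds every sum of two
entries of `A` and `B`, which are at most `V` each. -/
theorem Boundaries.blocks {S : Params} (hS : S.Good w) {V : ℕ} {σ : Mem} (h : Boundaries S V σ)
    (hUV : S.U < V) {A B C : Fin S.m → ℕ} (hA : Sorts S.U A (σ.A 0)) (hB : Sorts S.U B (σ.A 1))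
    (hC : Sorts S.U C (σ.A 2)) : Blocks S.g (σ.A 14) (σ.A 15) (σ.A 16) := by
  have mA : ∀ i i', i ≤ i' → i' ≤ S.g → σ.A 14 i ≤ σ.A 14 i' := fun _ _ =>
    boundary_mono hA.lt hA.le hUV hS.block_lt h.A h.endA.ge
  have mB : ∀ i i', i ≤ i' → i' ≤ S.g → σ.A 15 i ≤ σ.A 15 i' := fun _ _ =>
    boundary_mono hB.lt hB.le hUV hS.block_lt h.B h.endB.ge
  refine ⟨hS.g_pos, mA, mB, fun _ _ => boundary_mono hC.lt hC.le hUV hS.block_lt h.C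
    (by have := h.endC; omega), fun i j hi hj => ?_⟩
  have h1 := mA i S.g hi le_rfl
  have h2 := mB j S.g hj le_rfl
  rw [h.endA] at h1
  rw [h.endB] at h2
  rw [h.endC]
  omega

theorem Boundaries.lt_next {f α : ℕ → ℕ} {g b m U V : ℕ} (hf : ∀ x y, x < y → y < m → f x < f y)
    (hU : ∀ x, f x ≤ U) (hUV : U < V) (hm : ∀ i < g, i * b < m) (hα : ∀ i < g, α i = f (i * b))
    (hg : V ≤ α g) (hb : 0 < b) {x : ℕ} (hx : x < g * b) : f x < α (x / b + 1) := by
  have hlt : x / b < g := Nat.div_lt_of_lt_mul (by rwa [mul_comm])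
  rcases (show x / b + 1 ≤ g by omega).eq_or_lt with h | h
  · rw [h]; exact (hU x).trans_lt (hUV.trans_le hg)
  · rw [hα _ h]
    exact hf _ _ (Nat.lt_mul_of_div_lt (Nat.lt_succ_self _) hb) (hm _ h)

theorem Boundaries.le_self {f α : ℕ → ℕ} {g b m : ℕ} (hf : ∀ x y, x < y → y < m → f x < f y)
    (hα : ∀ i < g, α i = f (i * b)) {x : ℕ} (hxm : x < m)
    (hx : x < g * b) : α (x / b) ≤ f x := by
  have hlt : x / b < g := Nat.div_lt_of_lt_mul (by rwa [mul_comm])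
  rw [hα _ hlt]
  rcases (Nat.div_mul_le_self x b).eq_or_lt with h | h
  · rw [h]
  · exact (hf _ _ h hxm).le

/-- An element lies between the first element of its block and that of the next block. Inserting
these bounds into `A x + B y = C z` gives the two inequalities of relevance. -/
theorem Boundaries.relevant {S : Params} (hS : S.Good w) {V : ℕ} {σ : Mem} (h : Boundaries S V σ)
    (hUV : S.U < V) {A B C : Fin S.m → ℕ} (hA : Sorts S.U A (σ.A 0)) (hB : Sorts S.U B (σ.A 1))
    (hC : Sorts S.U C (σ.A 2)) (hb : 0 < S.b) (hgb : S.m ≤ S.g * S.b) {x y z : ℕ} (hx : x < S.m)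
    (hy : y < S.m) (hz : z < S.m) (hsum : σ.A 0 x + σ.A 1 y = σ.A 2 z) :
    Relevant (σ.A 14) (σ.A 15) (σ.A 16) (y / S.b) (x / S.b) (z / S.b) := by
  have h1 := lt_next hA.lt hA.le hUV hS.block_lt h.A h.endA.ge hb (hx.trans_le hgb)
  have h2 := lt_next hB.lt hB.le hUV hS.block_lt h.B h.endB.ge hb (hy.trans_le hgb)
  have h3 := lt_next hC.lt hC.le hUV hS.block_lt h.C (by have := h.endC; omega) hb (hz.trans_le hgb)
  have h4 := le_self hA.lt h.A hx (hx.trans_le hgb)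
  have h5 := le_self hB.lt h.B hy (hy.trans_le hgb)
  have h6 := le_self hC.lt h.C hz (hz.trans_le hgb)
  exact ⟨by omega, by omega⟩

theorem Params.mem_block {S : Params} (hb : 0 < S.b) {x : ℕ} (hx : x < S.m) :
    S.lo (x / S.b) ≤ x ∧ x < S.hi (x / S.b) := by
  refine ⟨Nat.div_mul_le_self _ _, lt_min ?_ hx⟩
  rw [← Nat.succ_mul]
  exact Nat.lt_mul_of_div_lt (Nat.lt_succ_self _) hb

/-! ### The program for 3SUM -/

/-- The parameters for sets of size `m` from a universe of size `κ * m ^ 3 * (log₂ m + 1) ^ 2`, with `M`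
batches, if the ratios of the size and the dimension to the powers of two are `D` and `E`. -/
def Params.ofSize (κ D E m M : ℕ) : Params where
  m := m
  N := E * 2 ^ (20 * (Nat.log 2 m / 32))
  n := D * 2 ^ (4 * (Nat.log 2 m / 32))
  h := 16 * (Nat.log 2 m / 32) - 1
  g := (m + 2 ^ (4 * (Nat.log 2 m / 32)) / (256 * (Nat.log 2 m / 32 + 1)) - 1) /
    (2 ^ (4 * (Nat.log 2 m / 32)) / (256 * (Nat.log 2 m / 32 + 1)))
  b := 2 ^ (4 * (Nat.log 2 m / 32)) / (256 * (Nat.log 2 m / 32 + 1))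
  M := M
  Q := 2 ^ (16 * (Nat.log 2 m / 32) - 3)
  thr := E * 2 ^ (18 * (Nat.log 2 m / 32))
  H := 20 * (Nat.log 2 m / 32) + E
  U := κ * m ^ 3 * (Nat.log 2 m + 1) ^ 2

/-- The number of bits of the elements of the sets. -/
def bits (κ m : ℕ) : ℕ := (Nat.log 2 m + 1) * 5 + κ

/-- Sort the sets; register `62` says whether they are small. -/
def start (κ u₀ : ℕ) : Cmd :=
  block [logarithm, block [.set 61 .div (.reg 60) (.const 32), .set 62 .lt (.reg 61) (.const u₀),
    .set 50 .add (.reg 60) (.const 1), .set 50 .mul (.reg 50) (.const 5),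
    .set 50 .add (.reg 50) (.const κ)], sortAll]

/-- Search all triples. -/
def searchAll : Cmd :=
  block [block [mov 32 (.const 0), mov 33 (.reg 0), mov 34 (.const 0), mov 35 (.reg 0),
    mov 36 (.const 0), mov 37 (.reg 0)], search]

/-- Compute the parameters. -/
def parameters (D E : ℕ) : Cmd :=
  block [block [.set 63 .mul (.reg 61) (.const 4), .set 63 .shl (.const 1) (.reg 63),
      .set 8 .mul (.const D) (.reg 63),
      .set 10 .add (.reg 61) (.const 1), .set 10 .mul (.const 256) (.reg 10),
      .set 10 .div (.reg 63) (.reg 10)],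
    block [.set 17 .mul (.const 20) (.reg 61), .set 7 .shl (.const 1) (.reg 17),
      .set 7 .mul (.const E) (.reg 7), .set 17 .add (.reg 17) (.const E),
      .set 13 .mul (.const 18) (.reg 61), .set 13 .shl (.const 1) (.reg 13),
      .set 13 .mul (.const E) (.reg 13)],
    block [.set 6 .mul (.const 16) (.reg 61), .set 12 .sub (.reg 6) (.const 3),
      .set 12 .shl (.const 1) (.reg 12), .set 6 .sub (.reg 6) (.const 1),
      .set 9 .add (.reg 0) (.reg 10), .set 9 .sub (.reg 9) (.const 1),
      .set 9 .div (.reg 9) (.reg 10), .set 65 .shl (.const 1) (.reg 50),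
      .set 64 .mul (.const 4) (.reg 65)]]

/-- Compute the parameters and list the relevant triples of blocks. -/
def listAll (D E : ℕ) : Cmd := block [parameters D E, boundaries, listTriples]

/-- The part of the program for large sets. -/
def large (D E : ℕ) (P : Cmd) (nr na : ℕ) : Cmd := block [listAll D E, batches P nr na]

/-- The program for 3SUM that is made from a program for compressed matrices. -/
def solver (κ D E u₀ : ℕ) (P : Cmd) (nr na : ℕ) : Cmd :=
  block [start κ u₀, .branch (.reg 62) searchAll (large D E P nr na), mov 0 (.reg 1)]

/-- The words are long enough for sets of size `m`. -/
structure Fits (w κ D E u₀ m : ℕ) : Prop where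
  w_large : 20 ≤ w
  m_pos : 0 < m
  m_lt : 2 * m + (Params.ofSize κ D E m 0).b + 2 < 2 ^ w
  bits_lt : 4 * 2 ^ bits κ m < 2 ^ w
  const_lt : u₀ < 2 ^ w ∧ D < 2 ^ w ∧ E < 2 ^ w
  N_lt : (Params.ofSize κ D E m 0).N < 2 ^ w
  n_lt : (Params.ofSize κ D E m 0).n < 2 ^ w
  H_lt : (Params.ofSize κ D E m 0).H < 2 ^ w
  D_pos : 0 < D
  E_pos : 0 < E
  size_lt : (Params.ofSize κ D E m 0).U < 2 ^ bits κ m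

/-- The memory at the beginning. -/
structure Initial {m : ℕ} (A B C : Fin m → ℕ) (σ : Mem) : Prop where
  R0 : σ.R 0 = m
  R_zero : ∀ r, r ≠ 0 → σ.R r = 0
  A_eq : ∀ i : Fin m, σ.A 0 i = A i
  B_eq : ∀ i : Fin m, σ.A 1 i = B i
  C_eq : ∀ i : Fin m, σ.A 2 i = C i
  A_zero : ∀ x, m ≤ x → σ.A 0 x = 0
  B_zero : ∀ x, m ≤ x → σ.A 1 x = 0
  C_zero : ∀ x, m ≤ x → σ.A 2 x = 0
  zero : ∀ a, 3 ≤ a → ∀ x, σ.A a x = 0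

/-- The memory after the sets have been sorted. -/
structure Sorted (κ u₀ : ℕ) {m : ℕ} (A B C : Fin m → ℕ) (σ : Mem) : Prop where
  R0 : σ.R 0 = m
  R1 : σ.R 1 = 0
  R50 : σ.R 50 = bits κ m
  R61 : σ.R 61 = Nat.log 2 m / 32
  R62 : σ.R 62 = if Nat.log 2 m / 32 < u₀ then 1 else 0
  R_zero : ∀ r, 102 ≤ r → σ.R r = 0
  sortA : Sorts (κ * m ^ 3 * (Nat.log 2 m + 1) ^ 2) A (σ.A 0)
  sortB : Sorts (κ * m ^ 3 * (Nat.log 2 m + 1) ^ 2) B (σ.A 1)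
  sortC : Sorts (κ * m ^ 3 * (Nat.log 2 m + 1) ^ 2) C (σ.A 2)
  zero : ∀ a, 4 ≤ a → ∀ x, σ.A a x = 0

theorem Sorted.solution_iff {κ u₀ m : ℕ} {A B C : Fin m → ℕ} {σ : Mem} (h : Sorted κ u₀ A B C σ) :
    Solution m σ ↔ ∃ i j k, A i + B j = C k := by
  constructor
  · rintro ⟨x, y, z, -, hx, -, hy, -, hz, hs⟩
    obtain ⟨i, hi⟩ := (h.sortA.range _).1 ⟨x, hx, rfl⟩
    obtain ⟨j, hj⟩ := (h.sortB.range _).1 ⟨y, hy, rfl⟩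
    obtain ⟨k, hk⟩ := (h.sortC.range _).1 ⟨z, hz, rfl⟩
    exact ⟨i, j, k, by rw [hi, hj, hk, hs]⟩
  · rintro ⟨i, j, k, hs⟩
    obtain ⟨x, hx, hi⟩ := (h.sortA.range _).2 ⟨i, rfl⟩
    obtain ⟨y, hy, hj⟩ := (h.sortB.range _).2 ⟨j, rfl⟩
    obtain ⟨z, hz, hk⟩ := (h.sortC.range _).2 ⟨k, rfl⟩
    exact ⟨x, y, z, Nat.zero_le _, hx, Nat.zero_le _, hy, Nat.zero_le _, hz, by rw [hi, hj, hk, hs]⟩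

theorem start_spec {κ D E u₀ m : ℕ} (hf : Fits w κ D E u₀ m) {A B C : Fin m → ℕ}
    (hA : Function.Injective A) (hB : Function.Injective B) (hC : Function.Injective C)
    (hAU : ∀ i, A i ≤ κ * m ^ 3 * (Nat.log 2 m + 1) ^ 2)
    (hBU : ∀ i, B i ≤ κ * m ^ 3 * (Nat.log 2 m + 1) ^ 2)
    (hCU : ∀ i, C i ≤ κ * m ^ 3 * (Nat.log 2 m + 1) ^ 2) {σ : Mem} (hσ : Initial A B C σ) :
    H w (start κ u₀) σ (Nat.log 2 m * 10 + 3 * (bits κ m * (m * 70 + 40)) + 80)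
      (Sorted κ u₀ A B C) := by
  obtain ⟨hw, hm0, hm, hL, ⟨hu₀, -, -⟩, -, -, -, -, -, hU⟩ := hf
  have hbl : bits κ m < 2 ^ bits κ m := Nat.lt_two_pow_self
  have h32 : 32 < 2 ^ w := lt_of_lt_of_le (by norm_num) (Nat.pow_le_pow_right two_pos hw)
  have hb : bits κ m = (Nat.log 2 m + 1) * 5 + κ := rfl
  refine H.bind (T₂ := 3 * (bits κ m * (m * 70 + 40)) + 60)
    (logarithm_spec (by omega) hm0 (by omega) hσ.R0) ?_ (by omega)
  rintro σ₁ ⟨e60, hF₁⟩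
  refine H.start (T₂ := 3 * (bits κ m * (m * 70 + 40)) + 45) (by omega) ?_
    (by simp [cost, block]; omega)
  simp [wp_block_cons, wp_block_nil, wp, Op.nat, Op.Fits, e60]
  refine ⟨by omega, by omega, by omega, by omega, by omega, by omega, by omega, by omega, ?_⟩
  refine H.last (H.mono (sortAll_spec (by omega) (m := m) (L := bits κ m)
    (U := κ * m ^ 3 * (Nat.log 2 m + 1) ^ 2) (A := A) (B := B) (C := C)
    ?_ ?_ (by omega) hU hA hB hC hAU hBU hCU ?_ ?_ ?_ ?_ ?_ ?_) le_rfl ?_) (by omega)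
  · simp [hF₁.1 0 (by decide), hσ.R0]
  · simp [hb]
  · simp [hF₁.2 0 (by decide), hσ.A_eq]
  · simp [hF₁.2 1 (by decide), hσ.B_eq]
  · simp [hF₁.2 2 (by decide), hσ.C_eq]
  · intro x hx; simp [hF₁.2 0 (by decide), hσ.A_zero x hx]
  · intro x hx; simp [hF₁.2 1 (by decide), hσ.B_zero x hx]
  · intro x hx; simp [hF₁.2 2 (by decide), hσ.C_zero x hx]
  · rintro σ₂ ⟨⟨s1, s2, s3⟩, hF₂⟩
    have hR : ∀ r, 62 < r → r ≠ 99 → σ₂.R r = σ.R r := fun r hr hr' => by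
      have h1 : ∀ l : List ℕ, (∀ x ∈ l, x ≤ 62 ∨ x = 99) → r ∉ l := fun l hl h => by
        have := hl r h; omega
      rw [hF₂.1 r (h1 _ (by decide))]
      simp only [Mem.setR_R]
      rw [if_neg (by omega), if_neg (by omega), if_neg (by omega), if_neg (by omega),
        if_neg (by omega), hF₁.1 r (h1 _ (by decide))]
    refine ⟨?_, ?_, ?_, ?_, ?_, fun r hr => ?_, s1, s2, s3, fun a ha x => ?_⟩
    · rw [hF₂.1 0 (by decide)]; simp [hF₁.1 0 (by decide), hσ.R0]
    · rw [hF₂.1 1 (by decide)]; simp [hF₁.1 1 (by decide), hσ.R_zero 1]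
    · rw [hF₂.1 50 (by decide)]; simp [hb]
    · rw [hF₂.1 61 (by decide)]; simp
    · rw [hF₂.1 62 (by decide)]; simp
    · rw [hR r (by omega) (by omega), hσ.R_zero r (by omega)]
    · have h1 : ∀ l : List ℕ, (∀ x ∈ l, x ≤ 3) → a ∉ l := fun l hl h => by
        have := hl a h; omega
      rw [hF₂.2 a (h1 _ (by decide))]
      simp [hF₁.2 a (h1 _ (by decide)), hσ.zero a (by omega) x]

theorem searchAll_spec (hw : 20 ≤ w) {κ u₀ m : ℕ} {A B C : Fin m → ℕ} {σ : Mem} (hmw : 2 * m < 2 ^ w)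
    (hU : 2 * (κ * m ^ 3 * (Nat.log 2 m + 1) ^ 2) < 2 ^ w) (h : Sorted κ u₀ A B C σ) :
    H w searchAll σ (m * (60 * m + 20) + 60)
      (fun σ' => (Solution m σ → σ'.R 1 = 1) ∧ (σ'.R 1 = 0 ∨ σ'.R 1 = 1 ∧ Solution m σ)) := by
  have h32 : 32 < 2 ^ w := lt_of_lt_of_le (by norm_num) (Nat.pow_le_pow_right two_pos hw)
  refine H.start (T₂ := m * (60 * m + 20) + 30) (by omega) ?_ (by simp [cost, block, mov]; omega)
  simp [wp_block_cons, wp_block_nil, wp_mov, h.R0]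
  refine H.last (H.mono (search_spec (by omega) (xl := 0) (xh := m) (yl := 0) (yh := m)
    (zl := 0) (zh := m) (U := κ * m ^ 3 * (Nat.log 2 m + 1) ^ 2) ?_ ?_ ?_ ?_ ?_ ?_ (by omega)
    (by omega) (by omega) hU ?_ ?_ (by omega) (by omega) ?_ ?_) le_rfl ?_) ?_
  · simp
  · simp
  · simp
  · simp
  · simp
  · simp
  · simpa using h.sortA.le
  · simpa using h.sortB.le
  · intro y y' h1 h2
    rcases h1.eq_or_lt with rfl | h1
    · rfl
    · simpa using (h.sortB.lt _ _ h1 h2).le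
  · intro y y' h1 h2
    rcases h1.eq_or_lt with rfl | h1
    · rfl
    · simpa using (h.sortC.lt _ _ h1 h2).le
  · intro σ' h'
    exact ⟨h'.1, h'.2.imp (fun e => e.trans (by simp [h.R1])) id⟩
  · simp only [Nat.sub_zero]
    have : (m + m) * 30 = 60 * m := by ring
    rw [this]; omega

/-- The memory after the parameters have been computed. -/
structure Parametrized (κ D E u₀ : ℕ) {m : ℕ} (A B C : Fin m → ℕ) (σ : Mem) : Prop
    extends Sorted κ u₀ A B C σ where
  R6 : σ.R 6 = (Params.ofSize κ D E m 0).h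
  R7 : σ.R 7 = (Params.ofSize κ D E m 0).N
  R8 : σ.R 8 = (Params.ofSize κ D E m 0).n
  R9 : σ.R 9 = (Params.ofSize κ D E m 0).g
  R10 : σ.R 10 = (Params.ofSize κ D E m 0).b
  R12 : σ.R 12 = (Params.ofSize κ D E m 0).Q
  R13 : σ.R 13 = (Params.ofSize κ D E m 0).thr
  R17 : σ.R 17 = (Params.ofSize κ D E m 0).H
  R64 : σ.R 64 = 4 * 2 ^ bits κ m
  R65 : σ.R 65 = 2 ^ bits κ m

theorem Sorted.frame {κ u₀ m : ℕ} {A B C : Fin m → ℕ} {σ σ' : Mem} (h : Sorted κ u₀ A B C σ)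
    (hR : ∀ r, r ∈ [0, 1, 50, 61, 62] ∨ 102 ≤ r → σ'.R r = σ.R r) (hA : σ'.A = σ.A) :
    Sorted κ u₀ A B C σ' where
  R0 := (hR 0 (by decide)).trans h.R0
  R1 := (hR 1 (by decide)).trans h.R1
  R50 := (hR 50 (by decide)).trans h.R50
  R61 := (hR 61 (by decide)).trans h.R61
  R62 := (hR 62 (by decide)).trans h.R62
  R_zero r hr := (hR r (Or.inr hr)).trans (h.R_zero r hr)
  sortA := hA ▸ h.sortA
  sortB := hA ▸ h.sortB
  sortC := hA ▸ h.sortC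
  zero := hA ▸ h.zero

/-- The bound on `u = ⌊log₂ m⌋ / 32` makes the block length positive and the subtractions in the
exponents exact; `Fits` keeps all intermediate results within a word. -/
theorem parameters_spec {κ D E u₀ m : ℕ} (hf : Fits w κ D E u₀ m) (hu : 8 ≤ Nat.log 2 m / 32)
    {A B C : Fin m → ℕ} {σ : Mem} (h : Sorted κ u₀ A B C σ) :
    H w (parameters D E) σ 100 (Parametrized κ D E u₀ A B C) := by
  obtain ⟨hw, hm0, hm, hL, ⟨-, hD, hE⟩, hN, hn, hH, hD0, hE0, hU⟩ := hf
  have h256 : 1000 < 2 ^ w := lt_of_lt_of_le (by norm_num) (Nat.pow_le_pow_right two_pos hw)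
  have hR0 := h.R0
  have hR50 := h.R50
  have hR61 := h.R61
  simp only [Params.ofSize] at hm hN hn hH
  set u := Nat.log 2 m / 32 with hu'
  have hpow : ∀ k : ℕ, 2 ^ (k * u) < 2 ^ w → k * u < w := fun k hk =>
    (Nat.pow_lt_pow_iff_right one_lt_two).1 hk
  have hww : w < 2 ^ w := Nat.lt_two_pow_self
  have p20 : 2 ^ (20 * u) < 2 ^ w := lt_of_le_of_lt (Nat.le_mul_of_pos_left _ hE0) hN
  have p4 : 2 ^ (4 * u) < 2 ^ w := lt_of_le_of_lt (Nat.pow_le_pow_right two_pos (by omega)) p20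
  have p18 : 2 ^ (18 * u) ≤ 2 ^ (20 * u) := Nat.pow_le_pow_right two_pos (by omega)
  have p16 : 2 ^ (16 * u - 3) ≤ 2 ^ (20 * u) := Nat.pow_le_pow_right two_pos (by omega)
  have hE18 : E * 2 ^ (18 * u) ≤ E * 2 ^ (20 * u) := Nat.mul_le_mul_left _ p18
  have h20 := hpow 20 p20
  -- Hence the quotient that defines the block length is not zero.
  have hbig : 256 * (u + 1) ≤ 2 ^ (4 * u) := by
    have h1 : u + 1 ≤ 2 ^ u := Nat.lt_two_pow_self
    have h2 : 256 ≤ 2 ^ u := le_trans (by norm_num) (Nat.pow_le_pow_right two_pos hu)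
    calc 256 * (u + 1) ≤ 2 ^ u * 2 ^ u := Nat.mul_le_mul h2 h1
      _ = 2 ^ (2 * u) := by rw [two_mul, pow_add]
      _ ≤ _ := Nat.pow_le_pow_right two_pos (by omega)
  have hb0 : 0 < 2 ^ (4 * u) / (256 * (u + 1)) := Nat.div_pos hbig (by omega)
  have h4 : u * 4 = 4 * u := mul_comm _ _
  generalize hb : 2 ^ (4 * u) / (256 * (u + 1)) = b at *
  refine H.start (T₂ := 70) (by omega) ?_ (by simp [cost, block])
  simp [wp_block_cons, wp_block_nil, wp, Op.nat, Op.Fits, hR61, h4, hb]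
  refine ⟨by omega, by omega, by omega, p4, by omega, hn, by omega, by omega, by omega, by omega, ?_⟩
  refine H.start (T₂ := 40) (by omega) ?_ (by simp [cost, block])
  simp [wp_block_cons, wp_block_nil, wp, Op.nat, Op.Fits, hR61]
  refine ⟨by omega, by omega, by omega, p20, by omega, hN, by omega, hH, by omega, by omega, by omega,
    by omega, by omega, by omega, ?_⟩
  refine H.start (T₂ := 1) (by omega) ?_ (by simp [cost, block])
  simp [wp_block_cons, wp_block_nil, wp, Op.nat, Op.Fits, hR61, hR0, hR50]
  refine ⟨by omega, by omega, by omega, by omega, by omega, by omega, by omega, by omega, by omega,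
    by omega, by omega, by omega, by omega, by omega, by omega, H.nil ?_⟩
  refine ⟨h.frame (fun r hr => ?_) rfl, ?_, ?_, ?_, ?_, ?_, ?_, ?_, ?_, ?_, ?_⟩
  · have h1 : ∀ l : List ℕ, (∀ x ∈ l, x < 102 ∧ x ∉ [0, 1, 50, 61, 62]) → r ∉ l := fun l hl h => by
      have := hl r h
      rcases hr with hr | hr
      · exact this.2 hr
      · omega
    have h2 := h1 [63, 8, 10, 17, 7, 13, 6, 12, 9, 65, 64] (by decide)
    simp only [List.mem_cons, List.not_mem_nil, or_false, not_or] at h2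
    obtain ⟨n1, n2, n3, n4, n5, n6, n7, n8, n9, n10, n11⟩ := h2
    simp only [Mem.setR_R, n1, n2, n3, n4, n5, n6, n7, n8, n9, n10, n11, if_false]
  all_goals simp [Params.ofSize, ← hu', hb]

/-- The memory after the relevant triples of blocks have been listed. -/
structure Ready (S : Params) {m : ℕ} (A B C : Fin m → ℕ) (σ : Mem) : Prop where
  setup : Setup S σ
  clean : Clean S.N S.n σ
  R1 : σ.R 1 = 0
  C_le : ∀ z, σ.A 2 z ≤ S.U
  batches_le : S.M * S.N ≤ 4 * S.g ^ 2 + S.g * S.N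
  solution_iff : Solution m σ ↔ ∃ i j k, A i + B j = C k
  listed : Solution m σ → ∃ β < S.M, ∃ r < S.N, RowSolved S (σ.setR 5 β) r

/-- The number `M` of batches is known only after the listing, so the parameters carry the content
of register `11`, and `hS` is required for every `M` that obeys the bound of `listTriples_spec`. -/
theorem listAll_spec {κ D E u₀ m : ℕ} (hf : Fits w κ D E u₀ m) (hu : 8 ≤ Nat.log 2 m / 32)
    (hS : ∀ M, M * (Params.ofSize κ D E m 0).N ≤ 4 * (Params.ofSize κ D E m 0).g ^ 2 +
        (Params.ofSize κ D E m 0).g * (Params.ofSize κ D E m 0).N →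
      (Params.ofSize κ D E m M).Good w)
    (hb0 : 0 < (Params.ofSize κ D E m 0).b)
    (hgb : m ≤ (Params.ofSize κ D E m 0).g * (Params.ofSize κ D E m 0).b)
    (hp : 4 * (Params.ofSize κ D E m 0).g ^ 2 +
      (Params.ofSize κ D E m 0).g * (Params.ofSize κ D E m 0).N + (Params.ofSize κ D E m 0).g + 1 <
        2 ^ w)
    {A B C : Fin m → ℕ} {σ : Mem} (h : Sorted κ u₀ A B C σ) :
    H w (listAll D E) σ (345 * (Params.ofSize κ D E m 0).g ^ 2 + 300)
      (fun σ' => Ready (Params.ofSize κ D E m (σ'.R 11)) A B C σ') := by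
  have hU : (Params.ofSize κ D E m 0).U < 2 ^ bits κ m := hf.size_lt
  have hL := hf.bits_lt
  have hw := hf.w_large
  have hS0 : (Params.ofSize κ D E m 0).Good w := hS 0 (by simp)
  have hg0 := hS0.g_pos
  have hgg : (Params.ofSize κ D E m 0).g ≤ (Params.ofSize κ D E m 0).g ^ 2 := by nlinarith
  have hN0 : 0 < (Params.ofSize κ D E m 0).N := by have := hS0.length_le; omega
  refine H.bind (T₂ := 345 * (Params.ofSize κ D E m 0).g ^ 2 + 190) (parameters_spec hf hu h) ?_
    (by omega)
  intro σ₁ h₁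
  refine H.bind (T₂ := 300 * (Params.ofSize κ D E m 0).g ^ 2 + 110)
    (boundaries_spec (by omega) h₁.R9 h₁.R10 fun i hi => ?_) ?_ (by omega)
  · have := hS0.block_lt i hi
    have := hS0.m_lt
    omega
  rintro σ₂ ⟨⟨a1, a2, a3, e1, e2, e3⟩, hF₂⟩
  have k0 : σ₂.A 0 = σ₁.A 0 := hF₂.2 0 (by decide)
  have k1 : σ₂.A 1 = σ₁.A 1 := hF₂.2 1 (by decide)
  have k2 : σ₂.A 2 = σ₁.A 2 := hF₂.2 2 (by decide)
  have hbd : Boundaries (Params.ofSize κ D E m 0) (2 ^ bits κ m) σ₂ :=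
    ⟨k0 ▸ a1, k1 ▸ a2, k2 ▸ a3, e1.trans h₁.R65, e2.trans h₁.R65, e3.trans h₁.R64⟩
  have sA : Sorts (Params.ofSize κ D E m 0).U A (σ₂.A 0) := k0 ▸ h₁.sortA
  have sB : Sorts (Params.ofSize κ D E m 0).U B (σ₂.A 1) := k1 ▸ h₁.sortB
  have sC : Sorts (Params.ofSize κ D E m 0).U C (σ₂.A 2) := k2 ▸ h₁.sortC
  have z2 : ∀ a, a ∉ [14, 15, 16] → 4 ≤ a → ∀ x, σ₂.A a x = 0 := fun a ha ha4 x => by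
    rw [hF₂.2 a (by simpa [boundaries, boundary, modA, block, forTo, mov] using ha), h₁.zero a ha4]
  refine H.last (H.mono (listTriples_spec (by omega) rfl rfl rfl (hbd.blocks hS0 hU sA sB sC)
    ((hF₂.1 9 (by decide)).trans h₁.R9) ((hF₂.1 7 (by decide)).trans h₁.R7) ?_ hN0 hp ?_) le_rfl ?_)
    (by omega)
  · rw [hbd.endC]; omega
  · intro p
    rw [z2 4 (by decide) (by decide), z2 5 (by decide) (by decide), z2 6 (by decide) (by decide)]
    exact ⟨hg0, hg0, hg0⟩
  rintro σ₃ ⟨⟨hM, hr, hrel⟩, hF₃⟩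
  have l0 : σ₃.A 0 = σ₁.A 0 := (hF₃.2 0 (by decide)).trans k0
  have l1 : σ₃.A 1 = σ₁.A 1 := (hF₃.2 1 (by decide)).trans k1
  have l2 : σ₃.A 2 = σ₁.A 2 := (hF₃.2 2 (by decide)).trans k2
  have hRR : ∀ r, r ∈ [0, 1, 6, 7, 8, 9, 10, 12, 13, 17] → σ₃.R r = σ₁.R r := fun r hr => by
    fin_cases hr <;> exact (hF₃.1 _ (by decide)).trans (hF₂.1 _ (by decide))
  have hsol : Solution m σ₃ ↔ Solution m σ₁ := HasSum.congr l0 l1 l2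
  have hz : ∀ a, 30 ≤ a → ∀ p, σ₃.A a p = 0 := fun a ha p => by
    have h1 : ∀ l : List ℕ, (∀ x ∈ l, x < 30) → a ∉ l := fun l hl h => by
      have := hl a h; omega
    rw [hF₃.2 a (h1 _ (by decide)), z2 a (h1 _ (by decide)) (by omega)]
  refine ⟨⟨?_, ?_, ?_, ?_, ?_, ?_, rfl, ?_, ?_, ?_, hr, ?_, ?_, ?_, ?_⟩, ⟨?_, ?_, ?_, ?_⟩, ?_, ?_, hM,
    hsol.trans h₁.solution_iff, ?_⟩
  · exact (hRR 0 (by decide)).trans h₁.R0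
  · exact (hRR 6 (by decide)).trans h₁.R6
  · exact (hRR 7 (by decide)).trans h₁.R7
  · exact (hRR 8 (by decide)).trans h₁.R8
  · exact (hRR 9 (by decide)).trans h₁.R9
  · exact (hRR 10 (by decide)).trans h₁.R10
  · exact (hRR 12 (by decide)).trans h₁.R12
  · exact (hRR 13 (by decide)).trans h₁.R13
  · exact (hRR 17 (by decide)).trans h₁.R17
  · rw [l0]; exact h₁.sortA.le
  · rw [l1]; exact h₁.sortB.le
  · rw [l1]
    intro x y hxy hy
    rcases hxy.eq_or_lt with rfl | hxy
    · rfl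
    · exact (h₁.sortB.lt _ _ hxy hy).le
  · rw [l2]
    intro x y hxy hy
    rcases hxy.eq_or_lt with rfl | hxy
    · rfl
    · exact (h₁.sortC.lt _ _ hxy hy).le
  · intro r hr
    have h1 : ∀ l : List ℕ, (∀ x ∈ l, x < 102) → r ∉ l := fun l hl h => by
      have := hl r h; omega
    rw [hF₃.1 r (h1 _ (by decide)), hF₂.1 r (h1 _ (by decide)), h₁.R_zero r hr]
  · exact fun a ha _ p _ => hz a ha p
  · exact fun a ha _ p _ => hz a (by omega) p
  · exact fun a ha p => hz a (by omega) p
  · exact (hRR 1 (by decide)).trans h₁.R1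
  · rw [l2]; exact h₁.sortC.le
  · rw [hsol]
    rintro ⟨x, y, z, -, hx, -, hy, -, hz, hs⟩
    have hrv := hbd.relevant hS0 hU sA sB sC hb0 hgb hx hy hz (by rwa [k0, k1, k2])
    have lt_g : ∀ x < m, x / (Params.ofSize κ D E m 0).b < (Params.ofSize κ D E m 0).g :=
      fun x hx => Nat.div_lt_of_lt_mul (by rw [mul_comm]; omega)
    obtain ⟨β, hβ, r, hr, q1, q2, q3⟩ := hrel _ (lt_g y hy) _ (lt_g x hx) _ (lt_g z hz) hrv
    refine ⟨β, hβ, r, hr, ?_⟩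
    have mb : ∀ x < m, _ := fun x hx =>
      Params.mem_block (S := Params.ofSize κ D E m (σ₃.R 11)) hb0 (x := x) hx
    obtain ⟨x1, x2⟩ := mb x hx
    obtain ⟨y1, y2⟩ := mb y hy
    obtain ⟨z1, z2⟩ := mb z hz
    unfold RowSolved
    simp only [Mem.setR_R, if_true, Mem.setR_A]
    rw [show (Params.ofSize κ D E m (σ₃.R 11)).N = (Params.ofSize κ D E m 0).N from rfl, q1, q2, q3]
    exact ⟨x, y, z, x1, x2, y1, y2, z1, z2, by simpa [l0, l1, l2] using hs⟩

/-- The facts about the parameters that are needed for large sets of size `m`; here `T` is a bound for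
the time of the program for matrices, `T'` a bound for the time to process the batches and `d` a bound for
the number of divisors. -/
structure Suitable (w κ D E m : ℕ) (P : Cmd) (nr na T T' d : ℕ) : Prop where
  log_le : 8 ≤ Nat.log 2 m / 32
  callable : ∀ M, M * (Params.ofSize κ D E m 0).N ≤ 4 * (Params.ofSize κ D E m 0).g ^ 2 +
        (Params.ofSize κ D E m 0).g * (Params.ofSize κ D E m 0).N →
      Callable w P nr na T (Params.ofSize κ D E m M)
  time_le : ∀ M, M * (Params.ofSize κ D E m 0).N ≤ 4 * (Params.ofSize κ D E m 0).g ^ 2 +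
        (Params.ofSize κ D E m 0).g * (Params.ofSize κ D E m 0).N →
      M * (2 * (Params.ofSize κ D E m 0).time T nr na + 10) + 10 ≤ T'
  b_pos : 0 < (Params.ofSize κ D E m 0).b
  le_mul : m ≤ (Params.ofSize κ D E m 0).g * (Params.ofSize κ D E m 0).b
  list_lt : 4 * (Params.ofSize κ D E m 0).g ^ 2 +
      (Params.ofSize κ D E m 0).g * (Params.ofSize κ D E m 0).N + (Params.ofSize κ D E m 0).g + 1 <
        2 ^ w
  card_divisors : ∀ x ≤ 2 * (Params.ofSize κ D E m 0).U, x.divisors.card ≤ d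
  false_le : 4 * ((Params.ofSize κ D E m 0).N * ((Params.ofSize κ D E m 0).b ^ 3 * d)) ≤
    (Params.ofSize κ D E m 0).thr * (Params.ofSize κ D E m 0).Q
  thr_pos : 0 < (Params.ofSize κ D E m 0).thr
  Q_dvd : (Params.ofSize κ D E m 0).Q ∣ 2 ^ w

theorem Pr.branch {x : Operand} {p q : Cmd} {σ : Mem} {T : ℕ} {Φ : Mem → Prop} {ρ : ℝ≥0∞}
    (hx : x.Fits w) (h₁ : x.ev σ ≠ 0 → Pr w p σ T Φ ρ) (h₂ : x.ev σ = 0 → Pr w q σ T Φ ρ) :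
    Pr w (.branch x p q) σ (T + 1) Φ ρ := by
  intro s hs
  by_cases h : x.eval s ≠ 0
  · rw [expect_of_step (c' := ([p], s)) (by simp only [step, if_pos h])]
    exact h₁ (hs ▸ (Operand.eval_ne_zero s hx).1 h) s hs
  · rw [expect_of_step (c' := ([q], s)) (by simp only [step, if_neg h])]
    rw [Operand.eval_ne_zero s hx, not_not, hs] at h
    exact h₂ h s hs

/-- A solution lies in some relevant triple, hence in some row of some batch `β`; most moduli are
good for that batch, so processing the batches finds it with probability at least `2/3`. -/
theorem large_spec {κ D E u₀ m : ℕ} {P : Cmd} {nr na T T' d : ℕ} (hf : Fits w κ D E u₀ m)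
    (hS : Suitable w κ D E m P nr na T T' d) {A B C : Fin m → ℕ} {σ : Mem}
    (h : Sorted κ u₀ A B C σ) :
    H w (large D E P nr na) σ (345 * (Params.ofSize κ D E m 0).g ^ 2 + 310 + T')
      (fun σ' => σ'.R 1 = 0 ∨ σ'.R 1 = 1 ∧ ∃ i j k, A i + B j = C k) ∧
    ((∃ i j k, A i + B j = C k) → Pr w (large D E P nr na) σ
      (345 * (Params.ofSize κ D E m 0).g ^ 2 + 310 + T') (fun σ' => σ'.R 1 = 1) (2 / 3)) := by
  have hlist := listAll_spec hf hS.log_le (fun M hM => (hS.callable M hM).good) hS.b_pos hS.le_mul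
    hS.list_lt h
  constructor
  · refine H.bind hlist (T₂ := T' + 2) (fun σ' hr => ?_) (by omega)
    have hC := hS.callable _ hr.batches_le
    refine H.last (H.mono (batches_spec hC hr.setup hr.clean hr.R1).1
      (hS.time_le _ hr.batches_le) fun σ'' h'' => ?_) le_rfl
    exact h''.found.imp id fun h => ⟨h.1, hr.solution_iff.1 h.2⟩
  · intro hsol
    refine Pr.bind_right hlist (T₂ := T' + 2) (fun σ' hr => ?_) (by omega)
    have hC := hS.callable _ hr.batches_le
    obtain ⟨β, hβ, hrow⟩ := hr.listed (hr.solution_iff.2 hsol)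
    refine Pr.bind_left ((batches_spec hC hr.setup hr.clean hr.R1).2 hS.Q_dvd β hβ ?_ hrow)
      (fun σ'' h'' => H.nil h'') ?_
    · refine three_mul_le_card_goodModuli hC.good (σ := σ'.setR 5 β) ?_ hr.C_le hS.card_divisors
        hS.thr_pos hS.false_le
      have hs := hr.setup
      exact ⟨hs.R0, hs.R6, hs.R7, hs.R8, hs.R9, hs.R10, hs.R11, hs.R12, hs.R13, hs.R17, hs.inRange,
        hs.A_le, hs.B_le, hs.B_mono, hs.C_mono⟩
    · exact Nat.add_le_add_right (Nat.add_le_add_right (hS.time_le _ hr.batches_le) 1) 1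

/-- The time of the program for sets of size `m`. -/
def solverTime (κ m T : ℕ) : ℕ :=
  Nat.log 2 m * 10 + 3 * (bits κ m * (m * 70 + 40)) + 100 + T

/-- Small sets are searched exhaustively, since the estimates for the parameters need `u` to be
large compared with the constants. Their time is bounded by a constant that depends on `u₀`. -/
theorem solver_spec {κ D E u₀ m : ℕ} {P : Cmd} {nr na T' : ℕ} (hf : Fits w κ D E u₀ m)
    (hsmall : Nat.log 2 m / 32 < u₀ → m * (60 * m + 20) + 60 ≤ T')
    (hlarge : u₀ ≤ Nat.log 2 m / 32 → ∃ T T'' d, Suitable w κ D E m P nr na T T'' d ∧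
      345 * (Params.ofSize κ D E m 0).g ^ 2 + 310 + T'' ≤ T')
    {A B C : Fin m → ℕ}
    (hA : Function.Injective A) (hB : Function.Injective B) (hC : Function.Injective C)
    (hAU : ∀ i, A i ≤ κ * m ^ 3 * (Nat.log 2 m + 1) ^ 2)
    (hBU : ∀ i, B i ≤ κ * m ^ 3 * (Nat.log 2 m + 1) ^ 2)
    (hCU : ∀ i, C i ≤ κ * m ^ 3 * (Nat.log 2 m + 1) ^ 2) {σ : Mem} (hσ : Initial A B C σ) :
    H w (solver κ D E u₀ P nr na) σ (solverTime κ m T')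
      (fun σ' => σ'.R 0 = 0 ∨ σ'.R 0 = 1 ∧ ∃ i j k, A i + B j = C k) ∧
    ((∃ i j k, A i + B j = C k) → Pr w (solver κ D E u₀ P nr na) σ (solverTime κ m T')
      (fun σ' => σ'.R 0 = 1) (2 / 3)) := by
  have hw := hf.w_large
  have hstart := start_spec hf hA hB hC hAU hBU hCU hσ
  have hend : ∀ σ' : Mem, H w (block [mov 0 (.reg 1)]) σ' 3 (fun σ'' => σ''.R 0 = σ'.R 1) := by
    intro σ'
    refine H.start (T₂ := 1) (by omega) ?_ (by simp [cost, mov])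
    rw [wp_mov (by simp)]
    exact H.nil (by simp)
  have hUw : 2 * (κ * m ^ 3 * (Nat.log 2 m + 1) ^ 2) < 2 ^ w := by
    have h1 : κ * m ^ 3 * (Nat.log 2 m + 1) ^ 2 < 2 ^ bits κ m := hf.size_lt
    have := hf.bits_lt
    omega
  have hmain : ∀ σ', Sorted κ u₀ A B C σ' →
      H w (.branch (.reg 62) searchAll (large D E P nr na)) σ' (T' + 1)
        (fun σ' => σ'.R 1 = 0 ∨ σ'.R 1 = 1 ∧ ∃ i j k, A i + B j = C k) ∧
      ((∃ i j k, A i + B j = C k) →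
        Pr w (.branch (.reg 62) searchAll (large D E P nr na)) σ' (T' + 1)
          (fun σ' => σ'.R 1 = 1) (2 / 3)) := by
    intro σ' hs
    have h62 := hs.R62
    by_cases hu : Nat.log 2 m / 32 < u₀
    · rw [if_pos hu] at h62
      have hse := (searchAll_spec hw (by have := hf.m_lt; omega) hUw hs).time (hsmall hu)
      rw [hs.solution_iff] at hse
      have hH := H.branch (w := w) (x := .reg 62) (q := large D E P nr na) trivial
        (fun _ => hse) (by simp [h62])
      exact ⟨hH.mono le_rfl fun _ h => h.2, fun hsol =>
        ((Pr.of_H hH).weaken (by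
          rw [← ENNReal.toReal_le_toReal (by finiteness) (by finiteness)]
          simp only [ENNReal.toReal_div, ENNReal.toReal_ofNat, ENNReal.toReal_one]
          norm_num)).mono le_rfl fun _ h => h.1 hsol⟩
    · rw [if_neg hu] at h62
      obtain ⟨T, T'', d, hS, hT⟩ := hlarge (by omega)
      have hl := large_spec hf hS hs
      refine ⟨H.branch trivial (by simp [h62]) fun _ => hl.1.time hT, fun hsol => ?_⟩
      exact Pr.branch trivial (by simp [h62]) fun _ => (hl.2 hsol).mono hT fun _ => id
  constructor
  · refine H.bind (T₂ := T' + 1 + 3 + 1) hstart (fun σ' hs => ?_) (by unfold solverTime; omega)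
    refine H.bind (hmain σ' hs).1 (fun σ'' h'' => (hend σ'').mono le_rfl fun σ₃ h₃ => ?_) le_rfl
    rw [h₃]; exact h''
  · intro hsol
    refine Pr.bind_right (T₂ := T' + 1 + 3 + 1) hstart (fun σ' hs => ?_) (by unfold solverTime; omega)
    refine Pr.bind_left ((hmain σ' hs).2 hsol) (fun σ'' h'' => (hend σ'').mono le_rfl
      fun σ₃ h₃ => ?_) le_rfl
    rw [h₃]; exact h''

theorem initial_threeSumInput {m : ℕ} {A B C : Fin m → ℕ} (hm : m < 2 ^ w)
    (hA : ∀ i, A i < 2 ^ w) (hB : ∀ i, B i < 2 ^ w) (hC : ∀ i, C i < 2 ^ w) :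
    Initial A B C (view (threeSumInput w A B C)) := by
  have h1 : ∀ {F : Fin m → ℕ}, (∀ i, F i < 2 ^ w) → ∀ i : Fin m,
      (if (i : ℕ) < 2 ^ w then (arrayOf F (BitVec.ofNat w i)).toNat else 0) = F i := by
    intro F hF i
    have hi := i.2.trans hm
    rw [if_pos hi]
    simp [arrayOf, Nat.mod_eq_of_lt hi, Nat.mod_eq_of_lt (hF i)]
  have h2 : ∀ {F : Fin m → ℕ} (x : ℕ), m ≤ x →
      (if x < 2 ^ w then (arrayOf F (BitVec.ofNat w x)).toNat else 0) = 0 := by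
    intro F x hx
    split_ifs with h
    · rw [arrayOf, dif_neg]
      · simp
      · simpa [Nat.mod_eq_of_lt h] using hx
    · rfl
  refine ⟨?_, fun r hr => ?_, h1 hA, h1 hB, h1 hC, h2, h2, h2, fun a ha x => ?_⟩
  · simp [view, threeSumInput, Nat.mod_eq_of_lt hm]
  · simp [view, threeSumInput, hr]
  · obtain ⟨a, rfl⟩ := Nat.exists_eq_add_of_le' ha
    simp [view, threeSumInput]

open Classical in
theorem solvesWithin_of_spec {P : Cmd} {m T T' : ℕ} {A B C : Fin m → ℕ}
    (h : H w P (view (threeSumInput w A B C)) T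
      (fun σ' => σ'.R 0 = 0 ∨ σ'.R 0 = 1 ∧ ∃ i j k, A i + B j = C k))
    (h' : (∃ i j k, A i + B j = C k) → Pr w P (view (threeSumInput w A B C)) T
      (fun σ' => σ'.R 0 = 1) (2 / 3)) (hT : T ≤ T') :
    SolvesWithin P (threeSumInput w A B C) T'
      (fun s => (s.reg 0).toNat = if ∃ i j k, A i + B j = C k then 1 else 0) := by
  have hs := h.time hT
  refine solvesWithin_of (hs _ rfl) ?_
  by_cases hsol : ∃ i j k, A i + B j = C k
  · have := ((h' hsol).mono hT fun _ => id) _ rfl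
    simp only [if_pos hsol]
    refine this.trans (expect_mono' fun s' => ?_)
    by_cases h1 : (s'.reg 0).toNat = 1
    · rw [if_pos h1]; split_ifs <;> simp
    · rw [if_neg (show ¬ (fun σ' : Mem => σ'.R 0 = 1) (view s') from h1)]; exact zero_le
  · simp only [if_neg hsol]
    refine (hs _ rfl).le_expect fun s' h1 => ?_
    have : (s'.reg 0).toNat = 0 := h1.resolve_right fun h2 => hsol h2.2
    rw [if_pos this, ← ENNReal.toReal_le_toReal (by finiteness) (by finiteness)]
    simp only [ENNReal.toReal_div, ENNReal.toReal_ofNat, ENNReal.toReal_one]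
    norm_num

/-! ### The number of divisors -/

/-- From `a < e (⌊a/e⌋ + 1)` and `k + 1 ≤ 2 ^ k` follows `a + 1 ≤ e 2 ^ ⌊a/e⌋`; take the power `e`.
-/
theorem succ_pow_le_mul_two_pow {e : ℕ} (he : 0 < e) (a : ℕ) : (a + 1) ^ e ≤ e ^ e * 2 ^ a := by
  have h1 : a + 1 ≤ e * 2 ^ (a / e) := by
    have h2 : a / e + 1 ≤ 2 ^ (a / e) := Nat.lt_two_pow_self
    have h3 : a < e * (a / e + 1) := Nat.lt_mul_div_succ a he
    exact (Nat.succ_le_of_lt h3).trans (Nat.mul_le_mul_left e h2)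
  calc (a + 1) ^ e ≤ (e * 2 ^ (a / e)) ^ e := Nat.pow_le_pow_left h1 e
    _ = e ^ e * 2 ^ (a / e * e) := by rw [mul_pow, ← pow_mul]
    _ ≤ _ := Nat.mul_le_mul_left _ (Nat.pow_le_pow_right two_pos (Nat.div_mul_le_self a e))

/-- The classical bound `d(x) = O(x^(1/e))`. In the product of `(a_p + 1)^e` over the primes `p` of
`x`, a prime `p ≥ 2 ^ e` contributes at most `p ^ a_p`; each of the fewer than `2 ^ e` smaller
primes costs an additional factor `e ^ e`. -/
theorem exists_card_divisors_pow_le {e : ℕ} (he : 0 < e) :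
    ∃ C : ℕ, ∀ x, x.divisors.card ^ e ≤ C * x := by
  refine ⟨(e ^ e) ^ 2 ^ e, fun x => ?_⟩
  rcases Nat.eq_zero_or_pos x with rfl | hx
  · simp [he.ne']
  have hK : 1 ≤ e ^ e := Nat.one_le_pow _ _ he
  have hle : ∀ p ∈ x.primeFactors, (x.factorization p + 1) ^ e ≤
      (if p < 2 ^ e then e ^ e else 1) * p ^ x.factorization p := by
    intro p hp
    have hp2 := (Nat.prime_of_mem_primeFactors hp).two_le
    split_ifs with h
    · exact (succ_pow_le_mul_two_pow he _).trans
        (Nat.mul_le_mul_left _ (Nat.pow_le_pow_left hp2 _))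
    · rw [one_mul]
      calc (x.factorization p + 1) ^ e ≤ (2 ^ x.factorization p) ^ e :=
            Nat.pow_le_pow_left Nat.lt_two_pow_self e
        _ = (2 ^ e) ^ x.factorization p := by rw [← pow_mul, ← pow_mul, mul_comm]
        _ ≤ _ := Nat.pow_le_pow_left (not_lt.1 h) _
  rw [Nat.card_divisors hx.ne', ← Finset.prod_pow]
  refine (Finset.prod_le_prod' hle).trans ?_
  rw [Finset.prod_mul_distrib]
  refine Nat.mul_le_mul ?_ (Nat.prod_factorization_pow_eq_self hx.ne').le
  rw [Finset.prod_ite, Finset.prod_const, Finset.prod_const_one, mul_one]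
  refine Nat.pow_le_pow_right hK ?_
  refine (Finset.card_le_card (t := Finset.range (2 ^ e)) fun p hp => ?_).trans (by simp)
  exact Finset.mem_range.2 (Finset.mem_filter.1 hp).2

/-- The exponent `100` makes the number of divisors small against `√t = 2 ^ (2 u)`. Since `log₂ m +
1 ≤ 32 u + 32`, the exponent to be bounded by `100 (2 u - 5)` is at most `160 u + 161 + κ + C`; this
is where `661 + κ + C ≤ 40 u` comes from. -/
theorem card_divisors_le {C κ u m : ℕ} (hC : ∀ x, x.divisors.card ^ 100 ≤ C * x)
    (hu : Nat.log 2 m / 32 = u) (hu₀ : 661 + κ + C ≤ 40 * u) {x : ℕ} (hx : x ≤ 2 * 2 ^ bits κ m) :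
    x.divisors.card ≤ 2 ^ (2 * u - 5) := by
  refine (Nat.pow_le_pow_iff_left (n := 100) (by norm_num)).1 ((hC x).trans ?_)
  calc C * x ≤ 2 ^ C * (2 * 2 ^ bits κ m) := Nat.mul_le_mul Nat.lt_two_pow_self.le hx
    _ = 2 ^ (C + (bits κ m + 1)) := by rw [pow_add, pow_succ 2 (bits κ m), mul_comm 2]
    _ ≤ 2 ^ ((2 * u - 5) * 100) := Nat.pow_le_pow_right two_pos (by unfold bits; omega)
    _ = _ := by rw [pow_mul]

/-! ### The constants -/

/-- A rational number `D / j` between `c₁` and `c₂`. With `N = j⁵ 2^(20u)` and `n = D 2^(4u)` the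
quotient of `n` and `N^(1/5)` is exactly `D / j`. -/
theorem exists_ratio {c₁ c₂ : ℝ} (hc₁ : 0 < c₁) (hc₂ : c₁ < c₂) :
    ∃ D j : ℕ, 0 < D ∧ 0 < j ∧ c₁ * j ≤ D ∧ (D : ℝ) ≤ c₂ * j := by
  obtain ⟨j, hj⟩ := exists_nat_gt (1 / (c₂ - c₁))
  have hd : 0 < c₂ - c₁ := sub_pos.2 hc₂
  have hj0 : (0 : ℝ) < j := (one_div_pos.2 hd).trans hj
  have h1 : 1 < j * (c₂ - c₁) := (div_lt_iff₀ hd).1 hj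
  refine ⟨⌈c₁ * j⌉₊, j, Nat.ceil_pos.2 (mul_pos hc₁ hj0), by exact_mod_cast hj0, Nat.le_ceil _, ?_⟩
  have := Nat.ceil_lt_add_one (mul_pos hc₁ hj0).le
  linarith

/-! ### Word length -/

/-- The words have at least `20 * (log₂ m + 1) + s` bits. -/
theorem pow_lt_of_le {s m : ℕ} (h : 20 * (Nat.log 2 m + 1) + s ≤ w) {a b : ℕ}
    (hab : a + b ≤ 19 * (Nat.log 2 m + 1) + s) : 2 ^ a * 2 ^ b < 2 ^ w := by
  rw [← pow_add]
  exact Nat.pow_lt_pow_right one_lt_two (by omega)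

theorem fits_of_le {κ D E u₀ m k : ℕ} (hm : 0 < m) (hD : 0 < D) (hE : 0 < E)
    (h : 20 * (Nat.log 2 m + 1) + (κ + 2 * D + E + u₀ + k) ≤ w) : Fits w κ D E u₀ m := by
  set X := Nat.log 2 m + 1 with hX
  set u := Nat.log 2 m / 32 with hu
  have hmX : m < 2 ^ X := Nat.lt_pow_succ_log_self one_lt_two m
  have hww : w < 2 ^ w := Nat.lt_two_pow_self
  have hlt : ∀ a, a < w → 2 ^ a < 2 ^ w := fun a ha => Nat.pow_lt_pow_right one_lt_two ha
  have hDD : D < 2 ^ D := Nat.lt_two_pow_self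
  have hEE : E < 2 ^ E := Nat.lt_two_pow_self
  have hκ : κ < 2 ^ κ := Nat.lt_two_pow_self
  have hXX : X < 2 ^ X := Nat.lt_two_pow_self
  have hb : 2 ^ (4 * u) / (256 * (u + 1)) ≤ 2 ^ X :=
    (Nat.div_le_self _ _).trans (Nat.pow_le_pow_right two_pos (by omega))
  have h1 : 1 ≤ 2 ^ X := Nat.one_le_two_pow
  refine ⟨by omega, hm, ?_, ?_, ⟨by omega, by omega, by omega⟩, ?_, ?_, ?_, hD, hE, ?_⟩
  · simp only [Params.ofSize, ← hu]
    have : 2 ^ (X + 3) < 2 ^ w := hlt _ (by omega)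
    rw [pow_add] at this
    omega
  · have : 2 ^ (bits κ m + 2) < 2 ^ w := hlt _ (by unfold bits; omega)
    rw [pow_add] at this
    omega
  · exact (Nat.mul_lt_mul_of_pos_right hEE (by positivity)).trans (pow_lt_of_le h (by omega))
  · exact (Nat.mul_lt_mul_of_pos_right hDD (by positivity)).trans (pow_lt_of_le h (by omega))
  · simp only [Params.ofSize]
    omega
  -- With `X = log₂ m + 1` both `m` and `X` are at most `2 ^ X`, so `m³ X²` has at most `5 X` bits.
  · simp only [Params.ofSize, bits, ← hX]
    calc κ * m ^ 3 * X ^ 2 ≤ κ * ((2 ^ X) ^ 3 * (2 ^ X) ^ 2) := by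
          rw [mul_assoc]
          exact Nat.mul_le_mul_left _ (Nat.mul_le_mul (Nat.pow_le_pow_left hmX.le 3)
            (Nat.pow_le_pow_left hXX.le 2))
      _ < 2 ^ κ * ((2 ^ X) ^ 3 * (2 ^ X) ^ 2) := Nat.mul_lt_mul_of_pos_right hκ (by positivity)
      _ = 2 ^ (X * 5 + κ) := by rw [← pow_add, ← pow_mul, ← pow_add]; congr 1; omega

/-! ### The parameters are suitable -/

/-- The size of the sets is large in comparison with the constants. -/
structure Large (κ E C m : ℕ) : Prop where
  E_pos : 0 < E
  E_le : E ≤ Nat.log 2 m / 32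
  eight_le : 8 ≤ Nat.log 2 m / 32
  divisors_le : 661 + κ + C ≤ 40 * (Nat.log 2 m / 32)

section
variable {κ D E C m : ℕ}

theorem Large.pos (h : Large κ E C m) : 0 < m := by
  have := h.eight_le
  by_contra h0
  have : m = 0 := by omega
  subst this
  simp at this

theorem Large.pow_le (h : Large κ E C m) : 2 ^ (32 * (Nat.log 2 m / 32)) ≤ m :=
  (Nat.pow_le_pow_right two_pos (Nat.mul_div_le _ _)).trans (Nat.pow_log_le_self 2 h.pos.ne')

theorem large_le_pow {u : ℕ} (hu : 8 ≤ u) : 4096 * (u + 1) ≤ 2 ^ (4 * u) := by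
  have h1 : u + 1 ≤ 2 ^ u := Nat.lt_two_pow_self
  have h2 : 4096 ≤ 2 ^ (3 * u) := le_trans (by norm_num) (Nat.pow_le_pow_right two_pos (show 12 ≤ 3 * u by omega))
  calc 4096 * (u + 1) ≤ 2 ^ (3 * u) * 2 ^ u := Nat.mul_le_mul h2 h1
    _ = 2 ^ (4 * u) := by rw [← pow_add]; congr 1; omega

theorem Large.b_pos (h : Large κ E C m) : 0 < (Params.ofSize κ D E m 0).b := by
  have := large_le_pow h.eight_le
  exact Nat.div_pos (by omega) (by omega)

theorem Params.ofSize_b_le : (Params.ofSize κ D E m 0).b ≤ 2 ^ (4 * (Nat.log 2 m / 32)) :=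
  Nat.div_le_self _ _

theorem Large.b_le (h : Large κ E C m) : (Params.ofSize κ D E m 0).b ≤ m :=
  Params.ofSize_b_le.trans ((Nat.pow_le_pow_right two_pos (by omega)).trans h.pow_le)

theorem Large.le_mul (h : Large κ E C m) :
    m ≤ (Params.ofSize κ D E m 0).g * (Params.ofSize κ D E m 0).b := by
  have hb : 0 < (Params.ofSize κ D E m 0).b := h.b_pos
  have h1 : (Params.ofSize κ D E m 0).g =
    (m + (Params.ofSize κ D E m 0).b - 1) / (Params.ofSize κ D E m 0).b := rfl
  rw [h1]
  generalize (Params.ofSize κ D E m 0).b = b at *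
  have := Nat.lt_mul_div_succ (m + b - 1) hb
  rw [mul_add, mul_comm] at this
  omega

theorem Large.mul_lt (h : Large κ E C m) :
    (Params.ofSize κ D E m 0).g * (Params.ofSize κ D E m 0).b < m + (Params.ofSize κ D E m 0).b := by
  have hb : 0 < (Params.ofSize κ D E m 0).b := h.b_pos
  have h1 : (Params.ofSize κ D E m 0).g * (Params.ofSize κ D E m 0).b ≤
    m + (Params.ofSize κ D E m 0).b - 1 := Nat.div_mul_le_self _ _
  have := h.pos
  omega

theorem Large.g_le (h : Large κ E C m) : (Params.ofSize κ D E m 0).g ≤ m := by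
  have hb : 0 < (Params.ofSize κ D E m 0).b := h.b_pos
  have h1 := h.mul_lt (D := D)
  have h2 := h.b_le (D := D)
  by_contra! h3
  have h4 : (m + 1) * (Params.ofSize κ D E m 0).b ≤
    (Params.ofSize κ D E m 0).g * (Params.ofSize κ D E m 0).b := Nat.mul_le_mul_right _ h3
  nlinarith

/-- There are at least `m / b ≥ 2^(28u)` blocks, while `N = E 2^(20u)`. Thus the cells wasted by
incomplete batches, at most `g N`, are of the same order as the `4 g²` triples. -/
theorem Large.N_le (h : Large κ E C m) :
    (Params.ofSize κ D E m 0).N ≤ (Params.ofSize κ D E m 0).g := by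
  have h1 := h.le_mul (D := D)
  have h2 := h.pow_le
  have h3 : (Params.ofSize κ D E m 0).b ≤ _ := Params.ofSize_b_le
  set u := Nat.log 2 m / 32 with hu
  have h4 : 2 ^ (28 * u) * 2 ^ (4 * u) ≤ (Params.ofSize κ D E m 0).g * 2 ^ (4 * u) := by
    rw [← pow_add, show 28 * u + 4 * u = 32 * u by ring]
    exact h2.trans (h1.trans (Nat.mul_le_mul_left _ h3))
  have h5 := Nat.le_of_mul_le_mul_right h4 (by positivity)
  refine le_trans ?_ h5
  have h6 : E ≤ 2 ^ (8 * u) :=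
    (Nat.lt_two_pow_self (n := E)).le.trans (Nat.pow_le_pow_right two_pos (by have := h.E_le; omega))
  calc E * 2 ^ (20 * u) ≤ 2 ^ (8 * u) * 2 ^ (20 * u) := Nat.mul_le_mul_right _ h6
    _ = 2 ^ (28 * u) := by rw [← pow_add]; congr 1; omega

theorem Large.list_le (h : Large κ E C m) : 4 * (Params.ofSize κ D E m 0).g ^ 2 +
    (Params.ofSize κ D E m 0).g * (Params.ofSize κ D E m 0).N ≤
      5 * (Params.ofSize κ D E m 0).g ^ 2 := by
  have := Nat.mul_le_mul_left (Params.ofSize κ D E m 0).g (h.N_le (D := D))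
  rw [pow_two]
  omega

/-- The factor `256 (u + 1)` in the block length leaves room for the logarithmic number of rules per
element and for the constant in the length of a slot. -/
theorem Large.good {u₀ : ℕ} (h : Large κ E C m) (hf : Fits w κ D E u₀ m) {k : ℕ}
    (hw : 20 * (Nat.log 2 m + 1) + (κ + 2 * D + E + u₀ + k) ≤ w) {M : ℕ}
    (hM : M * (Params.ofSize κ D E m 0).N ≤ 4 * (Params.ofSize κ D E m 0).g ^ 2 +
      (Params.ofSize κ D E m 0).g * (Params.ofSize κ D E m 0).N) :
    (Params.ofSize κ D E m M).Good w := by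
  have hmpos := h.pos
  have hb : 0 < (Params.ofSize κ D E m 0).b := h.b_pos
  have hlist := h.list_le (D := D)
  have hg := h.g_le (D := D)
  have hNg := h.N_le (D := D)
  have hmul := h.mul_lt (D := D)
  have hle := h.le_mul (D := D)
  have hlarge := large_le_pow h.eight_le
  have h8 := h.eight_le
  have hEu := h.E_le
  have hE0 := h.E_pos
  have hD0 := hf.D_pos
  have hbits := hf.bits_lt
  have hU := hf.size_lt
  have hmX : m < 2 ^ (Nat.log 2 m + 1) := Nat.lt_pow_succ_log_self one_lt_two m
  have hN : (Params.ofSize κ D E m 0).N = E * 2 ^ (20 * (Nat.log 2 m / 32)) := rfl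
  have hn : (Params.ofSize κ D E m 0).n = D * 2 ^ (4 * (Nat.log 2 m / 32)) := rfl
  have hbd : (Params.ofSize κ D E m 0).b =
    2 ^ (4 * (Nat.log 2 m / 32)) / (256 * (Nat.log 2 m / 32 + 1)) := rfl
  have hEE : E < 2 ^ E := Nat.lt_two_pow_self
  have hDD : D < 2 ^ D := Nat.lt_two_pow_self
  set u := Nat.log 2 m / 32 with hu
  have hexp : 16 * u - 3 + 3 = 16 * u := by omega
  have hbb : (Params.ofSize κ D E m 0).b * (256 * (u + 1)) ≤ 2 ^ (4 * u) := by
    rw [hbd]; exact Nat.div_mul_le_self _ _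
  have hm_lt := hf.m_lt
  have hgX : (Params.ofSize κ D E m 0).g ^ 2 < 2 ^ (2 * (Nat.log 2 m + 1)) := by
    rw [mul_comm, pow_mul]
    exact Nat.pow_lt_pow_left (by omega) two_ne_zero
  have hpow : 2 ^ (2 * (Nat.log 2 m + 1)) * 2 ^ 3 < 2 ^ w := pow_lt_of_le hw (by omega)
  have hgg : (Params.ofSize κ D E m 0).g ≤ (Params.ofSize κ D E m 0).g ^ 2 :=
    Nat.le_self_pow two_ne_zero _
  constructor
  · have := hf.w_large; omega
  · intro i hi
    have h1 : (i + 1) * (Params.ofSize κ D E m 0).b ≤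
      (Params.ofSize κ D E m 0).g * (Params.ofSize κ D E m 0).b := Nat.mul_le_mul_right _ hi
    have : i * (Params.ofSize κ D E m 0).b < m := by rw [add_mul] at h1; omega
    exact this
  · rcases Nat.eq_zero_or_pos (Params.ofSize κ D E m 0).g with h0 | h0
    · rw [h0] at hle; omega
    · exact h0
  · exact hm_lt
  · show 2 * (Params.ofSize κ D E m 0).U < 2 ^ w
    omega
  · exact Nat.two_pow_pos _
  · show 2 ^ (16 * u - 1) = 4 * 2 ^ (16 * u - 3)
    rw [show 16 * u - 1 = 16 * u - 3 + 2 by omega, pow_add]; ring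
  · show 16 * u - 1 < 20 * u + E
    omega
  · show 2 * 2 ^ (16 * u - 3) ≤ 2 ^ (20 * u + E)
    rw [← pow_succ']
    exact Nat.pow_le_pow_right two_pos (by omega)
  · show E * 2 ^ (20 * u) < 2 ^ (20 * u + E)
    rw [pow_add, mul_comm]
    exact Nat.mul_lt_mul_of_pos_left hEE (by positivity)
  · exact Nat.pow_lt_pow_right one_lt_two (show 20 * u + E < w by omega)
  -- Here `256 b ≤ 2^(4u)`, so the slots take at most the fraction `6/256` of `2^(20u) ≤ N`.
  · show 2 + (Params.ofSize κ D E m 0).b * (6 * 2 ^ (16 * u - 3)) ≤ (Params.ofSize κ D E m 0).N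
    have h1 : (Params.ofSize κ D E m 0).b * 256 ≤ 2 ^ (4 * u) :=
      (Nat.mul_le_mul_left _ (by omega)).trans hbb
    have h2 : (Params.ofSize κ D E m 0).b * 256 * 2 ^ (16 * u - 3) ≤
      2 ^ (4 * u) * 2 ^ (16 * u - 3) := Nat.mul_le_mul_right _ h1
    have h3 : 2 ^ (4 * u) * 2 ^ (16 * u - 3) ≤ 2 ^ (20 * u) := by
      rw [← pow_add]; exact Nat.pow_le_pow_right two_pos (by omega)
    have h4 : 2 ^ (20 * u) ≤ (Params.ofSize κ D E m 0).N := by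
      rw [hN]; exact Nat.le_mul_of_pos_left _ hE0
    have h5 : 0 < (Params.ofSize κ D E m 0).b * 2 ^ (16 * u - 3) := by positivity
    have e1 : (Params.ofSize κ D E m 0).b * 256 * 2 ^ (16 * u - 3) =
      256 * ((Params.ofSize κ D E m 0).b * 2 ^ (16 * u - 3)) := by ring
    have e2 : (Params.ofSize κ D E m 0).b * (6 * 2 ^ (16 * u - 3)) =
      6 * ((Params.ofSize κ D E m 0).b * 2 ^ (16 * u - 3)) := by ring
    omega
  -- With `E ≤ u` the tree and the slots need at most `(32 + 42) b (u + 1)` rules, against `256 b (u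
  -- + 1) ≤ 2^(4u) ≤ n`.
  · show 20 * u + E + 1 + 2 * (Params.ofSize κ D E m 0).b * (16 * u - 1) +
      (Params.ofSize κ D E m 0).b * (2 * (20 * u + E) + 1) + (20 * u + E) + 1 ≤
        (Params.ofSize κ D E m 0).n
    have h1 : 2 ^ (4 * u) ≤ (Params.ofSize κ D E m 0).n := by
      rw [hn]; exact Nat.le_mul_of_pos_left _ hD0
    have h2 : 2 * (Params.ofSize κ D E m 0).b * (16 * u - 1) ≤
        2 * (Params.ofSize κ D E m 0).b * (16 * (u + 1)) := Nat.mul_le_mul_left _ (by omega)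
    have h3 : (Params.ofSize κ D E m 0).b * (2 * (20 * u + E) + 1) ≤
        (Params.ofSize κ D E m 0).b * (42 * (u + 1)) := Nat.mul_le_mul_left _ (by omega)
    have e1 : 2 * (Params.ofSize κ D E m 0).b * (16 * (u + 1)) =
      32 * ((Params.ofSize κ D E m 0).b * (u + 1)) := by ring
    have e2 : (Params.ofSize κ D E m 0).b * (42 * (u + 1)) =
      42 * ((Params.ofSize κ D E m 0).b * (u + 1)) := by ring
    have e3 : (Params.ofSize κ D E m 0).b * (256 * (u + 1)) =
      256 * ((Params.ofSize κ D E m 0).b * (u + 1)) := by ring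
    omega
  · show M * (Params.ofSize κ D E m 0).N + (Params.ofSize κ D E m 0).N < 2 ^ w
    omega
  · show (Params.ofSize κ D E m 0).N * (Params.ofSize κ D E m 0).n +
      (Params.ofSize κ D E m 0).n < 2 ^ w
    have h1 : (Params.ofSize κ D E m 0).N + 1 ≤ 2 ^ (Nat.log 2 m + 1) := by omega
    have h2 : (Params.ofSize κ D E m 0).n ≤ 2 ^ D * 2 ^ (Nat.log 2 m + 1) := by
      rw [hn]; exact Nat.mul_le_mul hDD.le (Nat.pow_le_pow_right two_pos (by omega))
    calc _ = ((Params.ofSize κ D E m 0).N + 1) * (Params.ofSize κ D E m 0).n := by ring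
      _ ≤ 2 ^ (Nat.log 2 m + 1) * (2 ^ D * 2 ^ (Nat.log 2 m + 1)) := Nat.mul_le_mul h1 h2
      _ < 2 ^ w := by rw [← pow_add]; exact pow_lt_of_le hw (by omega)
  · show E * 2 ^ (18 * u) < 2 ^ w
    exact (Nat.mul_lt_mul_of_pos_right hEE (by positivity)).trans (pow_lt_of_le hw (by omega))

theorem Large.suitable {u₀ : ℕ} (h : Large κ E C m) (hf : Fits w κ D E u₀ m) {k : ℕ}
    (hw : 20 * (Nat.log 2 m + 1) + (κ + 2 * D + E + u₀ + k) ≤ w)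
    (hC : ∀ x, x.divisors.card ^ 100 ≤ C * x) {P : Cmd} {nr na T T' : ℕ}
    (hr : ∀ r ∈ modR P, r < nr) (ha : ∀ a ∈ modA P, a < na)
    (hP : SolvesSize P w (Params.ofSize κ D E m 0).N (Params.ofSize κ D E m 0).n T)
    (hT : T < 2 ^ w)
    (hT' : ∀ M, M * (Params.ofSize κ D E m 0).N ≤ 5 * (Params.ofSize κ D E m 0).g ^ 2 →
      M * (2 * (Params.ofSize κ D E m 0).time T nr na + 10) + 10 ≤ T') :
    Suitable w κ D E m P nr na T T' (2 ^ (2 * (Nat.log 2 m / 32) - 5)) := by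
  have hlist := h.list_le (D := D)
  have hgX : (Params.ofSize κ D E m 0).g ^ 2 < 2 ^ (2 * (Nat.log 2 m + 1)) := by
    rw [mul_comm, pow_mul]
    exact Nat.pow_lt_pow_left (h.g_le.trans_lt (Nat.lt_pow_succ_log_self one_lt_two m)) two_ne_zero
  have hpow : 2 ^ (2 * (Nat.log 2 m + 1)) * 2 ^ 3 < 2 ^ w := pow_lt_of_le hw (by omega)
  have hgg : (Params.ofSize κ D E m 0).g ≤ (Params.ofSize κ D E m 0).g ^ 2 :=
    Nat.le_self_pow two_ne_zero _
  have h8 := h.eight_le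
  refine ⟨h8, fun M hM => ⟨h.good hf hw hM, hr, ha, hP, hT⟩, fun M hM => hT' M (hM.trans hlist),
    h.b_pos, h.le_mul, by omega, fun x hx => card_divisors_le hC rfl h.divisors_le
      (hx.trans (Nat.mul_le_mul_left 2 hf.size_lt.le)), ?_, ?_, ?_⟩
  · have hb : (Params.ofSize κ D E m 0).b ^ 3 ≤ (2 ^ (4 * (Nat.log 2 m / 32))) ^ 3 :=
      Nat.pow_le_pow_left Params.ofSize_b_le 3
    show 4 * (E * 2 ^ (20 * (Nat.log 2 m / 32)) * ((Params.ofSize κ D E m 0).b ^ 3 *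
      2 ^ (2 * (Nat.log 2 m / 32) - 5))) ≤ E * 2 ^ (18 * (Nat.log 2 m / 32)) *
        2 ^ (16 * (Nat.log 2 m / 32) - 3)
    generalize Nat.log 2 m / 32 = u at *
    -- The exponents balance exactly: `2 + 20u + 12u + (2u - 5) = 18u + (16u - 3)`.
    calc _ ≤ 4 * (E * 2 ^ (20 * u) * ((2 ^ (4 * u)) ^ 3 * 2 ^ (2 * u - 5))) := by gcongr
      _ = E * 2 ^ (2 + 20 * u + 4 * u * 3 + (2 * u - 5)) := by
          rw [pow_add, pow_add, pow_add, pow_mul _ (4 * u) 3]; ring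
      _ = E * 2 ^ (18 * u + (16 * u - 3)) := by congr 2; omega
      _ = _ := by rw [pow_add, mul_assoc]
  · exact Nat.mul_pos h.E_pos (Nat.two_pow_pos _)
  · exact pow_dvd_pow 2 (by omega)

end

/-! ### The running time -/

/-- From `1 + y ≤ exp y` with `y = δ u log 2`. -/
theorem exists_succ_le_mul_rpow {δ : ℝ} (hδ : 0 < δ) :
    ∃ C : ℝ, 0 ≤ C ∧ ∀ u : ℕ, (u + 1 : ℝ) ≤ C * 2 ^ (δ * u) := by
  have hl : 0 < Real.log 2 * δ := mul_pos (Real.log_pos one_lt_two) hδ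
  refine ⟨1 + 1 / (Real.log 2 * δ), by positivity, fun u => ?_⟩
  have h1 : Real.log 2 * δ * u + 1 ≤ (2 : ℝ) ^ (δ * u) := by
    rw [Real.rpow_def_of_pos two_pos, ← mul_assoc]
    exact Real.add_one_le_exp _
  have h2 : (1 : ℝ) ≤ 2 ^ (δ * u) := by
    have : 0 ≤ Real.log 2 * δ * u := by positivity
    linarith
  have h3 : (u : ℝ) ≤ 1 / (Real.log 2 * δ) * 2 ^ (δ * u) := by
    rw [div_mul_eq_mul_div, one_mul, le_div_iff₀ hl]
    linarith
  linarith

/-- The saving `t^(-δ)` is `2^(-4δu)`. One half of the exponent absorbs the square of the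
logarithmic factor; the other half, `2^(-2δu)`, is at most a constant times `m^(-δ/16)`, because `m
≤ 2^(32u+32)`. -/
theorem exists_sq_mul_le {δ : ℝ} (hδ : 0 < δ) :
    ∃ C : ℝ, 0 ≤ C ∧ ∀ m : ℕ, 0 < m → ((Nat.log 2 m / 32 : ℕ) + 1 : ℝ) ^ 2 *
      ((2 : ℝ) ^ (4 * (Nat.log 2 m / 32))) ^ (-δ) ≤ C * (m : ℝ) ^ (-(δ / 16)) := by
  obtain ⟨C, hC, h⟩ := exists_succ_le_mul_rpow hδ
  refine ⟨C ^ 2 * 2 ^ (2 * δ), by positivity, fun m hm => ?_⟩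
  have h1 : ∀ u : ℕ, (u + 1 : ℝ) ^ 2 ≤ C ^ 2 * (2 : ℝ) ^ (2 * δ * u) := fun u => by
    have e : ((2 : ℝ) ^ (δ * u)) ^ 2 = (2 : ℝ) ^ (2 * δ * u) := by
      rw [← Real.rpow_mul_natCast two_pos.le]
      congr 1; push_cast; ring
    rw [← e, ← mul_pow]
    exact pow_le_pow_left₀ (by positivity) (h u) 2
  have hlog : m < 2 ^ (Nat.log 2 m + 1) := Nat.lt_pow_succ_log_self one_lt_two m
  have hu : m ≤ 2 ^ (32 * (Nat.log 2 m / 32) + 32) :=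
    hlog.le.trans (Nat.pow_le_pow_right two_pos (by omega))
  generalize Nat.log 2 m / 32 = u at hu ⊢
  have h2 : ((2 : ℝ) ^ (4 * u)) ^ (-δ) = 2 ^ (-(4 * δ * u)) := by
    rw [← Real.rpow_natCast, ← Real.rpow_mul two_pos.le]; congr 1; push_cast; ring
  have h3 : (2 : ℝ) ^ (-(2 * δ * u + 2 * δ)) ≤ (m : ℝ) ^ (-(δ / 16)) := by
    have hm' : (m : ℝ) ≤ 2 ^ (32 * u + 32) := by exact_mod_cast hu
    have hm0 : (0 : ℝ) < m := by exact_mod_cast hm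
    calc (2 : ℝ) ^ (-(2 * δ * u + 2 * δ)) = ((2 : ℝ) ^ (32 * u + 32)) ^ (-(δ / 16)) := by
          rw [← Real.rpow_natCast, ← Real.rpow_mul two_pos.le]; congr 1; push_cast; ring
      _ ≤ _ := Real.rpow_le_rpow_of_nonpos hm0 hm' (by linarith)
  clear hu hlog
  rw [h2]
  calc (u + 1 : ℝ) ^ 2 * 2 ^ (-(4 * δ * u)) ≤ C ^ 2 * 2 ^ (2 * δ * u) * 2 ^ (-(4 * δ * u)) := by
        exact mul_le_mul_of_nonneg_right (h1 u) (by positivity)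
    _ = C ^ 2 * 2 ^ (2 * δ) * 2 ^ (-(2 * δ * u + 2 * δ)) := by
        rw [mul_assoc (C ^ 2), mul_assoc (C ^ 2), ← Real.rpow_add two_pos, ← Real.rpow_add two_pos]
        congr 2; ring
    _ ≤ _ := by gcongr

theorem Params.time_le {S : Params} (T nr na : ℕ) (hN : 1 ≤ S.N) (hn : 1 ≤ S.n) (hb : 1 ≤ S.b) :
    2 * S.time T nr na + 10 ≤
      (3000 + 4 * na + 4 * nr) * (S.N * S.n + T + S.thr * S.b ^ 2) := by
  have h1 : S.N ≤ S.N * S.n := Nat.le_mul_of_pos_right _ hn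
  have h2 : S.n ≤ S.N * S.n := Nat.le_mul_of_pos_left _ hN
  have h3 : 1 ≤ S.N * S.n := hN.trans h1
  have h4 : S.thr ≤ S.thr * S.b ^ 2 := Nat.le_mul_of_pos_right _ (by positivity)
  have h5 : S.thr * S.b ≤ S.thr * S.b ^ 2 :=
    Nat.mul_le_mul_left _ (Nat.le_self_pow two_ne_zero _)
  have h6 : nr ≤ nr * (S.N * S.n) := Nat.le_mul_of_pos_right _ h3
  have e : 2 * S.time T nr na + 10 = 1200 * (S.N * S.n) + 70 * S.N + 1200 * S.n + 330 + 10 * T +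
      120 * (S.thr * S.b ^ 2) + 40 * (S.thr * S.b) + 240 * S.thr + 4 * (na * T) + 40 * T + 4 * nr := by
    unfold Params.time; ring
  have e' : (3000 + 4 * na + 4 * nr) * (S.N * S.n + T + S.thr * S.b ^ 2) =
      3000 * (S.N * S.n) + 3000 * T + 3000 * (S.thr * S.b ^ 2) + 4 * (na * T) +
      4 * (nr * (S.N * S.n)) +
      (4 * na * (S.N * S.n + S.thr * S.b ^ 2) + 4 * nr * (T + S.thr * S.b ^ 2)) := by ring
  rw [e, e']
  refine le_trans ?_ (Nat.le_add_right _ _)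
  omega

section
variable {κ D E C m : ℕ}

/-- Rounding costs factors of two only: `t < 256 (u+1) (b+1) ≤ 512 (u+1) b`, and `g b < m + b ≤ 2
m`. -/
theorem Large.g_real_le (h : Large κ E C m) :
    ((Params.ofSize κ D E m 0).g : ℝ) * (Params.ofSize κ D E m 0).b ≤ 2 * m ∧
    ((Params.ofSize κ D E m 0).g : ℝ) * 2 ^ (4 * (Nat.log 2 m / 32)) ≤
      1024 * m * ((Nat.log 2 m / 32 : ℕ) + 1) := by
  have h1 := h.mul_lt (D := D)
  have h2 := h.b_le (D := D)
  have hb : 0 < (Params.ofSize κ D E m 0).b := h.b_pos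
  have hN : (Params.ofSize κ D E m 0).g * (Params.ofSize κ D E m 0).b ≤ 2 * m := by omega
  have h3 : 2 ^ (4 * (Nat.log 2 m / 32)) ≤
      (Params.ofSize κ D E m 0).b * (512 * (Nat.log 2 m / 32 + 1)) := by
    have hbd : (Params.ofSize κ D E m 0).b =
      2 ^ (4 * (Nat.log 2 m / 32)) / (256 * (Nat.log 2 m / 32 + 1)) := rfl
    have := Nat.lt_mul_div_succ (2 ^ (4 * (Nat.log 2 m / 32)))
      (show 0 < 256 * (Nat.log 2 m / 32 + 1) by omega)
    rw [← hbd] at this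
    generalize Nat.log 2 m / 32 = u at *
    generalize (Params.ofSize κ D E m 0).b = b at *
    have h5 : (u + 1) * 1 ≤ (u + 1) * b := Nat.mul_le_mul_left _ hb
    have e1 : 256 * (u + 1) * (b + 1) = 256 * ((u + 1) * b) + 256 * (u + 1) := by ring
    have e2 : b * (512 * (u + 1)) = 512 * ((u + 1) * b) := by ring
    omega
  constructor
  · exact_mod_cast hN
  · have h4 : (Params.ofSize κ D E m 0).g * 2 ^ (4 * (Nat.log 2 m / 32)) ≤
        1024 * m * (Nat.log 2 m / 32 + 1) := by
      calc _ ≤ (Params.ofSize κ D E m 0).g *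
            ((Params.ofSize κ D E m 0).b * (512 * (Nat.log 2 m / 32 + 1))) :=
            Nat.mul_le_mul_left _ h3
        _ = (Params.ofSize κ D E m 0).g * (Params.ofSize κ D E m 0).b *
            (512 * (Nat.log 2 m / 32 + 1)) := by ring
        _ ≤ 2 * m * (512 * (Nat.log 2 m / 32 + 1)) := Nat.mul_le_mul_right _ hN
        _ = _ := by ring
    exact_mod_cast h4

/-- The bounds for the terms of the running time. -/
theorem Large.terms_le (h : Large κ E C m) (hD : 0 < D) {ε δ : ℝ} (hδ : δ ≤ ε) (hδ0 : 0 < δ)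
    (hδ2 : δ ≤ 1 / 2)
    {g b n t x : ℝ} (hg : g = (Params.ofSize κ D E m 0).g) (hb : b = (Params.ofSize κ D E m 0).b)
    (hn : n = (Params.ofSize κ D E m 0).n) (ht : t = 2 ^ (4 * (Nat.log 2 m / 32)))
    (hx : x = m ^ 2 * (((Nat.log 2 m / 32 : ℕ) + 1 : ℝ) ^ 2 * t ^ (-δ))) :
    g ^ 2 ≤ 1024 ^ 2 * x ∧ g ^ 2 * n ≤ 1024 ^ 2 * D * x ∧
      g ^ 2 * n ^ (2 - ε) ≤ 1024 ^ 2 * D ^ 2 * x ∧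
      g ^ 2 * b ^ 2 * ((2 : ℝ) ^ (2 * (Nat.log 2 m / 32)))⁻¹ ≤ 4 * x := by
  obtain ⟨h1, h2⟩ := h.g_real_le (D := D)
  rw [← hg, ← hb] at h1
  rw [← hg, ← ht] at h2
  have hg0 : 0 ≤ g := hg ▸ Nat.cast_nonneg _
  have hb0 : 0 ≤ b := hb ▸ Nat.cast_nonneg _
  have hn' : n = D * t := by rw [hn, ht]; simp [Params.ofSize]
  have hpow : (2 : ℝ) ^ (2 * (Nat.log 2 m / 32)) = t ^ (1 / 2 : ℝ) := by
    rw [ht, ← Real.rpow_natCast, ← Real.rpow_natCast, ← Real.rpow_mul two_pos.le]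
    congr 1; push_cast; ring
  have ht1 : 1 ≤ t := ht ▸ one_le_pow₀ one_le_two
  generalize Nat.log 2 m / 32 = u at *
  have ht0 : 0 < t := by linarith
  have hD1 : (1 : ℝ) ≤ D := by exact_mod_cast hD
  set y : ℝ := m ^ 2 * (u + 1 : ℝ) ^ 2 with hy
  have hy0 : 0 ≤ y := by positivity
  have hxy : x = y * t ^ (-δ) := by rw [hx, hy]; ring
  have key : ∀ a : ℝ, a ≤ -δ → y * t ^ a ≤ x := fun a ha => by
    rw [hxy]
    exact mul_le_mul_of_nonneg_left (Real.rpow_le_rpow_of_exponent_le ht1 ha) hy0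
  -- All but the last bound follow from this one; the last uses `g b ≤ 2 m` instead and gains the
  -- factor `t^(-1/2)`, which is why `δ ≤ 1/2` is required.
  have hgt : g ^ 2 ≤ 1024 ^ 2 * (y * t ^ (-2 : ℝ)) := by
    have h3 : (g * t) ^ 2 ≤ 1024 ^ 2 * y := by
      calc (g * t) ^ 2 ≤ (1024 * m * (u + 1)) ^ 2 := by gcongr
        _ = _ := by rw [hy]; ring
    rw [Real.rpow_neg ht0.le, ← div_eq_mul_inv, mul_div_assoc', le_div_iff₀ (by positivity)]
    calc g ^ 2 * t ^ (2 : ℝ) = (g * t) ^ 2 := by rw [mul_pow]; norm_cast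
      _ ≤ _ := h3
  refine ⟨?_, ?_, ?_, ?_⟩
  · exact hgt.trans (by gcongr; exact key _ (by linarith))
  · calc g ^ 2 * n ≤ 1024 ^ 2 * (y * t ^ (-2 : ℝ)) * (D * t) := by
          rw [hn']; gcongr
      _ = 1024 ^ 2 * D * (y * (t ^ (-2 : ℝ) * t ^ (1 : ℝ))) := by rw [Real.rpow_one]; ring
      _ = 1024 ^ 2 * D * (y * t ^ (-1 : ℝ)) := by rw [← Real.rpow_add ht0]; norm_num
      _ ≤ _ := by gcongr; exact key _ (by linarith)
  · have h4 : n ^ (2 - ε) ≤ D ^ 2 * t ^ (2 - ε) := by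
      rw [hn', Real.mul_rpow (by linarith) ht0.le]
      gcongr
      rw [← Real.rpow_natCast]
      exact Real.rpow_le_rpow_of_exponent_le hD1 (by push_cast; linarith)
    have hn0 : 0 ≤ n ^ (2 - ε) := Real.rpow_nonneg (by rw [hn']; positivity) _
    calc g ^ 2 * n ^ (2 - ε) ≤ 1024 ^ 2 * (y * t ^ (-2 : ℝ)) * (D ^ 2 * t ^ (2 - ε)) := by gcongr
      _ = 1024 ^ 2 * D ^ 2 * (y * (t ^ (-2 : ℝ) * t ^ (2 - ε))) := by ring
      _ = 1024 ^ 2 * D ^ 2 * (y * t ^ (-ε)) := by rw [← Real.rpow_add ht0]; ring_nf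
      _ ≤ _ := by gcongr; exact key _ (by linarith)
  · rw [hpow, ← Real.rpow_neg ht0.le]
    calc g ^ 2 * b ^ 2 * t ^ (-(1 / 2) : ℝ) = (g * b) ^ 2 * t ^ (-(1 / 2) : ℝ) := by ring
      _ ≤ (2 * m) ^ 2 * t ^ (-(1 / 2) : ℝ) := by gcongr
      _ = 4 * (m ^ 2 * 1 * t ^ (-(1 / 2) : ℝ)) := by ring
      _ ≤ 4 * (m ^ 2 * (u + 1 : ℝ) ^ 2 * t ^ (-(1 / 2) : ℝ)) := by
          gcongr
          exact one_le_pow₀ (by linarith [Nat.cast_nonneg (α := ℝ) u])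
      _ ≤ 4 * x := by gcongr; exact key _ (by linarith)

/-- The time for large sets. -/
theorem exists_batches_time_le (κ D E C nr na k : ℕ) (hD : 0 < D) {ε δ : ℝ} (hδ : δ ≤ ε)
    (hδ0 : 0 < δ) (hδ2 : δ ≤ 1 / 2) :
    ∃ c : ℝ, 0 ≤ c ∧ ∀ m T : ℕ, Large κ E C m →
      (T : ℝ) ≤ k * ((Params.ofSize κ D E m 0).N *
        ((Params.ofSize κ D E m 0).n : ℝ) ^ (2 - ε)) →
      ((345 * (Params.ofSize κ D E m 0).g ^ 2 + 310 : ℕ) : ℝ) ≤ c * (m : ℝ) ^ (2 - δ / 16) ∧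
      ∀ M, M * (Params.ofSize κ D E m 0).N ≤ 5 * (Params.ofSize κ D E m 0).g ^ 2 →
        ((M * (2 * (Params.ofSize κ D E m 0).time T nr na + 10) + 10 : ℕ) : ℝ) ≤
          c * (m : ℝ) ^ (2 - δ / 16) := by
  obtain ⟨B, hB0, hB⟩ := exists_sq_mul_le hδ0
  set s : ℝ := 3000 + 4 * na + 4 * nr with hs
  have hs0 : 0 ≤ s := by positivity
  set d : ℝ := s * (5 * (1024 ^ 2 * D + k * (1024 ^ 2 * D ^ 2) + 4)) with hd
  have hd0 : 0 ≤ d := by positivity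
  refine ⟨345 * (1024 ^ 2 * B) + d * B + 310, by positivity, fun m T h hT => ?_⟩
  have hm : (1 : ℝ) ≤ m := by exact_mod_cast h.pos
  obtain ⟨t1, t2, t3, t4⟩ := h.terms_le hD hδ hδ0 hδ2 rfl rfl rfl rfl rfl
  set x : ℝ := m ^ 2 * (((Nat.log 2 m / 32 : ℕ) + 1 : ℝ) ^ 2 *
    ((2 : ℝ) ^ (4 * (Nat.log 2 m / 32))) ^ (-δ)) with hx
  have hx0 : 0 ≤ x := by positivity
  set z : ℝ := (m : ℝ) ^ (2 - δ / 16) with hz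
  have hxz : x ≤ B * z := by
    calc x ≤ m ^ 2 * (B * (m : ℝ) ^ (-(δ / 16))) := by 
          rw [hx]; exact mul_le_mul_of_nonneg_left (hB m h.pos) (by positivity)
      _ = B * ((m : ℝ) ^ (2 : ℝ) * (m : ℝ) ^ (-(δ / 16))) := by norm_cast; ring
      _ = B * z := by rw [← Real.rpow_add (by linarith), hz]; rfl
  have hz1 : 1 ≤ z := Real.one_le_rpow hm (by linarith)
  have hN1 : 1 ≤ (Params.ofSize κ D E m 0).N := Nat.mul_pos h.E_pos (Nat.two_pow_pos _)
  have hn1 : 1 ≤ (Params.ofSize κ D E m 0).n := Nat.mul_pos hD (Nat.two_pow_pos _)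
  have hb1 : 1 ≤ (Params.ofSize κ D E m 0).b := h.b_pos
  have htime := Params.time_le T nr na hN1 hn1 hb1
  -- The threshold is `N / √t`, so `M` times the cost of the exact searches also has the factor `M N
  -- ≤ 5 g²`.
  have hthr : ((Params.ofSize κ D E m 0).thr : ℝ) = (Params.ofSize κ D E m 0).N *
      ((2 : ℝ) ^ (2 * (Nat.log 2 m / 32)))⁻¹ := by
    rw [← div_eq_mul_inv, eq_div_iff (by positivity)]
    simp only [Params.ofSize]
    push_cast
    rw [mul_assoc, ← pow_add]; congr 2; omega
  generalize Params.ofSize κ D E m 0 = S at *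
  constructor
  · push_cast
    have : 345 * (S.g : ℝ) ^ 2 ≤ 345 * (1024 ^ 2 * (B * z)) := by
      refine mul_le_mul_of_nonneg_left (t1.trans ?_) (by norm_num); gcongr
    have hdB : 0 ≤ d * B * z := by positivity
    have e : (345 * (1024 ^ 2 * B) + d * B + 310) * z =
      345 * (1024 ^ 2 * (B * z)) + d * B * z + 310 * z := by ring
    linarith
  · intro M hM
    have hM' : (M : ℝ) * S.N ≤ 5 * S.g ^ 2 := by exact_mod_cast hM
    have h1 : ((2 * S.time T nr na + 10 : ℕ) : ℝ) ≤
        s * (S.N * (S.n + k * (S.n : ℝ) ^ (2 - ε) +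
          S.b ^ 2 * ((2 : ℝ) ^ (2 * (Nat.log 2 m / 32)))⁻¹)) := by
      calc ((2 * S.time T nr na + 10 : ℕ) : ℝ) ≤ (((3000 + 4 * na + 4 * nr) *
            (S.N * S.n + T + S.thr * S.b ^ 2) : ℕ) : ℝ) := by exact_mod_cast htime
        _ = s * (S.N * S.n + T + S.thr * S.b ^ 2) := by push_cast; rfl
        _ ≤ s * (S.N * S.n + k * (S.N * (S.n : ℝ) ^ (2 - ε)) + S.thr * S.b ^ 2) := by gcongr
        _ = _ := by rw [hthr]; ring
    -- Each term of the time of a batch contains `N`, and `M N` is replaced by `5 g²`.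
    have h2 : ((M * (2 * S.time T nr na + 10) : ℕ) : ℝ) ≤ d * x := by
      calc ((M * (2 * S.time T nr na + 10) : ℕ) : ℝ) = M * ((2 * S.time T nr na + 10 : ℕ) : ℝ) := by
            push_cast; rfl
        _ ≤ M * (s * (S.N * (S.n + k * (S.n : ℝ) ^ (2 - ε) +
            S.b ^ 2 * ((2 : ℝ) ^ (2 * (Nat.log 2 m / 32)))⁻¹))) := by gcongr
        _ = s * ((M * S.N) * (S.n + k * (S.n : ℝ) ^ (2 - ε) +
            S.b ^ 2 * ((2 : ℝ) ^ (2 * (Nat.log 2 m / 32)))⁻¹)) := by ring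
        _ ≤ s * ((5 * S.g ^ 2) * (S.n + k * (S.n : ℝ) ^ (2 - ε) +
            S.b ^ 2 * ((2 : ℝ) ^ (2 * (Nat.log 2 m / 32)))⁻¹)) := by gcongr
        _ = s * (5 * (S.g ^ 2 * S.n + k * (S.g ^ 2 * (S.n : ℝ) ^ (2 - ε)) +
            S.g ^ 2 * S.b ^ 2 * ((2 : ℝ) ^ (2 * (Nat.log 2 m / 32)))⁻¹)) := by ring
        _ ≤ s * (5 * (1024 ^ 2 * D * x + k * (1024 ^ 2 * D ^ 2 * x) + 4 * x)) := by gcongr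
        _ = d * x := by rw [hd]; ring
    rw [Nat.cast_add, show ((10 : ℕ) : ℝ) = 10 by norm_num]
    have h3 : d * x ≤ d * (B * z) := by gcongr
    have h4 : 0 ≤ 345 * (1024 ^ 2 * B) * z := by positivity
    have e : (345 * (1024 ^ 2 * B) + d * B + 310) * z =
      345 * (1024 ^ 2 * B) * z + d * (B * z) + 310 * z := by ring
    linarith

end

/-- Sorting takes time `O(m log m)`, which is at most of order `m^(3/2)` and so disappears in
`m^(2-δ)` for `δ ≤ 1/2`. -/
theorem exists_solverTime_le (κ : ℕ) {δ c : ℝ} (hc : 0 ≤ c) (hδ : δ ≤ 1 / 2) :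
    ∃ K : ℝ, ∀ m, 0 < m →
      solverTime κ m ⌊c * (m : ℝ) ^ (2 - δ)⌋₊ ≤ ⌊K * (m : ℝ) ^ (2 - δ)⌋₊ := by
  obtain ⟨B, hB0, hB⟩ := exists_succ_le_mul_rpow (δ := 1 / 2) (by norm_num)
  refine ⟨(2000 + 400 * κ) * B + c, fun m hm => Nat.le_floor ?_⟩
  have hm1 : (1 : ℝ) ≤ m := by exact_mod_cast hm
  have hfl : (⌊c * (m : ℝ) ^ (2 - δ)⌋₊ : ℝ) ≤ c * (m : ℝ) ^ (2 - δ) := Nat.floor_le (by positivity)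
  have hl : (Nat.log 2 m + 1 : ℝ) ≤ B * (m : ℝ) ^ (1 / 2 : ℝ) := by
    refine (hB _).trans (mul_le_mul_of_nonneg_left ?_ hB0)
    have : ((2 ^ Nat.log 2 m : ℕ) : ℝ) ≤ m := by exact_mod_cast Nat.pow_log_le_self 2 hm.ne'
    calc (2 : ℝ) ^ (1 / 2 * (Nat.log 2 m : ℝ)) = ((2 ^ Nat.log 2 m : ℕ) : ℝ) ^ (1 / 2 : ℝ) := by
          push_cast
          rw [← Real.rpow_natCast, ← Real.rpow_mul two_pos.le, mul_comm]
      _ ≤ _ := by gcongr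
  have hlm : ((Nat.log 2 m + 1) * m : ℝ) ≤ B * (m : ℝ) ^ (2 - δ) := by
    calc ((Nat.log 2 m + 1) * m : ℝ) ≤ B * (m : ℝ) ^ (1 / 2 : ℝ) * (m : ℝ) ^ (1 : ℝ) := by
          rw [Real.rpow_one]; gcongr
      _ = B * (m : ℝ) ^ (1 / 2 + 1 : ℝ) := by rw [Real.rpow_add (by linarith), mul_assoc]
      _ ≤ _ := by
          gcongr
          linarith
  have hnat : Nat.log 2 m * 10 + 3 * (bits κ m * (m * 70 + 40)) + 100 ≤
      (2000 + 400 * κ) * ((Nat.log 2 m + 1) * m) := by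
    unfold bits
    generalize Nat.log 2 m = l
    have h1 : l + 1 ≤ (l + 1) * m := Nat.le_mul_of_pos_right _ hm
    have h2 : m ≤ (l + 1) * m := Nat.le_mul_of_pos_left _ (by omega)
    have h3 : κ * m ≤ κ * ((l + 1) * m) := Nat.mul_le_mul_left _ h2
    have h4 : κ ≤ κ * m := Nat.le_mul_of_pos_right _ hm
    have e : 3 * (((l + 1) * 5 + κ) * (m * 70 + 40)) = 1050 * ((l + 1) * m) + 600 * (l + 1) +
      210 * (κ * m) + 120 * κ := by ring
    have e' : (2000 + 400 * κ) * ((l + 1) * m) = 2000 * ((l + 1) * m) + 400 * (κ * ((l + 1) * m)) := by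
      ring
    omega
  have hnat' : ((Nat.log 2 m * 10 + 3 * (bits κ m * (m * 70 + 40)) + 100 : ℕ) : ℝ) ≤
      (2000 + 400 * κ) * ((Nat.log 2 m + 1) * m) := by exact_mod_cast hnat
  unfold solverTime
  rw [Nat.cast_add]
  calc _ ≤ (2000 + 400 * κ : ℝ) * (B * (m : ℝ) ^ (2 - δ)) + c * (m : ℝ) ^ (2 - δ) := by
        refine add_le_add (hnat'.trans ?_) hfl
        gcongr
    _ = _ := by ring

/-! ### The reduction -/

theorem exists_lt_of_list (l : List ℕ) : ∃ n, ∀ x ∈ l, x < n :=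
  ⟨l.sum + 1, fun _ hx => Nat.lt_succ_of_le (List.le_sum_of_mem hx)⟩

/-- Words of length proportional to `log m` are long enough for the program for matrices too, since
`N ≤ g ≤ m`. -/
theorem log_N_lt {κ E C D m : ℕ} (h : Large κ E C m) :
    Nat.log 2 (Params.ofSize κ D E m 0).N + 1 ≤ Nat.log 2 m + 1 :=
  Nat.succ_le_succ (Nat.log_mono_right ((h.N_le (D := D)).trans h.g_le))

theorem ratio_ofSize {κ D j m : ℕ} {c₁ c₂ : ℝ} (h₁ : c₁ * j ≤ D) (h₂ : (D : ℝ) ≤ c₂ * j) :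
    c₁ * ((Params.ofSize κ D (j ^ 5) m 0).N : ℝ) ^ (1 / 5 : ℝ) ≤ (Params.ofSize κ D (j ^ 5) m 0).n ∧
    ((Params.ofSize κ D (j ^ 5) m 0).n : ℝ) ≤
      c₂ * ((Params.ofSize κ D (j ^ 5) m 0).N : ℝ) ^ (1 / 5 : ℝ) := by
  have hN : ((Params.ofSize κ D (j ^ 5) m 0).N : ℝ) ^ (1 / 5 : ℝ) =
      j * 2 ^ (4 * (Nat.log 2 m / 32)) := by
    have e : ((Params.ofSize κ D (j ^ 5) m 0).N : ℝ) = (j * 2 ^ (4 * (Nat.log 2 m / 32))) ^ 5 := by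
      simp only [Params.ofSize]
      push_cast
      rw [mul_pow, ← pow_mul]; congr 2; omega
    rw [e, one_div]
    exact Real.pow_rpow_inv_natCast (by positivity) (by norm_num)
  have hn : ((Params.ofSize κ D (j ^ 5) m 0).n : ℝ) = D * 2 ^ (4 * (Nat.log 2 m / 32)) := by
    simp [Params.ofSize]
  rw [hN, hn, ← mul_assoc, ← mul_assoc]
  exact ⟨by gcongr, by gcongr⟩

/-- The log of the moved program has at most `T` entries; this bound keeps its counter within a
word. -/
theorem time_lt {κ D E C m k s T w : ℕ} (h : Large κ E C m) (hD : 0 < D) {ε : ℝ} (hε : 0 < ε)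
    (hw : 20 * (Nat.log 2 m + 1) + s ≤ w) (hs : k + 2 * D ≤ s)
    (hT : (T : ℝ) ≤ k * ((Params.ofSize κ D E m 0).N *
      ((Params.ofSize κ D E m 0).n : ℝ) ^ (2 - ε))) : T < 2 ^ w := by
  have hn1 : 1 ≤ (Params.ofSize κ D E m 0).n := Nat.mul_pos hD (Nat.two_pow_pos _)
  have h1 : T ≤ k * ((Params.ofSize κ D E m 0).N * (Params.ofSize κ D E m 0).n ^ 2) := by
    have : ((Params.ofSize κ D E m 0).n : ℝ) ^ (2 - ε) ≤ ((Params.ofSize κ D E m 0).n : ℝ) ^ 2 := by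
      rw [← Real.rpow_natCast]
      exact Real.rpow_le_rpow_of_exponent_le (by exact_mod_cast hn1) (by push_cast; linarith)
    have : (T : ℝ) ≤ k * ((Params.ofSize κ D E m 0).N * ((Params.ofSize κ D E m 0).n : ℝ) ^ 2) :=
      hT.trans (by gcongr)
    exact_mod_cast this
  have hm : m ≤ 2 ^ (Nat.log 2 m + 1) := (Nat.lt_pow_succ_log_self one_lt_two m).le
  have hN := ((h.N_le (D := D)).trans h.g_le).trans hm
  have hn : (Params.ofSize κ D E m 0).n ≤ 2 ^ D * 2 ^ (Nat.log 2 m + 1) :=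
    Nat.mul_le_mul Nat.lt_two_pow_self.le (Nat.pow_le_pow_right two_pos (by omega))
  have hk : k ≤ 2 ^ k := Nat.lt_two_pow_self.le
  have hX : 0 < Nat.log 2 m + 1 := Nat.succ_pos _
  refine h1.trans_lt ?_
  generalize Nat.log 2 m + 1 = X at *
  calc _ ≤ 2 ^ k * (2 ^ X * (2 ^ D * 2 ^ X) ^ 2) := by gcongr
    _ = 2 ^ (k + 3 * X + 2 * D) := by ring
    _ < 2 ^ w := Nat.pow_lt_pow_right one_lt_two (by omega)

/-- The reduction, with all constants fixed from `P`, `K`, `κ`, `c₁` and `c₂`; the new program is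
`solver`, and the saving in the exponent is `δ / 16`. -/
theorem exists_solvesThreeSum {c₁ c₂ ε K : ℝ} (hc₁ : 0 < c₁) (hc₂ : c₁ < c₂) (hε : 0 < ε) {P : Cmd}
    (hP : SolvesCompressedMatVec c₁ c₂ P ε K) (κ : ℕ) :
    ∃ (P' : Cmd) (K' ε' : ℝ), 0 < ε' ∧ SolvesThreeSum κ P' ε' K' := by
  classical
  obtain ⟨cP, hP⟩ := hP
  obtain ⟨D, j, hD, hj, hr₁, hr₂⟩ := exists_ratio hc₁ hc₂
  obtain ⟨C, hC⟩ := exists_card_divisors_pow_le (e := 100) (by norm_num)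
  obtain ⟨nr, hnr⟩ := exists_lt_of_list (modR P)
  obtain ⟨na, hna⟩ := exists_lt_of_list (modA P)
  obtain ⟨k, hk⟩ := exists_nat_ge |K|
  set E := j ^ 5 with hE
  have hE0 : 0 < E := by positivity
  -- The exact searches save only a factor `√t`, so no `δ` beyond `1/2` can be exploited.
  set δ := min ε (1 / 2) with hδ
  have hδ0 : 0 < δ := lt_min hε (by norm_num)
  have hδ2 : δ ≤ 1 / 2 := min_le_right _ _
  obtain ⟨c, hc0, hc⟩ := exists_batches_time_le κ D E C nr na k hD (min_le_left ε (1 / 2)) hδ0 hδ2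
  -- From `u ≥ u₀` on all conditions in `Large` hold; smaller sets are searched exhaustively.
  obtain ⟨u₀, hu₀⟩ : ∃ u₀, u₀ = 661 + κ + C + E := ⟨_, rfl⟩
  set c' : ℝ := 2 * c + 140 * (2 ^ (32 * u₀)) ^ 2 with hc'
  have hc'0 : 0 ≤ c' := by positivity
  obtain ⟨K', hK'⟩ := exists_solverTime_le κ (δ := δ / 16) hc'0 (by linarith)
  refine ⟨solver κ D E u₀ P nr na, K', δ / 16, by linarith,
    -- The summands provide for the numbers of the reduction, for its constants and the bound on
    -- `T`, and for the requirement of `P` on the word length.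
    20 + (κ + 2 * D + E + u₀ + k) + cP, fun m w hm hw A B C' hA hB hC' hAU hBU hCU => ?_⟩
  have hX : 1 ≤ Nat.log 2 m + 1 := by omega
  have hw1 : 20 * (Nat.log 2 m + 1) + (κ + 2 * D + E + u₀ + k) ≤ w := by
    have := Nat.mul_le_mul_left (κ + 2 * D + E + u₀ + k) hX
    rw [add_mul, add_mul] at hw
    omega
  have hw2 : cP * (Nat.log 2 m + 1) ≤ w := by
    rw [add_mul] at hw
    omega
  have hf : Fits w κ D E u₀ m := fits_of_le hm hD hE0 hw1
  have hz1 : (1 : ℝ) ≤ (m : ℝ) ^ (2 - δ / 16) :=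
    Real.one_le_rpow (by exact_mod_cast hm) (by linarith)
  have hfit : ∀ x ≤ κ * m ^ 3 * (Nat.log 2 m + 1) ^ 2, x < 2 ^ w := fun x hx => by
    have h1 : κ * m ^ 3 * (Nat.log 2 m + 1) ^ 2 < 2 ^ bits κ m := hf.size_lt
    have := hf.bits_lt
    omega
  have hinit : Initial A B C' (view (threeSumInput w A B C')) :=
    initial_threeSumInput (by have := hf.m_lt; omega) (fun i => hfit _ (hAU i).2)
      (fun i => hfit _ (hBU i).2) (fun i => hfit _ (hCU i).2)
  have hspec := solver_spec (P := P) (nr := nr) (na := na)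
    (T' := ⌊c' * (m : ℝ) ^ (2 - δ / 16)⌋₊) hf ?_ ?_ hA hB hC' (fun i => (hAU i).2)
    (fun i => (hBU i).2) (fun i => (hCU i).2) hinit
  · exact solvesWithin_of_spec hspec.1 hspec.2 (hK' m hm)
  · intro hu
    refine Nat.le_floor ?_
    have hm2 : m ≤ 2 ^ (32 * u₀) := ((Nat.lt_pow_succ_log_self one_lt_two m).le).trans
      (Nat.pow_le_pow_right two_pos (by omega))
    have h1 : m * (60 * m + 20) + 60 ≤ 140 * (2 ^ (32 * u₀)) ^ 2 := by
      calc _ ≤ 140 * m ^ 2 := by nlinarith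
        _ ≤ _ := by gcongr
    calc ((m * (60 * m + 20) + 60 : ℕ) : ℝ) ≤ ((140 * (2 ^ (32 * u₀)) ^ 2 : ℕ) : ℝ) := by
          exact_mod_cast h1
      _ = 140 * (2 ^ (32 * u₀)) ^ 2 := by push_cast; rfl
      _ ≤ c' := by linarith
      _ ≤ _ := le_mul_of_one_le_right hc'0 hz1
  · intro hu
    have hL : Large κ E C m := ⟨hE0, by omega, by omega, by omega⟩
    set T := ⌊K * ((Params.ofSize κ D E m 0).N *
      ((Params.ofSize κ D E m 0).n : ℝ) ^ (2 - ε))⌋₊ with hT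
    have hTk : (T : ℝ) ≤ k * ((Params.ofSize κ D E m 0).N *
        ((Params.ofSize κ D E m 0).n : ℝ) ^ (2 - ε)) := by
      have h0 : 0 ≤ ((Params.ofSize κ D E m 0).N : ℝ) *
        ((Params.ofSize κ D E m 0).n : ℝ) ^ (2 - ε) := by positivity
      have h1 : K * ((Params.ofSize κ D E m 0).N *
          ((Params.ofSize κ D E m 0).n : ℝ) ^ (2 - ε)) ≤ k * ((Params.ofSize κ D E m 0).N *
          ((Params.ofSize κ D E m 0).n : ℝ) ^ (2 - ε)) :=
        mul_le_mul_of_nonneg_right ((le_abs_self K).trans hk) h0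
      rcases Nat.eq_zero_or_pos T with h2 | h2
      · rw [h2]; push_cast; positivity
      · exact (Nat.floor_le (Nat.pos_of_floor_pos h2).le).trans h1
    obtain ⟨t1, t2⟩ := hc m T hL hTk
    have hsolve : SolvesSize P w (Params.ofSize κ D E m 0).N (Params.ofSize κ D E m 0).n T := by
      obtain ⟨q1, q2⟩ := ratio_ofSize (κ := κ) (m := m) hr₁ hr₂
      exact hP _ _ w (Nat.mul_pos hE0 (Nat.two_pow_pos _)) q1 q2
        ((Nat.mul_le_mul_left cP (log_N_lt hL)).trans hw2)
    refine ⟨T, ⌊c * (m : ℝ) ^ (2 - δ / 16)⌋₊, _, hL.suitable hf hw1 hC hnr hna hsolve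
      (time_lt hL hD hε hw1 (by omega) hTk) fun M hM => Nat.le_floor (t2 M hM), Nat.le_floor ?_⟩
    have hfl : (⌊c * (m : ℝ) ^ (2 - δ / 16)⌋₊ : ℝ) ≤ c * (m : ℝ) ^ (2 - δ / 16) :=
      Nat.floor_le (by positivity)
    have hpos : 0 ≤ 140 * ((2 : ℝ) ^ (32 * u₀)) ^ 2 * (m : ℝ) ^ (2 - δ / 16) := by positivity
    rw [Nat.cast_add]
    calc _ ≤ c * (m : ℝ) ^ (2 - δ / 16) + c * (m : ℝ) ^ (2 - δ / 16) := add_le_add t1 hfl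
      _ ≤ c' * (m : ℝ) ^ (2 - δ / 16) := by rw [hc', add_mul]; linarith

end WordRAM

/-! ### The theorem -/

theorem theorem2 (h3SUM : ThreeSumConjecture) (c₁ c₂ : ℝ) (hc₁ : 0 < c₁) (hc₂ : c₁ < c₂)
    (ε : ℝ) (hε : 0 < ε) :
    ¬ ∃ (P : WordRAM.Cmd) (K : ℝ), SolvesCompressedMatVec c₁ c₂ P ε K := by
  rintro ⟨P, K, hP⟩
  obtain ⟨κ, hκ⟩ := h3SUM
  obtain ⟨P', K', ε', hε', h⟩ := WordRAM.exists_solvesThreeSum hc₁ hc₂ hε hP κ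
  exact hκ ε' hε' ⟨P', K', h⟩
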